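/- Let $\alpha,\beta>0$. The square-hexagon lattice has a white vertex $\mathbf w(X,U)$ at each $(X,U)\in\mathbb Z^2$ with $X\equiv 0,1 \pmod 3$ and a black vertex $\mathbf b(X,U)$ at each $(X,U)$ with $X\equiv 1,2\pmod 3$. Its edges are as follows. For $X\equiv 0 \pmod 3$, the vertex $\mathbf w(X,U)$ is joined to $\mathbf b(X+1,U)$, $\mathbf b(X+1,U-1)$, $\mathbf b(X-1,U)$, $\mathbf b(X-1,U+1)$, with weights $1,\alpha,1,\beta$. For $X\equiv 1\pmod 3$, the vertex $\mathbf w(X,U)$ is joined to $\mathbf b(X,U)$, $\mathbf b(X+1,U)$, $\mathbf b(X+1,U-1)$, all with weight $1$. The Kasteleyn matrix entry $\mathbf K(\mathbf b,\mathbf w)$ of an edge is its weight, multiplied by $-1$ for the edges $\mathbf w(X,U)-\mathbf b(X+1,U)$. The tower of size $N$ is the subgraph induced by the vertices with $0\le X\le 3N$ and $-X+\lfloor X/3\rfloor\le U\le N-\lfloor X/3\rfloor-1$. It carries the probability measure $P_N$ on dimer covers (perfect matchings) proportional to the product of the edge weights. **Finite kernel.** Write $X=3t-m$ with $m\in\{1,2,3\}$,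 and set $$\Phi(X,N;z)=(1+\beta z)^{N-t+1}(1-z^{-1})^{t-1+\mathbf 1_{m=1}}(1-\alpha z^{-1})^{t-1+\mathbf 1_{m\le 2}} .$$ The extended Schur-process kernel of the tower of size $N$ is, for $(X_1,U),(X_2,V)\in\mathbb Z^2$, $$K_N((X_1,U),(X_2,V))=\frac1{(2\pi i)^2}\oint\oint\frac{\Phi(X_1,N;z)}{\Phi(X_2,N;w)}\,\frac{w}{z-w}\,\frac{dw\,dz}{z^{U+1}w^{-V+1}} .$$ Both contours are simple, counterclockwise, enclose $0,1,\alpha$ and leave $-1/\beta$ outside. The $z$-contour encloses the $w$-contour if $X_1\ge X_2$, and is enclosed by it if $X_1<X_2$. **Gibbs kernel.** For $z_0\in\mathbb C\setminus\{-1/\beta,0,1,\alpha\}$ with $\operatorname{Im}z_0\ge 0$ and for $X'=3t'-m'$, $X=3t-m$ with $m,m'\in\{1,2,3\}$, let $$K^{z_0}[(X',U'),(X,U)]=\frac1{2\pi i}\int_{\overline{z_0}}^{z_0}(1+\beta z)^{t-t'}(1-z^{-1})^{t'-t+\mathbf 1_{m'=1}-\mathbf 1_{m=1}}(1-\alpha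 z^{-1})^{t'-t-\mathbf 1_{m'=3}+\mathbf 1_{m=3}}z^{U-U'-1}\,dz .$$ The integral is along the circle $|z|=|z_0|$. It runs counterclockwise through the right of the origin if $X'\ge X$, and clockwise through the left of the origin if $X'<X$. If $z_0$ is real, the arc is a single point when it lies on the same side of the origin as $z_0$, and the full circle otherwise. *A Gibbs measure with complex coordinate $z_0$* is a probability measure $\mu$ on dimer covers of the whole lattice which is invariant and ergodic under the translations by $3\mathbb Z\times\mathbb Z$, and which has the following two properties. First, it is Gibbs: for two matchings of the same finite vertex set, the probabilities of seeing one or the other, given the rest of the configuration, are proportional to the products of their edge weights. Second, for all distinct edges $(\mathbf w_1,\mathbf b_1),\dots,(\mathbf w_k,\mathbf b_k)$, $$\mu\big((\mathbf w_i,\mathbf b_i)\in M\ \forall i\big)=\prod_{i}\mathbf K(\mathbf b_i,\mathbf w_i)\,\det\big(K^{z_0}[\mathbf w_i,\mathbf b_j]\big)_{i,j} .$$ **Regions.** Let $\mathfrak T=\{(x,u)\in\mathbb R^2:0<x<1,\ -2x<u<1-x\}$ and $$S(z;x,u)=x\big(\log(1-1/z)+\log(1-\alpha/z)\big)-u\log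 z+(1-x)\log(1+\beta z).$$ Its critical points are the $z\in\mathbb C\setminus\{-1/\beta,0,1,\alpha\}$ with $\partial_zS(z;x,u)=0$; the derivative $\partial_zS$ is a rational function of $z$, independent of the branches of the logarithms. The liquid region $\mathfrak L$ is the set of $(x,u)\in\mathfrak T$ for which $S$ has a pair of non-real complex conjugate critical points. The frozen region is the set of $(x,u)\in\mathfrak T$ for which all critical points of $S$ are real and distinct (that is, real and simple). **Theorem.** There is a function $z_0=z_0(x,u)$ on the union of the liquid and the frozen region such that the following hold. 1. If $(x,u)\in\mathfrak L$, then $z_0$ is the unique critical point of $S(\cdot\,;x,u)$ in the open upper half plane. 2. If $(x,u)$ is in the frozen region, then $z_0$ is a real critical point of $S(\cdot\,;x,u)$. In particular it lies in one of the intervals into which $-1/\beta,0,1,\alpha$ divide $\mathbb R$ (five intervals if $\alpha\ne1$). 3. In both cases, for all $(X',U'),(X,U)\in\mathbb Z^2$, $$\lim_{N\to\infty}K_N\big((3\lfloor Nx\rfloor+X',\lfloor Nu\rfloor+U'),(3\lfloor Nx\rfloor+X,\lfloor Nu\rfloor+U)\big)=K^{z_0}[(X',U'),(X,U)] .$$ 4.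 In both cases there is a Gibbs measure $\mu$ with complex coordinate $z_0$ which is the local limit of the towers: for every finite set of edges of the lattice, the $P_N$-probability that their translates by $(3\lfloor Nx\rfloor,\lfloor Nu\rfloor)$ all belong to the dimer cover converges, as $N\to\infty$, to the $\mu$-probability that the edges themselves all do. In the frozen region $\mu$ is nonrandom: it is the point mass at a single dimer cover. -/

import Mathlib

noncomputable section

namespace TowerDimer

open MeasureTheory Filter Topology

/-! ### The square-hexagon lattice

Vertices are indexed by pairs `(X, U)` of integers. There is a white vertex at `(X, U)` when
`X ≡ 0, 1 (mod 3)` and a black vertex at `(X, U)` when `X ≡ 1, 2 (mod 3)`. -/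

/-- Coordinates `(X, U)`. -/
abbrev Pt : Type := ℤ × ℤ

/-- A pair `(w, b)`: the coordinates of a white vertex followed by those of a black vertex. -/
abbrev Edge : Type := Pt × Pt

/-- There is a white vertex at these coordinates. -/
def IsWhite (p : Pt) : Prop := p.1 % 3 = 0 ∨ p.1 % 3 = 1

/-- There is a black vertex at these coordinates. -/
def IsBlack (p : Pt) : Prop := p.1 % 3 = 1 ∨ p.1 % 3 = 2

/-- The weight of the pair `(w, b)`; it is `0` when `(w, b)` is not an edge of the lattice. -/
def weight (α β : ℝ) (e : Edge) : ℝ :=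
  let X := e.1.1
  let U := e.1.2
  if X % 3 = 0 then
    if e.2 = (X + 1, U) then 1
    else if e.2 = (X + 1, U - 1) then α
    else if e.2 = (X - 1, U) then 1
    else if e.2 = (X - 1, U + 1) then β
    else 0
  else if X % 3 = 1 then
    if e.2 = (X, U) then 1
    else if e.2 = (X + 1, U) then 1
    else if e.2 = (X + 1, U - 1) then 1
    else 0
  else 0

/-- The edges of the lattice. -/
def IsEdge (e : Edge) : Prop :=
  (e.1.1 % 3 = 0 ∧ (e.2 = (e.1.1 + 1, e.1.2) ∨ e.2 = (e.1.1 + 1, e.1.2 - 1) ∨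
      e.2 = (e.1.1 - 1, e.1.2) ∨ e.2 = (e.1.1 - 1, e.1.2 + 1))) ∨
  (e.1.1 % 3 = 1 ∧ (e.2 = (e.1.1, e.1.2) ∨ e.2 = (e.1.1 + 1, e.1.2) ∨
      e.2 = (e.1.1 + 1, e.1.2 - 1)))

/-- The Kasteleyn matrix entry of the pair `(w, b)`: the edges `w(X, U) - b(X + 1, U)` carry the
sign `-1`, all others the sign `+1`. -/
def kasteleyn (α β : ℝ) (e : Edge) : ℝ :=
  if e.2 = (e.1.1 + 1, e.1.2) then -weight α β e else weight α β e

/-- `M` is a dimer cover (perfect matching) of the subgraph of the lattice induced by the vertices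
with coordinates in `R`. -/
structure IsDimerCover (R : Set Pt) (M : Set Edge) : Prop where
  edge : ∀ e ∈ M, IsEdge e ∧ e.1 ∈ R ∧ e.2 ∈ R
  white : ∀ w ∈ R, IsWhite w → ∃! b, (w, b) ∈ M
  black : ∀ b ∈ R, IsBlack b → ∃! w, (w, b) ∈ M

/-- Translation of an edge by the vector `v`. -/
def shiftEdge (v : Pt) (e : Edge) : Edge := (e.1 + v, e.2 + v)

/-! ### The tower graph and its dimer measure -/

/-- The coordinates `(X, U)` of the vertices of the tower of size `N`:
`0 ≤ X ≤ 3N` and `-X + ⌊X/3⌋ ≤ U ≤ N - ⌊X/3⌋ - 1`. The outer box only serves to make this a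
`Finset`; it is implied by the inequalities. -/
def towerVertices (N : ℕ) : Finset Pt :=
  (Finset.Icc (0 : ℤ) (3 * N) ×ˢ Finset.Icc (-3 * (N : ℤ)) N).filter fun p =>
    -p.1 + p.1 / 3 ≤ p.2 ∧ p.2 ≤ N - p.1 / 3 - 1

open Classical in
/-- The dimer covers of the tower of size `N`. -/
def towerCovers (N : ℕ) : Finset (Finset Edge) :=
  (towerVertices N ×ˢ towerVertices N).powerset.filter fun M =>
    IsDimerCover (towerVertices N : Set Pt) (M : Set Edge)

open Classical in
/-- The probability that all edges of `s` belong to a random dimer cover `M` of the tower of size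
`N`, when the probability of `M` is proportional to the product of its edge weights. -/
def towerProb (α β : ℝ) (N : ℕ) (s : Finset Edge) : ℝ :=
  (∑ M ∈ (towerCovers N).filter fun M => s ⊆ M, ∏ e ∈ M, weight α β e) /
    ∑ M ∈ towerCovers N, ∏ e ∈ M, weight α β e

/-! ### The Schur process kernel of the tower -/

/-- The `t` of the unique decomposition `X = 3 t - m` with `m ∈ {1, 2, 3}`. -/
def tOf (X : ℤ) : ℤ := X / 3 + 1

/-- The `m ∈ {1, 2, 3}` of the unique decomposition `X = 3 t - m`. -/
def mOf (X : ℤ) : ℤ := 3 - X % 3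

theorem eq_three_mul_tOf_sub_mOf (X : ℤ) :
    X = 3 * tOf X - mOf X ∧ 1 ≤ mOf X ∧ mOf X ≤ 3 := by
  unfold tOf mOf
  omega

/-- Indicator of a proposition, as an integer. -/
def ind (p : Prop) [Decidable p] : ℤ := if p then 1 else 0

/-- `Φ(3 t - m, N; z)`. -/
def Phi (α β : ℝ) (X : ℤ) (N : ℕ) (z : ℂ) : ℂ :=
  (1 + β * z) ^ ((N : ℤ) - tOf X + 1) /
    ((1 - z⁻¹) ^ (-(tOf X - 1) - ind (mOf X = 1)) *
      (1 - α * z⁻¹) ^ (-(tOf X - 1) - ind (mOf X ≤ 2)))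

/-- Centre of the two circular contours. -/
def contourCentre (α : ℝ) : ℂ := ((1 + α : ℝ) : ℂ)

/-- Radius of the inner contour `Γ₋`. -/
def innerRadius (α β : ℝ) : ℝ := 1 + α + 1 / (3 * β)

/-- Radius of the outer contour `Γ₊`. -/
def outerRadius (α β : ℝ) : ℝ := 1 + α + 2 / (3 * β)

/-- For `α, β > 0` both contours are admissible: they enclose `0`, `1` and `α`, they leave `-1/β`
outside, and `Γ₊` encloses `Γ₋`. -/
theorem contours_admissible {α β : ℝ} (hα : 0 < α) (hβ : 0 < β) :
    (∀ r, r = innerRadius α β ∨ r = outerRadius α β →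
      0 ∈ Metric.ball (contourCentre α) r ∧ 1 ∈ Metric.ball (contourCentre α) r ∧
      (α : ℂ) ∈ Metric.ball (contourCentre α) r ∧
      ((-1 / β : ℝ) : ℂ) ∉ Metric.closedBall (contourCentre α) r) ∧
    innerRadius α β < outerRadius α β := by
  have h1 : 0 < 1 / β := by positivity
  have e1 : 1 / (3 * β) = 1 / β / 3 := by field_simp
  have e2 : 2 / (3 * β) = 1 / β * 2 / 3 := by field_simp
  have e3 : -1 / β = -(1 / β) := by ring
  have key : ∀ a r : ℝ, ((a : ℝ) : ℂ) ∈ Metric.ball (contourCentre α) r ↔ |a - (1 + α)| < r := by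
    intro a r
    rw [contourCentre, Metric.mem_ball, Complex.dist_eq, ← Complex.ofReal_sub,
      Complex.norm_real, Real.norm_eq_abs]
  have key' : ∀ a r : ℝ,
      ((a : ℝ) : ℂ) ∈ Metric.closedBall (contourCentre α) r ↔ |a - (1 + α)| ≤ r := by
    intro a r
    rw [contourCentre, Metric.mem_closedBall, Complex.dist_eq, ← Complex.ofReal_sub,
      Complex.norm_real, Real.norm_eq_abs]
  refine ⟨?_, by unfold innerRadius outerRadius; rw [e1, e2]; linarith⟩
  rintro r hr
  have hr' : 1 + α < r ∧ r < 1 + α + 1 / β := by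
    rcases hr with rfl | rfl
    · unfold innerRadius; rw [e1]; constructor <;> linarith
    · unfold outerRadius; rw [e2]; constructor <;> linarith
  obtain ⟨hr1, hr2⟩ := hr'
  refine ⟨?_, ?_, ?_, ?_⟩
  · have := (key 0 r).2 (by rw [abs_lt]; constructor <;> linarith)
    simpa using this
  · have := (key 1 r).2 (by rw [abs_lt]; constructor <;> linarith)
    simpa using this
  · exact (key α r).2 (by rw [abs_lt]; constructor <;> linarith)
  · rw [key', e3, not_le, lt_abs]
    right; linarith

/-- The integrand of the kernel. -/
def kernelIntegrand (α β : ℝ) (N : ℕ) (P Q : Pt) (z w : ℂ) : ℂ :=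
  Phi α β P.1 N z / Phi α β Q.1 N w * (w / (z - w)) *
    (1 / (z ^ (P.2 + 1) * w ^ (-Q.2 + 1)))

/-- The extended correlation kernel `K_N((X₁, U), (X₂, V))` of the Schur process of the tower of
size `N`: the `z`-contour is outside the `w`-contour if `X₁ ≥ X₂`, and inside it if `X₁ < X₂`. -/
def schurKernel (α β : ℝ) (N : ℕ) (P Q : Pt) : ℂ :=
  if Q.1 ≤ P.1 then
    (1 / (2 * Real.pi * Complex.I) ^ 2) *
      ∮ z in C(contourCentre α, outerRadius α β), ∮ w in C(contourCentre α, innerRadius α β),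
        kernelIntegrand α β N P Q z w
  else
    (1 / (2 * Real.pi * Complex.I) ^ 2) *
      ∮ z in C(contourCentre α, innerRadius α β), ∮ w in C(contourCentre α, outerRadius α β),
        kernelIntegrand α β N P Q z w

/-! ### The kernels of the infinite volume Gibbs measures -/

/-- The integrand of the Gibbs kernel at `P = (X', U')`, `Q = (X, U)`. -/
def gibbsIntegrand (α β : ℝ) (P Q : Pt) (z : ℂ) : ℂ :=
  (1 + β * z) ^ (tOf Q.1 - tOf P.1) *
    (1 - z⁻¹) ^ (tOf P.1 - tOf Q.1 + ind (mOf P.1 = 1) - ind (mOf Q.1 = 1)) *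
    (1 - α * z⁻¹) ^ (tOf P.1 - tOf Q.1 - ind (mOf P.1 = 3) + ind (mOf Q.1 = 3)) *
    z ^ (Q.2 - P.2 - 1)

/-- The kernel `K^{z₀}[w(X', U'), b(X, U)]` at `P = (X', U')`, `Q = (X, U)`, for `z₀ ≠ 0` with
`0 ≤ im z₀`. The integral runs from `conj z₀` to `z₀` along the circle `|z| = |z₀|`:
counterclockwise, on the right of the origin, if `X' ≥ X`, and clockwise, on the left of the
origin, if `X' < X`. For real `z₀` exactly one of the two arcs is degenerate and the other one is
the full circle. -/
def gibbsKernel (α β : ℝ) (z₀ : ℂ) (P Q : Pt) : ℂ :=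
  (1 / (2 * Real.pi * Complex.I)) *
    ∫ θ in (if Q.1 ≤ P.1 then -Complex.arg z₀ else 2 * Real.pi - Complex.arg z₀)..Complex.arg z₀,
      gibbsIntegrand α β P Q (circleMap 0 ‖z₀‖ θ) * deriv (circleMap 0 ‖z₀‖) θ

/-- `μ` is the infinite volume Gibbs measure with complex coordinate `z₀`: a translation invariant
ergodic Gibbs measure on dimer covers of the lattice whose edge correlations are given by the
determinantal formula with kernel `K^{z₀}`. -/
structure IsGibbsMeasure (α β : ℝ) (z₀ : ℂ) (μ : Measure (Set Edge)) : Prop where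
  isProbabilityMeasure : IsProbabilityMeasure μ
  /-- `μ` lives on dimer covers of the whole lattice. -/
  cover : ∀ᵐ M ∂μ, IsDimerCover Set.univ M
  /-- Edge probabilities. -/
  determinantal : ∀ s : Finset Edge, (∀ e ∈ s, IsEdge e) →
    ((μ.real {M | (s : Set Edge) ⊆ M} : ℝ) : ℂ) =
      (∏ e ∈ s, (kasteleyn α β e : ℂ)) *
        (Matrix.of fun e f : s => gibbsKernel α β z₀ e.1.1 f.1.2).det
  /-- Gibbs property: if `A` and `A'` are two matchings of the same finite set of vertices then,
  conditionally on the rest of the configuration, seeing `A` or `A'` there has probabilities in the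
  proportion of the products of edge weights. -/
  gibbs : ∀ A A' : Finset Edge, (∀ e ∈ A, IsEdge e) → (∀ e ∈ A', IsEdge e) →
    Set.InjOn Prod.fst (A : Set Edge) → Set.InjOn Prod.snd (A : Set Edge) →
    Set.InjOn Prod.fst (A' : Set Edge) → Set.InjOn Prod.snd (A' : Set Edge) →
    A.image Prod.fst = A'.image Prod.fst → A.image Prod.snd = A'.image Prod.snd →
    ∀ B : Set (Set Edge), MeasurableSet B →
      μ.real {M | (A : Set Edge) ⊆ M ∧ M \ A ∈ B} * ∏ e ∈ A', weight α β e =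
        μ.real {M | (A' : Set Edge) ⊆ M ∧ M \ A' ∈ B} * ∏ e ∈ A, weight α β e
  /-- Invariance under the translations of the weighted lattice. -/
  invariant : ∀ a b : ℤ, μ.map (fun M => shiftEdge (3 * a, b) ⁻¹' M) = μ
  /-- Ergodicity under these translations. -/
  ergodic : ∀ B : Set (Set Edge), MeasurableSet B →
    (∀ a b : ℤ, (fun M => shiftEdge (3 * a, b) ⁻¹' M) ⁻¹' B = B) → μ B = 0 ∨ μ B = 1

/-! ### The action function -/

/-- The action function, with principal logarithms. -/
def action (α β x u : ℝ) (z : ℂ) : ℂ :=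
  x * (Complex.log (1 - 1 / z) + Complex.log (1 - α / z)) - u * Complex.log z +
    (1 - x) * Complex.log (1 + β * z)

/-- The derivative of the action function. It does not depend on the branches of the
logarithms. -/
def actionDeriv (α β x u : ℝ) (z : ℂ) : ℂ :=
  x * (1 / (z * (z - 1)) + α / (z * (z - α))) - u / z + (1 - x) * β / (1 + β * z)

theorem hasDerivAt_action {α β : ℝ} (hα : 0 < α) (hβ : 0 < β) (x u : ℝ) {z : ℂ}
    (hz : z.im ≠ 0) : HasDerivAt (action α β x u) (actionDeriv α β x u z) z := by
  have hz0 : z ≠ 0 := by rintro rfl; simp at hz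
  have hn : Complex.normSq z ≠ 0 := by simpa using hz0
  have hs : ∀ a : ℝ, a ≠ 0 → (1 - (a : ℂ) / z).im ≠ 0 := by
    intro a ha
    simp only [Complex.sub_im, Complex.one_im, Complex.div_im, Complex.ofReal_im,
      Complex.ofReal_re, zero_mul, zero_div, zero_sub]
    have : a * z.im / Complex.normSq z ≠ 0 := div_ne_zero (mul_ne_zero ha hz) hn
    simpa using this
  have hne : ∀ a : ℝ, z - a ≠ 0 := by
    intro a h
    apply hz
    have := congrArg Complex.im h
    simpa using this
  have hl : ∀ a : ℝ, a ≠ 0 →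
      HasDerivAt (fun z : ℂ => Complex.log (1 - (a : ℂ) / z)) (a / (z * (z - a))) z := by
    intro a ha
    have h1 : HasDerivAt (fun z : ℂ => 1 - (a : ℂ) / z) (a / z ^ 2) z := by
      have := ((hasDerivAt_inv hz0).const_mul (a : ℂ)).const_sub 1
      have e : (a : ℂ) / z ^ 2 = -(a * -(z ^ 2)⁻¹) := by ring
      rw [e]
      simpa only [div_eq_mul_inv] using this
    have h2 := h1.clog (Or.inr (hs a ha))
    convert h2 using 1
    have := hne a
    field_simp
  have hb : HasDerivAt (fun z : ℂ => Complex.log (1 + β * z)) (β / (1 + β * z)) z := by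
    have h1 : HasDerivAt (fun z : ℂ => 1 + (β : ℂ) * z) β z := by
      simpa using ((hasDerivAt_id z).const_mul (β : ℂ)).const_add 1
    refine h1.clog (Or.inr ?_)
    simpa using ⟨hβ.ne', hz⟩
  have h0 : HasDerivAt (fun z : ℂ => Complex.log z) (1 / z) z := by
    simpa using (hasDerivAt_id z).clog (Or.inr hz)
  have h1 := hl 1 one_ne_zero
  have h2 := hl α hα.ne'
  have h3 : HasDerivAt
      (fun z : ℂ => (x : ℂ) * (Complex.log (1 - ((1 : ℝ) : ℂ) / z) + Complex.log (1 - (α : ℂ) / z)) -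
        u * Complex.log z + (1 - x) * Complex.log (1 + β * z))
      (x * (((1 : ℝ) : ℂ) / (z * (z - ((1 : ℝ) : ℂ))) + α / (z * (z - α))) - u * (1 / z) +
        (1 - x) * (β / (1 + β * z))) z :=
    (((h1.add h2).const_mul (x : ℂ)).sub (h0.const_mul (u : ℂ))).add
      (hb.const_mul ((1 : ℂ) - x))
  simp only [Complex.ofReal_one] at h3
  have e : actionDeriv α β x u z = x * (1 / (z * (z - 1)) + α / (z * (z - α))) - u * (1 / z) +
      (1 - x) * (β / (1 + β * z)) := by
    rw [actionDeriv]
    ring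
  rw [e]
  exact h3

/-- `z` is a critical point of the action function (at a point where it is analytic, for some
branches of the logarithms). -/
def IsCriticalPoint (α β x u : ℝ) (z : ℂ) : Prop :=
  z ≠ 0 ∧ z ≠ 1 ∧ z ≠ α ∧ 1 + β * z ≠ 0 ∧ actionDeriv α β x u z = 0

/-- The rescaled tower domain. -/
def domain : Set (ℝ × ℝ) := {p | 0 < p.1 ∧ p.1 < 1 ∧ -2 * p.1 < p.2 ∧ p.2 < 1 - p.1}

/-- The liquid region: the action has a pair of non-real, complex conjugate critical points. -/
def liquidRegion (α β : ℝ) : Set (ℝ × ℝ) :=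
  {p | p ∈ domain ∧ ∃ z : ℂ, 0 < z.im ∧ IsCriticalPoint α β p.1 p.2 z ∧
    IsCriticalPoint α β p.1 p.2 (starRingEnd ℂ z)}

/-- The frozen region: the critical points of the action are real and distinct, i.e. every
critical point is real and simple. -/
def frozenRegion (α β : ℝ) : Set (ℝ × ℝ) :=
  {p | p ∈ domain ∧ ∀ z : ℂ, IsCriticalPoint α β p.1 p.2 z →
    z.im = 0 ∧ deriv (actionDeriv α β p.1 p.2) z ≠ 0}

/-- The lattice site `(3⌊N x⌋, ⌊N u⌋)` near the macroscopic position `(x, u)`. -/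
def site (N : ℕ) (p : ℝ × ℝ) : Pt := (3 * ⌊(N : ℝ) * p.1⌋, ⌊(N : ℝ) * p.2⌋)

open Classical in
/-- The dimers of the towers of size `N` near the site `(3⌊N x⌋, ⌊N u⌋)` converge in distribution
to `μ`: all joint edge probabilities converge. -/
def IsLocalLimit (α β : ℝ) (p : ℝ × ℝ) (μ : Measure (Set Edge)) : Prop :=
  ∀ s : Finset Edge, (∀ e ∈ s, IsEdge e) →
    Tendsto (fun N : ℕ => towerProb α β N (s.image (shiftEdge (site N p)))) atTop
      (𝓝 (μ.real {M | (s : Set Edge) ⊆ M}))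

/-- The extended kernels at the site `(3⌊N x⌋, ⌊N u⌋)` converge to the Gibbs kernel `K^{z₀}`. -/
def KernelConverges (α β : ℝ) (p : ℝ × ℝ) (z₀ : ℂ) : Prop :=
  ∀ P Q : Pt, Tendsto (fun N : ℕ => schurKernel α β N (site N p + P) (site N p + Q)) atTop
    (𝓝 (gibbsKernel α β z₀ P Q))

end TowerDimer

end

/-! The proof has three layers: an exact determinantal formula for the towers, a saddle point
analysis of its kernel, and a compactness argument which turns convergence of kernels into a Gibbs
measure.

Exact formula. For arbitrary positive edge weights the Kasteleyn matrix is injective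
(`kast_injective`): for a null vector, each step from a column `X ≡ 0` to the next one would create
two new changes of sign, and the last column is too short for them. The determinant therefore never
vanishes, and letting all weights outside one cover tend to `0` shows that all covers enter it with
the same sign (`exists_termSign_eq`). The Schur kernel is a right inverse of this matrix
(`sum_kasteleyn_mul_schurKernel`): the factors by which `Φ` changes from column to column are the
Kasteleyn relations, the exchange of the two contours produces the identity matrix, and the kernel
vanishes at the white neighbours just above and below the tower. `towerProb_eq_det` then gives the
edge probabilities.

Asymptotics. With `energy = |exp S|` the integrand has size about `(energy z / energy w) ^ N`. A
saddle (`IsSaddle`) is a critical point which maximizes the energy on its circle around `0` and is a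
strict minimum in the radial direction. In the liquid region the critical point in the upper half
plane is one (`isSaddle_of_im_pos`): on a circle every `|p + q z|²` is affine in `Re z`, the
logarithm is concave, and the imaginary part of the critical equation says that the slope at the
point is zero. In the frozen region the maximum over a circle is minimized over all circles; strict
concavity makes the maximizer unique up to conjugation, which forces it to be critical, and
simplicity of the critical points makes it nondegenerate (`exists_isSaddle_of_frozen`).

By the maximum principle every other circle contains a point of larger energy, and the angles of
such points in the upper half plane form an interval, so a smooth curve can be chosen which crosses
each circle once and stays above the saddle value (`IsSaddle.exists_curve`). The `z`-contour is
moved to the circle through the saddle. The `w`-contour is moved to this curve and its conjugate,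
completed by arcs of a large and a small circle. The double integral tends to `0` by dominated
convergence: the Cauchy transform over the circle is bounded by an inverse square root of the
distance, which stays integrable where the contours cross (`norm_circleIntegral_cauchy_le`,
`tendsto_integral_piece`). The surviving term is the residue at `z = w` along the part of the
`w`-contour inside the circle, and it is the Gibbs kernel (`IsSaddle.kernelConverges`). Deformations
are carried out by comparing values of primitives on the two closed half planes, all singularities
being real.

Measure. The laws of the translated towers have a limit along an ultrafilter; since all edge
probabilities converge, this limit is the local limit, and the cover and Gibbs properties are
inherited from local events (`exists_limit_measure`). Invariance can be read off the kernel. Up to a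
gauge factor the kernel is a Fourier coefficient of an arc, so it decays under vertical translation
by the Riemann-Lebesgue lemma; this gives mixing and hence ergodicity. At a real saddle the arcs are
empty or full circles and every edge probability is a residue equal to `0` or `1`
(`edge_zero_or_one`), whence a point mass. -/

noncomputable section

namespace TowerDimer

/-! ### Alternating signs of integer sequences -/

/-- The sequence `f` takes values of alternating strict signs at some `k + 1` increasing integers. -/
def SignAlt (f : ℤ → ℝ) (k : ℕ) : Prop :=
  ∃ (i : ℕ → ℤ) (ε : ℝ), (∀ j < k, i j < i (j + 1)) ∧ ∀ j ≤ k, 0 < ε * (-1) ^ j * f (i j)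

/-- A discrete intermediate value theorem. A strict sign at `U` and a weak opposite sign at `U + 1`
are enough to make a weighted difference of the two values strictly positive. -/
theorem exists_sign_drop (f : ℤ → ℝ) {i i' : ℤ} (h : i ≤ i') (hi : 0 < f i) (hi' : f i' ≤ 0) :
    ∃ U, i ≤ U ∧ U < i' ∧ 0 < f U ∧ f (U + 1) ≤ 0 := by
  obtain ⟨n, rfl⟩ := Int.le.dest h
  induction n with
  | zero => simp at hi'; linarith
  | succ n ih =>
    by_cases hn : f (i + n) ≤ 0
    · obtain ⟨U, h1, h2, h3⟩ := ih (by omega) hn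
      exact ⟨U, h1, by push_cast; omega, h3⟩
    · exact ⟨i + n, by omega, by push_cast; omega, not_le.1 hn,
        by simpa [add_assoc] using hi'⟩

theorem exists_sign_rise (f : ℤ → ℝ) {i i' : ℤ} (h : i ≤ i') (hi : f i ≤ 0) (hi' : 0 < f i') :
    ∃ U, i ≤ U ∧ U < i' ∧ f U ≤ 0 ∧ 0 < f (U + 1) := by
  obtain ⟨U, h1, h2, h3, h4⟩ := exists_sign_drop (fun U => f (-U)) (i := -i') (i' := -i)
    (by omega) (by simpa using hi') (by simpa using hi)
  refine ⟨-U - 1, by omega, by omega, ?_, ?_⟩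
  · have e : -U - 1 = -(U + 1) := by ring
    rw [e]; exact h4
  · simpa using h3

/-- Weighted differences of a finitely supported sequence have one more change of sign. -/
theorem SignAlt.diff {f a a' : ℤ → ℝ} {k : ℕ} (ha : ∀ U, 0 < a U) (ha' : ∀ U, 0 < a' U)
    {lo hi : ℤ} (hlo : ∀ U ≤ lo, f U = 0) (hhi : ∀ U, hi ≤ U → f U = 0) (h : SignAlt f k) :
    SignAlt (fun U => a U * f U - a' U * f (U + 1)) (k + 1) := by
  obtain ⟨i, ε, hm, hs⟩ := h
  have hne : ∀ j ≤ k, f (i j) ≠ 0 := fun j hj h0 => by have := hs j hj; simp [h0] at this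
  have hlt : ∀ j ≤ k, lo < i j := fun j hj => by
    by_contra hc; exact hne j hj (hlo _ (not_lt.1 hc))
  have hgt : ∀ j ≤ k, i j < hi := fun j hj => by
    by_contra hc; exact hne j hj (hhi _ (not_lt.1 hc))
  -- One drop of `ε * (-1) ^ j * f` occurs between consecutive alternation points, and one more
  -- after the last point, because `f` vanishes far to the right.
  have H : ∀ j, ∃ U, (j ≤ k → i j ≤ U ∧ (j < k → U < i (j + 1)) ∧
      0 < ε * (-1) ^ j * f U ∧ ε * (-1) ^ j * f (U + 1) ≤ 0) := by
    intro j
    by_cases hj : j ≤ k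
    · by_cases hjk : j < k
      · obtain ⟨U, h1, h2, h3, h4⟩ := exists_sign_drop (fun U => ε * (-1) ^ j * f U)
          (hm j hjk).le (hs j hj) (by
            have := hs (j + 1) hjk
            rw [pow_succ] at this
            nlinarith)
        exact ⟨U, fun _ => ⟨h1, fun _ => h2, h3, h4⟩⟩
      · obtain ⟨U, h1, h2, h3, h4⟩ := exists_sign_drop (fun U => ε * (-1) ^ j * f U)
          (hgt j hj).le (hs j hj) (by simp [hhi hi le_rfl])
        exact ⟨U, fun _ => ⟨h1, fun h => absurd h hjk, h3, h4⟩⟩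
    · exact ⟨0, fun h => absurd h hj⟩
  choose V hV using H
  -- The additional change of sign comes from the left end: `f` rises from `0` before its first
  -- alternation point, which gives a difference of the opposite sign. This is why the new sequence
  -- starts with `-ε`.
  obtain ⟨V0, h1, h2, h3, h4⟩ := exists_sign_rise (fun U => ε * f U)
    (hlt 0 (Nat.zero_le _)).le (by simp [hlo lo le_rfl]) (by simpa using hs 0 (Nat.zero_le _))
  refine ⟨fun j => if j = 0 then V0 else V (j - 1), -ε, ?_, ?_⟩
  · intro j hj
    rcases j with _ | j
    · simpa using h2.trans_le (hV 0 (Nat.zero_le _)).1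
    · have hjk : j + 1 ≤ k := by omega
      simpa using ((hV j (by omega)).2.1 (by omega)).trans_le (hV (j + 1) hjk).1
  · intro j hj
    rcases j with _ | j
    · simp only [pow_zero, if_true]
      have := ha V0; have := ha' V0
      nlinarith [mul_pos (ha' V0) h4, mul_nonneg (ha V0).le (neg_nonneg.2 h3)]
    · simp only [Nat.add_one_ne_zero, if_false, Nat.add_sub_cancel]
      obtain ⟨-, -, h5, h6⟩ := hV j (by omega)
      rw [pow_succ]
      nlinarith [mul_pos (ha (V j)) h5, mul_nonneg (ha' (V j)).le (neg_nonneg.2 h6)]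

/-- Weighted sums of neighbouring terms do not have more changes of sign. -/
theorem SignAlt.of_sum {f d d' : ℤ → ℝ} {k : ℕ} (hd : ∀ U, 0 < d U) (hd' : ∀ U, 0 < d' U)
    (h : SignAlt (fun U => d U * f U + d' U * f (U - 1)) k) : SignAlt f k := by
  obtain ⟨i, ε, hm, hs⟩ := h
  -- If both neighbours had the wrong sign, so would their sum with positive weights.
  have H : ∀ j, ∃ m, j ≤ k → (m = i j ∨ m = i j - 1) ∧ 0 < ε * (-1) ^ j * f m := by
    intro j
    by_cases hj : j ≤ k
    · by_cases h1 : 0 < ε * (-1) ^ j * f (i j)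
      · exact ⟨i j, fun _ => ⟨Or.inl rfl, h1⟩⟩
      · refine ⟨i j - 1, fun _ => ⟨Or.inr rfl, ?_⟩⟩
        by_contra h2
        have := hs j hj
        nlinarith [mul_nonneg (hd (i j)).le (neg_nonneg.2 (not_lt.1 h1)),
          mul_nonneg (hd' (i j)).le (neg_nonneg.2 (not_lt.1 h2))]
    · exact ⟨0, fun h => absurd h hj⟩
  choose m hm' using H
  refine ⟨m, ε, fun j hj => ?_, fun j hj => (hm' j hj).2⟩
  have h1 := hm' j hj.le
  have h2 := hm' (j + 1) hj
  have h3 := hm j hj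
  -- The choices satisfy `m j ≤ i j ≤ i (j + 1) - 1 ≤ m (j + 1)`; the opposite signs of `f` exclude
  -- equality.
  have hne : m j ≠ m (j + 1) := by
    intro he
    have h4 := h1.2
    have h5 := h2.2
    rw [← he, pow_succ] at h5
    nlinarith
  omega

/-! ### Vertices of the tower -/

theorem mem_towerVertices {N : ℕ} {p : Pt} : p ∈ towerVertices N ↔
    0 ≤ p.1 ∧ p.1 ≤ 3 * N ∧ -p.1 + p.1 / 3 ≤ p.2 ∧ p.2 ≤ N - p.1 / 3 - 1 := by
  unfold towerVertices
  simp only [Finset.mem_filter, Finset.mem_product, Finset.mem_Icc]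
  omega

/-- White vertices of the tower. -/
def whites (N : ℕ) : Finset Pt := (towerVertices N).filter fun p => p.1 % 3 = 0 ∨ p.1 % 3 = 1

/-- Black vertices of the tower. -/
def blacks (N : ℕ) : Finset Pt := (towerVertices N).filter fun p => p.1 % 3 = 1 ∨ p.1 % 3 = 2

theorem mem_whites {N : ℕ} {p : Pt} : p ∈ whites N ↔ p ∈ towerVertices N ∧ IsWhite p := by
  simp [whites, IsWhite]

theorem mem_blacks {N : ℕ} {p : Pt} : p ∈ blacks N ↔ p ∈ towerVertices N ∧ IsBlack p := by
  simp [blacks, IsBlack]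

theorem IsEdge.isWhite {e : Edge} (h : IsEdge e) : IsWhite e.1 := by
  rcases h with h | h
  · exact Or.inl h.1
  · exact Or.inr h.1

theorem IsEdge.isBlack {e : Edge} (h : IsEdge e) : IsBlack e.2 := by
  obtain ⟨w, b⟩ := e
  unfold IsBlack
  rcases h with ⟨h, h1⟩ | ⟨h, h1⟩
  · simp only at h h1 ⊢
    rcases h1 with rfl | rfl | rfl | rfl <;> simp only <;> omega
  · simp only at h h1 ⊢
    rcases h1 with rfl | rfl | rfl <;> simp only <;> omega

theorem isEdge_iff_of_mod_one {w b : Pt} (hb : b.1 % 3 = 1) : IsEdge (w, b) ↔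
    w = b ∨ w = (b.1 - 1, b.2) ∨ w = (b.1 - 1, b.2 + 1) := by
  obtain ⟨X, U⟩ := b
  obtain ⟨Y, V⟩ := w
  simp only [IsEdge, Prod.mk.injEq] at hb ⊢
  omega

theorem isEdge_iff_of_mod_two {w b : Pt} (hb : b.1 % 3 = 2) : IsEdge (w, b) ↔
    w = (b.1 - 1, b.2) ∨ w = (b.1 - 1, b.2 + 1) ∨ w = (b.1 + 1, b.2) ∨ w = (b.1 + 1, b.2 - 1) := by
  obtain ⟨X, U⟩ := b
  obtain ⟨Y, V⟩ := w
  simp only [IsEdge, Prod.mk.injEq] at hb ⊢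
  omega

/-- A sum over the white neighbours of a black vertex in a column `X ≡ 1`. -/
theorem sum_nbrs_of_mod_one {R : Type*} [AddCommMonoid R] {b : Pt} (hb : b.1 % 3 = 1)
    (S : Finset Pt) (g : Pt → R) (hS : ∀ w ∉ S, IsEdge (w, b) → g w = 0)
    (hg : ∀ w, ¬ IsEdge (w, b) → g w = 0) :
    ∑ w ∈ S, g w = g b + (g (b.1 - 1, b.2) + g (b.1 - 1, b.2 + 1)) := by
  have h1 : ∑ w ∈ S, g w =
      ∑ w ∈ ({b, (b.1 - 1, b.2), (b.1 - 1, b.2 + 1)} : Finset Pt), g w := by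
    apply Finset.sum_congr_of_eq_on_inter
    · intro w _ hw
      apply hg
      rw [isEdge_iff_of_mod_one hb]
      simpa using hw
    · intro w hw hwS
      exact hS w hwS (by rw [isEdge_iff_of_mod_one hb]; simpa using hw)
    · intros; rfl
  rw [h1, Finset.sum_insert, Finset.sum_pair]
  · simp
  · obtain ⟨X, U⟩ := b
    simp only [Finset.mem_insert, Finset.mem_singleton, Prod.mk.injEq]
    omega

/-- A sum over the white neighbours of a black vertex in a column `X ≡ 2`. -/
theorem sum_nbrs_of_mod_two {R : Type*} [AddCommMonoid R] {b : Pt} (hb : b.1 % 3 = 2)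
    (S : Finset Pt) (g : Pt → R) (hS : ∀ w ∉ S, IsEdge (w, b) → g w = 0)
    (hg : ∀ w, ¬ IsEdge (w, b) → g w = 0) :
    ∑ w ∈ S, g w = g (b.1 - 1, b.2) + (g (b.1 - 1, b.2 + 1) +
      (g (b.1 + 1, b.2) + g (b.1 + 1, b.2 - 1))) := by
  have h1 : ∑ w ∈ S, g w = ∑ w ∈ ({(b.1 - 1, b.2), (b.1 - 1, b.2 + 1), (b.1 + 1, b.2),
      (b.1 + 1, b.2 - 1)} : Finset Pt), g w := by
    apply Finset.sum_congr_of_eq_on_inter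
    · intro w _ hw
      apply hg
      rw [isEdge_iff_of_mod_two hb]
      simpa using hw
    · intro w hw hwS
      exact hS w hwS (by rw [isEdge_iff_of_mod_two hb]; simpa using hw)
    · intros; rfl
  rw [h1, Finset.sum_insert, Finset.sum_insert, Finset.sum_pair]
  all_goals
    obtain ⟨X, U⟩ := b
    simp only [Finset.mem_insert, Finset.mem_singleton, Prod.mk.injEq, ne_eq]
    omega

/-- The sign of an edge in the Kasteleyn matrix. -/
def edgeSign (e : Edge) : ℝ := if e.2 = (e.1.1 + 1, e.1.2) then -1 else 1

open Classical in
/-- The Kasteleyn matrix with arbitrary edge weights `ν`. -/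
def kast (ν : Edge → ℝ) (e : Edge) : ℝ := if IsEdge e then edgeSign e * ν e else 0

theorem kast_of_not {ν : Edge → ℝ} {e : Edge} (h : ¬ IsEdge e) : kast ν e = 0 := if_neg h

/-- For positive edge weights, the Kasteleyn matrix of the tower is injective on functions of the
white vertices: otherwise the number of changes of sign would grow too much from one side of the
tower to the other. -/
theorem kast_injective {N : ℕ} {ν : Edge → ℝ} (hν : ∀ e, 0 < ν e) {x : Pt → ℝ}
    (hx : ∀ p ∉ whites N, x p = 0)
    (h : ∀ b ∈ blacks N, ∑ w ∈ whites N, kast ν (w, b) * x w = 0) : ∀ p, x p = 0 := by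
  have hin : ∀ p, x p ≠ 0 → p ∈ towerVertices N ∧ IsWhite p := fun p hp => by
    rw [← mem_whites]; by_contra hc; exact hp (hx p hc)
  -- The equation at the black vertex `(X + 1, U)`. It holds for all `U`, since a black position
  -- outside the tower has only white neighbours outside the tower, where `x` is zero.
  have e1 : ∀ X U : ℤ, X % 3 = 0 → X < 3 * N → x (X + 1, U) * ν ((X + 1, U), (X + 1, U)) =
      ν ((X, U), (X + 1, U)) * x (X, U) - ν ((X, U + 1), (X + 1, U)) * x (X, U + 1) := by
    intro X U hX hXN
    have hm : (X + 1) % 3 = 1 := by omega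
    by_cases hb : ((X + 1, U) : Pt) ∈ blacks N
    · have := h _ hb
      rw [sum_nbrs_of_mod_one (b := (X + 1, U)) hm _ _ (fun w hw _ => by simp [hx w hw])
        (fun w hw => by simp [kast_of_not hw])] at this
      simp only [kast, edgeSign, isEdge_iff_of_mod_one (b := (X + 1, U)) hm] at this
      simp at this
      linarith
    · have h0 : ∀ p : Pt, p = (X + 1, U) ∨ p = (X, U) ∨ p = (X, U + 1) → x p = 0 := by
        intro p hp
        by_contra hc
        obtain ⟨h1, h2⟩ := hin p hc
        apply hb
        rw [mem_blacks, mem_towerVertices]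
        rw [mem_towerVertices] at h1
        unfold IsBlack
        rcases hp with rfl | rfl | rfl <;> simp only at h1 ⊢ <;> omega
      rw [h0 (X + 1, U) (by simp), h0 (X, U) (by simp), h0 (X, U + 1) (by simp)]
      simp
  -- The equation at the black vertex `(X + 2, U)`, in the form: a weighted difference in column `X
  -- + 1` equals a weighted sum in column `X + 3`.
  have e2 : ∀ X U : ℤ, X % 3 = 0 → 0 ≤ X → X < 3 * N →
      ν ((X + 1, U), (X + 2, U)) * x (X + 1, U) -
        ν ((X + 1, U + 1), (X + 2, U)) * x (X + 1, U + 1) =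
      ν ((X + 3, U), (X + 2, U)) * x (X + 3, U) +
        ν ((X + 3, U - 1), (X + 2, U)) * x (X + 3, U - 1) := by
    intro X U hX hX0 hXN
    have hm : (X + 2) % 3 = 2 := by omega
    by_cases hb : ((X + 2, U) : Pt) ∈ blacks N
    · have := h _ hb
      rw [sum_nbrs_of_mod_two (b := (X + 2, U)) hm _ _ (fun w hw _ => by simp [hx w hw])
        (fun w hw => by simp [kast_of_not hw])] at this
      simp only [kast, edgeSign, isEdge_iff_of_mod_two (b := (X + 2, U)) hm] at this
      have a1 : X + 2 - 1 = X + 1 := by ring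
      have a2 : X + 2 + 1 = X + 3 := by ring
      have a3 : X + 2 = X + 1 + 1 := by ring
      simp only [a1, a2] at this
      simp [a3] at this
      rw [a3]
      linarith
    · have h0 : ∀ p : Pt, p = (X + 1, U) ∨ p = (X + 1, U + 1) ∨ p = (X + 3, U) ∨
          p = (X + 3, U - 1) → x p = 0 := by
        intro p hp
        by_contra hc
        obtain ⟨h1, h2⟩ := hin p hc
        apply hb
        rw [mem_blacks, mem_towerVertices]
        rw [mem_towerVertices] at h1
        unfold IsBlack
        rcases hp with rfl | rfl | rfl | rfl <;> simp only at h1 ⊢ <;> omega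
      rw [h0 (X + 1, U) (by simp), h0 (X + 1, U + 1) (by simp), h0 (X + 3, U) (by simp),
        h0 (X + 3, U - 1) (by simp)]
      simp
  have hlo : ∀ X U : ℤ, U ≤ -3 * N - 1 → x (X, U) = 0 := by
    intro X U hU
    by_contra hc
    have := (hin _ hc).1
    rw [mem_towerVertices] at this
    simp only at this
    omega
  have hhi : ∀ X U : ℤ, (N : ℤ) ≤ U → x (X, U) = 0 := by
    intro X U hU
    by_contra hc
    have := (hin _ hc).1
    rw [mem_towerVertices] at this
    simp only at this
    omega
  -- Each of the two differences gains one change of sign, and undoing the sum in column `X + 3`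
  -- loses none.
  have step : ∀ X : ℤ, X % 3 = 0 → 0 ≤ X → X < 3 * N → ∀ k, SignAlt (fun U => x (X, U)) k →
      SignAlt (fun U => x (X + 3, U)) (k + 2) := by
    intro X hX hX0 hXN k hk
    have h1 := hk.diff (a := fun U => ν ((X, U), (X + 1, U)) / ν ((X + 1, U), (X + 1, U)))
      (a' := fun U => ν ((X, U + 1), (X + 1, U)) / ν ((X + 1, U), (X + 1, U)))
      (fun U => div_pos (hν _) (hν _)) (fun U => div_pos (hν _) (hν _)) (hlo X) (hhi X)
    have h2 : (fun U => ν ((X, U), (X + 1, U)) / ν ((X + 1, U), (X + 1, U)) * x (X, U) -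
        ν ((X, U + 1), (X + 1, U)) / ν ((X + 1, U), (X + 1, U)) * x (X, U + 1)) =
        fun U => x (X + 1, U) := by
      funext U
      have := e1 X U hX hXN
      have hp := (hν ((X + 1, U), (X + 1, U))).ne'
      field_simp
      linarith
    rw [h2] at h1
    have h3 := h1.diff (a := fun U => ν ((X + 1, U), (X + 2, U)))
      (a' := fun U => ν ((X + 1, U + 1), (X + 2, U))) (fun U => hν _) (fun U => hν _)
      (hlo (X + 1)) (hhi (X + 1))
    simp only [e2 X _ hX hX0 hXN] at h3
    exact SignAlt.of_sum (d := fun U => ν ((X + 3, U), (X + 2, U)))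
      (d' := fun U => ν ((X + 3, U - 1), (X + 2, U))) (fun U => hν _) (fun U => hν _) h3
  have h0 : ∀ U, x (0, U) = 0 := by
    by_contra! hc
    obtain ⟨U, hU⟩ := hc
    have ha : ∀ s ≤ N, SignAlt (fun U => x (3 * s, U)) (2 * s) := by
      intro s
      induction s with
      | zero =>
        exact fun _ => ⟨fun _ => U, x (0, U), by simp, fun j hj => by
          obtain rfl : j = 0 := by omega
          simpa using mul_self_pos.2 hU⟩
      | succ s ih =>
        intro hs
        have := step (3 * s) (by omega) (by omega) (by omega) _ (ih (by omega))
        have e : ((3 * (s + 1 : ℕ) : ℤ)) = 3 * s + 3 := by push_cast; ring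
        rw [e]
        exact this
    obtain ⟨i, ε, hm, hs⟩ := ha N le_rfl
    have hmono : ∀ j ≤ 2 * N, i 0 + j ≤ i j := by
      intro j
      induction j with
      | zero => simp
      | succ j ih => intro hj; have := ih (by omega); have := hm j (by omega); push_cast; omega
    -- The last column has the `2 * N` sites `-2 * N, ..., -1`, whereas `2 * N` changes of sign need
    -- `2 * N + 1` sites.
    have hr : ∀ j ≤ 2 * N, -2 * (N : ℤ) ≤ i j ∧ i j ≤ -1 := by
      intro j hj
      have hne : x (3 * N, i j) ≠ 0 := fun h0 => by have := hs j hj; simp [h0] at this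
      have := (hin _ hne).1
      rw [mem_towerVertices] at this
      simp only at this
      omega
    have := hmono (2 * N) le_rfl
    have := hr 0 (by omega)
    have := hr (2 * N) le_rfl
    push_cast at *
    omega
  -- Once a column `X ≡ 0` vanishes, column `X + 1` vanishes by `e1`, and then `e2` is a two-term
  -- recursion in column `X + 3`, which is solved upwards from below the tower.
  have hcol : ∀ s : ℕ, ∀ U, x (3 * s, U) = 0 ∧ x (3 * s + 1, U) = 0 := by
    have h1 : ∀ X : ℤ, X % 3 = 0 → (∀ U, x (X, U) = 0) → ∀ U, x (X + 1, U) = 0 := by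
      intro X hX hU U
      by_cases hXN : X < 3 * N
      swap
      · by_contra hc
        have := (hin _ hc).1
        rw [mem_towerVertices] at this
        simp only at this
        omega
      have := e1 X U hX hXN
      simp only [hU, mul_zero, sub_zero, mul_eq_zero] at this
      exact this.resolve_right (hν _).ne'
    intro s
    induction s with
    | zero => exact fun U => ⟨by simpa using h0 U, by simpa using h1 0 (by simp) h0 U⟩
    | succ s ih =>
      have e : ((3 * (s + 1 : ℕ) : ℤ)) = 3 * s + 3 := by push_cast; ring
      rw [e]
      have h3 : ∀ n : ℕ, x (3 * s + 3, -3 * N - 1 + n) = 0 := by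
        intro n
        induction n with
        | zero => exact hlo _ _ (by simp)
        | succ n ihn =>
          by_cases hXN : 3 * (s : ℤ) < 3 * N
          swap
          · by_contra hc
            have := (hin _ hc).1
            rw [mem_towerVertices] at this
            simp only at this
            omega
          have := e2 (3 * s) (-3 * N - 1 + (n + 1 : ℕ)) (by omega) (by omega) hXN
          have e' : -3 * (N : ℤ) - 1 + ((n + 1 : ℕ) : ℤ) - 1 = -3 * N - 1 + n := by push_cast; ring
          rw [(ih _).2, (ih _).2, e', ihn] at this
          simp only [mul_zero, sub_zero, add_zero] at this
          exact (mul_eq_zero.1 this.symm).resolve_left (hν _).ne'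
      have h4 : ∀ U, x (3 * s + 3, U) = 0 := by
        intro U
        rcases le_or_gt U (-3 * N - 1) with h | h
        · exact hlo _ _ h
        · obtain ⟨n, rfl⟩ := Int.le.dest h.le
          exact h3 n
      exact fun U => ⟨h4 U, h1 _ (by omega) h4 U⟩
  intro p
  by_contra hc
  obtain ⟨hp, hw⟩ := hin p hc
  obtain ⟨X, U⟩ := p
  rw [mem_towerVertices] at hp
  simp only [IsWhite] at hp hw
  obtain ⟨s, hs⟩ := Int.eq_ofNat_of_zero_le (show 0 ≤ X / 3 by omega)
  rcases hw with hw | hw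
  · have := (hcol s U).1
    rw [show (3 * (s : ℤ)) = X by omega] at this
    exact hc this
  · have := (hcol s U).2
    rw [show (3 * (s : ℤ) + 1) = X by omega] at this
    exact hc this

end TowerDimer

end

/-! ### The Kasteleyn determinant and the common sign of all dimer covers. -/

noncomputable section

namespace TowerDimer

open Matrix

theorem edgeSign_sq (e : Edge) : edgeSign e = 1 ∨ edgeSign e = -1 := by
  unfold edgeSign; split_ifs <;> simp

theorem weight_pos {α β : ℝ} (hα : 0 < α) (hβ : 0 < β) {e : Edge} (h : IsEdge e) :
    0 < weight α β e := by
  obtain ⟨⟨X, U⟩, b⟩ := e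
  unfold weight
  simp only [IsEdge] at h ⊢
  rcases h with ⟨h, h1⟩ | ⟨h, h1⟩
  · rw [if_pos h]
    split_ifs <;> first | positivity | (exfalso; tauto)
  · rw [if_neg (by omega), if_pos h]
    split_ifs <;> first | positivity | (exfalso; tauto)

theorem weight_of_not {α β : ℝ} {e : Edge} (h : ¬ IsEdge e) : weight α β e = 0 := by
  obtain ⟨⟨X, U⟩, b⟩ := e
  unfold weight
  simp only [IsEdge] at h ⊢
  split_ifs <;> first | rfl | (exfalso; tauto)

theorem kasteleyn_eq (α β : ℝ) (e : Edge) : kasteleyn α β e = kast (weight α β) e := by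
  unfold kasteleyn kast edgeSign
  by_cases h : IsEdge e
  · rw [if_pos h]; split_ifs <;> simp
  · rw [if_neg h, weight_of_not h]; simp

/-- The Kasteleyn matrix of the tower with edge weights `ν`. -/
def kastMatrix (N : ℕ) (ν : Edge → ℝ) : Matrix (blacks N) (whites N) ℝ :=
  fun b w => kast ν (w.1, b.1)

theorem kastMatrix_mulVec_injective {N : ℕ} {ν : Edge → ℝ} (hν : ∀ e, IsEdge e → 0 < ν e) :
    Function.Injective (kastMatrix N ν).mulVec := by
  classical
  refine (injective_iff_map_eq_zero (kastMatrix N ν).mulVecLin).2 fun v hv => ?_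
  -- Values of the weight off the edges do not enter the matrix; setting them to `1` makes the
  -- weight positive everywhere.
  set ν' : Edge → ℝ := fun e => if IsEdge e then ν e else 1 with hν'
  have hk : ∀ e, kast ν e = kast ν' e := by
    intro e
    unfold kast
    split_ifs with h
    · simp [hν', h]
    · rfl
  have := kast_injective (N := N) (ν := ν') (fun e => by
      simp only [hν']; split_ifs with h
      · exact hν e h
      · exact one_pos)
    (x := fun p => if h : p ∈ whites N then v ⟨p, h⟩ else 0) (fun p hp => dif_neg hp) (by
      intro b hb
      have h1 := congrFun hv ⟨b, hb⟩
      simp only [mulVecLin_apply, mulVec, dotProduct, kastMatrix, Pi.zero_apply] at h1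
      rw [← h1, ← Finset.sum_coe_sort]
      refine Finset.sum_congr rfl fun w _ => ?_
      rw [hk, dif_pos w.2])
  ext w
  simpa using this w.1

theorem det_kastMatrix_ne_zero {N : ℕ} {ν : Edge → ℝ} (hν : ∀ e, IsEdge e → 0 < ν e)
    (e₀ : whites N ≃ blacks N) : ((kastMatrix N ν).submatrix e₀ id).det ≠ 0 := by
  intro h
  obtain ⟨v, hv, h0⟩ := exists_mulVec_eq_zero_iff.2 h
  apply hv
  apply kastMatrix_mulVec_injective hν
  rw [mulVec_zero]
  ext b
  have := congrFun h0 (e₀.symm b)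
  simpa [mulVec, dotProduct] using this

/-- The sign of the term of the determinant of the Kasteleyn matrix given by a permutation. -/
def termSign {N : ℕ} (e₀ : whites N ≃ blacks N) (σ : Equiv.Perm (whites N)) : ℝ :=
  (Equiv.Perm.sign σ : ℤ) * ∏ w, edgeSign (w.1, (e₀ (σ w)).1)

theorem det_kastMatrix {N : ℕ} (ν : Edge → ℝ) (e₀ : whites N ≃ blacks N) :
    ((kastMatrix N ν).submatrix e₀ id).det =
      ∑ σ : Equiv.Perm (whites N), (Equiv.Perm.sign σ : ℤ) *
        ∏ w : whites N, kast ν (w.1, (e₀ (σ w)).1) := by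
  rw [det_apply']
  rfl

theorem termSign_sq {N : ℕ} (e₀ : whites N ≃ blacks N) (σ : Equiv.Perm (whites N)) :
    termSign e₀ σ = 1 ∨ termSign e₀ σ = -1 := by
  unfold termSign
  have h1 : ∀ s : Finset (whites N), ∏ w ∈ s, edgeSign (w.1, (e₀ (σ w)).1) = 1 ∨
      ∏ w ∈ s, edgeSign (w.1, (e₀ (σ w)).1) = -1 := by
    intro s
    induction s using Finset.cons_induction with
    | empty => simp
    | cons a s ha ih =>
      rw [Finset.prod_cons]
      rcases edgeSign_sq (a.1, (e₀ (σ a)).1) with h | h <;> rcases ih with h' | h' <;>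
        simp [h, h']
  rcases Int.units_eq_one_or (Equiv.Perm.sign σ) with h | h <;>
    rcases h1 Finset.univ with h' | h' <;> rw [h, h'] <;> norm_num

/-- All dimer covers contribute with the same sign to the determinant. -/
theorem exists_termSign_eq {N : ℕ} (e₀ : whites N ≃ blacks N) :
    ∃ ε : ℝ, ε ≠ 0 ∧ ∀ σ : Equiv.Perm (whites N),
      (∀ w : whites N, IsEdge (w.1, (e₀ (σ w)).1)) → termSign e₀ σ = ε := by
  classical
  set D1 := ((kastMatrix N fun _ => 1).submatrix e₀ id).det with hD1
  have hD1ne : D1 ≠ 0 := det_kastMatrix_ne_zero (fun _ _ => one_pos) e₀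
  have key : ∀ σ : Equiv.Perm (whites N),
      (∀ w : whites N, IsEdge (w.1, (e₀ (σ w)).1)) → 0 < termSign e₀ σ * D1 := by
    intro σ hσ
    -- A path of weights from the constant weight `1` at `t = 1` to the indicator of the chosen
    -- cover at `t = 0`. The determinant is nonzero along it, hence keeps its sign, and at `t = 0`
    -- it is the single term of `σ`.
    set ν : ℝ → Edge → ℝ := fun t e =>
      if ∃ w : whites N, e = (w.1, (e₀ (σ w)).1) then 1 else t with hν
    set D : ℝ → ℝ := fun t => ((kastMatrix N (ν t)).submatrix e₀ id).det with hD
    have hcont : Continuous D := by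
      simp only [hD, det_kastMatrix]
      refine continuous_finsetSum _ fun τ _ => continuous_const.mul ?_
      refine continuous_finsetProd _ fun w _ => ?_
      unfold kast
      split_ifs
      · refine continuous_const.mul ?_
        simp only [hν]
        split_ifs <;> fun_prop
      · fun_prop
    have hpos : ∀ t, 0 < t → D t ≠ 0 := fun t ht =>
      det_kastMatrix_ne_zero (fun e _ => by simp only [hν]; split_ifs <;> positivity) e₀
    have hD1' : D 1 = D1 := by simp [hD, hν, hD1]
    -- A permutation different from `σ` uses at least one pair which is not in the cover of `σ`; at
    -- `t = 0` its entry is zero.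
    have hD0 : D 0 = termSign e₀ σ := by
      simp only [hD, det_kastMatrix]
      rw [Finset.sum_eq_single σ]
      · unfold termSign
        congr 1
        refine Finset.prod_congr rfl fun w _ => ?_
        unfold kast
        rw [if_pos (hσ w)]
        simp only [hν]
        rw [if_pos ⟨w, rfl⟩, mul_one]
      · intro τ _ hτ
        obtain ⟨w, hw⟩ : ∃ w, τ w ≠ σ w := by
          by_contra! hc
          exact hτ (Equiv.ext hc)
        rw [Finset.prod_eq_zero (Finset.mem_univ w), mul_zero]
        unfold kast
        split_ifs with h
        · simp only [hν]
          rw [if_neg, mul_zero]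
          rintro ⟨w', hw'⟩
          rw [Prod.mk.injEq] at hw'
          obtain rfl := Subtype.ext hw'.1
          exact hw (e₀.injective (Subtype.ext hw'.2))
        · rfl
      · simp
    have hD0ne : D 0 ≠ 0 := by
      rw [hD0]; rcases termSign_sq e₀ σ with h | h <;> simp [h]
    have hne : ∀ t ∈ Set.Icc (0 : ℝ) 1, D t ≠ 0 := by
      intro t ht
      rcases ht.1.eq_or_lt with rfl | h
      · exact hD0ne
      · exact hpos t h
    rw [← hD0, ← hD1']
    by_contra hc
    have hlt : D 0 * D 1 < 0 := lt_of_le_of_ne (not_lt.1 hc) (mul_ne_zero hD0ne (hpos 1 one_pos))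
    rcases mul_neg_iff.1 hlt with ⟨h1, h2⟩ | ⟨h1, h2⟩
    · obtain ⟨t, ht, h⟩ := intermediate_value_Icc' zero_le_one hcont.continuousOn
        (show (0 : ℝ) ∈ Set.Icc (D 1) (D 0) from ⟨h2.le, h1.le⟩)
      exact hne t ht h
    · obtain ⟨t, ht, h⟩ := intermediate_value_Icc zero_le_one hcont.continuousOn
        (show (0 : ℝ) ∈ Set.Icc (D 0) (D 1) from ⟨h1.le, h2.le⟩)
      exact hne t ht h
  refine ⟨if 0 < D1 then 1 else -1, by split_ifs <;> norm_num, fun σ hσ => ?_⟩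
  have := key σ hσ
  rcases termSign_sq e₀ σ with h | h <;> rw [h] at this ⊢
  · rw [if_pos (by linarith)]
  · rw [if_neg (by linarith)]

/-- The set of edges matched by a permutation. -/
def graphOf {N : ℕ} (e₀ : whites N ≃ blacks N) (σ : Equiv.Perm (whites N)) : Finset Edge :=
  Finset.univ.map ⟨fun w : whites N => (w.1, (e₀ (σ w)).1), fun w w' h => by
    simp only [Prod.mk.injEq] at h
    exact Subtype.ext h.1⟩

theorem mem_graphOf {N : ℕ} {e₀ : whites N ≃ blacks N} {σ : Equiv.Perm (whites N)} {e : Edge} :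
    e ∈ graphOf e₀ σ ↔ ∃ w : whites N, (w.1, (e₀ (σ w)).1) = e := by
  rw [graphOf, Finset.mem_map]
  exact ⟨fun ⟨w, _, h⟩ => ⟨w, h⟩, fun ⟨w, h⟩ => ⟨w, Finset.mem_univ w, h⟩⟩

theorem mem_towerCovers {N : ℕ} {M : Finset Edge} : M ∈ towerCovers N ↔
    IsDimerCover (towerVertices N : Set Pt) (M : Set Edge) := by
  classical
  unfold towerCovers
  rw [Finset.mem_filter, Finset.mem_powerset]
  refine ⟨fun h => h.2, fun h => ⟨fun e he => ?_, h⟩⟩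
  have := h.edge e he
  rw [Finset.mem_product]
  exact this.2

theorem graphOf_mem_towerCovers {N : ℕ} (e₀ : whites N ≃ blacks N) (σ : Equiv.Perm (whites N))
    (h : ∀ w : whites N, IsEdge (w.1, (e₀ (σ w)).1)) : graphOf e₀ σ ∈ towerCovers N := by
  rw [mem_towerCovers]
  refine ⟨fun e he => ?_, fun w hw hw' => ?_, fun b hb hb' => ?_⟩
  · obtain ⟨w, rfl⟩ := mem_graphOf.1 he
    exact ⟨h w, (mem_whites.1 w.2).1, (mem_blacks.1 (e₀ (σ w)).2).1⟩
  · have hm : w ∈ whites N := mem_whites.2 ⟨hw, hw'⟩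
    refine ⟨(e₀ (σ ⟨w, hm⟩)).1, mem_graphOf.2 ⟨⟨w, hm⟩, rfl⟩, fun b hb => ?_⟩
    obtain ⟨w', hw''⟩ := mem_graphOf.1 hb
    simp only [Prod.mk.injEq] at hw''
    obtain rfl : w' = ⟨w, hm⟩ := Subtype.ext hw''.1
    exact hw''.2.symm
  · have hm : b ∈ blacks N := mem_blacks.2 ⟨hb, hb'⟩
    refine ⟨(σ.symm (e₀.symm ⟨b, hm⟩)).1, mem_graphOf.2
      ⟨σ.symm (e₀.symm ⟨b, hm⟩), ?_⟩, fun w hw => ?_⟩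
    · simp
    · obtain ⟨w', hw''⟩ := mem_graphOf.1 hw
      simp only [Prod.mk.injEq] at hw''
      have : e₀ (σ w') = ⟨b, hm⟩ := Subtype.ext hw''.2
      rw [← this]
      simp [hw''.1]

theorem exists_graphOf {N : ℕ} (e₀ : whites N ≃ blacks N) {M : Finset Edge}
    (hM : M ∈ towerCovers N) : ∃ σ : Equiv.Perm (whites N),
      (∀ w : whites N, IsEdge (w.1, (e₀ (σ w)).1)) ∧ graphOf e₀ σ = M := by
  rw [mem_towerCovers] at hM
  have H : ∀ w : whites N, ∃ b : blacks N, (w.1, b.1) ∈ M := by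
    intro w
    obtain ⟨b, hb, -⟩ := hM.white w.1 (mem_whites.1 w.2).1 (mem_whites.1 w.2).2
    have := hM.edge _ hb
    exact ⟨⟨b, mem_blacks.2 ⟨this.2.2, this.1.isBlack⟩⟩, hb⟩
  choose g hg using H
  have hinj : Function.Injective g := by
    intro w w' h
    have h1 := hg w
    rw [h] at h1
    have hb := mem_blacks.1 (g w').2
    exact Subtype.ext ((hM.black _ hb.1 hb.2).unique h1 (hg w'))
  have hinj' : Function.Injective (e₀.symm ∘ g) := e₀.symm.injective.comp hinj
  refine ⟨Equiv.ofBijective _ (Finite.injective_iff_bijective.1 hinj'), fun w => ?_, ?_⟩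
  · simpa using (hM.edge _ (hg w)).1
  · ext e
    rw [mem_graphOf]
    constructor
    · rintro ⟨w, rfl⟩
      simpa using hg w
    · intro he
      have h1 := hM.edge e he
      have hw : e.1 ∈ whites N := mem_whites.2 ⟨h1.2.1, h1.1.isWhite⟩
      refine ⟨⟨e.1, hw⟩, ?_⟩
      have := (hM.white _ h1.2.1 h1.1.isWhite).unique he (hg ⟨e.1, hw⟩)
      simp [← this]

/-- Dimer covers correspond to the permutations all of whose pairs are edges, and any other
permutation has a factor of weight `0`. This turns the partition sums into signless determinants. -/
theorem sum_towerCovers {N : ℕ} (e₀ : whites N ≃ blacks N) (α β : ℝ) (P : Finset Edge → Prop)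
    [DecidablePred P] :
    ∑ M ∈ (towerCovers N).filter P, ∏ e ∈ M, weight α β e =
      ∑ σ : Equiv.Perm (whites N), if P (graphOf e₀ σ) then
        ∏ w : whites N, weight α β (w.1, (e₀ (σ w)).1) else 0 := by
  classical
  rw [← Finset.sum_filter]
  have h1 : ∑ σ : Equiv.Perm (whites N) with P (graphOf e₀ σ),
      ∏ w : whites N, weight α β (w.1, (e₀ (σ w)).1) =
      ∑ σ : Equiv.Perm (whites N) with P (graphOf e₀ σ) ∧
        ∀ w : whites N, IsEdge (w.1, (e₀ (σ w)).1),
        ∏ w : whites N, weight α β (w.1, (e₀ (σ w)).1) := by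
    rw [← Finset.filter_filter]
    symm
    apply Finset.sum_filter_of_ne
    intro σ _ h w
    by_contra hc
    exact h (Finset.prod_eq_zero (Finset.mem_univ w) (weight_of_not hc))
  rw [h1]
  symm
  refine Finset.sum_nbij (graphOf e₀) ?_ ?_ ?_ ?_
  · intro σ hσ
    rw [Finset.mem_filter] at hσ ⊢
    exact ⟨graphOf_mem_towerCovers e₀ σ hσ.2.2, hσ.2.1⟩
  · intro σ _ τ _ h
    refine Equiv.ext fun w => ?_
    have : (w.1, (e₀ (σ w)).1) ∈ graphOf e₀ τ := by
      rw [← h]; exact mem_graphOf.2 ⟨w, rfl⟩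
    obtain ⟨w', hw'⟩ := mem_graphOf.1 this
    rw [Prod.mk.injEq] at hw'
    obtain rfl := Subtype.ext hw'.1
    exact (e₀.injective (Subtype.ext hw'.2)).symm
  · intro M hM
    rw [Finset.mem_coe, Finset.mem_filter] at hM
    obtain ⟨σ, h1, rfl⟩ := exists_graphOf e₀ hM.1
    refine ⟨σ, ?_, rfl⟩
    rw [Finset.mem_coe, Finset.mem_filter]
    exact ⟨Finset.mem_univ _, hM.2, h1⟩
  · intro σ _
    rw [graphOf, Finset.prod_map]
    rfl

end TowerDimer

end

/-! ### Edge probabilities as minors of an inverse Kasteleyn matrix. -/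

noncomputable section

namespace TowerDimer

open Matrix

open Classical in
/-- The Kasteleyn matrix of the tower in which the rows of the black vertices of `s` are replaced
by their entries at the edges of `s`. -/
def pinnedMatrix (α β : ℝ) (N : ℕ) (s : Finset Edge) : Matrix (blacks N) (whites N) ℝ :=
  fun b w => if ∃ e ∈ s, e.2 = b.1 then
    (if (w.1, b.1) ∈ s then kasteleyn α β (w.1, b.1) else 0) else kasteleyn α β (w.1, b.1)

/-- In a pinned row only the entry at the edge of `s` survives, so a permutation contributes only if
its cover contains `s`. All contributing covers have the common sign `ε`. -/
theorem det_pinnedMatrix {α β : ℝ} {N : ℕ} {s : Finset Edge}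
    (hs : ∀ e ∈ s, e.2 ∈ blacks N) (hinj : Set.InjOn Prod.snd (s : Set Edge))
    (e₀ : whites N ≃ blacks N) {ε : ℝ} (hε : ∀ σ : Equiv.Perm (whites N),
      (∀ w : whites N, IsEdge (w.1, (e₀ (σ w)).1)) → termSign e₀ σ = ε) [DecidablePred (s ⊆ ·)] :
    ((pinnedMatrix α β N s).submatrix e₀ id).det =
      ε * ∑ M ∈ (towerCovers N).filter fun M => s ⊆ M, ∏ e ∈ M, weight α β e := by
  classical
  rw [sum_towerCovers e₀, Finset.mul_sum, det_apply']
  refine Finset.sum_congr rfl fun σ _ => ?_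
  simp only [submatrix_apply, id]
  by_cases hσ : ∀ w : whites N, IsEdge (w.1, (e₀ (σ w)).1)
  · split_ifs with hsub
    · rw [← hε σ hσ, termSign, mul_assoc, ← Finset.prod_mul_distrib]
      congr 1
      refine Finset.prod_congr rfl fun w _ => ?_
      have h1 : kasteleyn α β (w.1, (e₀ (σ w)).1) =
          edgeSign (w.1, (e₀ (σ w)).1) * weight α β (w.1, (e₀ (σ w)).1) := by
        rw [kasteleyn_eq, kast, if_pos (hσ w)]
      unfold pinnedMatrix
      split_ifs with h2 h3
      · exact h1
      · exfalso
        apply h3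
        obtain ⟨e, he, he2⟩ := h2
        obtain ⟨w', rfl⟩ := mem_graphOf.1 (hsub he)
        obtain rfl : w' = w := σ.injective (e₀.injective (Subtype.ext he2))
        exact he
      · exact h1
    · rw [mul_zero]
      obtain ⟨e, he, he2⟩ := Finset.not_subset.1 hsub
      set w := σ.symm (e₀.symm ⟨e.2, hs e he⟩) with hw
      have hw2 : (e₀ (σ w)).1 = e.2 := by simp [hw]
      rw [Finset.prod_eq_zero (Finset.mem_univ w), mul_zero]
      unfold pinnedMatrix
      rw [if_pos ⟨e, he, hw2.symm⟩, if_neg]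
      intro h3
      have := hinj h3 he hw2
      exact he2 (mem_graphOf.2 ⟨w, this⟩)
  · push Not at hσ
    obtain ⟨w, hw⟩ := hσ
    have h0 : kasteleyn α β (w.1, (e₀ (σ w)).1) = 0 := by rw [kasteleyn_eq, kast_of_not hw]
    rw [Finset.prod_eq_zero (Finset.mem_univ w), Finset.prod_eq_zero (Finset.mem_univ w)]
    · simp
    · exact weight_of_not hw
    · unfold pinnedMatrix
      rw [h0]; simp

/-- The determinantal formula for the edge probabilities of the tower, for a right inverse `G` of
the Kasteleyn matrix. -/
theorem towerProb_eq_det {α β : ℝ} (hα : 0 < α) (hβ : 0 < β) {N : ℕ} {G : Pt → Pt → ℂ}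
    (hG : ∀ b ∈ blacks N, ∀ b' ∈ blacks N,
      ∑ w ∈ whites N, (kasteleyn α β (w, b) : ℂ) * G w b' = if b = b' then 1 else 0)
    {s : Finset Edge} (hs : ∀ e ∈ s, e.1 ∈ whites N ∧ e.2 ∈ blacks N) :
    ((towerProb α β N s : ℝ) : ℂ) = (∏ e ∈ s, (kasteleyn α β e : ℂ)) *
      (Matrix.of fun e f : s => G e.1.1 f.1.2).det := by
  classical
  set K : Matrix (blacks N) (whites N) ℂ := fun b w => (kasteleyn α β (w.1, b.1) : ℂ) with hK
  set G' : Matrix (whites N) (blacks N) ℂ := fun w b => G w.1 b.1 with hG'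
  have hKG : K * G' = 1 := by
    ext b b'
    rw [mul_apply, one_apply]
    have := hG b.1 b.2 b'.1 b'.2
    rw [← Finset.sum_coe_sort (whites N)] at this
    simp only [Subtype.ext_iff]
    exact this
  have hw : ∀ e, IsEdge e → 0 < weight α β e := fun e he => weight_pos hα hβ he
  have hKR : ∀ b w, kastMatrix N (weight α β) b w = kasteleyn α β (w.1, b.1) := fun b w =>
    (kasteleyn_eq _ _ _).symm
  -- Injectivity gives one inequality between the numbers of white and black vertices; the right
  -- inverse makes the matrix surjective and gives the other.
  have hcard : Fintype.card (whites N) = Fintype.card (blacks N) := by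
    apply le_antisymm
    · have := LinearMap.finrank_le_finrank_of_injective
        (f := (kastMatrix N (weight α β)).mulVecLin) (kastMatrix_mulVec_injective hw)
      simpa using this
    · have h1 : Function.Surjective K.mulVecLin := by
        intro v
        refine ⟨G' *ᵥ v, ?_⟩
        rw [mulVecLin_apply, mulVec_mulVec, hKG, one_mulVec]
      have := LinearMap.finrank_le_finrank_of_surjective h1
      simpa using this
  obtain ⟨e₀⟩ : Nonempty (whites N ≃ blacks N) := ⟨Fintype.equivOfCardEq hcard⟩
  obtain ⟨ε, hε0, hε⟩ := exists_termSign_eq e₀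
  have hZ : ((kastMatrix N (weight α β)).submatrix e₀ id).det =
      ε * ∑ M ∈ towerCovers N, ∏ e ∈ M, weight α β e := by
    have := det_pinnedMatrix (α := α) (β := β) (s := ∅) (by simp) (by simp) e₀ hε
    simp only [Finset.empty_subset, Finset.filter_true] at this
    rw [← this]
    congr 1
    ext i j
    simp [pinnedMatrix, hKR]
  have hdet := det_kastMatrix_ne_zero hw e₀
  have hZ0 : ∑ M ∈ towerCovers N, ∏ e ∈ M, weight α β e ≠ 0 := by
    intro h; rw [h, mul_zero] at hZ; exact hdet hZ
  -- If two edges of `s` share a black vertex, no cover contains both, and the matrix on the right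
  -- has two equal columns.
  by_cases hinj : Set.InjOn Prod.snd (s : Set Edge)
  swap
  · have h1 : towerProb α β N s = 0 := by
      unfold towerProb
      rw [Finset.sum_eq_zero, zero_div]
      intro M hM
      rw [Finset.mem_filter, mem_towerCovers] at hM
      exfalso
      apply hinj
      intro e he f hf hef
      obtain ⟨hM, hsub⟩ := hM
      have h2 := hM.edge e (hsub he)
      have h3 := hM.black e.2 h2.2.2 h2.1.isBlack
      have h4 : (f.1, e.2) ∈ (M : Set Edge) := by rw [hef]; exact hsub hf
      exact Prod.ext (h3.unique (hsub he) h4) hef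
    rw [h1]
    unfold Set.InjOn at hinj
    push Not at hinj
    obtain ⟨e, he, f, hf, hef, hne⟩ := hinj
    rw [det_zero_of_column_eq (i := ⟨e, he⟩) (j := ⟨f, hf⟩)]
    · simp
    · exact fun h => hne (Subtype.ext_iff.1 h)
    · intro k
      simp [hef]
  · have hP := det_pinnedMatrix (α := α) (β := β) (fun e he => (hs e he).2) hinj e₀ hε
    have h1 : towerProb α β N s = ((pinnedMatrix α β N s).submatrix e₀ id).det /
        ((kastMatrix N (weight α β)).submatrix e₀ id).det := by
      rw [hP, hZ, mul_div_mul_left _ _ hε0]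
      unfold towerProb
      congr!
    set P : Matrix (blacks N) (whites N) ℂ := fun b w => (pinnedMatrix α β N s b w : ℂ) with hPdef
    have h2 : ((((pinnedMatrix α β N s).submatrix e₀ id).det : ℝ) : ℂ) =
        (P.submatrix e₀ id).det := by
      have := RingHom.map_det Complex.ofRealHom ((pinnedMatrix α β N s).submatrix e₀ id)
      exact this
    have h3 : ((((kastMatrix N (weight α β)).submatrix e₀ id).det : ℝ) : ℂ) =
        (K.submatrix e₀ id).det := by
      have := RingHom.map_det Complex.ofRealHom ((kastMatrix N (weight α β)).submatrix e₀ id)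
      refine this.trans ?_
      congr 1
      ext i j
      exact congrArg Complex.ofReal (hKR (e₀ i) j)
    -- The probability is a quotient of determinants; since `det K * det G' = 1` after reindexing,
    -- it becomes the determinant of the product `P * G'`.
    have h4 : (K.submatrix e₀ id).det * (G'.submatrix id e₀).det = 1 := by
      rw [← det_mul, ← submatrix_mul _ _ e₀ id e₀ Function.bijective_id, hKG,
        submatrix_one_equiv, det_one]
    have h5 : (P.submatrix e₀ id).det * (G'.submatrix id e₀).det = (P * G').det := by
      rw [← det_mul, ← submatrix_mul _ _ e₀ id e₀ Function.bijective_id, det_submatrix_equiv_self]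
    have h6 : ((towerProb α β N s : ℝ) : ℂ) = (P * G').det := by
      rw [h1, Complex.ofReal_div, h2, h3, ← h5]
      have : (K.submatrix e₀ id).det ≠ 0 := left_ne_zero_of_mul_eq_one h4
      rw [div_eq_iff this, mul_assoc, mul_comm (G'.submatrix id e₀).det, h4, mul_one]
    rw [h6]
    -- Rows of `P` which are not pinned are rows of `K`, so there `P * G'` agrees with the identity.
    -- It is block triangular, and only the block of the pinned rows matters.
    have hrow : ∀ b b' : blacks N, (¬ ∃ e ∈ s, e.2 = b.1) → (P * G') b b' =
        (1 : Matrix (blacks N) (blacks N) ℂ) b b' := by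
      intro b b' hb
      rw [← hKG, mul_apply, mul_apply]
      refine Finset.sum_congr rfl fun w _ => ?_
      simp only [hPdef, pinnedMatrix, hK]
      rw [if_neg hb]
    have hrow' : ∀ e (he : e ∈ s) (b' : blacks N), (P * G') ⟨e.2, (hs e he).2⟩ b' =
        kasteleyn α β e * G e.1 b'.1 := by
      intro e he b'
      rw [mul_apply, Finset.sum_eq_single ⟨e.1, (hs e he).1⟩]
      · simp only [hPdef, pinnedMatrix, hG']
        rw [if_pos ⟨e, he, rfl⟩, if_pos he]
      · intro w _ hw
        simp only [hPdef, pinnedMatrix]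
        rw [if_pos ⟨e, he, rfl⟩, if_neg, Complex.ofReal_zero, zero_mul]
        intro h
        have := hinj h he rfl
        exact hw (Subtype.ext (congrArg Prod.fst this))
      · simp
    rw [twoBlockTriangular_det _ (fun b : blacks N => ∃ e ∈ s, e.2 = b.1)]
    · have h7 : (toSquareBlockProp (P * G') fun b : blacks N => ¬ ∃ e ∈ s, e.2 = b.1) = 1 := by
        ext b b'
        rw [toSquareBlockProp_def, of_apply, hrow _ _ b.2, one_apply, one_apply]
        simp only [Subtype.ext_iff]
      rw [h7, det_one, mul_one]
      have hbij : Function.Bijective (fun e : s =>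
          (⟨⟨e.1.2, (hs e.1 e.2).2⟩, e.1, e.2, rfl⟩ :
            {b : blacks N // ∃ e ∈ s, e.2 = b.1})) := by
        constructor
        · intro e f h
          simp only [Subtype.mk.injEq] at h
          exact Subtype.ext (hinj e.2 f.2 h)
        · rintro ⟨b, hb⟩
          obtain ⟨e, he, heb⟩ := hb
          exact ⟨⟨e, he⟩, Subtype.ext (Subtype.ext heb)⟩
      rw [← det_submatrix_equiv_self (Equiv.ofBijective _ hbij), ← Finset.prod_coe_sort,
        ← det_mul_column]
      congr 1
      ext e f
      simp only [submatrix_apply, Equiv.ofBijective_apply, toSquareBlockProp_def, of_apply]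
      exact hrow' e.1 e.2 _
    · intro b hb b' hb'
      rw [hrow _ _ hb, one_apply_ne]
      rintro rfl
      exact hb hb'

/-- For `s = ∅` the determinantal formula gives probability `1`, while a vanishing partition
function would give `0 / 0 = 0`. -/
theorem sum_towerCovers_ne_zero {α β : ℝ} (hα : 0 < α) (hβ : 0 < β) {N : ℕ} {G : Pt → Pt → ℂ}
    (hG : ∀ b ∈ blacks N, ∀ b' ∈ blacks N,
      ∑ w ∈ whites N, (kasteleyn α β (w, b) : ℂ) * G w b' = if b = b' then 1 else 0) :
    ∑ M ∈ towerCovers N, ∏ e ∈ M, weight α β e ≠ 0 := by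
  intro h
  have := towerProb_eq_det hα hβ hG (s := ∅) (by simp)
  unfold towerProb at this
  rw [h] at this
  simp at this

end TowerDimer

end

noncomputable section

namespace TowerDimer

open MeasureTheory Filter Topology Metric Complex Bornology

/-! ### Circle integrals -/

theorem hasDerivAt_sub_inv_ne {z w : ℂ} (h : z ≠ w) :
    DifferentiableAt ℂ (fun z => (z - w)⁻¹) z :=
  (differentiableAt_id.sub_const w).inv (sub_ne_zero.2 h)

/-- Circle integrals over concentric circles agree when there is no singularity in between. -/
theorem circleIntegral_annulus_eq {c : ℂ} {r R : ℝ} (h0 : 0 < r) (hle : r ≤ R) {f : ℂ → ℂ}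
    (hf : ∀ z, r ≤ dist z c → dist z c ≤ R → DifferentiableAt ℂ f z) :
    (∮ z in C(c, R), f z) = ∮ z in C(c, r), f z := by
  refine circleIntegral_eq_of_differentiable_on_annulus_off_countable h0 hle
    Set.countable_empty ?_ ?_
  · intro z hz
    refine (hf z ?_ ?_).continuousAt.continuousWithinAt
    · simpa using hz.2
    · simpa using hz.1
  · intro z hz
    refine hf z ?_ ?_
    · exact (not_le.1 (by simpa using hz.1.2)).le
    · exact (mem_ball.1 hz.1.1).le

theorem circleIntegral_sub_inv_of_lt {c w : ℂ} {r : ℝ} (h0 : 0 ≤ r) (hw : r < dist w c) :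
    (∮ z in C(c, r), (z - w)⁻¹) = 0 := by
  refine circleIntegral_eq_zero_of_differentiable_on_off_countable h0 Set.countable_empty ?_ ?_
  · intro z hz
    refine (hasDerivAt_sub_inv_ne ?_).continuousAt.continuousWithinAt
    rintro rfl
    exact absurd (mem_closedBall.1 hz) (not_le.2 hw)
  · intro z hz
    refine hasDerivAt_sub_inv_ne ?_
    rintro rfl
    exact absurd (mem_ball.1 hz.1) (not_lt.2 hw.le)

/-- The difference of the circle integrals of `f z / (z - w)` over two concentric circles with
`w` in between is a residue. -/
theorem circleIntegral_annulus_pole {c w : ℂ} {r R : ℝ} (h0 : 0 < r) (hr : r < dist w c)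
    (hR : dist w c < R) {f : ℂ → ℂ}
    (hf : ∀ z, r ≤ dist z c → dist z c ≤ R → DifferentiableAt ℂ f z) :
    (∮ z in C(c, R), f z * (z - w)⁻¹) =
      (∮ z in C(c, r), f z * (z - w)⁻¹) + 2 * Real.pi * I * f w := by
  have hR0 : 0 < R := h0.trans (hr.trans hR)
  -- The difference quotient has no pole at `w`, so its two integrals agree; what is left of `f z /
  -- (z - w)` is `f w / (z - w)`, whose integral is known on each circle.
  have hds : (∮ z in C(c, R), dslope f w z) = ∮ z in C(c, r), dslope f w z := by
    refine circleIntegral_eq_of_differentiable_on_annulus_off_countable h0 (hr.trans hR).le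
      (Set.countable_singleton w) ?_ ?_
    · intro z hz
      have hfz := hf z (by simpa using hz.2) (by simpa using hz.1)
      apply ContinuousAt.continuousWithinAt
      by_cases hzw : z = w
      · rw [hzw] at hfz ⊢
        exact continuousAt_dslope_same.2 hfz
      · exact (continuousAt_dslope_of_ne hzw).2 hfz.continuousAt
    · intro z hz
      refine (differentiableAt_dslope_of_ne (by simpa using hz.2)).2 (hf z ?_ ?_)
      · exact (not_le.1 (by simpa using hz.1.2)).le
      · exact (mem_ball.1 hz.1.1).le
  have hcont : ∀ ρ, r ≤ ρ → ρ ≤ R → ContinuousOn f (sphere c ρ) := fun ρ h1 h2 z hz => by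
    rw [mem_sphere] at hz
    exact (hf z (by rw [hz]; exact h1) (by rw [hz]; exact h2)).continuousAt.continuousWithinAt
  have hinv : ∀ ρ, ρ ≠ dist w c → ContinuousOn (fun z => (z - w)⁻¹) (sphere c ρ) := fun ρ h z hz => by
    rw [mem_sphere] at hz
    refine (hasDerivAt_sub_inv_ne ?_).continuousAt.continuousWithinAt
    rintro rfl; exact h hz.symm
  have key : ∀ ρ, 0 ≤ ρ → r ≤ ρ → ρ ≤ R → ρ ≠ dist w c → (∮ z in C(c, ρ), dslope f w z) =
      (∮ z in C(c, ρ), f z * (z - w)⁻¹) - f w * ∮ z in C(c, ρ), (z - w)⁻¹ := by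
    intro ρ h1 h2 h3 h4
    rw [← circleIntegral.integral_const_mul, ← circleIntegral.integral_sub]
    · refine circleIntegral.integral_congr h1 fun z hz => ?_
      have : z ≠ w := by rintro rfl; exact h4 (mem_sphere.1 hz).symm
      simp only [dslope_of_ne f this, slope, vsub_eq_sub, smul_eq_mul]
      ring
    · exact ((hcont ρ h2 h3).mul (hinv ρ h4)).circleIntegrable h1
    · exact (continuousOn_const.mul (hinv ρ h4)).circleIntegrable h1
  rw [key R hR0.le (hr.trans hR).le le_rfl hR.ne', key r h0.le le_rfl (hr.trans hR).le hr.ne,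
    circleIntegral_sub_inv_of_lt h0.le hr, circleIntegral.integral_sub_inv_of_mem_ball
      (mem_ball.2 hR)] at hds
  linear_combination hds

theorem continuous_comp_circleMap {c c' : ℂ} {r r' : ℝ} (hr : 0 ≤ r) (hr' : 0 ≤ r')
    {f : ℂ → ℂ → ℂ}
    (hf : ContinuousOn (fun p : ℂ × ℂ => f p.1 p.2) (sphere c r ×ˢ sphere c' r')) :
    Continuous fun p : ℝ × ℝ => f (circleMap c r p.1) (circleMap c' r' p.2) :=
  hf.comp_continuous (f := fun p : ℝ × ℝ => (circleMap c r p.1, circleMap c' r' p.2))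
    (by fun_prop) fun _ => ⟨circleMap_mem_sphere _ hr _, circleMap_mem_sphere _ hr' _⟩

/-- Circle integrals can be interchanged. -/
theorem circleIntegral_swap {c c' : ℂ} {r r' : ℝ} (hr : 0 ≤ r) (hr' : 0 ≤ r') {f : ℂ → ℂ → ℂ}
    (hf : ContinuousOn (fun p : ℂ × ℂ => f p.1 p.2) (sphere c r ×ˢ sphere c' r')) :
    (∮ z in C(c, r), ∮ w in C(c', r'), f z w) = ∮ w in C(c', r'), ∮ z in C(c, r), f z w := by
  unfold circleIntegral
  simp only [smul_eq_mul, ← intervalIntegral.integral_const_mul]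
  have h1 := continuous_comp_circleMap hr hr' hf
  rw [intervalIntegral_intervalIntegral_swap]
  · refine intervalIntegral.integral_congr fun θ _ => intervalIntegral.integral_congr fun φ _ => ?_
    ring
  · simp only [deriv_circleMap]
    refine ContinuousOn.integrableOn_compact (K := Set.uIcc 0 (2 * Real.pi) ×ˢ
      Set.uIcc 0 (2 * Real.pi)) (isCompact_uIcc.prod isCompact_uIcc) ?_ |>.mono_set
      (Set.prod_mono Set.uIoc_subset_uIcc Set.uIoc_subset_uIcc)
    apply Continuous.continuousOn
    unfold Function.uncurry
    simp only
    exact (((continuous_circleMap 0 r).comp continuous_fst).mul continuous_const).mul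
      ((((continuous_circleMap 0 r').comp continuous_snd).mul continuous_const).mul h1)

theorem circleIntegrable_circleIntegral {c c' : ℂ} {r r' : ℝ} (hr : 0 ≤ r) (hr' : 0 ≤ r')
    {f : ℂ → ℂ → ℂ}
    (hf : ContinuousOn (fun p : ℂ × ℂ => f p.1 p.2) (sphere c r ×ˢ sphere c' r')) :
    CircleIntegrable (fun w => ∮ z in C(c, r), f z w) c' r' := by
  apply Continuous.intervalIntegrable
  unfold circleIntegral
  simp only [smul_eq_mul, deriv_circleMap]
  apply intervalIntegral.continuous_parametric_intervalIntegral_of_continuous'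
  unfold Function.uncurry
  simp only
  exact (((continuous_circleMap 0 r).comp continuous_snd).mul continuous_const).mul
    ((continuous_comp_circleMap hr hr' hf).comp continuous_swap)

/-- Exchange of the two contours of a double integral with a simple pole on the diagonal. -/
theorem circleIntegral_exchange {c : ℂ} {r₀ r₁ r₂ R : ℝ} (h0 : 0 ≤ r₀) (h01 : r₀ < r₁)
    (h12 : r₁ < r₂) (h2 : r₂ < R) {f g : ℂ → ℂ}
    (hf : ∀ z, r₀ < dist z c → dist z c < R → DifferentiableAt ℂ f z)
    (hg : ∀ z, r₀ < dist z c → dist z c < R → DifferentiableAt ℂ g z) :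
    (∮ z in C(c, r₂), ∮ w in C(c, r₁), f z * g w * (z - w)⁻¹) =
      (∮ z in C(c, r₁), ∮ w in C(c, r₂), f z * g w * (z - w)⁻¹) +
        2 * Real.pi * I * ∮ z in C(c, r₁), f z * g z := by
  -- An intermediate radius: the `z`-circle is shrunk from `r₂` to `r < r₁`, which crosses the pole
  -- at `w` once; then `w` moves from `r₁` to `r₂` and `z` from `r` to `r₁` without meeting each
  -- other.
  obtain ⟨r, hr0, hr1⟩ := exists_between h01
  have hcont : ∀ ρ ρ', r₀ < ρ → ρ < R → r₀ < ρ' → ρ' < R → ρ ≠ ρ' →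
      ContinuousOn (fun p : ℂ × ℂ => f p.1 * g p.2 * (p.1 - p.2)⁻¹)
        (sphere c ρ ×ˢ sphere c ρ') := by
    rintro ρ ρ' h1 h2 h3 h4 h5 ⟨z, w⟩ ⟨hz, hw⟩
    rw [mem_sphere] at hz hw
    simp only at hz hw
    apply ContinuousAt.continuousWithinAt
    have hfz : ContinuousAt (fun p : ℂ × ℂ => f p.1) (z, w) :=
      ContinuousAt.comp (f := Prod.fst) (x := (z, w))
        (hf z (by rw [hz]; exact h1) (by rw [hz]; exact h2)).continuousAt continuousAt_fst
    have hgw : ContinuousAt (fun p : ℂ × ℂ => g p.2) (z, w) :=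
      ContinuousAt.comp (f := Prod.snd) (x := (z, w))
        (hg w (by rw [hw]; exact h3) (by rw [hw]; exact h4)).continuousAt continuousAt_snd
    refine (hfz.mul hgw).mul (ContinuousAt.inv₀ (by fun_prop) ?_)
    intro h
    simp only [sub_eq_zero] at h
    apply h5
    rw [← hz, ← hw, h]
  have swap : ∀ ρ ρ', r₀ < ρ → ρ < R → r₀ < ρ' → ρ' < R → ρ ≠ ρ' →
      (∮ z in C(c, ρ), ∮ w in C(c, ρ'), f z * g w * (z - w)⁻¹) =
      ∮ w in C(c, ρ'), ∮ z in C(c, ρ), f z * g w * (z - w)⁻¹ := fun ρ ρ' h1 h2 h3 h4 h5 =>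
    circleIntegral_swap (f := fun z w => f z * g w * (z - w)⁻¹) (by linarith) (by linarith)
      (hcont ρ ρ' h1 h2 h3 h4 h5)
  have hr : 0 < r := by linarith
  have hr1' : 0 ≤ r₁ := by linarith
  have hr2' : 0 ≤ r₂ := by linarith
  have s1 : (∮ w in C(c, r₁), ∮ z in C(c, r₂), f z * g w * (z - w)⁻¹) =
      (∮ w in C(c, r₁), ((∮ z in C(c, r), f z * g w * (z - w)⁻¹) +
        2 * Real.pi * I * (f w * g w))) := by
    refine circleIntegral.integral_congr hr1' fun w hw => ?_
    rw [mem_sphere] at hw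
    have e : ∀ z, f z * g w * (z - w)⁻¹ = g w * (f z * (z - w)⁻¹) := fun z => by ring
    simp only [e, circleIntegral.integral_const_mul]
    rw [circleIntegral_annulus_pole hr (r := r) (by rw [hw]; exact hr1) (by rw [hw]; exact h12)
      (fun z h1 h2 => hf z (by linarith) (by linarith))]
    ring
  have hfgc : ContinuousOn (fun z => f z * g z) (sphere c r₁) := by
    intro z hz
    rw [mem_sphere] at hz
    exact ((hf z (by rw [hz]; exact h01) (by rw [hz]; linarith)).mul
      (hg z (by rw [hz]; exact h01) (by rw [hz]; linarith))).continuousAt.continuousWithinAt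
  have s2 : (∮ w in C(c, r₁), ((∮ z in C(c, r), f z * g w * (z - w)⁻¹) +
        2 * Real.pi * I * (f w * g w))) = (∮ w in C(c, r₁), (∮ z in C(c, r),
          f z * g w * (z - w)⁻¹)) + 2 * Real.pi * I * ∮ w in C(c, r₁), f w * g w := by
    rw [circleIntegral.integral_add, circleIntegral.integral_const_mul]
    · exact circleIntegrable_circleIntegral (f := fun z w => f z * g w * (z - w)⁻¹) hr.le hr1'
        (hcont r r₁ hr0 (by linarith) h01 (by linarith) hr1.ne)
    · exact (continuousOn_const.mul hfgc).circleIntegrable hr1'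
  have s3 : (∮ z in C(c, r), ∮ w in C(c, r₁), f z * g w * (z - w)⁻¹) =
      ∮ z in C(c, r), ∮ w in C(c, r₂), f z * g w * (z - w)⁻¹ := by
    refine circleIntegral.integral_congr hr.le fun z hz => ?_
    rw [mem_sphere] at hz
    symm
    refine circleIntegral_annulus_eq (by linarith) h12.le fun w h1 h2 => ?_
    refine ((hg w (by linarith) (by linarith)).const_mul (f z)).mul ?_
    refine ((differentiableAt_const z).sub differentiableAt_id).inv ?_
    intro h
    have hzw : z = w := sub_eq_zero.1 h
    rw [← hzw] at h1
    linarith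
  have s4 : (∮ w in C(c, r₂), ∮ z in C(c, r), f z * g w * (z - w)⁻¹) =
      ∮ w in C(c, r₂), ∮ z in C(c, r₁), f z * g w * (z - w)⁻¹ := by
    refine circleIntegral.integral_congr hr2' fun w hw => ?_
    rw [mem_sphere] at hw
    symm
    refine circleIntegral_annulus_eq (by linarith) hr1.le fun z h1 h2 => ?_
    refine ((hf z (by linarith) (by linarith)).mul_const (g w)).mul (hasDerivAt_sub_inv_ne ?_)
    rintro rfl
    linarith
  rw [swap r₂ r₁ (by linarith) h2 h01 (by linarith) h12.ne', s1, s2,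
    ← swap r r₁ hr0 (by linarith) h01 (by linarith) hr1.ne, s3,
    swap r r₂ hr0 (by linarith) (by linarith) h2 (hr1.trans h12).ne, s4,
    ← swap r₁ r₂ h01 (by linarith) (by linarith) h2 h12.ne]

/-- A function which is holomorphic outside a disc and decays faster than `1 / z` has vanishing
circle integral. -/
theorem circleIntegral_eq_zero_of_decay {c : ℂ} {r : ℝ} (h0 : 0 < r) {f : ℂ → ℂ}
    (hf : ∀ z, r ≤ dist z c → DifferentiableAt ℂ f z)
    (hd : Tendsto (fun z => (z - c) * f z) (cobounded ℂ) (𝓝 0)) : (∮ z in C(c, r), f z) = 0 := by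
  by_contra hne
  set I₀ := ∮ z in C(c, r), f z with hI
  have hpos : 0 < ‖I₀‖ := norm_pos_iff.2 hne
  -- On a large circle of radius `ρ` the integrand is at most `‖I₀‖ / (4 π ρ)`; times the length `2
  -- π ρ` this is only half of `‖I₀‖`.
  have hev := (tendsto_zero_iff_norm_tendsto_zero.1 hd).eventually
    (gt_mem_nhds (show (0 : ℝ) < ‖I₀‖ / (4 * Real.pi) by positivity))
  rw [(hasBasis_cobounded_compl_ball c).eventually_iff] at hev
  obtain ⟨R, -, hR⟩ := hev
  set ρ := max r R with hρ
  have hρ0 : 0 < ρ := h0.trans_le (le_max_left _ _)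
  have h1 : ‖∮ z in C(c, ρ), f z‖ ≤ 2 * Real.pi * ρ * (‖I₀‖ / (4 * Real.pi) / ρ) := by
    refine circleIntegral.norm_integral_le_of_norm_le_const hρ0.le fun z hz => ?_
    rw [mem_sphere] at hz
    have h2 := hR (x := z) (by
      rw [Set.mem_compl_iff, mem_ball, hz, not_lt]
      exact le_max_right _ _)
    rw [norm_mul, ← dist_eq_norm, hz] at h2
    rw [le_div_iff₀ hρ0, mul_comm]
    exact h2.le
  rw [circleIntegral_annulus_eq h0 (le_max_left _ _) (fun z h _ => hf z h), ← hI] at h1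
  have h3 : 2 * Real.pi * ρ * (‖I₀‖ / (4 * Real.pi) / ρ) = ‖I₀‖ / 2 := by
    have := Real.pi_pos
    field_simp
    ring
  rw [h3] at h1
  linarith

end TowerDimer

end

/-! ### The kernel integrand as a product of rational functions of `z` and `w`. -/

noncomputable section

namespace TowerDimer

open MeasureTheory Filter Topology Metric Complex Bornology

/-- The rational function `(1 + β z) ^ a (z - 1) ^ b (z - α) ^ c z ^ d`. -/
def mono (α β : ℝ) (a b c d : ℤ) (z : ℂ) : ℂ :=
  (1 + β * z) ^ a * (z - 1) ^ b * (z - α) ^ c * z ^ d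

section mono

variable {α β : ℝ}

theorem differentiableAt_zpow_of {a : ℤ} {f : ℂ → ℂ} {z : ℂ} (hf : DifferentiableAt ℂ f z)
    (h : f z ≠ 0 ∨ 0 ≤ a) : DifferentiableAt ℂ (fun z => f z ^ a) z :=
  (differentiableAt_zpow.2 h).comp z hf

theorem differentiableAt_mono {a b c d : ℤ} {z : ℂ} (ha : 1 + β * z ≠ 0 ∨ 0 ≤ a)
    (hb : z ≠ 1 ∨ 0 ≤ b) (hc : z ≠ α ∨ 0 ≤ c) (hd : z ≠ 0 ∨ 0 ≤ d) :
    DifferentiableAt ℂ (mono α β a b c d) z := by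
  have h1 : DifferentiableAt ℂ (fun z : ℂ => (1 + β * z) ^ a) z :=
    differentiableAt_zpow_of (f := fun z => 1 + β * z) (by fun_prop) ha
  have h2 : DifferentiableAt ℂ (fun z : ℂ => (z - 1) ^ b) z :=
    differentiableAt_zpow_of (f := fun z => z - 1) (by fun_prop) (hb.imp_left sub_ne_zero.2)
  have h3 : DifferentiableAt ℂ (fun z : ℂ => (z - α) ^ c) z :=
    differentiableAt_zpow_of (f := fun z => z - α) (by fun_prop) (hc.imp_left sub_ne_zero.2)
  have h4 : DifferentiableAt ℂ (fun z : ℂ => z ^ d) z :=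
    differentiableAt_zpow_of (f := fun z => z) (by fun_prop) hd
  exact ((h1.mul h2).mul h3).mul h4

theorem mono_mul {a b c d a' b' c' d' : ℤ} {z : ℂ} (ha : 1 + β * z ≠ 0) (hb : z ≠ 1)
    (hc : z ≠ α) (hd : z ≠ 0) : mono α β a b c d z * mono α β a' b' c' d' z =
      mono α β (a + a') (b + b') (c + c') (d + d') z := by
  unfold mono
  rw [zpow_add₀ ha, zpow_add₀ (sub_ne_zero.2 hb), zpow_add₀ (sub_ne_zero.2 hc), zpow_add₀ hd]
  ring

/-- Decay of `mono` at infinity. -/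
theorem tendsto_mono_mul_zpow {a b c d n : ℤ} (hβ : 0 < β) (h : a + b + c + d + n < 0) :
    Tendsto (fun z => mono α β a b c d z * z ^ n) (cobounded ℂ) (𝓝 0) := by
  have h0 : Tendsto (fun z : ℂ => z⁻¹) (cobounded ℂ) (𝓝 0) := tendsto_inv₀_cobounded
  have key : ∀ (u v : ℂ) (k : ℤ), v ≠ 0 →
      Tendsto (fun z : ℂ => (u * z⁻¹ + v) ^ k) (cobounded ℂ) (𝓝 (v ^ k)) := by
    intro u v k hv
    have h1 : Tendsto (fun z : ℂ => u * z⁻¹ + v) (cobounded ℂ) (𝓝 v) := by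
      simpa using (h0.const_mul u).add_const v
    exact h1.zpow₀ k (Or.inl hv)
  have hz : Tendsto (fun z : ℂ => z ^ (a + b + c + d + n)) (cobounded ℂ) (𝓝 0) := by
    obtain ⟨m, hm⟩ := Int.eq_ofNat_of_zero_le (show 0 ≤ -(a + b + c + d + n) by omega)
    have e : ∀ z : ℂ, z ^ (a + b + c + d + n) = z⁻¹ ^ m := by
      intro z
      rw [show a + b + c + d + n = -(m : ℤ) by omega, zpow_neg, zpow_natCast, inv_pow]
    simp only [e]
    have := h0.pow m
    rwa [zero_pow (by omega)] at this
  have hβ' : (β : ℂ) ≠ 0 := by exact_mod_cast hβ.ne'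
  have hlim := (((key 1 β a hβ').mul (key (-1) 1 b one_ne_zero)).mul
    (key (-α) 1 c one_ne_zero)).mul hz
  rw [mul_zero] at hlim
  refine hlim.congr' ?_
  filter_upwards [eventually_ne_cobounded (0 : ℂ)] with z hz0
  unfold mono
  rw [zpow_add₀ hz0, zpow_add₀ hz0, zpow_add₀ hz0, zpow_add₀ hz0]
  have e1 : (1 + β * z) ^ a = (1 * z⁻¹ + β) ^ a * z ^ a := by
    rw [← mul_zpow]; congr 1; field_simp
  have e2 : (z - 1) ^ b = (-1 * z⁻¹ + 1) ^ b * z ^ b := by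
    rw [← mul_zpow]; congr 1; field_simp; ring
  have e3 : (z - α) ^ c = (-α * z⁻¹ + 1) ^ c * z ^ c := by
    rw [← mul_zpow]; congr 1; field_simp; ring
  rw [e1, e2, e3]
  ring

end mono

/-- The exponent of `1 - 1 / z` in `Φ(X, N; z)`. -/
def expB (X : ℤ) : ℤ := tOf X - 1 + ind (mOf X = 1)

/-- The exponent of `1 - α / z` in `Φ(X, N; z)`. -/
def expC (X : ℤ) : ℤ := tOf X - 1 + ind (mOf X ≤ 2)

/-- The part of the kernel integrand depending on `z`. -/
def phiK (α β : ℝ) (N : ℕ) (P : Pt) : ℂ → ℂ :=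
  mono α β (N - tOf P.1 + 1) (expB P.1) (expC P.1) (-expB P.1 - expC P.1 - P.2 - 1)

/-- The part of the kernel integrand depending on `w`. -/
def psiK (α β : ℝ) (N : ℕ) (Q : Pt) : ℂ → ℂ :=
  mono α β (-(N - tOf Q.1 + 1)) (-expB Q.1) (-expC Q.1) (expB Q.1 + expC Q.1 + Q.2)

theorem Phi_eq {α β : ℝ} {X : ℤ} {N : ℕ} {z : ℂ} (hz : z ≠ 0) :
    Phi α β X N z = mono α β (N - tOf X + 1) (expB X) (expC X) (-expB X - expC X) z := by
  have e1 : 1 - z⁻¹ = (z - 1) * z⁻¹ := by field_simp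
  have e2 : 1 - α * z⁻¹ = (z - α) * z⁻¹ := by field_simp
  unfold Phi mono
  rw [show -(tOf X - 1) - ind (mOf X = 1) = -expB X by unfold expB; ring,
    show -(tOf X - 1) - ind (mOf X ≤ 2) = -expC X by unfold expC; ring, zpow_neg, zpow_neg,
    ← mul_inv, div_inv_eq_mul, e1, e2, mul_zpow, mul_zpow, sub_eq_add_neg (-expB X),
    zpow_add₀ hz, inv_zpow', inv_zpow']
  ring

theorem kernelIntegrand_eq {α β : ℝ} {N : ℕ} {P Q : Pt} {z w : ℂ} (hz : z ≠ 0) (hw : w ≠ 0) :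
    kernelIntegrand α β N P Q z w = phiK α β N P z * psiK α β N Q w * (z - w)⁻¹ := by
  unfold kernelIntegrand
  rw [Phi_eq hz, Phi_eq hw]
  unfold phiK psiK mono
  rw [zpow_neg (1 + β * w), zpow_neg (w - 1), zpow_neg (w - α),
    show -expB P.1 - expC P.1 - P.2 - 1 = (-expB P.1 - expC P.1) + -(P.2 + 1) by ring,
    zpow_add₀ hz (-expB P.1 - expC P.1), zpow_neg z (P.2 + 1),
    show -Q.2 + 1 = -(Q.2 - 1) by ring, zpow_neg w (Q.2 - 1),
    show expB Q.1 + expC Q.1 + Q.2 = -(-expB Q.1 - expC Q.1) + (Q.2 - 1) + 1 by ring,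
    zpow_add₀ hw _ 1, zpow_add₀ hw, zpow_neg w (-expB Q.1 - expC Q.1), zpow_one]
  simp only [mul_inv, inv_inv, div_eq_mul_inv]
  ring

section contours

variable {α β : ℝ}

/-- All four points are real. Seen from the centre `1 + α`, the points `0`, `1`, `α` lie within
distance `1 + α`, and `-1 / β` at distance exactly `1 + α + 1 / β`. -/
theorem contour_avoid (hα : 0 < α) (hβ : 0 < β) {z : ℂ} (h1 : 1 + α < dist z (contourCentre α))
    (h2 : dist z (contourCentre α) < 1 + α + 1 / β) :
    1 + β * z ≠ 0 ∧ z ≠ 1 ∧ z ≠ α ∧ z ≠ 0 := by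
  have key : ∀ a : ℝ, z = a → 1 + α < |a - (1 + α)| ∧ |a - (1 + α)| < 1 + α + 1 / β := by
    rintro a rfl
    rw [contourCentre, Complex.dist_eq, ← Complex.ofReal_sub, Complex.norm_real,
      Real.norm_eq_abs] at h1 h2
    exact ⟨h1, h2⟩
  have hb : 0 < 1 / β := by positivity
  refine ⟨fun h => ?_, fun h => ?_, fun h => ?_, fun h => ?_⟩
  · have h3 : z = ((-(1 / β) : ℝ) : ℂ) := by
      have : (β : ℂ) ≠ 0 := by exact_mod_cast hβ.ne'
      push_cast
      field_simp
      linear_combination h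
    have := (key _ h3).2
    rw [abs_lt] at this
    linarith [this.1]
  · have := (key 1 (by simpa using h)).1
    rw [lt_abs] at this
    rcases this with h | h <;> linarith
  · have := (key α h).1
    rw [lt_abs] at this
    rcases this with h | h <;> linarith
  · have := (key 0 (by simpa using h)).1
    rw [lt_abs] at this
    rcases this with h | h <;> linarith

theorem radii_lt (hβ : 0 < β) : 1 + α < innerRadius α β ∧
    innerRadius α β < outerRadius α β ∧ outerRadius α β < 1 + α + 1 / β := by
  have h1 : 0 < 1 / β := by positivity
  have e1 : 1 / (3 * β) = 1 / β / 3 := by field_simp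
  have e2 : 2 / (3 * β) = 1 / β * 2 / 3 := by field_simp
  unfold innerRadius outerRadius
  rw [e1, e2]
  refine ⟨?_, ?_, ?_⟩ <;> linarith

/-- The double contour integral with the `z`-contour of radius `r` and the `w`-contour of radius
`r'`. -/
def dblInt (α r r' : ℝ) (f g : ℂ → ℂ) : ℂ :=
  ∮ z in C(contourCentre α, r), ∮ w in C(contourCentre α, r'), f z * g w * (z - w)⁻¹

theorem schurKernel_eq (hα : 0 < α) (hβ : 0 < β) (N : ℕ) (P Q : Pt) : schurKernel α β N P Q =
    (1 / (2 * Real.pi * I) ^ 2) * if Q.1 ≤ P.1 then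
      dblInt α (outerRadius α β) (innerRadius α β) (phiK α β N P) (psiK α β N Q)
    else dblInt α (innerRadius α β) (outerRadius α β) (phiK α β N P) (psiK α β N Q) := by
  obtain ⟨h1, h2, h3⟩ := radii_lt (α := α) hβ
  have h0 : ∀ r, 1 + α < r → r < 1 + α + 1 / β → ∀ z ∈ sphere (contourCentre α) r, z ≠ 0 := by
    intro r hr hr' z hz
    rw [mem_sphere] at hz
    exact (contour_avoid hα hβ (by rw [hz]; exact hr) (by rw [hz]; exact hr')).2.2.2
  unfold schurKernel dblInt
  split_ifs <;>
  · congr 1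
    refine circleIntegral.integral_congr (by linarith) fun z hz =>
      circleIntegral.integral_congr (by linarith) fun w hw => ?_
    exact kernelIntegrand_eq (h0 _ (by linarith) (by linarith) z hz)
      (h0 _ (by linarith) (by linarith) w hw)

theorem dblInt_continuousOn {r r' : ℝ} (hrr : r ≠ r') {f g : ℂ → ℂ}
    (hf : ContinuousOn f (sphere (contourCentre α) r))
    (hg : ContinuousOn g (sphere (contourCentre α) r')) :
    ContinuousOn (fun p : ℂ × ℂ => f p.1 * g p.2 * (p.1 - p.2)⁻¹)
      (sphere (contourCentre α) r ×ˢ sphere (contourCentre α) r') := by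
  refine ((hf.comp continuousOn_fst fun p hp => hp.1).mul
    (hg.comp continuousOn_snd fun p hp => hp.2)).mul
    (ContinuousOn.inv₀ (by fun_prop) fun p hp h => ?_)
  have h1 := mem_sphere.1 hp.1
  rw [sub_eq_zero.1 h, mem_sphere.1 hp.2] at h1
  exact hrr h1.symm

theorem dblInt_swap {r r' : ℝ} (hr : 0 ≤ r) (hr' : 0 ≤ r') (hrr : r ≠ r') {f g : ℂ → ℂ}
    (hf : ContinuousOn f (sphere (contourCentre α) r))
    (hg : ContinuousOn g (sphere (contourCentre α) r')) : dblInt α r r' f g =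
      ∮ w in C(contourCentre α, r'), g w *
        ∮ z in C(contourCentre α, r), f z * (z - w)⁻¹ := by
  unfold dblInt
  rw [circleIntegral_swap (f := fun z w => f z * g w * (z - w)⁻¹) hr hr'
    (dblInt_continuousOn hrr hf hg)]
  simp only [← circleIntegral.integral_const_mul]
  refine circleIntegral.integral_congr hr' fun w _ => circleIntegral.integral_congr hr fun z _ => ?_
  ring

theorem dblInt_sum {ι : Type*} (s : Finset ι) {r r' : ℝ} (hr : 0 ≤ r) (hr' : 0 ≤ r') (hrr : r ≠ r')
    (a : ι → ℂ) {f : ι → ℂ → ℂ} {g : ℂ → ℂ}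
    (hf : ∀ i ∈ s, ContinuousOn (f i) (sphere (contourCentre α) r))
    (hg : ContinuousOn g (sphere (contourCentre α) r')) :
    ∑ i ∈ s, a i * dblInt α r r' (f i) g = dblInt α r r' (fun z => ∑ i ∈ s, a i * f i z) g := by
  have h1 : ∀ i ∈ s, a i * dblInt α r r' (f i) g = ∮ z in C(contourCentre α, r),
      ∮ w in C(contourCentre α, r'), a i * (f i z * g w * (z - w)⁻¹) := by
    intro i _
    unfold dblInt
    simp only [circleIntegral.integral_const_mul]
  rw [Finset.sum_congr rfl h1, ← circleIntegral.integral_fun_sum]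
  · unfold dblInt
    refine circleIntegral.integral_congr hr fun z hz => ?_
    simp only
    rw [← circleIntegral.integral_fun_sum]
    · refine circleIntegral.integral_congr hr' fun w hw => ?_
      simp only [Finset.sum_mul]
      exact Finset.sum_congr rfl fun i _ => by ring
    · intro i hi
      apply ContinuousOn.circleIntegrable hr'
      exact continuousOn_const.mul ((dblInt_continuousOn hrr (hf i hi) hg).comp
        (f := fun w => (z, w)) (by fun_prop) fun w hw => ⟨hz, hw⟩)
  · intro i hi
    refine circleIntegrable_circleIntegral (f := fun w z => a i * (f i z * g w * (z - w)⁻¹))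
      hr' hr ?_
    exact continuousOn_const.mul ((dblInt_continuousOn hrr (hf i hi) hg).comp
      (f := fun p : ℂ × ℂ => (p.2, p.1)) (by fun_prop) fun p hp => ⟨hp.2, hp.1⟩)

end contours

end TowerDimer

end

/-! ### The Schur kernel is a right inverse of the Kasteleyn matrix. -/

noncomputable section

namespace TowerDimer

open MeasureTheory Filter Topology Metric Complex Bornology

section inverse

variable {α β : ℝ}

theorem ne_of_lt_dist (hα : 0 < α) {z : ℂ} (h1 : 1 + α < dist z (contourCentre α)) :
    z ≠ 1 ∧ z ≠ α ∧ z ≠ 0 := by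
  have key : ∀ a : ℝ, z = a → 1 + α < |a - (1 + α)| := by
    rintro a rfl
    rwa [contourCentre, Complex.dist_eq, ← Complex.ofReal_sub, Complex.norm_real,
      Real.norm_eq_abs] at h1
  refine ⟨fun h => ?_, fun h => ?_, fun h => ?_⟩
  · have := key 1 (by simpa using h)
    rw [lt_abs] at this
    rcases this with h | h <;> linarith
  · have := key α h
    rw [lt_abs] at this
    rcases this with h | h <;> linarith
  · have := key 0 (by simpa using h)
    rw [lt_abs] at this
    rcases this with h | h <;> linarith

theorem one_add_mul_ne_zero_of_dist_lt (hβ : 0 < β) {z : ℂ}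
    (h2 : dist z (contourCentre α) < 1 + α + 1 / β) : 1 + β * z ≠ 0 := by
  intro h
  have hb : 0 < 1 / β := by positivity
  have h3 : z = ((-(1 / β) : ℝ) : ℂ) := by
    have : (β : ℂ) ≠ 0 := by exact_mod_cast hβ.ne'
    push_cast
    field_simp
    linear_combination h
  rw [h3, contourCentre, Complex.dist_eq, ← Complex.ofReal_sub, Complex.norm_real,
    Real.norm_eq_abs, abs_lt] at h2
  linarith [h2.1]

theorem differentiableAt_mono_annulus (hα : 0 < α) (hβ : 0 < β) {a b c d : ℤ} {z : ℂ}
    (h1 : 1 + α < dist z (contourCentre α)) (h2 : dist z (contourCentre α) < 1 + α + 1 / β) :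
    DifferentiableAt ℂ (mono α β a b c d) z := by
  obtain ⟨h3, h4, h5, h6⟩ := contour_avoid hα hβ h1 h2
  exact differentiableAt_mono (Or.inl h3) (Or.inl h4) (Or.inl h5) (Or.inl h6)

theorem continuousOn_mono_sphere (hα : 0 < α) (hβ : 0 < β) {a b c d : ℤ} {r : ℝ}
    (h1 : 1 + α < r) (h2 : r < 1 + α + 1 / β) :
    ContinuousOn (mono α β a b c d) (sphere (contourCentre α) r) := fun z hz => by
  rw [mem_sphere] at hz
  exact (differentiableAt_mono_annulus hα hβ (by rw [hz]; exact h1)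
    (by rw [hz]; exact h2)).continuousAt.continuousWithinAt

theorem tendsto_sub_mul_sub_inv (c w : ℂ) :
    Tendsto (fun z : ℂ => (z - c) * (z - w)⁻¹) (cobounded ℂ) (𝓝 1) := by
  have h1 : Tendsto (fun z : ℂ => (z - w)⁻¹) (cobounded ℂ) (𝓝 0) :=
    tendsto_inv₀_cobounded.comp (tendsto_sub_const_cobounded w)
  have h2 : Tendsto (fun z : ℂ => 1 + (w - c) * (z - w)⁻¹) (cobounded ℂ) (𝓝 1) := by
    simpa using (h1.const_mul (w - c)).const_add 1
  refine h2.congr' ?_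
  filter_upwards [eventually_ne_cobounded w] with z hz
  have := sub_ne_zero.2 hz
  field_simp
  ring

/-- Exchange of the contours of the kernel. -/
theorem dblInt_exchange (hα : 0 < α) (hβ : 0 < β) {f g : ℂ → ℂ}
    (hf : ∀ z, 1 + α < dist z (contourCentre α) → dist z (contourCentre α) < 1 + α + 1 / β →
      DifferentiableAt ℂ f z)
    (hg : ∀ z, 1 + α < dist z (contourCentre α) → dist z (contourCentre α) < 1 + α + 1 / β →
      DifferentiableAt ℂ g z) :
    dblInt α (outerRadius α β) (innerRadius α β) f g =
      dblInt α (innerRadius α β) (outerRadius α β) f g +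
        2 * Real.pi * I * ∮ z in C(contourCentre α, innerRadius α β), f z * g z := by
  obtain ⟨h1, h2, h3⟩ := radii_lt (α := α) hβ
  exact circleIntegral_exchange (by linarith) h1 h2 h3 hf hg

/-- This is the residue term of the contour exchange. The dependence on `N` cancels between the two
factors. -/
theorem circleIntegral_phiK_mul_psiK (hα : 0 < α) (hβ : 0 < β) (N : ℕ) (P Q : Pt) :
    (∮ z in C(contourCentre α, innerRadius α β), phiK α β N P z * psiK α β N Q z) =
      ∮ z in C(contourCentre α, innerRadius α β), mono α β (tOf Q.1 - tOf P.1)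
        (expB P.1 - expB Q.1) (expC P.1 - expC Q.1)
        (expB Q.1 + expC Q.1 - expB P.1 - expC P.1 + Q.2 - P.2 - 1) z := by
  obtain ⟨h1, h2, h3⟩ := radii_lt (α := α) hβ
  refine circleIntegral.integral_congr (by linarith) fun z hz => ?_
  rw [mem_sphere] at hz
  obtain ⟨h3, h4, h5, h6⟩ := contour_avoid hα hβ (z := z) (by rw [hz]; exact h1)
    (by rw [hz]; linarith)
  simp only [phiK, psiK]
  rw [mono_mul h3 h4 h5 h6]
  congr 1 <;> ring

/-- With the `z`-contour outside, nothing is singular beyond it, and `phiK` has negative degree at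
infinity for such high sites. Together with `(z - w)⁻¹` this is decay faster than `1 / z`. -/
theorem dblInt_eq_zero_above (hα : 0 < α) (hβ : 0 < β) {N : ℕ} {P Q : Pt}
    (h : N - tOf P.1 + 1 ≤ P.2) (h0 : 0 ≤ N - tOf P.1 + 1) :
    dblInt α (outerRadius α β) (innerRadius α β) (phiK α β N P) (psiK α β N Q) = 0 := by
  obtain ⟨h1, h2, h3⟩ := radii_lt (α := α) hβ
  rw [dblInt_swap (f := phiK α β N P) (g := psiK α β N Q) (by linarith) (by linarith) h2.ne'
    (continuousOn_mono_sphere hα hβ (by linarith) h3)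
    (continuousOn_mono_sphere hα hβ h1 (by linarith))]
  have key : ∀ w ∈ sphere (contourCentre α) (innerRadius α β),
      psiK α β N Q w * (∮ z in C(contourCentre α, outerRadius α β),
        phiK α β N P z * (z - w)⁻¹) = (0 : ℂ) := by
    intro w hw
    rw [mem_sphere] at hw
    rw [circleIntegral_eq_zero_of_decay (by linarith), mul_zero]
    · intro z hz
      obtain ⟨h4, h5, h6⟩ := ne_of_lt_dist hα (z := z) (by linarith)
      refine (differentiableAt_mono (Or.inr h0) (Or.inl h4) (Or.inl h5) (Or.inl h6)).mul
        (hasDerivAt_sub_inv_ne ?_)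
      rintro rfl
      linarith
    · have h4 := tendsto_mono_mul_zpow (α := α) (β := β) (a := N - tOf P.1 + 1) (b := expB P.1)
        (c := expC P.1) (d := -expB P.1 - expC P.1 - P.2 - 1) (n := 0) hβ (by linarith)
      have h5 := h4.mul (tendsto_sub_mul_sub_inv (contourCentre α) w)
      rw [zero_mul] at h5
      refine h5.congr fun z => ?_
      rw [zpow_zero, mul_one, phiK]
      ring
  rw [circleIntegral.integral_congr (g := fun _ => 0) (by linarith) key]
  simp [circleIntegral]

theorem circleIntegral_eq_zero_above (hα : 0 < α) (hβ : 0 < β) {a b c d : ℤ} (ha : 0 ≤ a)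
    (h : a + b + c + d ≤ -2) :
    (∮ z in C(contourCentre α, innerRadius α β), mono α β a b c d z) = 0 := by
  obtain ⟨h1, h2, h3⟩ := radii_lt (α := α) hβ
  refine circleIntegral_eq_zero_of_decay (by linarith) (fun z hz => ?_) ?_
  · obtain ⟨h4, h5, h6⟩ := ne_of_lt_dist hα (z := z) (by linarith)
    exact differentiableAt_mono (Or.inr ha) (Or.inl h4) (Or.inl h5) (Or.inl h6)
  · have h4 := tendsto_mono_mul_zpow (α := α) (n := 0) hβ (show a + b + c + d + 0 < 0 by linarith)
    have h5 := tendsto_mono_mul_zpow (α := α) (n := 1) hβ (show a + b + c + d + 1 < 0 by linarith)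
    have h6 := h5.sub (h4.const_mul (contourCentre α))
    rw [mul_zero, sub_zero] at h6
    refine h6.congr fun z => ?_
    rw [zpow_zero, mul_one, zpow_one]
    ring

/-- For such low sites `phiK` is a polynomial; with the `z`-contour inside, the pole at `w` is not
enclosed either. -/
theorem dblInt_eq_zero_below (hα : 0 < α) (hβ : 0 < β) {N : ℕ} {P Q : Pt}
    (h0 : 0 ≤ N - tOf P.1 + 1) (hB : 0 ≤ expB P.1) (hC : 0 ≤ expC P.1)
    (h : P.2 ≤ -expB P.1 - expC P.1 - 1) :
    dblInt α (innerRadius α β) (outerRadius α β) (phiK α β N P) (psiK α β N Q) = 0 := by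
  obtain ⟨h1, h2, h3⟩ := radii_lt (α := α) hβ
  rw [dblInt_swap (f := phiK α β N P) (g := psiK α β N Q) (by linarith) (by linarith) h2.ne
    (continuousOn_mono_sphere hα hβ h1 (by linarith))
    (continuousOn_mono_sphere hα hβ (by linarith) h3)]
  have key : ∀ w ∈ sphere (contourCentre α) (outerRadius α β),
      psiK α β N Q w * (∮ z in C(contourCentre α, innerRadius α β),
        phiK α β N P z * (z - w)⁻¹) = (0 : ℂ) := by
    intro w hw
    rw [mem_sphere] at hw
    have hd : ∀ z, dist z (contourCentre α) ≤ innerRadius α β →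
        DifferentiableAt ℂ (fun z => phiK α β N P z * (z - w)⁻¹) z := by
      intro z hz
      refine (differentiableAt_mono (Or.inr h0) (Or.inr hB) (Or.inr hC)
        (Or.inr (by linarith))).mul (hasDerivAt_sub_inv_ne ?_)
      rintro rfl
      linarith
    rw [circleIntegral_eq_zero_of_differentiable_on_off_countable (by linarith)
      Set.countable_empty, mul_zero]
    · exact fun z hz => (hd z (mem_closedBall.1 hz)).continuousAt.continuousWithinAt
    · exact fun z hz => hd z (mem_ball.1 hz.1).le
  rw [circleIntegral.integral_congr (g := fun _ => 0) (by linarith) key]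
  simp [circleIntegral]

theorem circleIntegral_eq_zero_below (hα : 0 < α) (hβ : 0 < β) {a b c d : ℤ} (hb : 0 ≤ b)
    (hc : 0 ≤ c) (hd : 0 ≤ d) :
    (∮ z in C(contourCentre α, innerRadius α β), mono α β a b c d z) = 0 := by
  obtain ⟨h1, h2, h3⟩ := radii_lt (α := α) hβ
  have hd : ∀ z, dist z (contourCentre α) ≤ innerRadius α β →
      DifferentiableAt ℂ (mono α β a b c d) z := fun z hz =>
    differentiableAt_mono (Or.inl (one_add_mul_ne_zero_of_dist_lt (α := α) hβ (by linarith)))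
      (Or.inr hb) (Or.inr hc) (Or.inr hd)
  refine circleIntegral_eq_zero_of_differentiable_on_off_countable (by linarith)
    Set.countable_empty ?_ ?_
  · exact fun z hz => (hd z (mem_closedBall.1 hz)).continuousAt.continuousWithinAt
  · exact fun z hz => hd z (mem_ball.1 hz.1).le

/-- The kernel vanishes at the white vertices just above and just below the tower. -/
theorem schurKernel_eq_zero (hα : 0 < α) (hβ : 0 < β) {N : ℕ} {w b' : Pt} (hw : IsWhite w)
    (h0 : 0 ≤ w.1) (h1 : w.1 ≤ 3 * N) (hw' : w ∉ whites N) (hb' : b' ∈ blacks N) :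
    schurKernel α β N w b' = 0 := by
  obtain ⟨X, U⟩ := w
  obtain ⟨Y, V⟩ := b'
  rw [mem_blacks, mem_towerVertices] at hb'
  rw [mem_whites, mem_towerVertices] at hw'
  have hout : U ≥ N - X / 3 ∨ U ≤ -X + X / 3 - 1 := by
    by_contra hc
    apply hw'
    refine ⟨?_, hw⟩
    simp only at *
    omega
  clear hw'
  simp only [IsWhite, IsBlack] at hw hb' h0 h1
  have hA : (0 : ℤ) ≤ N - tOf X + 1 := by unfold tOf; omega
  have hd : ∀ P : Pt, ∀ z, 1 + α < dist z (contourCentre α) →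
      dist z (contourCentre α) < 1 + α + 1 / β → DifferentiableAt ℂ (phiK α β N P) z :=
    fun P z h1 h2 => differentiableAt_mono_annulus hα hβ h1 h2
  have hd' : ∀ P : Pt, ∀ z, 1 + α < dist z (contourCentre α) →
      dist z (contourCentre α) < 1 + α + 1 / β → DifferentiableAt ℂ (psiK α β N P) z :=
    fun P z h1 h2 => differentiableAt_mono_annulus hα hβ h1 h2
  -- One order of the contours gives zero directly. For the other order the exchange formula leaves
  -- the residue term, which vanishes by decay at infinity above the tower and by holomorphy inside
  -- the contour below it; the position of the two columns provides the signs of the exponents.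
  have hex := dblInt_exchange hα hβ (hd (X, U)) (hd' (Y, V))
  rw [circleIntegral_phiK_mul_psiK hα hβ] at hex
  rw [schurKernel_eq hα hβ]
  rcases hout with hout | hout
  · have hz := dblInt_eq_zero_above hα hβ (N := N) (P := (X, U)) (Q := (Y, V))
      (by unfold tOf; simp only; omega) hA
    split_ifs with hXY
    · rw [hz, mul_zero]
    · simp only at hXY
      rw [hz, circleIntegral_eq_zero_above hα hβ (by unfold tOf; simp only; omega)
        (by unfold tOf; simp only; omega), mul_zero, add_zero] at hex
      rw [← hex, mul_zero]
  · have hz := dblInt_eq_zero_below hα hβ (N := N) (P := (X, U)) (Q := (Y, V)) hA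
      (by simp only [expB, tOf, mOf, ind]; split_ifs <;> omega)
      (by simp only [expC, tOf, mOf, ind]; split_ifs <;> omega)
      (by simp only [expB, expC, tOf, mOf, ind]; split_ifs <;> omega)
    split_ifs with hXY
    · simp only at hXY
      rw [hz, circleIntegral_eq_zero_below hα hβ
        (by simp only [expB, tOf, mOf, ind]; split_ifs <;> omega)
        (by simp only [expC, tOf, mOf, ind]; split_ifs <;> omega)
        (by simp only [expB, expC, tOf, mOf, ind]; split_ifs <;> omega), mul_zero,
        add_zero] at hex
      rw [hex, mul_zero]
    · rw [hz, mul_zero]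

theorem circleIntegral_zpow (hα : 0 < α) (hβ : 0 < β) (n : ℤ) :
    (∮ z in C(contourCentre α, innerRadius α β), z ^ n) =
      if n = -1 then 2 * Real.pi * I else 0 := by
  split_ifs with h
  · subst h
    have := circleIntegral.integral_sub_inv_of_mem_ball
      (((contours_admissible hα hβ).1 (innerRadius α β) (Or.inl rfl)).1)
    simpa [zpow_neg_one] using this
  · simpa using circleIntegral.integral_sub_zpow_of_ne h (contourCentre α) 0 (innerRadius α β)

/-- From a column `≡ 0` to the next one `Φ` is multiplied by `1 - α / z`, and the factor `z⁻¹`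
raises the height by one. Read in this way, the factor is the Kasteleyn relation at a black vertex
in a column `≡ 1`. -/
theorem phiK_rel_one {N : ℕ} {X U : ℤ} (hX : X % 3 = 1) {z : ℂ} (hz : z ≠ 0) (hz' : z ≠ α) :
    phiK α β N (X, U) z - phiK α β N (X - 1, U) z + α * phiK α β N (X - 1, U + 1) z = 0 := by
  have e1 : tOf (X - 1) = tOf X := by unfold tOf; omega
  have e2 : expB (X - 1) = expB X := by simp only [expB, tOf, mOf, ind]; split_ifs <;> omega
  have e3 : expC X = expC (X - 1) + 1 := by simp only [expC, tOf, mOf, ind]; split_ifs <;> omega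
  simp only [phiK, mono]
  rw [e1, e2, e3, zpow_add₀ (sub_ne_zero.2 hz'),
    show -expB X - (expC (X - 1) + 1) - U - 1 = (-expB X - expC (X - 1) - U - 2) by ring,
    show -expB X - expC (X - 1) - U - 1 = (-expB X - expC (X - 1) - U - 2) + 1 by ring,
    show -expB X - expC (X - 1) - (U + 1) - 1 = (-expB X - expC (X - 1) - U - 2) by ring,
    zpow_add₀ hz]
  simp only [zpow_one]
  ring

/-- The factors are `1 - 1 / z` from the column on the left, and `1 + β z` as the inverse of the
step to the right. Both halves of the Kasteleyn relation in a column `≡ 2` reduce to the same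
function `phiK` at `(X, U)`, with opposite signs. -/
theorem phiK_rel_two {N : ℕ} {X U : ℤ} (hX : X % 3 = 2) {z : ℂ} (hz : z ≠ 0) (hz' : z ≠ 1)
    (hzβ : 1 + β * z ≠ 0) :
    -phiK α β N (X - 1, U) z + phiK α β N (X - 1, U + 1) z = -phiK α β N (X, U) z ∧
    phiK α β N (X + 1, U) z + β * phiK α β N (X + 1, U - 1) z = phiK α β N (X, U) z := by
  have e1 : tOf (X - 1) = tOf X := by unfold tOf; omega
  have e2 : expB X = expB (X - 1) + 1 := by simp only [expB, tOf, mOf, ind]; split_ifs <;> omega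
  have e3 : expC (X - 1) = expC X := by simp only [expC, tOf, mOf, ind]; split_ifs <;> omega
  have e1' : tOf (X + 1) = tOf X + 1 := by unfold tOf; omega
  have e2' : expB (X + 1) = expB (X - 1) + 1 := by
    simp only [expB, tOf, mOf, ind]; split_ifs <;> omega
  have e3' : expC (X + 1) = expC X := by simp only [expC, tOf, mOf, ind]; split_ifs <;> omega
  simp only [phiK, mono]
  set b := expB (X - 1)
  set c := expC X
  rw [e1, e2, e3, e1', e2', e3']
  constructor
  · rw [zpow_add₀ (sub_ne_zero.2 hz'),
      show -b - c - U - 1 = (-b - c - U - 2) + 1 by ring,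
      show -b - c - (U + 1) - 1 = (-b - c - U - 2) by ring,
      show -(b + 1) - c - U - 1 = (-b - c - U - 2) by ring, zpow_add₀ hz]
    simp only [zpow_one]
    ring
  · have hA : (N : ℤ) - tOf X + 1 = ((N : ℤ) - (tOf X + 1) + 1) + 1 := by ring
    rw [hA]
    generalize (N : ℤ) - (tOf X + 1) + 1 = A
    rw [zpow_add₀ hzβ,
      show -(b + 1) - c - U - 1 = (-b - c - U - 2) by ring,
      show -(b + 1) - c - (U - 1) - 1 = (-b - c - U - 2) + 1 by ring, zpow_add₀ hz]
    simp only [zpow_one]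
    ring

theorem dblInt_pair {r r' : ℝ} (hr : 0 ≤ r) (hr' : 0 ≤ r') (hrr : r ≠ r')
    {a a' c : ℂ} {f f' h g : ℂ → ℂ} (hf : ContinuousOn f (sphere (contourCentre α) r))
    (hf' : ContinuousOn f' (sphere (contourCentre α) r))
    (hg : ContinuousOn g (sphere (contourCentre α) r'))
    (hrel : ∀ z ∈ sphere (contourCentre α) r, a * f z + a' * f' z = c * h z) :
    a * dblInt α r r' f g + a' * dblInt α r r' f' g = c * dblInt α r r' h g := by
  have h1 := dblInt_sum (Finset.univ : Finset (Fin 2)) hr hr' hrr ![a, a'] (f := ![f, f']) (g := g)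
    (by intro i _; fin_cases i <;> assumption) hg
  simp only [Fin.sum_univ_two, Matrix.cons_val_zero, Matrix.cons_val_one] at h1
  rw [h1]
  unfold dblInt
  rw [← circleIntegral.integral_const_mul]
  refine circleIntegral.integral_congr hr fun z hz => ?_
  simp only
  rw [← circleIntegral.integral_const_mul]
  refine circleIntegral.integral_congr hr' fun w hw => ?_
  simp only [hrel z hz]
  ring

/-- The double integral of the kernel, with the `z`-contour outside if `o` holds and inside
otherwise. -/
def kernelAt (α β : ℝ) (N : ℕ) (o : Prop) [Decidable o] (P Q : Pt) : ℂ :=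
  if o then dblInt α (outerRadius α β) (innerRadius α β) (phiK α β N P) (psiK α β N Q)
    else dblInt α (innerRadius α β) (outerRadius α β) (phiK α β N P) (psiK α β N Q)

theorem kernelAt_pair (hα : 0 < α) (hβ : 0 < β) {N : ℕ} (o : Prop) [Decidable o] {P P' R Q : Pt}
    {a a' c : ℂ} (hrel : ∀ z : ℂ, 1 + β * z ≠ 0 → z ≠ 1 → z ≠ α → z ≠ 0 →
      a * phiK α β N P z + a' * phiK α β N P' z = c * phiK α β N R z) :
    a * kernelAt α β N o P Q + a' * kernelAt α β N o P' Q = c * kernelAt α β N o R Q := by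
  obtain ⟨h1, h2, h3⟩ := radii_lt (α := α) hβ
  have hrel' : ∀ r, 1 + α < r → r < 1 + α + 1 / β → ∀ z ∈ sphere (contourCentre α) r,
      a * phiK α β N P z + a' * phiK α β N P' z = c * phiK α β N R z := by
    intro r hr hr' z hz
    rw [mem_sphere] at hz
    obtain ⟨k1, k2, k3, k4⟩ := contour_avoid hα hβ (by rw [hz]; exact hr) (by rw [hz]; exact hr')
    exact hrel z k1 k2 k3 k4
  unfold kernelAt
  split_ifs
  · exact dblInt_pair (by linarith) (by linarith) h2.ne'
      (continuousOn_mono_sphere hα hβ (by linarith) h3)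
      (continuousOn_mono_sphere hα hβ (by linarith) h3)
      (continuousOn_mono_sphere hα hβ h1 (by linarith)) (hrel' _ (by linarith) h3)
  · exact dblInt_pair (by linarith) (by linarith) h2.ne
      (continuousOn_mono_sphere hα hβ h1 (by linarith))
      (continuousOn_mono_sphere hα hβ h1 (by linarith))
      (continuousOn_mono_sphere hα hβ (by linarith) h3) (hrel' _ h1 (by linarith))

theorem kernelAt_congr {N : ℕ} {o o' : Prop} [Decidable o] [Decidable o'] (h : o ↔ o') (P Q : Pt) :
    kernelAt α β N o P Q = kernelAt α β N o' P Q := by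
  unfold kernelAt
  simp only [h]

/-- Within one column the residue term is the integral of a pure power of `z`, nonzero only for the
exponent `-1`. This is the source of the identity matrix. -/
theorem kernelAt_sub (hα : 0 < α) (hβ : 0 < β) {N : ℕ} {o o' : Prop} [Decidable o] [Decidable o']
    (X U V : ℤ) (ho : o) (ho' : ¬o') :
    kernelAt α β N o (X, U) (X, V) - kernelAt α β N o' (X, U) (X, V) =
      if U = V then (2 * Real.pi * I) ^ 2 else 0 := by
  unfold kernelAt
  rw [if_pos ho, if_neg ho', dblInt_exchange (f := phiK α β N (X, U)) (g := psiK α β N (X, V)) hα hβ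
    (fun z h1 h2 => differentiableAt_mono_annulus hα hβ h1 h2)
    (fun z h1 h2 => differentiableAt_mono_annulus hα hβ h1 h2),
    circleIntegral_phiK_mul_psiK hα hβ]
  have e : mono α β (tOf X - tOf X) (expB X - expB X) (expC X - expC X)
      (expB X + expC X - expB X - expC X + V - U - 1) = fun z => z ^ (V - U - 1) := by
    funext z
    simp only [mono, sub_self, zpow_zero, one_mul]
    congr 1
    ring
  simp only
  rw [e, circleIntegral_zpow hα hβ, add_sub_cancel_left]
  by_cases h : U = V
  · rw [if_pos h, if_pos (by omega)]
    ring
  · rw [if_neg h, if_neg (by omega), mul_zero]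

/-- The kernel `K_N` is a right inverse of the Kasteleyn matrix of the tower. -/
theorem sum_kasteleyn_mul_schurKernel (hα : 0 < α) (hβ : 0 < β) {N : ℕ} {b b' : Pt}
    (hb : b ∈ blacks N) (hb' : b' ∈ blacks N) :
    ∑ w ∈ whites N, (kasteleyn α β (w, b) : ℂ) * schurKernel α β N w b' =
      if b = b' then 1 else 0 := by
  -- Neighbours of `b` outside the tower may be included in the sum because the kernel vanishes
  -- there; the relation becomes the same at boundary and interior vertices.
  have hS : ∀ w, w ∉ whites N → IsEdge (w, b) →
      (kasteleyn α β (w, b) : ℂ) * schurKernel α β N w b' = 0 := by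
    intro w hw he
    have hwh := he.isWhite
    have hbd : 0 ≤ w.1 ∧ w.1 ≤ 3 * N := by
      rw [mem_blacks, mem_towerVertices] at hb
      obtain ⟨hb1, hb2⟩ := hb
      simp only [IsEdge, IsBlack, Prod.ext_iff] at he hb2
      omega
    rw [schurKernel_eq_zero hα hβ hwh hbd.1 hbd.2 hw hb', mul_zero]
  have hg : ∀ w, ¬IsEdge (w, b) → (kasteleyn α β (w, b) : ℂ) * schurKernel α β N w b' = 0 := by
    intro w he
    rw [kasteleyn_eq, kast_of_not he]
    simp
  have hbb := (mem_blacks.1 hb).2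
  have hbb' := (mem_blacks.1 hb').2
  obtain ⟨X, U⟩ := b
  obtain ⟨Y, V⟩ := b'
  simp only [IsBlack] at hbb hbb'
  have hpi : (2 * Real.pi * I : ℂ) ^ 2 ≠ 0 := pow_ne_zero 2 two_pi_I_ne_zero
  have hK : ∀ P : Pt, schurKernel α β N P (Y, V) =
      1 / (2 * Real.pi * I) ^ 2 * kernelAt α β N (Y ≤ P.1) P (Y, V) :=
    fun P => schurKernel_eq hα hβ N P _
  -- The neighbours of `b` combine to the kernel at the position of `b` itself, once for each of two
  -- contour orders. The orders `Y ≤ X` and `Y < X` differ only when both black vertices are in the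
  -- same column.
  have hfin : ∀ (o o' : Prop) [Decidable o] [Decidable o'], (o ↔ Y ≤ X) → (o' ↔ Y < X) →
      1 / (2 * Real.pi * I) ^ 2 * (kernelAt α β N o (X, U) (Y, V) -
        kernelAt α β N o' (X, U) (Y, V)) = if (X, U) = (Y, V) then 1 else 0 := by
    intro o o' _ _ ho ho'
    by_cases hXY : X = Y
    · subst hXY
      rw [kernelAt_sub hα hβ X U V (ho.2 le_rfl) (fun h => lt_irrefl _ (ho'.1 h))]
      by_cases hU : U = V
      · rw [if_pos hU, if_pos (by rw [hU])]
        field_simp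
      · rw [if_neg hU, if_neg (by rw [Prod.ext_iff]; simpa using hU), mul_zero]
    · rw [kernelAt_congr (show o ↔ o' by rw [ho, ho']; omega), sub_self, mul_zero,
        if_neg (by rw [Prod.ext_iff]; exact fun h => hXY h.1)]
  rcases hbb with hX | hX
  · rw [sum_nbrs_of_mod_one hX _ _ hS hg]
    have hr := kernelAt_pair hα hβ (N := N) (Y ≤ X - 1) (P := (X - 1, U)) (P' := (X - 1, U + 1))
      (R := (X, U)) (Q := (Y, V)) (a := -1) (a' := α) (c := -1) (fun z _ _ h1 h0 => by
        linear_combination phiK_rel_one (β := β) (N := N) (U := U) hX h0 h1)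
    have k1 : kasteleyn α β ((X, U), (X, U)) = 1 := by
      simp [kasteleyn, weight, hX]
    have k2 : kasteleyn α β ((X - 1, U), (X, U)) = -1 := by
      simp [kasteleyn, weight, show (X - 1) % 3 = 0 by omega]
    have k3 : kasteleyn α β ((X - 1, U + 1), (X, U)) = α := by
      simp [kasteleyn, weight, show (X - 1) % 3 = 0 by omega]
    rw [← hfin (Y ≤ X) (Y ≤ X - 1) Iff.rfl (by omega)]
    simp only [k1, k2, k3, hK]
    push_cast
    linear_combination (1 / (2 * Real.pi * I) ^ 2 : ℂ) * hr
  · rw [sum_nbrs_of_mod_two hX _ _ hS hg]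
    have hr := kernelAt_pair hα hβ (N := N) (Y ≤ X - 1) (P := (X - 1, U)) (P' := (X - 1, U + 1))
      (R := (X, U)) (Q := (Y, V)) (a := -1) (a' := 1) (c := -1) (fun z h4 h3 h1 h0 => by
        linear_combination (phiK_rel_two (α := α) (N := N) (U := U) hX h0 h3 h4).1)
    have hr' := kernelAt_pair hα hβ (N := N) (Y ≤ X + 1) (P := (X + 1, U)) (P' := (X + 1, U - 1))
      (R := (X, U)) (Q := (Y, V)) (a := 1) (a' := β) (c := 1) (fun z h4 h3 h1 h0 => by
        linear_combination (phiK_rel_two (α := α) (N := N) (U := U) hX h0 h3 h4).2)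
    have k1 : kasteleyn α β ((X - 1, U), (X, U)) = -1 := by
      simp [kasteleyn, weight, show (X - 1) % 3 = 1 by omega]
    have k2 : kasteleyn α β ((X - 1, U + 1), (X, U)) = 1 := by
      simp [kasteleyn, weight, show (X - 1) % 3 = 1 by omega]
    have k3 : kasteleyn α β ((X + 1, U), (X, U)) = 1 := by
      simp [kasteleyn, weight, show (X + 1) % 3 = 0 by omega, show ¬X = X + 1 + 1 by omega,
        show ¬U = U - 1 by omega]
    have k4 : kasteleyn α β ((X + 1, U - 1), (X, U)) = β := by
      simp [kasteleyn, weight, show (X + 1) % 3 = 0 by omega, show ¬X = X + 1 + 1 by omega,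
        show ¬U = U - 1 by omega]
    -- Column `X + 1` is `≡ 0` and contains no black vertex, so `Y ≤ X + 1` is the same as `Y ≤ X`.
    rw [← hfin (Y ≤ X + 1) (Y ≤ X - 1) (by omega) (by omega)]
    simp only [k1, k2, k3, k4, hK]
    push_cast
    linear_combination (1 / (2 * Real.pi * I) ^ 2 : ℂ) * (hr + hr')

/-- The dimers of the tower form a determinantal process with kernel `K_N`. -/
theorem towerProb_eq_det_schurKernel (hα : 0 < α) (hβ : 0 < β) {N : ℕ} {s : Finset Edge}
    (hs : ∀ e ∈ s, e.1 ∈ whites N ∧ e.2 ∈ blacks N) :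
    (towerProb α β N s : ℂ) = (∏ e ∈ s, (kasteleyn α β e : ℂ)) *
      (Matrix.of fun e f : s => schurKernel α β N e.1.1 f.1.2).det :=
  towerProb_eq_det hα hβ
    (fun _ hb _ hb' => sum_kasteleyn_mul_schurKernel hα hβ hb hb') hs

end inverse

end TowerDimer

end

/-! ### Primitives on star domains and on the two half planes. -/

noncomputable section

namespace TowerDimer

open MeasureTheory Filter Topology Metric Complex Bornology

/-- A holomorphic function on a star-convex open set has a primitive. -/
theorem exists_primitive_of_starConvex {U : Set ℂ} (hU : IsOpen U) {c : ℂ}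
    (hs : ∀ z ∈ U, ∀ t ∈ Set.Icc (0 : ℝ) 1, c + t * (z - c) ∈ U) {f : ℂ → ℂ}
    (hf : DifferentiableOn ℂ f U) : ∃ J : ℂ → ℂ, ∀ z ∈ U, HasDerivAt J (f z) z := by
  have hd : ∀ z ∈ U, HasDerivAt f (deriv f z) z := fun z hz =>
    (hf.differentiableAt (hU.mem_nhds hz)).hasDerivAt
  have hf' : ContinuousOn (deriv f) U := (hf.deriv hU).continuousOn
  -- The primitive is the integral along the segment from `c` to `z`, differentiated under the
  -- integral sign.
  refine ⟨fun z => ∫ t in (0 : ℝ)..1, f (c + t * (z - c)) * (z - c), fun z₀ hz₀ => ?_⟩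
  have hV : IsOpen {p : ℂ × ℝ | c + p.2 * (p.1 - c) ∈ U} := hU.preimage (by fun_prop)
  -- The tube lemma provides a ball around `z₀` for which all segments to `c` stay in `U`;
  -- compactness then bounds the derivative of the integrand uniformly.
  obtain ⟨u, v, hu, hv, hzu, htv, huv⟩ := generalized_tube_lemma (isCompact_singleton (x := z₀))
    (isCompact_Icc (a := (0 : ℝ)) (b := 1)) hV (by
      rintro ⟨z, t⟩ ⟨hz, ht⟩
      rw [Set.mem_singleton_iff] at hz
      simp only at hz
      subst hz
      exact hs _ hz₀ t ht)
  obtain ⟨ε, hε, hεu⟩ := nhds_basis_closedBall.mem_iff.1 (hu.mem_nhds (hzu rfl))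
  have hmem : ∀ z ∈ closedBall z₀ ε, ∀ t ∈ Set.Icc (0 : ℝ) 1, c + t * (z - c) ∈ U :=
    fun z hz t ht => huv (show (z, t) ∈ u ×ˢ v from ⟨hεu hz, htv ht⟩)
  have hmaps : Set.MapsTo (fun p : ℂ × ℝ => c + p.2 * (p.1 - c))
      (closedBall z₀ ε ×ˢ Set.Icc (0 : ℝ) 1) U := fun p hp => hmem p.1 hp.1 p.2 hp.2
  have hcont : ContinuousOn (fun p : ℂ × ℝ => deriv f (c + p.2 * (p.1 - c)) * p.2 * (p.1 - c) +
      f (c + p.2 * (p.1 - c))) (closedBall z₀ ε ×ˢ Set.Icc (0 : ℝ) 1) := by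
    have h1 := hf'.comp (f := fun p : ℂ × ℝ => c + p.2 * (p.1 - c)) (by fun_prop) hmaps
    have h2 := hf.continuousOn.comp (f := fun p : ℂ × ℝ => c + p.2 * (p.1 - c)) (by fun_prop) hmaps
    exact ((h1.mul (by fun_prop)).mul (by fun_prop)).add h2
  obtain ⟨C, hC⟩ := ((isCompact_closedBall z₀ ε).prod isCompact_Icc).exists_bound_of_continuousOn
    hcont
  have hsec : ∀ z ∈ closedBall z₀ ε, ContinuousOn (fun t : ℝ => f (c + t * (z - c)))
      (Set.Icc 0 1) := fun z hz =>
    hf.continuousOn.comp (f := fun t : ℝ => c + t * (z - c)) (by fun_prop) fun t ht => hmem z hz t ht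
  have hsec' : ContinuousOn (fun t : ℝ => deriv f (c + t * (z₀ - c)) * t * (z₀ - c) +
      f (c + t * (z₀ - c))) (Set.Icc 0 1) :=
    hcont.comp (f := fun t : ℝ => (z₀, t)) (by fun_prop) fun t ht =>
      ⟨mem_closedBall_self hε.le, ht⟩
  have hz₀' : z₀ ∈ closedBall z₀ ε := mem_closedBall_self hε.le
  have hIoc : Set.uIoc (0 : ℝ) 1 ⊆ Set.Icc 0 1 := by
    rw [Set.uIoc_of_le zero_le_one]
    exact Set.Ioc_subset_Icc_self
  have hint : ∀ g : ℝ → ℂ, ContinuousOn g (Set.Icc 0 1) → IntervalIntegrable g volume 0 1 :=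
    fun g hg => ContinuousOn.intervalIntegrable (by rwa [Set.uIcc_of_le zero_le_one])
  have key := (intervalIntegral.hasDerivAt_integral_of_dominated_loc_of_deriv_le (μ := volume)
    (a := 0) (b := 1) (bound := fun _ => C) (s := closedBall z₀ ε)
    (F := fun (z : ℂ) (t : ℝ) => f (c + t * (z - c)) * (z - c))
    (F' := fun (z : ℂ) (t : ℝ) => deriv f (c + t * (z - c)) * t * (z - c) + f (c + t * (z - c)))
    (x₀ := z₀) (closedBall_mem_nhds z₀ hε) ?_ ?_ ?_ ?_ ?_ ?_).2
  -- The differentiated integrand is the derivative in `t` of `t * f (c + t * (z₀ - c))`.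
  · have hftc : (∫ t in (0 : ℝ)..1, deriv f (c + t * (z₀ - c)) * t * (z₀ - c) +
        f (c + t * (z₀ - c))) = f z₀ := by
      rw [intervalIntegral.integral_eq_sub_of_hasDerivAt
        (f := fun t : ℝ => (t : ℂ) * f (c + t * (z₀ - c)))]
      · simp
      · intro t ht
        rw [Set.uIcc_of_le zero_le_one] at ht
        have h1 : HasDerivAt (fun t : ℂ => c + t * (z₀ - c)) (z₀ - c) t := by
          simpa using ((hasDerivAt_id (t : ℂ)).mul_const (z₀ - c)).const_add c
        have h2 := (hd _ (hmem z₀ hz₀' t ht)).comp (t : ℂ) h1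
        have h3 := ((hasDerivAt_id (t : ℂ)).mul h2).comp_ofReal
        exact h3.congr_deriv (by simp; ring)
      · exact hint _ hsec'
    rw [hftc] at key
    exact key
  · filter_upwards [closedBall_mem_nhds z₀ hε] with z hz
    exact ((((hsec z hz).mul continuousOn_const).mono hIoc).aestronglyMeasurable
      measurableSet_uIoc)
  · exact hint _ ((hsec z₀ hz₀').mul continuousOn_const)
  · exact (hsec'.mono hIoc).aestronglyMeasurable measurableSet_uIoc
  · exact Eventually.of_forall fun t ht z hz => hC (z, t) ⟨hz, hIoc ht⟩
  · exact intervalIntegrable_const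
  · refine Eventually.of_forall fun t ht z hz => ?_
    have h1 : HasDerivAt (fun z : ℂ => c + t * (z - c)) t z := by
      simpa using (((hasDerivAt_id z).sub_const c).const_mul (t : ℂ)).const_add c
    have h2 := ((hd _ (hmem z hz t (hIoc ht))).comp z h1).mul ((hasDerivAt_id z).sub_const c)
    exact h2.congr_deriv (by simp)

/-- The complement of the rays `a + t (a - σ I)`, `0 ≤ t`, for `a ∈ S`. -/
def slitDomain (S : Set ℝ) (σ : ℝ) : Set ℂ :=
  {z | ∀ a ∈ S, 0 < σ * z.im ∨ z.re ≠ a * (1 - σ * z.im)}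

theorem isOpen_slitDomain {S : Set ℝ} (hS : S.Finite) (σ : ℝ) : IsOpen (slitDomain S σ) := by
  have h : slitDomain S σ = ⋂ a ∈ S, ({z : ℂ | 0 < σ * z.im} ∪ {z | z.re ≠ a * (1 - σ * z.im)}) := by
    ext z
    simp [slitDomain]
  rw [h]
  refine hS.isOpen_biInter fun a _ => IsOpen.union ?_ ?_
  · exact isOpen_lt (by fun_prop) (by fun_prop)
  · exact isOpen_ne_fun (by fun_prop) (by fun_prop)

/-- The slits run radially away from the centre `σ * I`: if a point of a segment from the centre
lies on a slit, so does its endpoint. -/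
theorem slitDomain_starConvex {S : Set ℝ} {σ : ℝ} (hσ : σ * σ = 1) {z : ℂ}
    (hz : z ∈ slitDomain S σ) {t : ℝ} (ht : t ∈ Set.Icc (0 : ℝ) 1) :
    σ * I + t * (z - σ * I) ∈ slitDomain S σ := by
  intro a ha
  have him : σ * (σ * I + t * (z - σ * I) : ℂ).im = 1 + t * (σ * z.im - 1) := by
    simp
    linear_combination (1 - t) * hσ
  have hre : (σ * I + t * (z - σ * I) : ℂ).re = t * z.re := by simp
  rw [him, hre]
  by_cases h0 : 0 < 1 + t * (σ * z.im - 1)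
  · exact Or.inl h0
  · right
    intro h
    push Not at h0
    have ht0 : 0 < t := by
      rcases ht.1.lt_or_eq with h1 | h1
      · exact h1
      · rw [← h1] at h0; norm_num at h0
    have ht1 : 1 * t ≤ 1 := by linarith [ht.2]
    rcases hz a ha with h1 | h1
    · nlinarith [ht.2]
    · apply h1
      have : t * (z.re - a * (1 - σ * z.im)) = 0 := by linear_combination h
      rcases mul_eq_zero.1 this with h2 | h2 <;> linarith

theorem mem_slitDomain {S : Set ℝ} {σ : ℝ} {z : ℂ} (h0 : 0 ≤ σ * z.im)
    (hz : ∀ a ∈ S, z ≠ (a : ℝ)) (hσ : σ ≠ 0) : z ∈ slitDomain S σ := by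
  intro a ha
  rcases h0.lt_or_eq with h | h
  · exact Or.inl h
  · right
    rw [← h]
    intro hre
    have him : z.im = 0 := by
      rcases mul_eq_zero.1 h.symm with h1 | h1
      · exact absurd h1 hσ
      · exact h1
    exact hz a ha (Complex.ext (by simpa using hre) (by simpa using him))

/-- A function which is holomorphic off a finite set of real points has primitives on the two
closed half planes. -/
theorem exists_primitive_halfPlane {S : Set ℝ} (hS : S.Finite) {f : ℂ → ℂ}
    (hf : ∀ z : ℂ, (∀ a ∈ S, z ≠ (a : ℝ)) → DifferentiableAt ℂ f z) {σ : ℝ} (hσ : σ * σ = 1) :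
    ∃ J : ℂ → ℂ, ∀ z : ℂ, 0 ≤ σ * z.im → (∀ a ∈ S, z ≠ (a : ℝ)) → HasDerivAt J (f z) z := by
  have hσ0 : σ ≠ 0 := by rintro rfl; norm_num at hσ
  have hd : DifferentiableOn ℂ f (slitDomain S σ) := by
    intro z hz
    refine (hf z ?_).differentiableWithinAt
    rintro a ha rfl
    rcases hz a ha with h | h <;> simp at h
  obtain ⟨J, hJ⟩ := exists_primitive_of_starConvex (isOpen_slitDomain hS σ)
    (fun z hz t ht => slitDomain_starConvex hσ hz ht) hd
  exact ⟨J, fun z h0 hz => hJ z (mem_slitDomain h0 hz hσ0)⟩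

/-- Integration along a path. -/
theorem integral_comp_path {f J : ℂ → ℂ} {γ γ' : ℝ → ℂ} {a b : ℝ}
    (hγ : ∀ t ∈ Set.uIcc a b, HasDerivAt γ (γ' t) t) (hγ' : ContinuousOn γ' (Set.uIcc a b))
    (hJ : ∀ t ∈ Set.uIcc a b, HasDerivAt J (f (γ t)) (γ t))
    (hf : ∀ t ∈ Set.uIcc a b, ContinuousAt f (γ t)) :
    ∫ t in a..b, f (γ t) * γ' t = J (γ b) - J (γ a) := by
  refine intervalIntegral.integral_eq_sub_of_hasDerivAt (f := J ∘ γ)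
    (fun t ht => (hJ t ht).comp t (hγ t ht)) (ContinuousOn.intervalIntegrable (ContinuousOn.mul ?_ hγ'))
  exact fun t ht => ((hf t ht).comp (hγ t ht).continuousAt).continuousWithinAt

/-- Primitives on the two half planes differ by a constant on real intervals. -/
theorem primitive_sub_eq {S : Set ℝ} {f J J' : ℂ → ℂ}
    (hf : ∀ z : ℂ, (∀ a ∈ S, z ≠ (a : ℝ)) → DifferentiableAt ℂ f z)
    (hJ : ∀ z : ℂ, 0 ≤ z.im → (∀ a ∈ S, z ≠ (a : ℝ)) → HasDerivAt J (f z) z)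
    (hJ' : ∀ z : ℂ, z.im ≤ 0 → (∀ a ∈ S, z ≠ (a : ℝ)) → HasDerivAt J' (f z) z) {p q : ℝ}
    (hpq : ∀ a ∈ S, a ∉ Set.uIcc p q) : J q - J' q = J p - J' p := by
  have hmem : ∀ t ∈ Set.uIcc p q, ∀ a ∈ S, (t : ℂ) ≠ (a : ℝ) := by
    intro t ht a ha h
    rw [Complex.ofReal_inj] at h
    exact hpq a ha (h ▸ ht)
  have hγ : ∀ t ∈ Set.uIcc p q, HasDerivAt (fun t : ℝ => (t : ℂ)) 1 t := fun t _ =>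
    Complex.ofRealCLM.hasDerivAt
  have hc : ∀ t ∈ Set.uIcc p q, ContinuousAt f (t : ℂ) := fun t ht =>
    (hf _ (hmem t ht)).continuousAt
  have h1 := integral_comp_path (γ := fun t : ℝ => (t : ℂ)) (γ' := fun _ => 1) hγ
    continuousOn_const (fun t ht => hJ t (by simp) (hmem t ht)) hc
  have h2 := integral_comp_path (γ := fun t : ℝ => (t : ℂ)) (γ' := fun _ => 1) hγ
    continuousOn_const (fun t ht => hJ' t (by simp) (hmem t ht)) hc
  rw [h1] at h2
  linear_combination h2

/-- A circle integral in terms of primitives on the two half planes. -/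
theorem circleIntegral_eq_primitive {S : Set ℝ} {f J J' : ℂ → ℂ}
    (hf : ∀ z : ℂ, (∀ a ∈ S, z ≠ (a : ℝ)) → DifferentiableAt ℂ f z)
    (hJ : ∀ z : ℂ, 0 ≤ z.im → (∀ a ∈ S, z ≠ (a : ℝ)) → HasDerivAt J (f z) z)
    (hJ' : ∀ z : ℂ, z.im ≤ 0 → (∀ a ∈ S, z ≠ (a : ℝ)) → HasDerivAt J' (f z) z) {c r : ℝ}
    (hr : 0 ≤ r) (hc : ∀ a ∈ S, (a : ℂ) ∉ sphere (c : ℂ) r) :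
    (∮ z in C(c, r), f z) = (J ((c - r : ℝ)) - J' ((c - r : ℝ))) -
      (J ((c + r : ℝ)) - J' ((c + r : ℝ))) := by
  have hmem : ∀ t, ∀ a ∈ S, circleMap c r t ≠ (a : ℝ) := by
    intro t a ha h
    exact hc a ha (h ▸ circleMap_mem_sphere _ hr _)
  have him : ∀ t, (circleMap c r t).im = r * Real.sin t := by
    intro t
    simp [circleMap, Complex.exp_ofReal_mul_I_im]
  have hγ : ∀ t, HasDerivAt (circleMap c r) (circleMap 0 r t * I) t := fun t =>
    hasDerivAt_circleMap _ _ t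
  have hγ' : Continuous fun t => circleMap 0 r t * I := by fun_prop
  have hfc : ∀ t, ContinuousAt f (circleMap c r t) := fun t => (hf _ (hmem t)).continuousAt
  have hi : ∀ a b : ℝ, IntervalIntegrable (fun t => f (circleMap c r t) * (circleMap 0 r t * I))
      volume a b := by
    intro a b
    refine Continuous.intervalIntegrable (Continuous.mul ?_ hγ') _ _
    exact continuous_iff_continuousAt.2 fun t => (hfc t).comp (hγ t).continuousAt
  have e0 : circleMap c r 0 = ((c + r : ℝ) : ℂ) := by simp [circleMap]
  have e1 : circleMap c r Real.pi = ((c - r : ℝ) : ℂ) := by simp [circleMap, sub_eq_add_neg]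
  have e2 : circleMap c r (2 * Real.pi) = ((c + r : ℝ) : ℂ) := by simp [circleMap]
  have hpi := Real.pi_pos
  have h1 := integral_comp_path (a := 0) (b := Real.pi) (fun t _ => hγ t) hγ'.continuousOn
    (fun t ht => hJ _ (by
      rw [Set.uIcc_of_le hpi.le] at ht
      rw [him]
      exact mul_nonneg hr (Real.sin_nonneg_of_nonneg_of_le_pi ht.1 ht.2)) (hmem t))
    (fun t _ => hfc t)
  have h2 := integral_comp_path (a := Real.pi) (b := 2 * Real.pi) (fun t _ => hγ t)
    hγ'.continuousOn (fun t ht => hJ' _ (by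
      rw [Set.uIcc_of_le (by linarith)] at ht
      rw [him]
      refine mul_nonpos_of_nonneg_of_nonpos hr ?_
      have := Real.sin_nonneg_of_nonneg_of_le_pi (x := t - Real.pi) (by linarith [ht.1])
        (by linarith [ht.2])
      rw [Real.sin_sub_pi] at this
      linarith) (hmem t))
    (fun t _ => hfc t)
  have h3 : (∮ z in C(c, r), f z) =
      ∫ t in (0 : ℝ)..2 * Real.pi, f (circleMap c r t) * (circleMap 0 r t * I) := by
    unfold circleIntegral
    simp only [deriv_circleMap, smul_eq_mul]
    exact intervalIntegral.integral_congr fun t _ => mul_comm _ _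
  rw [h3, ← intervalIntegral.integral_add_adjacent_intervals (hi 0 Real.pi) (hi _ _), h1, h2, e0,
    e1, e2]
  ring

end TowerDimer

end

/-! ### Cauchy transforms of functions holomorphic off the origin. -/

noncomputable section

namespace TowerDimer

open MeasureTheory Filter Topology Metric Complex Bornology

/-- The two circles need not be concentric. Each integral is a difference of the jumps between the
two half plane primitives at the real points of the circle, and these jumps are constant on each
side of `0`. -/
theorem circleIntegral_punctured_plane {f : ℂ → ℂ} (hf : ∀ z, z ≠ 0 → DifferentiableAt ℂ f z)
    {c ρ r : ℝ} (hc : |c| < ρ) (hr : 0 < r) : (∮ z in C(c, ρ), f z) = ∮ z in C(0, r), f z := by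
  have hf' : ∀ z : ℂ, (∀ a ∈ ({0} : Set ℝ), z ≠ (a : ℝ)) → DifferentiableAt ℂ f z := fun z hz =>
    hf z (by simpa using hz)
  obtain ⟨J, hJ⟩ := exists_primitive_halfPlane (Set.finite_singleton 0) hf' (σ := 1) (by norm_num)
  obtain ⟨J', hJ'⟩ := exists_primitive_halfPlane (Set.finite_singleton 0) hf' (σ := -1)
    (by norm_num)
  have h1 : ∀ z : ℂ, 0 ≤ z.im → (∀ a ∈ ({0} : Set ℝ), z ≠ (a : ℝ)) → HasDerivAt J (f z) z :=
    fun z hz => hJ z (by simpa using hz)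
  have h2 : ∀ z : ℂ, z.im ≤ 0 → (∀ a ∈ ({0} : Set ℝ), z ≠ (a : ℝ)) → HasDerivAt J' (f z) z :=
    fun z hz => hJ' z (by simpa using hz)
  have hc' := abs_lt.1 hc
  have e1 := circleIntegral_eq_primitive hf' h1 h2 (c := c) (r := ρ) (by linarith [abs_nonneg c])
    (by
      rintro a rfl h
      rw [mem_sphere, dist_comm, Complex.dist_eq, ← Complex.ofReal_sub, Complex.norm_real, sub_zero,
        Real.norm_eq_abs] at h
      linarith)
  have e2 := circleIntegral_eq_primitive hf' h1 h2 (c := 0) (r := r) hr.le (by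
    rintro a rfl h
    simp at h
    exact hr.ne h)
  have e3 := primitive_sub_eq hf' h1 h2 (p := c - ρ) (q := 0 - r) (by
    rintro a rfl h
    rw [Set.mem_uIcc] at h
    rcases h with h | h <;> linarith)
  have e4 := primitive_sub_eq hf' h1 h2 (p := c + ρ) (q := 0 + r) (by
    rintro a rfl h
    rw [Set.mem_uIcc] at h
    rcases h with h | h <;> linarith)
  rw [Complex.ofReal_zero] at e2
  rw [e1, e2, e3, e4]

/-- The contribution of the pole at `0` to the Cauchy transform of `f`. -/
def cauchyPart (f : ℂ → ℂ) (w : ℂ) : ℂ := ∮ z in C(0, 1), dslope f w z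

section cauchyPart

variable {f : ℂ → ℂ}

theorem differentiableAt_dslope_punctured (hf : ∀ z, z ≠ 0 → DifferentiableAt ℂ f z) {w z : ℂ}
    (hw : w ≠ 0) (hz : z ≠ 0) : DifferentiableAt ℂ (dslope f w) z := by
  have h := (Complex.differentiableOn_dslope (s := {0}ᶜ) (isOpen_compl_singleton.mem_nhds hw)).2
    fun z hz => (hf z hz).differentiableWithinAt
  exact h.differentiableAt (isOpen_compl_singleton.mem_nhds hz)

/-- Subtracting `f w / (z - w)` leaves the difference quotient, which is holomorphic off `0`; its
integral is the same for all circles around `0`. The position of `w` only matters for the second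
term. -/
theorem circleIntegral_cauchy (hf : ∀ z, z ≠ 0 → DifferentiableAt ℂ f z) {w : ℂ} (hw : w ≠ 0)
    {c ρ : ℝ} (hc : |c| < ρ) (hws : w ∉ sphere (c : ℂ) ρ) :
    (∮ z in C(c, ρ), f z * (z - w)⁻¹) =
      cauchyPart f w + f w * ∮ z in C(c, ρ), (z - w)⁻¹ := by
  have hρ : 0 ≤ ρ := by linarith [abs_nonneg c]
  have h0 : ∀ z ∈ sphere (c : ℂ) ρ, z ≠ 0 := by
    rintro z h rfl
    rw [mem_sphere, dist_comm, Complex.dist_eq, sub_zero, Complex.norm_real,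
      Real.norm_eq_abs] at h
    linarith
  have hne : ∀ z ∈ sphere (c : ℂ) ρ, z ≠ w := fun z hz h => hws (h ▸ hz)
  rw [cauchyPart, ← circleIntegral_punctured_plane
    (fun z hz => differentiableAt_dslope_punctured hf hw hz) hc one_pos,
    ← circleIntegral.integral_const_mul, ← circleIntegral.integral_add]
  · refine circleIntegral.integral_congr hρ fun z hz => ?_
    have h1 := sub_ne_zero.2 (hne z hz)
    rw [dslope_of_ne _ (hne z hz), slope_def_field]
    field_simp
    ring
  · exact ContinuousOn.circleIntegrable hρ fun z hz =>
      (differentiableAt_dslope_punctured hf hw (h0 z hz)).continuousAt.continuousWithinAt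
  · exact ContinuousOn.circleIntegrable hρ fun z hz =>
      ((hasDerivAt_sub_inv_ne (hne z hz)).const_mul (f w)).continuousAt.continuousWithinAt

theorem circleIntegral_cauchy_of_mem (hf : ∀ z, z ≠ 0 → DifferentiableAt ℂ f z) {w : ℂ}
    (hw : w ≠ 0) {c ρ : ℝ} (hc : |c| < ρ) (hws : w ∈ ball (c : ℂ) ρ) :
    (∮ z in C(c, ρ), f z * (z - w)⁻¹) = cauchyPart f w + 2 * Real.pi * I * f w := by
  rw [circleIntegral_cauchy hf hw hc (fun h => (mem_ball.1 hws).ne (mem_sphere.1 h)),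
    circleIntegral.integral_sub_inv_of_mem_ball hws]
  ring

theorem circleIntegral_cauchy_of_notMem (hf : ∀ z, z ≠ 0 → DifferentiableAt ℂ f z) {w : ℂ}
    (hw : w ≠ 0) {c ρ : ℝ} (hc : |c| < ρ) (hws : w ∉ closedBall (c : ℂ) ρ) :
    (∮ z in C(c, ρ), f z * (z - w)⁻¹) = cauchyPart f w := by
  rw [circleIntegral_cauchy hf hw hc (fun h => hws (sphere_subset_closedBall h)),
    circleIntegral_sub_inv_of_lt (by linarith [abs_nonneg c]) (by simpa using hws)]
  ring

/-- On a circle enclosing both `0` and `w`, `cauchyPart` is the Cauchy integral minus `2 π i f w`,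
and the Cauchy integral has a power series. -/
theorem differentiableAt_cauchyPart (hf : ∀ z, z ≠ 0 → DifferentiableAt ℂ f z) {w : ℂ}
    (hw : w ≠ 0) : DifferentiableAt ℂ (cauchyPart f) w := by
  set R : NNReal := ‖w‖₊ + 1 with hR
  have hR0 : 0 < R := by positivity
  have hwR : w ∈ ball (0 : ℂ) R := by
    rw [mem_ball_zero_iff, hR]
    push_cast
    linarith
  have hi : CircleIntegrable f 0 R := by
    refine ContinuousOn.circleIntegrable R.2 fun z hz => (hf z ?_).continuousAt.continuousWithinAt
    rintro rfl
    rw [mem_sphere, dist_self] at hz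
    exact hR0.ne (by exact_mod_cast hz)
  have h1 := (hasFPowerSeriesOn_cauchy_integral hi hR0).differentiableOn.differentiableAt
    (isOpen_eball.mem_nhds (by rw [Metric.eball_coe]; exact hwR))
  have h2 := (h1.const_mul (2 * Real.pi * I)).sub ((hf w hw).const_mul (2 * Real.pi * I))
  refine h2.congr_of_eventuallyEq ?_
  filter_upwards [isOpen_ball.mem_nhds hwR, isOpen_ne.mem_nhds hw] with w' hw1 hw2
  have h3 := circleIntegral_cauchy_of_mem hf hw2 (c := 0) (ρ := R) (by simpa using hR0)
    (by simpa using hw1)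
  have h4 : (∮ z in C((0 : ℂ), R), (z - w')⁻¹ • f z) = ∮ z in C((0 : ℂ), R), f z * (z - w')⁻¹ := by
    simp only [smul_eq_mul, mul_comm]
  simp only [Pi.sub_apply]
  rw [Complex.ofReal_zero] at h3
  rw [h4, h3, smul_eq_mul, ← mul_assoc, mul_inv_cancel₀ two_pi_I_ne_zero]
  ring

end cauchyPart

section poisson

/-- On the circle `r ^ 2 = z * conj z`, so `r ^ 2 - conj w * z = z * conj (z - w)`. This makes the
mean of `1 / |z - w|²` a contour integral. -/
theorem normSq_sub_circleMap {r : ℝ} (hr : 0 < r) (w : ℂ) (t : ℝ) :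
    circleMap 0 r t * ((circleMap 0 r t - w)⁻¹ * (r ^ 2 - (starRingEnd ℂ) w * circleMap 0 r t)⁻¹) =
      ((1 / ‖circleMap 0 r t - w‖ ^ 2 : ℝ) : ℂ) := by
  set z := circleMap 0 r t with hz
  have hz0 : z ≠ 0 := circleMap_ne_center hr.ne'
  have hzr : z * (starRingEnd ℂ) z = r ^ 2 := by
    rw [Complex.mul_conj, Complex.normSq_eq_norm_sq, hz, norm_circleMap_zero, abs_of_pos hr]
    push_cast
    rfl
  have h1 : (r : ℂ) ^ 2 - (starRingEnd ℂ) w * z = z * (starRingEnd ℂ) (z - w) := by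
    rw [← hzr, map_sub]
    ring
  have h2 : ((‖z - w‖ ^ 2 : ℝ) : ℂ) = (z - w) * (starRingEnd ℂ) (z - w) := by
    rw [Complex.mul_conj, Complex.normSq_eq_norm_sq]
  rw [h1, Complex.ofReal_div, h2, mul_inv, Complex.ofReal_one, one_div, mul_inv]
  field_simp

/-- A Poisson kernel computation: the only pole inside the circle is `w` itself if `w` is inside,
and its reflection `r ^ 2 / conj w` otherwise. -/
theorem integral_norm_sub_circleMap {r : ℝ} (hr : 0 < r) {w : ℂ} (hw : ‖w‖ ≠ r) :
    ∫ t in (0 : ℝ)..2 * Real.pi, 1 / ‖circleMap 0 r t - w‖ ^ 2 =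
      2 * Real.pi / |r ^ 2 - ‖w‖ ^ 2| := by
  have hww : w * (starRingEnd ℂ) w = ((‖w‖ ^ 2 : ℝ) : ℂ) := by
    rw [Complex.mul_conj, Complex.normSq_eq_norm_sq]
  have h1 : (∮ z in C((0 : ℂ), r), (z - w)⁻¹ * (r ^ 2 - (starRingEnd ℂ) w * z)⁻¹) =
      I * ((∫ t in (0 : ℝ)..2 * Real.pi, 1 / ‖circleMap 0 r t - w‖ ^ 2 : ℝ) : ℂ) := by
    rw [← intervalIntegral.integral_ofReal, ← intervalIntegral.integral_const_mul]
    unfold circleIntegral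
    refine intervalIntegral.integral_congr fun t _ => ?_
    simp only [deriv_circleMap, smul_eq_mul]
    rw [← normSq_sub_circleMap hr]
    ring
  have h2 : (∮ z in C((0 : ℂ), r), (z - w)⁻¹ * (r ^ 2 - (starRingEnd ℂ) w * z)⁻¹) =
      2 * Real.pi * I * ((|r ^ 2 - ‖w‖ ^ 2|⁻¹ : ℝ) : ℂ) := by
    have hr2 : ((r : ℂ)) ^ 2 = ((r ^ 2 : ℝ) : ℂ) := by push_cast; rfl
    rcases lt_or_gt_of_ne hw with h | h
    · have hd : DiffContOnCl ℂ (fun z => ((r : ℂ) ^ 2 - (starRingEnd ℂ) w * z)⁻¹) (ball 0 r) := by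
        refine DifferentiableOn.diffContOnCl fun z hz => ?_
        rw [closure_ball _ hr.ne', mem_closedBall_zero_iff] at hz
        refine (DifferentiableAt.inv (by fun_prop) fun h0 => ?_).differentiableWithinAt
        have h3 : ‖(r : ℂ) ^ 2‖ = ‖(starRingEnd ℂ) w * z‖ := by rw [sub_eq_zero.1 h0]
        rw [norm_pow, Complex.norm_real, norm_mul, Complex.norm_conj, Real.norm_eq_abs,
          abs_of_pos hr] at h3
        nlinarith [norm_nonneg z, norm_nonneg w]
      have h3 := hd.circleIntegral_sub_inv_smul (w := w) (by simpa using h)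
      simp only [smul_eq_mul] at h3
      rw [h3, abs_of_pos (by nlinarith [norm_nonneg w]), mul_comm _ w, hww]
      push_cast
      rfl
    · have hw0 : (starRingEnd ℂ) w ≠ 0 := by
        rw [map_ne_zero]
        rintro rfl
        simp at h
        linarith
      have hd : DiffContOnCl ℂ (fun z => (z - w)⁻¹ * (-(starRingEnd ℂ) w)⁻¹) (ball 0 r) := by
        refine DifferentiableOn.diffContOnCl fun z hz => ?_
        rw [closure_ball _ hr.ne', mem_closedBall_zero_iff] at hz
        refine ((hasDerivAt_sub_inv_ne ?_).mul_const _).differentiableWithinAt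
        rintro rfl
        linarith
      have h3 := hd.circleIntegral_sub_inv_smul (w := r ^ 2 / (starRingEnd ℂ) w) (by
        rw [mem_ball_zero_iff, norm_div, norm_pow, Complex.norm_real, Complex.norm_conj,
          Real.norm_eq_abs, abs_of_pos hr, div_lt_iff₀ (by linarith)]
        nlinarith)
      have h4 : ∀ z : ℂ, (z - w)⁻¹ * ((r : ℂ) ^ 2 - (starRingEnd ℂ) w * z)⁻¹ =
          (z - r ^ 2 / (starRingEnd ℂ) w)⁻¹ * ((z - w)⁻¹ * (-(starRingEnd ℂ) w)⁻¹) := by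
        intro z
        have h5 : (r : ℂ) ^ 2 - (starRingEnd ℂ) w * z =
            -(starRingEnd ℂ) w * (z - r ^ 2 / (starRingEnd ℂ) w) := by
          field_simp
          ring
        rw [h5, mul_inv]
        ring
      simp only [smul_eq_mul] at h3
      simp only [h4]
      rw [h3, abs_of_neg (by nlinarith), ← mul_inv]
      have h5 : ((r : ℂ) ^ 2 / (starRingEnd ℂ) w - w) * -(starRingEnd ℂ) w =
          ((-(r ^ 2 - ‖w‖ ^ 2) : ℝ) : ℂ) := by
        have : ((-(r ^ 2 - ‖w‖ ^ 2) : ℝ) : ℂ) = w * (starRingEnd ℂ) w - (r : ℂ) ^ 2 := by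
          rw [hww]; push_cast; ring
        rw [this]
        field_simp
        ring
      rw [h5, Complex.ofReal_inv]
  have h3 := h1.symm.trans h2
  have h4 : I * ((∫ t in (0 : ℝ)..2 * Real.pi, 1 / ‖circleMap 0 r t - w‖ ^ 2 : ℝ) : ℂ) =
      I * ((2 * Real.pi / |r ^ 2 - ‖w‖ ^ 2| : ℝ) : ℂ) := by
    rw [h3, div_eq_mul_inv]
    push_cast
    ring
  exact_mod_cast mul_left_cancel₀ I_ne_zero h4

theorem circleMap_sub_ne {r : ℝ} (hr : 0 < r) {w : ℂ} (hw : ‖w‖ ≠ r) (t : ℝ) :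
    circleMap 0 r t - w ≠ 0 := by
  intro h
  apply hw
  rw [← sub_eq_zero.1 h, norm_circleMap_zero, abs_of_pos hr]

/-- A Cauchy-Schwarz estimate for the mean of `1 / |z - w|`. The exponent `-1/2` is the point: it
stays integrable along a curve of points `w` crossing the circle, unlike the reciprocal distance. -/
theorem norm_circleIntegral_cauchy_le {r : ℝ} (hr : 0 < r) {w : ℂ} (hw : ‖w‖ ≠ r) {f : ℂ → ℂ}
    {M : ℝ} (hf : ∀ z ∈ sphere (0 : ℂ) r, ‖f z‖ ≤ M) :
    ‖∮ z in C(0, r), f z * (z - w)⁻¹‖ ≤ 2 * Real.pi * r * M * |r ^ 2 - ‖w‖ ^ 2| ^ (-(1 / 2) : ℝ) := by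
  have hM : 0 ≤ M := (norm_nonneg _).trans (hf _ (circleMap_mem_sphere 0 hr.le 0))
  have hd : 0 < |r ^ 2 - ‖w‖ ^ 2| := by
    rw [abs_pos, sub_ne_zero]
    intro h
    exact hw ((pow_left_inj₀ (norm_nonneg w) hr.le two_ne_zero).1 h.symm)
  set δ := |r ^ 2 - ‖w‖ ^ 2| with hδ
  -- The best parameter in `1 / s ≤ ε / 2 + 1 / (2 ε s²)`: after integration the two terms are
  -- equal.
  set ε := δ ^ (-(1 / 2) : ℝ) with hε
  have hε0 : 0 < ε := Real.rpow_pos_of_pos hd _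
  have hεδ : ε * ε * δ = 1 := by
    rw [hε, ← Real.rpow_add hd, ← Real.rpow_add_one hd.ne']
    norm_num
  have hne := circleMap_sub_ne hr hw
  have hpi := Real.pi_pos
  have hint : IntervalIntegrable (fun t => 1 / ‖circleMap 0 r t - w‖ ^ 2) volume 0
      (2 * Real.pi) := by
    refine Continuous.intervalIntegrable (Continuous.div continuous_const (by fun_prop) fun t => ?_)
      _ _
    exact pow_ne_zero 2 (norm_ne_zero_iff.2 (hne t))
  unfold circleIntegral
  refine (intervalIntegral.norm_integral_le_of_norm_le (by linarith)
    (g := fun t => r * M * (ε / 2 + 1 / (2 * ε) * (1 / ‖circleMap 0 r t - w‖ ^ 2)))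
    (Eventually.of_forall fun t _ => ?_) ?_).trans ?_
  · rw [norm_smul, norm_mul, norm_inv, deriv_circleMap, norm_mul, Complex.norm_I, mul_one,
      norm_circleMap_zero, abs_of_pos hr, ← mul_assoc]
    have h1 : 0 < ‖circleMap 0 r t - w‖ := norm_pos_iff.2 (hne t)
    refine mul_le_mul (mul_le_mul_of_nonneg_left (hf _ (circleMap_mem_sphere 0 hr.le t)) hr.le) ?_
      (by positivity) (by positivity)
    have h2 : ε / 2 + 1 / (2 * ε) * (1 / ‖circleMap 0 r t - w‖ ^ 2) - ‖circleMap 0 r t - w‖⁻¹ =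
        (ε * ‖circleMap 0 r t - w‖ - 1) ^ 2 / (2 * ε * ‖circleMap 0 r t - w‖ ^ 2) := by
      field_simp
      ring
    have h3 : 0 ≤ (ε * ‖circleMap 0 r t - w‖ - 1) ^ 2 / (2 * ε * ‖circleMap 0 r t - w‖ ^ 2) := by
      positivity
    linarith
  · exact (intervalIntegrable_const.add (hint.const_mul _)).const_mul _
  · rw [intervalIntegral.integral_const_mul, intervalIntegral.integral_add
      intervalIntegrable_const (hint.const_mul _), intervalIntegral.integral_const_mul,
      integral_norm_sub_circleMap hr hw, intervalIntegral.integral_const, ← hδ]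
    apply le_of_eq
    have h5 : 1 / (2 * ε) * (2 * Real.pi / δ) = Real.pi * ε := by
      field_simp
      linear_combination -hεδ
    rw [h5, smul_eq_mul]
    ring

end poisson

end TowerDimer

end

/-! ### The energy and its maximum principle. -/

noncomputable section

namespace TowerDimer

open MeasureTheory Filter Topology Metric Complex Bornology

/-- The modulus of the exponential of the action. -/
def energy (α β x u : ℝ) (z : ℂ) : ℝ :=
  ‖1 + β * z‖ ^ (1 - x) * ‖-1 + 1 * z‖ ^ x * ‖-α + 1 * z‖ ^ x * ‖0 + 1 * z‖ ^ (-(u + 2 * x))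

/-- Conditions for a point not to be one of the singularities of the action. -/
def Regular (α β : ℝ) (z : ℂ) : Prop := z ≠ 0 ∧ z ≠ 1 ∧ z ≠ α ∧ 1 + β * z ≠ 0

theorem isCriticalPoint_iff {α β x u : ℝ} {z : ℂ} :
    IsCriticalPoint α β x u z ↔ Regular α β z ∧ actionDeriv α β x u z = 0 := by
  unfold IsCriticalPoint Regular
  tauto

/-- The logarithm is taken of the quotient by the value at `z₀`, which is close to `1`, so that no
branch cut interferes. -/
theorem exists_log_factor (p q : ℂ) {z₀ : ℂ} (h : p + q * z₀ ≠ 0) :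
    ∃ L : ℂ → ℂ, L z₀ = 0 ∧ (∀ᶠ z in 𝓝 z₀, HasDerivAt L (q / (p + q * z)) z) ∧
      ∀ᶠ z in 𝓝 z₀, ∀ w : ℝ, ‖p + q * z‖ ^ w = ‖p + q * z₀‖ ^ w * Real.exp (w * (L z).re) := by
  have hc : Continuous fun z => (p + q * z) / (p + q * z₀) := by fun_prop
  have hs : ∀ᶠ z in 𝓝 z₀, (p + q * z) / (p + q * z₀) ∈ slitPlane :=
    hc.continuousAt.eventually (isOpen_slitPlane.mem_nhds (by
      simp only [div_self h]; exact one_mem_slitPlane))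
  refine ⟨fun z => Complex.log ((p + q * z) / (p + q * z₀)), by simp [div_self h], ?_, ?_⟩
  · filter_upwards [hs] with z hz
    have hz0 : p + q * z ≠ 0 := by
      intro h0
      rw [h0, zero_div] at hz
      exact zero_notMem_slitPlane hz
    have h1 : HasDerivAt (fun z => (p + q * z) / (p + q * z₀)) (q / (p + q * z₀)) z := by
      simpa using (((hasDerivAt_id z).const_mul q).const_add p).div_const (p + q * z₀)
    exact (h1.clog hz).congr_deriv (by field_simp)
  · filter_upwards [hs] with z hz w
    have hz0 : p + q * z ≠ 0 := by
      intro h0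
      rw [h0, zero_div] at hz
      exact zero_notMem_slitPlane hz
    have h1 : 0 < ‖p + q * z‖ := norm_pos_iff.2 hz0
    have h2 : 0 < ‖p + q * z₀‖ := norm_pos_iff.2 h
    rw [Complex.log_re, norm_div, Real.rpow_def_of_pos h1, Real.rpow_def_of_pos h2, ← Real.exp_add,
      Real.log_div h1.ne' h2.ne']
    congr 1
    ring

section energy

variable {α β x u : ℝ}

theorem energy_nonneg (z : ℂ) : 0 ≤ energy α β x u z := by unfold energy; positivity

theorem Regular.factors {z : ℂ} (h : Regular α β z) :
    1 + β * z ≠ 0 ∧ -1 + 1 * z ≠ 0 ∧ -(α : ℂ) + 1 * z ≠ 0 ∧ 0 + 1 * z ≠ 0 := by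
  obtain ⟨h0, h1, h2, h3⟩ := h
  refine ⟨h3, ?_, ?_, by simpa using h0⟩
  · rw [one_mul, neg_add_eq_sub]; exact sub_ne_zero.2 h1
  · rw [one_mul, neg_add_eq_sub]; exact sub_ne_zero.2 h2

theorem Regular.energy_pos {z : ℂ} (h : Regular α β z) : 0 < energy α β x u z := by
  obtain ⟨h1, h2, h3, h4⟩ := h.factors
  have := norm_pos_iff.2 h1
  have := norm_pos_iff.2 h2
  have := norm_pos_iff.2 h3
  have := norm_pos_iff.2 h4
  unfold energy
  positivity

theorem regular_of_energy_ne (hx0 : 0 < x) (hx1 : x < 1) {z : ℂ} (hz : z ≠ 0)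
    (h : energy α β x u z ≠ 0) : Regular α β z := by
  refine ⟨hz, ?_, ?_, ?_⟩
  · rintro rfl
    apply h
    simp [energy, Real.zero_rpow hx0.ne']
  · rintro rfl
    apply h
    simp [energy, Real.zero_rpow hx0.ne']
  · intro h0
    apply h
    unfold energy
    rw [h0, norm_zero, Real.zero_rpow (by linarith)]
    ring

theorem continuousAt_energy (hx0 : 0 < x) (hx1 : x < 1) {z : ℂ} (hz : z ≠ 0) :
    ContinuousAt (energy α β x u) z := by
  have h1 : ContinuousAt (fun z : ℂ => ‖1 + β * z‖) z := by fun_prop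
  have h2 : ContinuousAt (fun z : ℂ => ‖-1 + 1 * z‖) z := by fun_prop
  have h3 : ContinuousAt (fun z : ℂ => ‖-α + 1 * z‖) z := by fun_prop
  have h4 : ContinuousAt (fun z : ℂ => ‖0 + 1 * z‖) z := by fun_prop
  exact (((h1.rpow_const (Or.inr (by linarith))).mul (h2.rpow_const (Or.inr hx0.le))).mul
    (h3.rpow_const (Or.inr hx0.le))).mul (h4.rpow_const (Or.inl (by simpa using hz)))

/-- A local branch of the action. -/
theorem exists_branch (x u : ℝ) {z₀ : ℂ} (h : Regular α β z₀) :
    ∃ g : ℂ → ℂ, g z₀ = 0 ∧ (∀ᶠ z in 𝓝 z₀, HasDerivAt g (actionDeriv α β x u z) z) ∧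
      ∀ᶠ z in 𝓝 z₀, energy α β x u z = energy α β x u z₀ * Real.exp (g z).re := by
  obtain ⟨h1, h2, h3, h4⟩ := h.factors
  obtain ⟨L1, e1, d1, n1⟩ := exists_log_factor _ _ h1
  obtain ⟨L2, e2, d2, n2⟩ := exists_log_factor _ _ h2
  obtain ⟨L3, e3, d3, n3⟩ := exists_log_factor _ _ h3
  obtain ⟨L4, e4, d4, n4⟩ := exists_log_factor _ _ h4
  have hne : ∀ p q : ℂ, p + q * z₀ ≠ 0 → ∀ᶠ z in 𝓝 z₀, p + q * z ≠ 0 := fun p q h =>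
    (show ContinuousAt (fun z => p + q * z) z₀ by fun_prop).eventually_ne h
  refine ⟨fun z => ((1 - x : ℝ) : ℂ) * L1 z + (x : ℂ) * L2 z + (x : ℂ) * L3 z +
    ((-(u + 2 * x) : ℝ) : ℂ) * L4 z, by simp [e1, e2, e3, e4], ?_, ?_⟩
  · filter_upwards [d1, d2, d3, d4, hne _ _ h2, hne _ _ h3, hne _ _ h4] with z d1 d2 d3 d4 k2 k3 k4
    refine ((((d1.const_mul _).add (d2.const_mul _)).add (d3.const_mul _)).add
      (d4.const_mul _)).congr_deriv ?_
    rw [one_mul, neg_add_eq_sub] at k2 k3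
    rw [one_mul, zero_add] at k4
    unfold actionDeriv
    push_cast
    rw [one_mul, neg_add_eq_sub, neg_add_eq_sub, zero_add]
    have e1 : 1 / (z * (z - 1)) = 1 / (z - 1) - 1 / z := by field_simp; ring
    have e2 : (α : ℂ) / (z * (z - α)) = 1 / (z - α) - 1 / z := by field_simp; ring
    rw [e1, e2]
    ring
  · filter_upwards [n1, n2, n3, n4] with z n1 n2 n3 n4
    unfold energy
    rw [n1, n2, n3, n4]
    simp only [Complex.add_re, Complex.re_ofReal_mul, Real.exp_add]
    ring

/-- The numerator of the derivative of the action, as a polynomial. -/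
def critPoly (α β x u : ℝ) : Polynomial ℂ :=
  Polynomial.C (x : ℂ) * Polynomial.X * (Polynomial.X - Polynomial.C (α : ℂ)) *
      (1 + Polynomial.C (β : ℂ) * Polynomial.X) +
    Polynomial.C (x : ℂ) * Polynomial.X * (Polynomial.X - 1) *
      (1 + Polynomial.C (β : ℂ) * Polynomial.X) +
    Polynomial.C ((1 - x) * β : ℂ) * Polynomial.X * (Polynomial.X - 1) *
      (Polynomial.X - Polynomial.C (α : ℂ)) -
    Polynomial.C (u + 2 * x : ℂ) * (Polynomial.X - 1) * (Polynomial.X - Polynomial.C (α : ℂ)) *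
      (1 + Polynomial.C (β : ℂ) * Polynomial.X)

theorem natDegree_critPoly : (critPoly α β x u).natDegree ≤ 3 := by
  unfold critPoly
  compute_degree

/-- The constant coefficient is `-(u + 2 x) α`. -/
theorem critPoly_ne_zero (hα : 0 < α) (hu : 0 < u + 2 * x) : critPoly α β x u ≠ 0 := by
  intro h
  have h1 := congrArg (Polynomial.eval 0) h
  simp [critPoly] at h1
  rcases h1 with h1 | h1
  · have : ((u + 2 * x : ℝ) : ℂ) = 0 := by push_cast; linear_combination -h1
    rw [Complex.ofReal_eq_zero] at this
    linarith
  · linarith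

theorem isRoot_critPoly {z : ℂ} (h : IsCriticalPoint α β x u z) : (critPoly α β x u).IsRoot z := by
  obtain ⟨h0, h1, h2, h3, h4⟩ := h
  have h1' := sub_ne_zero.2 h1
  have h2' := sub_ne_zero.2 h2
  have e : (critPoly α β x u).eval z =
      actionDeriv α β x u z * (z * (z - 1) * (z - α) * (1 + β * z)) := by
    simp only [critPoly, actionDeriv, Polynomial.eval_sub, Polynomial.eval_add, Polynomial.eval_mul,
      Polynomial.eval_C, Polynomial.eval_X, Polynomial.eval_one]
    have hD : (1 + β * z) * (1 + β * z)⁻¹ = 1 := mul_inv_cancel₀ h3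
    rw [div_eq_mul_inv _ (1 + β * z)]
    generalize (1 + β * z)⁻¹ = D at hD
    field_simp
    linear_combination -((1 - x) * β * z * (z - 1) * (z - α)) * hD
  rw [Polynomial.IsRoot.def, e, h4, zero_mul]

/-- The energy is not locally constant. -/
theorem not_isLocalMax_energy (hα : 0 < α) (hx0 : 0 < x) (hx1 : x < 1) (hu : 0 < u + 2 * x) {z₀ : ℂ}
    (hz : z₀ ≠ 0) (hE : energy α β x u z₀ ≠ 0) : ¬IsLocalMax (energy α β x u) z₀ := by
  intro hmax
  have hreg := regular_of_energy_ne hx0 hx1 hz hE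
  obtain ⟨g, hg0, hgd, hge⟩ := exists_branch x u hreg
  have hd : ∀ᶠ z in 𝓝 z₀, DifferentiableAt ℂ (fun z => Complex.exp (g z)) z := by
    filter_upwards [hgd] with z hz
    exact hz.differentiableAt.cexp
  have hmax' : IsLocalMax (norm ∘ fun z => Complex.exp (g z)) z₀ := by
    filter_upwards [hmax, hge] with z h1 h2
    rw [h2] at h1
    simp only [Function.comp, Complex.norm_exp, hg0, Complex.zero_re, Real.exp_zero]
    have h3 : 0 < energy α β x u z₀ := hreg.energy_pos
    exact le_of_mul_le_mul_left (by linarith) h3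
  -- At a local maximum the holomorphic branch `exp g` is locally constant; then every nearby point
  -- is critical and `critPoly` has infinitely many roots.
  have hconst := Complex.eventually_eq_of_isLocalMax_norm hd hmax'
  have hreg' : ∀ᶠ z in 𝓝 z₀, Regular α β z := by
    filter_upwards [(continuousAt_energy (α := α) (β := β) (u := u) hx0 hx1 hz).eventually_ne hE,
      isOpen_ne.mem_nhds hz] with z h1 h2 using regular_of_energy_ne hx0 hx1 h2 h1
  have hcrit : ∀ᶠ z in 𝓝 z₀, (critPoly α β x u).IsRoot z := by
    filter_upwards [hconst.eventually_nhds, hgd, hreg'] with z h1 h2 h3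
    refine isRoot_critPoly (isCriticalPoint_iff.2 ⟨h3, ?_⟩)
    have h4 := h2.cexp
    have h5 : HasDerivAt (fun z => Complex.exp (g z)) 0 z :=
      (hasDerivAt_const z (Complex.exp (g z₀))).congr_of_eventuallyEq h1
    exact (mul_eq_zero.1 (h4.unique h5)).resolve_left (Complex.exp_ne_zero _)
  refine critPoly_ne_zero (β := β) hα hu (Polynomial.eq_zero_of_infinite_isRoot _ ?_)
  exact infinite_of_mem_nhds z₀ hcrit

/-- The maximum principle for the energy on an annulus. -/
theorem energy_lt_of_annulus (hα : 0 < α) (hx0 : 0 < x) (hx1 : x < 1) (hu : 0 < u + 2 * x)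
    {r R M : ℝ} (hr : 0 < r) (h1 : ∀ z : ℂ, ‖z‖ = r → energy α β x u z ≤ M)
    (h2 : ∀ z : ℂ, ‖z‖ = R → energy α β x u z ≤ M) {z : ℂ} (hz1 : r < ‖z‖) (hz2 : ‖z‖ < R) :
    energy α β x u z < M := by
  set A : Set ℂ := {z | r ≤ ‖z‖ ∧ ‖z‖ ≤ R} with hA
  have hA0 : ∀ z ∈ A, z ≠ 0 := by
    rintro z hz rfl
    have := hz.1
    rw [norm_zero] at this
    linarith
  have hcpt : IsCompact A := by
    refine (isCompact_closedBall (0 : ℂ) R).of_isClosed_subset ?_ fun z hz => by simpa using hz.2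
    exact (isClosed_le continuous_const continuous_norm).inter
      (isClosed_le continuous_norm continuous_const)
  have hzA : z ∈ A := ⟨hz1.le, hz2.le⟩
  obtain ⟨z₁, hz₁, hmax⟩ := hcpt.exists_isMaxOn ⟨z, hzA⟩ fun z hz =>
    (continuousAt_energy (α := α) (β := β) (u := u) hx0 hx1 (hA0 z hz)).continuousWithinAt
  -- No interior point of the annulus attains the maximum, so the maximum is attained on the
  -- boundary and exceeds all interior values strictly.
  have hint : ∀ z : ℂ, r < ‖z‖ → ‖z‖ < R → energy α β x u z ≠ energy α β x u z₁ := by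
    intro y hy1 hy2 hy
    have hyA : y ∈ A := ⟨hy1.le, hy2.le⟩
    have hnhds : ∀ᶠ v in 𝓝 y, v ∈ A := by
      filter_upwards [(isOpen_lt continuous_const continuous_norm).mem_nhds hy1,
        (isOpen_lt continuous_norm continuous_const).mem_nhds hy2] with v hv1 hv2
      exact ⟨le_of_lt hv1, le_of_lt hv2⟩
    have hloc : IsLocalMax (energy α β x u) y := by
      filter_upwards [hnhds] with v hv
      rw [hy]
      exact hmax hv
    by_cases h0 : energy α β x u y = 0
    · -- the energy would vanish near `y`
      have hvan : ∀ᶠ v in 𝓝 y, ¬Regular α β v := by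
        filter_upwards [hloc] with v hv hreg
        have := hreg.energy_pos (x := x) (u := u)
        linarith
      have hfin : {v : ℂ | ¬Regular α β v} ⊆ {0, 1, (α : ℂ), -(β : ℂ)⁻¹} := by
        intro v hv
        by_contra hc
        simp only [Set.mem_insert_iff, Set.mem_singleton_iff, not_or] at hc
        refine hv ⟨hc.1, hc.2.1, hc.2.2.1, fun h => hc.2.2.2 ?_⟩
        have hβ : (β : ℂ) ≠ 0 := by
          rintro hβ
          rw [hβ] at h
          simp at h
        field_simp
        linear_combination h
      exact (infinite_of_mem_nhds y hvan) (Set.Finite.subset (by simp) hfin)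
    · exact not_isLocalMax_energy hα hx0 hx1 hu (hA0 y hyA) h0 hloc
  have hb : energy α β x u z₁ ≤ M := by
    rcases hz₁.1.eq_or_lt with h | h
    · exact h1 z₁ h.symm
    · rcases hz₁.2.eq_or_lt with h' | h'
      · exact h2 z₁ h'
      · exact absurd rfl (hint z₁ h h')
  exact lt_of_lt_of_le (lt_of_le_of_ne (hmax hzA) (hint z hz1 hz2)) hb

end energy

/-- A strict form of the second derivative test. -/
theorem eventually_lt_of_second_deriv_pos {h h' : ℝ → ℝ} {s₀ A : ℝ}
    (hd : ∀ᶠ s in 𝓝 s₀, HasDerivAt h (h' s) s) (h0 : h' s₀ = 0) (hA : HasDerivAt h' A s₀)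
    (hpos : 0 < A) : ∀ᶠ s in 𝓝[≠] s₀, h s₀ < h s := by
  -- After subtraction of `A / 4 * (s - s₀) ^ 2` the second derivative is still `A / 2 > 0`, so
  -- there is still a local minimum; the subtracted square makes the inequality for `h` strict.
  have hk : ∀ᶠ s in 𝓝 s₀, HasDerivAt (fun s => h s - A / 4 * (s - s₀) ^ 2)
      (h' s - A / 2 * (s - s₀)) s := by
    filter_upwards [hd] with s hs
    refine (hs.sub ((((hasDerivAt_id s).sub_const s₀).pow 2).const_mul (A / 4))).congr_deriv ?_
    simp
    ring
  have hk' : HasDerivAt (deriv fun s => h s - A / 4 * (s - s₀) ^ 2) (A / 2) s₀ := by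
    have h1 : HasDerivAt (fun s => h' s - A / 2 * (s - s₀)) (A / 2) s₀ := by
      refine (hA.sub (((hasDerivAt_id s₀).sub_const s₀).const_mul (A / 2))).congr_deriv ?_
      ring
    exact h1.congr_of_eventuallyEq (hk.mono fun s hs => hs.deriv)
  have hmin := isLocalMin_of_deriv_deriv_pos (by rw [hk'.deriv]; linarith)
    (by rw [hk.self_of_nhds.deriv, h0]; ring) hk.self_of_nhds.continuousAt
  filter_upwards [nhdsWithin_le_nhds hmin, self_mem_nhdsWithin] with s hs hne
  have h2 : 0 < (s - s₀) ^ 2 := by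
    have := sub_ne_zero.2 (show s ≠ s₀ from hne)
    positivity
  simp only [sub_self] at hs
  nlinarith

end TowerDimer

end

/-! ### Second order behaviour at critical points; saddles in the liquid region. -/

noncomputable section

namespace TowerDimer

open MeasureTheory Filter Topology Metric Complex Bornology

/-- The derivative of `z * S' z`. -/
def actionSecond (α β x : ℝ) (z : ℂ) : ℂ :=
  (1 - x) * (β / (1 + β * z) ^ 2) + x * (-1 / (-1 + 1 * z) ^ 2) + x * (-α / (-α + 1 * z) ^ 2)

section

variable {α β x u : ℝ}

/-- `z S' z` is the derivative of the action with respect to `log z`, the natural variable for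
circles and rays. Its partial fractions can be differentiated, and their imaginary parts taken, term
by term. -/
theorem mul_actionDeriv_eq {z : ℂ} (h : Regular α β z) : z * actionDeriv α β x u z =
    (1 - x) * (1 - (1 + β * z)⁻¹) + x * (1 - -(-1 + 1 * z)⁻¹) +
      x * (1 - -α * (-α + 1 * z)⁻¹) - (u + 2 * x) := by
  obtain ⟨k1, k2, k3, k4⟩ := h.factors
  rw [one_mul, neg_add_eq_sub] at k2 k3
  rw [one_mul, zero_add] at k4
  unfold actionDeriv
  rw [one_mul, neg_add_eq_sub, neg_add_eq_sub, div_eq_mul_inv _ (1 + β * z)]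
  have hD : (1 + β * z) * (1 + β * z)⁻¹ = 1 := mul_inv_cancel₀ k1
  generalize (1 + β * z)⁻¹ = D at hD
  field_simp
  linear_combination (1 - x) * (z - 1) * (z - α) * hD

theorem isOpen_regular : IsOpen {z | Regular α β z} := by
  have h : {z | Regular α β z} =
      (({z | z ≠ 0} ∩ {z | z ≠ 1}) ∩ {z | z ≠ (α : ℂ)}) ∩ {z | 1 + β * z ≠ 0} := by
    ext z
    unfold Regular
    simp only [Set.mem_inter_iff, Set.mem_ofPred_eq]
    tauto
  rw [h]
  exact ((isOpen_ne.inter isOpen_ne).inter isOpen_ne).inter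
    (isOpen_ne_fun (by fun_prop) continuous_const)

theorem Regular.eventually {z : ℂ} (h : Regular α β z) : ∀ᶠ z in 𝓝 z, Regular α β z :=
  isOpen_regular.mem_nhds h

theorem hasDerivAt_mul_actionDeriv {z : ℂ} (h : Regular α β z) :
    HasDerivAt (fun z => z * actionDeriv α β x u z) (actionSecond α β x z) z := by
  obtain ⟨k1, k2, k3, k4⟩ := h.factors
  have hl : ∀ p q : ℂ, p + q * z ≠ 0 →
      HasDerivAt (fun z => (p + q * z)⁻¹) (-q / (p + q * z) ^ 2) z := by
    intro p q hpq
    have h1 : HasDerivAt (fun z => p + q * z) q z := by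
      simpa using ((hasDerivAt_id z).const_mul q).const_add p
    exact h1.inv hpq
  have h1 := (((((hl _ _ k1).const_sub 1).const_mul (1 - x : ℂ)).add
    (((hl _ _ k2).neg.const_sub 1).const_mul (x : ℂ))).add
    ((((hl _ _ k3).const_mul (-α : ℂ)).const_sub 1).const_mul (x : ℂ))).sub_const (u + 2 * x : ℂ)
  refine (h1.congr_deriv ?_).congr_of_eventuallyEq ?_
  · unfold actionSecond
    ring
  · filter_upwards [h.eventually] with z hz
    exact mul_actionDeriv_eq hz

/-- The energy along the curve `exp (t d) z₀`. -/
theorem energy_lt_of_second (x u : ℝ) {z₀ d : ℂ} (h : Regular α β z₀)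
    (h1 : (d * (z₀ * actionDeriv α β x u z₀)).re = 0)
    (h2 : 0 < (d ^ 2 * (z₀ * actionSecond α β x z₀)).re) :
    ∀ᶠ t : ℝ in 𝓝[≠] 0, energy α β x u z₀ < energy α β x u (Complex.exp (t * d) * z₀) := by
  obtain ⟨g, hg0, hgd, hge⟩ := exists_branch x u h
  set γ : ℝ → ℂ := fun t => Complex.exp (t * d) * z₀ with hγ
  have hγ0 : γ 0 = z₀ := by simp [hγ]
  have hγd : ∀ t, HasDerivAt γ (d * γ t) t := by
    intro t
    have h3 : HasDerivAt (fun t : ℂ => Complex.exp (t * d) * z₀)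
        (Complex.exp (t * d) * (1 * d) * z₀) t :=
      (((hasDerivAt_id (t : ℂ)).mul_const d).cexp).mul_const z₀
    refine (h3.comp_ofReal).congr_deriv ?_
    simp only [hγ]
    ring
  have hγt : Tendsto γ (𝓝 0) (𝓝 z₀) := by
    have := (hγd 0).continuousAt.tendsto
    rwa [hγ0] at this
  -- Along `exp (t d) z₀` the first two derivatives of the logarithm of the energy are the real
  -- parts of `d * z S'` and `d² * z (z S')'`. The direction `d = 1` is radial and `d = I` follows
  -- the circle.
  have key := eventually_lt_of_second_deriv_pos (s₀ := 0) (A := (d ^ 2 * (z₀ * actionSecond α β x z₀)).re)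
    (h := fun t => (g (γ t)).re) (h' := fun t => (d * (γ t * actionDeriv α β x u (γ t))).re)
    ?_ ?_ ?_ h2
  · filter_upwards [key, nhdsWithin_le_nhds (hγt.eventually hge)] with t h3 h4
    rw [h4]
    have h5 : 0 < energy α β x u z₀ := h.energy_pos
    simp only [hγ0, hg0, Complex.zero_re] at h3
    have h6 := Real.one_lt_exp_iff.2 h3
    nlinarith
  · filter_upwards [hγt.eventually hgd] with t ht
    have h3 := (ht.comp t (hγd t))
    have h4 := (Complex.reCLM.hasFDerivAt.comp_hasDerivAt t h3)
    refine h4.congr_deriv ?_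
    simp only [Complex.reCLM_apply]
    congr 1
    ring
  · simp only [hγ0]
    exact h1
  · have h3 : HasDerivAt (fun z => z * actionDeriv α β x u z) (actionSecond α β x z₀) (γ 0) := by
      rw [hγ0]
      exact hasDerivAt_mul_actionDeriv h
    have h4 := (h3.comp (0 : ℝ) (hγd 0)).const_mul d
    have h5 := (Complex.reCLM.hasFDerivAt.comp_hasDerivAt (0 : ℝ) h4)
    refine h5.congr_deriv ?_
    rw [hγ0]
    simp only [Complex.reCLM_apply]
    congr 1
    ring

/-- The saddle point condition used in the asymptotic analysis. -/
structure IsSaddle (α β x u : ℝ) (z₀ : ℂ) : Prop where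
  im_nonneg : 0 ≤ z₀.im
  crit : IsCriticalPoint α β x u z₀
  le : ∀ z : ℂ, ‖z‖ = ‖z₀‖ → energy α β x u z ≤ energy α β x u z₀
  lt_radial : ∃ δ > 0, ∀ t : ℝ, t ≠ 0 → |t| ≤ δ →
    energy α β x u z₀ < energy α β x u (Real.exp t * z₀)

theorem isSaddle_of (hx : 0 ≤ z₀.im) (hc : IsCriticalPoint α β x u z₀)
    (hle : ∀ z : ℂ, ‖z‖ = ‖z₀‖ → energy α β x u z ≤ energy α β x u z₀)
    (hA : 0 < (z₀ * actionSecond α β x z₀).re) : IsSaddle α β x u z₀ := by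
  refine ⟨hx, hc, hle, ?_⟩
  obtain ⟨hreg, h0⟩ := isCriticalPoint_iff.1 hc
  have h1 := energy_lt_of_second x u (d := 1) hreg (by rw [h0]; simp) (by simpa using hA)
  rw [eventually_nhdsWithin_iff, Metric.eventually_nhds_iff] at h1
  obtain ⟨ε, hε, h2⟩ := h1
  refine ⟨ε / 2, by positivity, fun t ht0 ht => ?_⟩
  have h3 := @h2 t (by rw [Real.dist_eq, sub_zero]; linarith) ht0
  rw [mul_one, ← Complex.ofReal_exp] at h3
  exact h3

/-- On any other circle the energy exceeds its value at the saddle point. -/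
theorem IsSaddle.exists_lt {z₀ : ℂ} (h : IsSaddle α β x u z₀) (hα : 0 < α) (hx0 : 0 < x)
    (hx1 : x < 1) (hu : 0 < u + 2 * x) {r : ℝ} (hr : 0 < r) (hne : r ≠ ‖z₀‖) :
    ∃ z : ℂ, ‖z‖ = r ∧ energy α β x u z₀ < energy α β x u z := by
  by_contra hc
  push Not at hc
  obtain ⟨δ, hδ, hrad⟩ := h.lt_radial
  have hz0 : 0 < ‖z₀‖ := norm_pos_iff.2 h.crit.1
  have hnorm : ∀ t : ℝ, ‖(Real.exp t : ℂ) * z₀‖ = Real.exp t * ‖z₀‖ := by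
    intro t
    rw [norm_mul, Complex.norm_real, Real.norm_eq_abs, abs_of_pos (Real.exp_pos t)]
  set L := Real.log (r / ‖z₀‖) with hL
  have hLr : Real.exp L * ‖z₀‖ = r := by
    rw [hL, Real.exp_log (by positivity)]
    field_simp
  have hL0 : L ≠ 0 := by
    intro h0
    rw [h0, Real.exp_zero, one_mul] at hLr
    exact hne hLr.symm
  -- If the other circle stayed below the saddle value, the annulus between the circles would be
  -- strictly below it. The radial point at parameter `t`, chosen strictly between the circles and
  -- within `δ` of the saddle, contradicts this.
  rcases lt_or_gt_of_ne hL0 with h1 | h1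
  · set t := max (L / 2) (-δ) with ht
    have ht1 : t < 0 := max_lt (by linarith) (by linarith)
    have ht2 : L < t := lt_max_of_lt_left (by linarith)
    have ht3 := hrad t ht1.ne (by rw [abs_of_neg ht1]; linarith [le_max_right (L / 2) (-δ)])
    have h2 := energy_lt_of_annulus hα hx0 hx1 hu hr hc h.le (z := Real.exp t * z₀)
      (by rw [hnorm, ← hLr]; exact mul_lt_mul_of_pos_right (Real.exp_lt_exp.2 ht2) hz0)
      (by rw [hnorm]; exact mul_lt_of_lt_one_left hz0 (Real.exp_lt_one_iff.2 ht1))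
    linarith
  · set t := min (L / 2) δ with ht
    have ht1 : 0 < t := lt_min (by linarith) (by linarith)
    have ht2 : t < L := min_lt_of_left_lt (by linarith)
    have ht3 := hrad t ht1.ne' (by rw [abs_of_pos ht1]; exact min_le_right _ _)
    have h2 := energy_lt_of_annulus hα hx0 hx1 hu hz0 h.le hc (z := Real.exp t * z₀)
      (by rw [hnorm]; exact lt_mul_of_one_lt_left hz0 (Real.one_lt_exp_iff.2 ht1))
      (by rw [hnorm, ← hLr]; exact mul_lt_mul_of_pos_right (Real.exp_lt_exp.2 ht2) hz0)
    linarith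

/-! ### The liquid region -/

/-- The tangent inequality for the logarithm at `t₀ ^ 2`, applied to `t ^ 2`. -/
theorem rpow_le_mul_exp {t t₀ w : ℝ} (ht : 0 ≤ t) (ht₀ : 0 < t₀) (hw : 0 ≤ w) :
    t ^ w ≤ t₀ ^ w * Real.exp (w * ((t ^ 2 / t₀ ^ 2 - 1) / 2)) := by
  set v := (t ^ 2 / t₀ ^ 2 - 1) / 2 with hv
  have h1 : t ≤ t₀ * Real.exp v := by
    refine le_of_sq_le_sq ?_ (by positivity)
    rw [mul_pow, ← Real.exp_nat_mul]
    have h2 := Real.add_one_le_exp ((2 : ℕ) * v)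
    have h3 : ((2 : ℕ) : ℝ) * v + 1 = t ^ 2 / t₀ ^ 2 := by
      rw [hv]; push_cast; ring
    rw [h3, div_le_iff₀ (by positivity)] at h2
    linarith
  calc t ^ w ≤ (t₀ * Real.exp v) ^ w := Real.rpow_le_rpow ht h1 hw
    _ = _ := by
      rw [Real.mul_rpow ht₀.le (Real.exp_pos v).le, ← Real.exp_mul, mul_comm v w]

/-- On a circle around `0` this is affine in `z.re`; all comparisons of the energy along a circle
rest on it. -/
theorem norm_sq_factor (p q : ℝ) (z : ℂ) :
    ‖(p : ℂ) + q * z‖ ^ 2 = p ^ 2 + q ^ 2 * ‖z‖ ^ 2 + 2 * p * q * z.re := by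
  rw [Complex.sq_norm, Complex.sq_norm, Complex.normSq_apply, Complex.normSq_apply]
  simp
  ring

theorem im_inv_factor (p q : ℝ) (z : ℂ) :
    ((p : ℂ) + q * z)⁻¹.im = -(q * z.im / ‖(p : ℂ) + q * z‖ ^ 2) := by
  rw [Complex.inv_im, Complex.sq_norm]
  simp
  ring

/-- The first term is `z.re` times a term of the kind occurring in `im_critical`, and will cancel in
the sum over the factors; the second has a square, which gives positivity. -/
theorem re_second_factor (p q : ℝ) {z : ℂ} (h : (p : ℂ) + q * z ≠ 0) :
    (z * ((p * q : ℝ) / ((p : ℂ) + q * z) ^ 2)).re =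
      p * q * z.re / ‖(p : ℂ) + q * z‖ ^ 2 +
        2 * (p * q * z.im / ‖(p : ℂ) + q * z‖ ^ 2) ^ 2 := by
  set ζ := (p : ℂ) + q * z with hζ
  have hn : Complex.normSq ζ ≠ 0 := by simpa using h
  have h1 : z * ((p * q : ℝ) / ζ ^ 2) =
      ((p * q / Complex.normSq ζ ^ 2 : ℝ) : ℂ) * (z * (starRingEnd ℂ) ζ ^ 2) := by
    have h2 : ((Complex.normSq ζ : ℝ) : ℂ) = ζ * (starRingEnd ℂ) ζ := (Complex.mul_conj ζ).symm
    have h3 : (starRingEnd ℂ) ζ ≠ 0 := by simpa using h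
    push_cast
    rw [h2]
    field_simp
  rw [h1, Complex.re_ofReal_mul, Complex.sq_norm]
  have hre : ζ.re = p + q * z.re := by simp [hζ]
  have him : ζ.im = q * z.im := by simp [hζ]
  have hN : Complex.normSq ζ = (p + q * z.re) ^ 2 + (q * z.im) ^ 2 := by
    rw [Complex.normSq_apply, hre, him]; ring
  have h4 : (z * (starRingEnd ℂ) ζ ^ 2).re =
      z.re * Complex.normSq ζ + 2 * (p * q) * z.im ^ 2 := by
    rw [hN]
    simp [pow_two, hre, him]
    ring
  rw [h4]
  field_simp

/-- The vanishing of the imaginary part of `z * S' z` at a non-real critical point. -/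
theorem im_critical {z : ℂ} (hc : IsCriticalPoint α β x u z) (hz : 0 < z.im) :
    (1 - x) * (β / ‖1 + β * z‖ ^ 2) + x * (-1 / ‖-1 + 1 * z‖ ^ 2) +
      x * (-α / ‖-α + 1 * z‖ ^ 2) = 0 := by
  obtain ⟨hreg, h0⟩ := isCriticalPoint_iff.1 hc
  have h1 := mul_actionDeriv_eq (x := x) (u := u) hreg
  rw [h0, mul_zero] at h1
  have h2 := congrArg Complex.im h1
  have e1 := im_inv_factor 1 β z
  have e2 := im_inv_factor (-1) 1 z
  have e3 := im_inv_factor (-α) 1 z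
  have k1 : ((1 - x : ℂ)) = ((1 - x : ℝ) : ℂ) := by push_cast; rfl
  have k2 : (u + 2 * x : ℂ) = ((u + 2 * x : ℝ) : ℂ) := by push_cast; rfl
  have k3 : (-α : ℂ) = ((-α : ℝ) : ℂ) := by push_cast; rfl
  push_cast at e1 e2 e3
  rw [k1, k2] at h2
  simp only [Complex.zero_im, Complex.sub_im, Complex.add_im, Complex.im_ofReal_mul,
    Complex.ofReal_im, Complex.one_im, Complex.neg_im] at h2
  rw [k3, Complex.im_ofReal_mul, ← k3, e1, e2, e3] at h2
  have h3 : z.im * ((1 - x) * (β / ‖1 + β * z‖ ^ 2) + x * (-1 / ‖-1 + 1 * z‖ ^ 2) +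
      x * (-α / ‖-α + 1 * z‖ ^ 2)) = 0 := by
    linear_combination -h2
  exact (mul_eq_zero.1 h3).resolve_left hz.ne'

/-- The tangent inequality for the three logarithms bounds the energy on the circle by its value at
`z₀` times the exponential of an affine function of `z.re - z₀.re`, whose slope is zero by
`im_critical`. The same identity removes the indefinite part of the second radial derivative and
leaves a sum of squares. -/
theorem isSaddle_of_im_pos (hβ : 0 < β) (hx0 : 0 < x) (hx1 : x < 1) {z₀ : ℂ}
    (hc : IsCriticalPoint α β x u z₀) (hz : 0 < z₀.im) : IsSaddle α β x u z₀ := by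
  have hstar := im_critical hc hz
  obtain ⟨hreg, h0⟩ := isCriticalPoint_iff.1 hc
  obtain ⟨k1, k2, k3, k4⟩ := hreg.factors
  have n1 := norm_pos_iff.2 k1
  have n2 := norm_pos_iff.2 k2
  have n3 := norm_pos_iff.2 k3
  refine isSaddle_of hz.le hc (fun z hzz => ?_) ?_
  · have f1 := norm_sq_factor 1 β z
    have f2 := norm_sq_factor (-1) 1 z
    have f3 := norm_sq_factor (-α) 1 z
    have g1 := norm_sq_factor 1 β z₀
    have g2 := norm_sq_factor (-1) 1 z₀
    have g3 := norm_sq_factor (-α) 1 z₀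
    push_cast at f1 f2 f3 g1 g2 g3
    rw [hzz] at f1 f2 f3
    have r1 := rpow_le_mul_exp (norm_nonneg (1 + β * z)) n1 (show 0 ≤ 1 - x by linarith)
    have r2 := rpow_le_mul_exp (norm_nonneg (-1 + 1 * z)) n2 hx0.le
    have r3 := rpow_le_mul_exp (norm_nonneg (-α + 1 * z)) n3 hx0.le
    have hn : ‖(0 : ℂ) + 1 * z‖ = ‖(0 : ℂ) + 1 * z₀‖ := by simpa using hzz
    unfold energy
    rw [hn]
    refine mul_le_mul_of_nonneg_right ?_ (by positivity)
    refine (mul_le_mul (mul_le_mul r1 r2 (by positivity) (by positivity)) r3 (by positivity)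
      (by positivity)).trans (le_of_eq ?_)
    have d1 : ‖1 + β * z‖ ^ 2 / ‖1 + β * z₀‖ ^ 2 - 1 =
        2 * (z.re - z₀.re) * (β / ‖1 + β * z₀‖ ^ 2) := by
      field_simp
      linear_combination f1 - g1
    have d2 : ‖-1 + 1 * z‖ ^ 2 / ‖-1 + 1 * z₀‖ ^ 2 - 1 =
        2 * (z.re - z₀.re) * (-1 / ‖-1 + 1 * z₀‖ ^ 2) := by
      have : ‖-1 + 1 * z₀‖ ^ 2 ≠ 0 := by positivity
      rw [div_sub_one this, mul_div_assoc']
      congr 1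
      linear_combination f2 - g2
    have d3 : ‖-α + 1 * z‖ ^ 2 / ‖-α + 1 * z₀‖ ^ 2 - 1 =
        2 * (z.re - z₀.re) * (-α / ‖-α + 1 * z₀‖ ^ 2) := by
      have : ‖-α + 1 * z₀‖ ^ 2 ≠ 0 := by positivity
      rw [div_sub_one this, mul_div_assoc']
      congr 1
      linear_combination f3 - g3
    rw [d1, d2, d3]
    have e : ∀ a b c d e f : ℝ, a * Real.exp b * (c * Real.exp d) * (e * Real.exp f) =
        a * c * e * Real.exp (b + d + f) := by
      intro a b c d e f
      rw [Real.exp_add, Real.exp_add]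
      ring
    rw [e]
    have h5 : (1 - x) * (2 * (z.re - z₀.re) * (β / ‖1 + β * z₀‖ ^ 2) / 2) +
        x * (2 * (z.re - z₀.re) * (-1 / ‖-1 + 1 * z₀‖ ^ 2) / 2) +
        x * (2 * (z.re - z₀.re) * (-α / ‖-α + 1 * z₀‖ ^ 2) / 2) = 0 := by
      linear_combination (z.re - z₀.re) * hstar
    rw [h5, Real.exp_zero, mul_one]
  · have e1 := re_second_factor 1 β (z := z₀) (by push_cast; exact k1)
    have e2 := re_second_factor (-1) 1 (z := z₀) (by push_cast; exact k2)
    have e3 := re_second_factor (-α) 1 (z := z₀) (by push_cast; exact k3)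
    push_cast at e1 e2 e3
    simp only [one_mul, mul_one] at e1 e2 e3 hstar k1 k2 k3 n1 n2 n3
    have h1 : z₀ * actionSecond α β x z₀ =
        ((1 - x : ℝ) : ℂ) * (z₀ * (β / (1 + β * z₀) ^ 2)) + (x : ℂ) * (z₀ * (-1 / (-1 + z₀) ^ 2)) +
          (x : ℂ) * (z₀ * (-α / (-α + z₀) ^ 2)) := by
      unfold actionSecond
      push_cast
      ring
    rw [h1]
    simp only [Complex.add_re, Complex.re_ofReal_mul]
    rw [e1, e2, e3]
    have p1 : 0 < (1 - x) * (2 * (β * z₀.im / ‖1 + β * z₀‖ ^ 2) ^ 2) := by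
      have : 0 < 1 - x := by linarith
      positivity
    have p2 : 0 ≤ x * (2 * (-1 * z₀.im / ‖-1 + z₀‖ ^ 2) ^ 2) := by positivity
    have p3 : 0 ≤ x * (2 * (-α * z₀.im / ‖-α + z₀‖ ^ 2) ^ 2) := by positivity
    have h2 : (1 - x) * (β * z₀.re / ‖1 + β * z₀‖ ^ 2) + x * (-1 * z₀.re / ‖-1 + z₀‖ ^ 2) +
        x * (-α * z₀.re / ‖-α + z₀‖ ^ 2) = 0 := by
      linear_combination z₀.re * hstar
    linarith

theorem actionDeriv_conj (x u : ℝ) (z : ℂ) :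
    actionDeriv α β x u ((starRingEnd ℂ) z) = (starRingEnd ℂ) (actionDeriv α β x u z) := by
  simp [actionDeriv]

theorem isCriticalPoint_conj {z : ℂ} (h : IsCriticalPoint α β x u z) :
    IsCriticalPoint α β x u ((starRingEnd ℂ) z) := by
  obtain ⟨h0, h1, h2, h3, h4⟩ := h
  have hinj := (starRingEnd ℂ).injective
  refine ⟨by simpa using h0, fun h => h1 (hinj (by simpa using h)),
    fun h => h2 (hinj (by simpa using h)), fun h => h3 (hinj (by simpa using h)), ?_⟩
  rw [actionDeriv_conj, h4, map_zero]

/-- There is at most one critical point in the upper half plane. -/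
theorem critical_unique (hα : 0 < α) (hu : 0 < u + 2 * x) {z z' : ℂ}
    (hc : IsCriticalPoint α β x u z) (hz : 0 < z.im) (hc' : IsCriticalPoint α β x u z')
    (hz' : 0 < z'.im) : z = z' := by
  classical
  by_contra hne
  have hp := critPoly_ne_zero (β := β) hα hu
  have hroot : ∀ v, IsCriticalPoint α β x u v → v ∈ (critPoly α β x u).roots.toFinset := by
    intro v hv
    rw [Multiset.mem_toFinset, Polynomial.mem_roots hp]
    exact isRoot_critPoly hv
  -- Two critical points in the upper half plane and their conjugates would be four roots of a
  -- nonzero polynomial of degree at most three.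
  have hsub : ({z, z', (starRingEnd ℂ) z, (starRingEnd ℂ) z'} : Finset ℂ) ⊆
      (critPoly α β x u).roots.toFinset := by
    intro v hv
    simp only [Finset.mem_insert, Finset.mem_singleton] at hv
    rcases hv with rfl | rfl | rfl | rfl
    · exact hroot _ hc
    · exact hroot _ hc'
    · exact hroot _ (isCriticalPoint_conj hc)
    · exact hroot _ (isCriticalPoint_conj hc')
  have him : ∀ a b : ℂ, 0 < a.im → 0 < b.im → a ≠ (starRingEnd ℂ) b := by
    intro a b ha hb h
    rw [h, Complex.conj_im] at ha
    linarith
  have hcard : ({z, z', (starRingEnd ℂ) z, (starRingEnd ℂ) z'} : Finset ℂ).card = 4 := by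
    rw [Finset.card_insert_of_notMem, Finset.card_insert_of_notMem, Finset.card_insert_of_notMem,
      Finset.card_singleton]
    · simpa using fun h : (starRingEnd ℂ) z = (starRingEnd ℂ) z' => hne ((starRingEnd ℂ).injective h)
    · simp only [Finset.mem_insert, Finset.mem_singleton, not_or]
      exact ⟨him _ _ hz' hz, him _ _ hz' hz'⟩
    · simp only [Finset.mem_insert, Finset.mem_singleton, not_or]
      exact ⟨hne, him _ _ hz hz, him _ _ hz hz'⟩
  have h1 := Finset.card_le_card hsub
  have h2 := Multiset.toFinset_card_le (critPoly α β x u).roots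
  have h3 := Polynomial.card_roots' (critPoly α β x u)
  have h4 := natDegree_critPoly (α := α) (β := β) (x := x) (u := u)
  omega

end

end TowerDimer

end

/-! ### Strict concavity of the energy on circles, and its growth at `0` and infinity. -/

noncomputable section

namespace TowerDimer

open MeasureTheory Filter Topology Metric Complex Bornology

section

variable {α β x u : ℝ}

theorem strictConcaveOn_log_affine {w p q r : ℝ} (hw : 0 < w) (hp : p ≠ 0) (hq : q ≠ 0) :
    StrictConcaveOn ℝ {ξ : ℝ | 0 < p ^ 2 + q ^ 2 * r ^ 2 + 2 * p * q * ξ}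
      fun ξ => w * Real.log (p ^ 2 + q ^ 2 * r ^ 2 + 2 * p * q * ξ) := by
  have hcomb : ∀ ξ η a b : ℝ, a + b = 1 → p ^ 2 + q ^ 2 * r ^ 2 + 2 * p * q * (a * ξ + b * η) =
      a * (p ^ 2 + q ^ 2 * r ^ 2 + 2 * p * q * ξ) +
        b * (p ^ 2 + q ^ 2 * r ^ 2 + 2 * p * q * η) := by
    intro ξ η a b hab
    linear_combination -(p ^ 2 + q ^ 2 * r ^ 2) * hab
  constructor
  · intro ξ hξ η hη a b ha hb hab
    have h1 : 0 < p ^ 2 + q ^ 2 * r ^ 2 + 2 * p * q * ξ := hξ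
    have h2 : 0 < p ^ 2 + q ^ 2 * r ^ 2 + 2 * p * q * η := hη
    show 0 < p ^ 2 + q ^ 2 * r ^ 2 + 2 * p * q * (a * ξ + b * η)
    rw [hcomb _ _ _ _ hab]
    rcases ha.eq_or_lt with h | h
    · rw [← h] at hab ⊢
      rw [show b = 1 by linarith]
      linarith
    · have := mul_pos h h1
      have := mul_nonneg hb h2.le
      linarith
  · intro ξ hξ η hη hne a b ha hb hab
    have h1 := strictConcaveOn_log_Ioi.2 (show p ^ 2 + q ^ 2 * r ^ 2 + 2 * p * q * ξ ∈ Set.Ioi 0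
      from hξ) (show p ^ 2 + q ^ 2 * r ^ 2 + 2 * p * q * η ∈ Set.Ioi 0 from hη) (by
        intro h
        apply hne
        have : 2 * p * q ≠ 0 := by positivity
        exact mul_left_cancel₀ this (by linarith)) ha hb hab
    simp only [smul_eq_mul] at h1 ⊢
    rw [hcomb _ _ _ _ hab]
    calc _ = w * (a * Real.log (p ^ 2 + q ^ 2 * r ^ 2 + 2 * p * q * ξ) +
          b * Real.log (p ^ 2 + q ^ 2 * r ^ 2 + 2 * p * q * η)) := by ring
      _ < _ := mul_lt_mul_of_pos_left h1 hw

/-- The interval on which `profile` is defined. -/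
def profileDomain (α β r : ℝ) : Set ℝ :=
  ({ξ : ℝ | 0 < 1 ^ 2 + β ^ 2 * r ^ 2 + 2 * 1 * β * ξ} ∩
    {ξ : ℝ | 0 < (-1) ^ 2 + 1 ^ 2 * r ^ 2 + 2 * (-1) * 1 * ξ}) ∩
    {ξ : ℝ | 0 < (-α) ^ 2 + 1 ^ 2 * r ^ 2 + 2 * (-α) * 1 * ξ}

/-- The logarithm of the energy on the circle of radius `r`, up to a constant, as a function of the
real part. -/
def profile (α β x r : ℝ) : ℝ → ℝ :=
  ((fun ξ => (1 - x) / 2 * Real.log (1 ^ 2 + β ^ 2 * r ^ 2 + 2 * 1 * β * ξ)) +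
    fun ξ => x / 2 * Real.log ((-1) ^ 2 + 1 ^ 2 * r ^ 2 + 2 * (-1) * 1 * ξ)) +
    fun ξ => x / 2 * Real.log ((-α) ^ 2 + 1 ^ 2 * r ^ 2 + 2 * (-α) * 1 * ξ)

theorem strictConcaveOn_profile (hα : 0 < α) (hβ : 0 < β) (hx0 : 0 < x) (hx1 : x < 1) (r : ℝ) :
    StrictConcaveOn ℝ (profileDomain α β r) (profile α β x r) := by
  have h1 := strictConcaveOn_log_affine (r := r) (show 0 < (1 - x) / 2 by linarith) one_ne_zero
    hβ.ne'
  have h2 := strictConcaveOn_log_affine (r := r) (show 0 < x / 2 by linarith)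
    (show (-1 : ℝ) ≠ 0 by norm_num) one_ne_zero
  have h3 := strictConcaveOn_log_affine (r := r) (show 0 < x / 2 by linarith)
    (show (-α : ℝ) ≠ 0 by linarith) one_ne_zero
  have hc12 := h1.1.inter h2.1
  have hc := hc12.inter h3.1
  exact ((h1.subset (fun ξ h => h.1.1) hc).add (h2.subset (fun ξ h => h.1.2) hc)).add
    (h3.subset (fun ξ h => h.2) hc)

theorem regular_iff_profileDomain {z : ℂ} (hz : z ≠ 0) :
    Regular α β z ↔ z.re ∈ profileDomain α β ‖z‖ := by
  have f1 := norm_sq_factor 1 β z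
  have f2 := norm_sq_factor (-1) 1 z
  have f3 := norm_sq_factor (-α) 1 z
  constructor
  · intro h
    obtain ⟨k1, k2, k3, -⟩ := h.factors
    refine ⟨⟨?_, ?_⟩, ?_⟩
    · show 0 < 1 ^ 2 + β ^ 2 * ‖z‖ ^ 2 + 2 * 1 * β * z.re
      rw [← f1]
      have : ((1 : ℝ) : ℂ) + β * z ≠ 0 := by push_cast; exact k1
      positivity
    · show 0 < (-1) ^ 2 + 1 ^ 2 * ‖z‖ ^ 2 + 2 * (-1) * 1 * z.re
      rw [← f2]
      have : ((-1 : ℝ) : ℂ) + (1 : ℝ) * z ≠ 0 := by push_cast; exact k2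
      positivity
    · show 0 < (-α) ^ 2 + 1 ^ 2 * ‖z‖ ^ 2 + 2 * (-α) * 1 * z.re
      rw [← f3]
      have : ((-α : ℝ) : ℂ) + (1 : ℝ) * z ≠ 0 := by push_cast; exact k3
      positivity
  · rintro ⟨⟨h1, h2⟩, h3⟩
    have h1' : 0 < 1 ^ 2 + β ^ 2 * ‖z‖ ^ 2 + 2 * 1 * β * z.re := h1
    have h2' : 0 < (-1) ^ 2 + 1 ^ 2 * ‖z‖ ^ 2 + 2 * (-1) * 1 * z.re := h2
    have h3' : 0 < (-α) ^ 2 + 1 ^ 2 * ‖z‖ ^ 2 + 2 * (-α) * 1 * z.re := h3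
    rw [← f1] at h1'
    rw [← f2] at h2'
    rw [← f3] at h3'
    refine ⟨hz, ?_, ?_, ?_⟩
    · rintro rfl
      simp at h2'
    · rintro rfl
      simp at h3'
    · intro h
      push_cast at h1'
      rw [h] at h1'
      simp at h1'

theorem energy_eq_profile (x u : ℝ) {z : ℂ} (h : Regular α β z) :
    energy α β x u z = Real.exp (profile α β x ‖z‖ z.re) * ‖z‖ ^ (-(u + 2 * x)) := by
  obtain ⟨k1, k2, k3, k4⟩ := h.factors
  have f1 := norm_sq_factor 1 β z
  have f2 := norm_sq_factor (-1) 1 z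
  have f3 := norm_sq_factor (-α) 1 z
  unfold profile
  simp only [Pi.add_apply]
  rw [← f1, ← f2, ← f3, Real.log_pow, Real.log_pow, Real.log_pow, Real.exp_add, Real.exp_add]
  push_cast
  unfold energy
  rw [Real.rpow_def_of_pos (norm_pos_iff.2 k1), Real.rpow_def_of_pos (norm_pos_iff.2 k2),
    Real.rpow_def_of_pos (norm_pos_iff.2 k3), zero_add, one_mul]
  congr 1
  congr 1
  · congr 1
    · congr 1
      ring_nf
    · congr 1
      ring_nf
  · congr 1
    ring_nf

/-- The superlevel sets of the energy on the upper half of a circle are convex. -/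
theorem convex_superlevel (hα : 0 < α) (hβ : 0 < β) (hx0 : 0 < x) (hx1 : x < 1) {r e : ℝ}
    (hr : 0 < r) (he : 0 < e) :
    Convex ℝ {θ : ℝ | θ ∈ Set.Icc 0 Real.pi ∧ e < energy α β x u (circleMap 0 r θ)} := by
  have hnorm : ∀ θ, ‖circleMap 0 r θ‖ = r := fun θ => by
    rw [norm_circleMap_zero, abs_of_pos hr]
  have hne : ∀ θ, circleMap 0 r θ ≠ 0 := fun θ => circleMap_ne_center hr.ne'
  have hre : ∀ θ, (circleMap 0 r θ).re = r * Real.cos θ := by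
    intro θ
    simp [circleMap, Complex.exp_ofReal_mul_I_re]
  have hiff : ∀ θ, e < energy α β x u (circleMap 0 r θ) ↔ r * Real.cos θ ∈
      {ξ | ξ ∈ profileDomain α β r ∧ Real.log (e / r ^ (-(u + 2 * x))) < profile α β x r ξ} := by
    intro θ
    have hrp : 0 < r ^ (-(u + 2 * x)) := Real.rpow_pos_of_pos hr _
    have key : Regular α β (circleMap 0 r θ) → (e < energy α β x u (circleMap 0 r θ) ↔
        Real.log (e / r ^ (-(u + 2 * x))) < profile α β x r (r * Real.cos θ)) := by
      intro hreg
      rw [energy_eq_profile x u hreg, hnorm, hre, Real.log_lt_iff_lt_exp (by positivity),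
        div_lt_iff₀ hrp]
    have hd := regular_iff_profileDomain (α := α) (β := β) (hne θ)
    rw [hnorm, hre] at hd
    constructor
    · intro h
      have hreg := regular_of_energy_ne hx0 hx1 (hne θ) (by linarith : energy α β x u _ ≠ 0)
      exact ⟨hd.1 hreg, (key hreg).1 h⟩
    · intro h
      exact (key (hd.2 h.1)).2 h.2
  -- Superlevel sets of a concave function of the real part are intervals, and `r * cos θ` is
  -- monotone for `θ ∈ [0, π]`.
  have hconv := ((strictConcaveOn_profile hα hβ hx0 hx1 r).concaveOn.convex_gt
    (Real.log (e / r ^ (-(u + 2 * x))))).ordConnected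
  apply Set.OrdConnected.convex
  constructor
  rintro θ₁ ⟨h1, h1'⟩ θ₂ ⟨h2, h2'⟩ θ hθ
  have hθ' : θ ∈ Set.Icc 0 Real.pi := ⟨h1.1.trans hθ.1, hθ.2.trans h2.2⟩
  refine ⟨hθ', (hiff θ).2 ?_⟩
  refine hconv.out ((hiff θ₂).1 h2') ((hiff θ₁).1 h1') ⟨?_, ?_⟩
  · exact mul_le_mul_of_nonneg_left (Real.cos_le_cos_of_nonneg_of_le_pi hθ'.1 h2.2 hθ.2) hr.le
  · exact mul_le_mul_of_nonneg_left (Real.cos_le_cos_of_nonneg_of_le_pi h1.1 hθ'.2 hθ.1) hr.le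

/-- Two maximum points of the energy on a circle have the same real part. -/
theorem re_eq_of_max (hα : 0 < α) (hβ : 0 < β) (hx0 : 0 < x) (hx1 : x < 1) {z z' : ℂ}
    (hz0 : z ≠ 0) (hpos : 0 < energy α β x u z) (hzz : ‖z'‖ = ‖z‖)
    (hz : ∀ v : ℂ, ‖v‖ = ‖z‖ → energy α β x u v ≤ energy α β x u z)
    (hz' : energy α β x u z ≤ energy α β x u z') : z.re = z'.re := by
  have hz0' : z' ≠ 0 := by
    rw [← norm_ne_zero_iff, hzz]
    exact norm_ne_zero_iff.2 hz0
  have hreg := regular_of_energy_ne hx0 hx1 hz0 hpos.ne'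
  have hreg' := regular_of_energy_ne hx0 hx1 hz0' (hpos.trans_le hz').ne'
  set r := ‖z‖ with hr
  have hr0 : 0 < r := norm_pos_iff.2 hz0
  have hrp : 0 < r ^ (-(u + 2 * x)) := Real.rpow_pos_of_pos hr0 _
  have hconv := (convex_Icc (𝕜 := ℝ) (-r) r).inter (strictConcaveOn_profile hα hβ hx0 hx1 r).1
  have hsc := (strictConcaveOn_profile hα hβ hx0 hx1 r).subset
    (Set.inter_subset_right (s := Set.Icc (-r) r)) hconv
  have hmem : ∀ v : ℂ, ‖v‖ = r → Regular α β v → v.re ∈ Set.Icc (-r) r ∩ profileDomain α β r := by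
    intro v hv hreg
    refine ⟨?_, ?_⟩
    · rw [← hv, Set.mem_Icc, ← abs_le]
      exact Complex.abs_re_le_norm v
    · rw [← hv]
      exact (regular_iff_profileDomain hreg.1).1 hreg
  -- Every `ξ ∈ [-r, r]` is the real part of a point of the circle, so a maximum of the energy on
  -- the circle is a maximum of `profile` on an interval; strict concavity allows only one.
  have hmax : ∀ v : ℂ, ‖v‖ = r → Regular α β v → energy α β x u z ≤ energy α β x u v →
      IsMaxOn (profile α β x r) (Set.Icc (-r) r ∩ profileDomain α β r) v.re := by
    intro v hv hregv hle ξ hξ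
    have h1 : ξ ^ 2 ≤ r ^ 2 := sq_le_sq.2 (by rw [abs_of_pos hr0]; exact abs_le.2 hξ.1)
    set y : ℂ := ⟨ξ, Real.sqrt (r ^ 2 - ξ ^ 2)⟩ with hy
    have hyn : ‖y‖ = r := by
      rw [Complex.norm_def, Complex.normSq_apply]
      simp only [hy]
      rw [Real.mul_self_sqrt (by linarith), show ξ * ξ + (r ^ 2 - ξ ^ 2) = r ^ 2 by ring,
        Real.sqrt_sq hr0.le]
    have hyreg : Regular α β y := by
      rw [regular_iff_profileDomain (norm_ne_zero_iff.1 (by rw [hyn]; exact hr0.ne')), hyn]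
      exact hξ.2
    have h2 := (hz y hyn).trans hle
    rw [energy_eq_profile x u hyreg, energy_eq_profile x u hregv, hyn, hv] at h2
    exact Real.exp_le_exp.1 (le_of_mul_le_mul_right h2 hrp)
  exact hsc.eq_of_isMaxOn (hmax z rfl hreg le_rfl) (hmax z' hzz hreg' hz')
    (hmem z rfl hreg) (hmem z' hzz hreg')

/-- The total degree at infinity is `(1 - x) + x + x - (u + 2 x) = 1 - x - u`, positive below the
upper boundary of the domain. -/
theorem tendsto_energy_cobounded (hβ : 0 < β) (hu : x + u < 1) :
    Tendsto (energy α β x u) (cobounded ℂ) atTop := by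
  have h0 : Tendsto (fun z : ℂ => z⁻¹) (cobounded ℂ) (𝓝 0) := tendsto_inv₀_cobounded
  have key : ∀ (p q : ℂ) (w : ℝ), q ≠ 0 →
      Tendsto (fun z : ℂ => ‖p * z⁻¹ + q‖ ^ w) (cobounded ℂ) (𝓝 (‖q‖ ^ w)) := by
    intro p q w hq
    have h1 : Tendsto (fun z : ℂ => p * z⁻¹ + q) (cobounded ℂ) (𝓝 q) := by
      simpa using (h0.const_mul p).add_const q
    exact h1.norm.rpow_const (Or.inl (norm_ne_zero_iff.2 hq))
  have hβ' : (β : ℂ) ≠ 0 := by exact_mod_cast hβ.ne'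
  have h1 := ((key 1 β (1 - x) hβ').mul (key (-1) 1 x one_ne_zero)).mul
    (key (-α) 1 x one_ne_zero)
  have h2 : Tendsto (fun z : ℂ => ‖z‖ ^ (1 - (x + u))) (cobounded ℂ) atTop :=
    (tendsto_rpow_atTop (by linarith)).comp tendsto_norm_cobounded_atTop
  have h3 := h1.pos_mul_atTop (mul_pos (mul_pos (Real.rpow_pos_of_pos (norm_pos_iff.2 hβ') _)
    (Real.rpow_pos_of_pos (by simp) _)) (Real.rpow_pos_of_pos (by simp) _)) h2
  refine h3.congr' ?_
  filter_upwards [eventually_ne_cobounded (0 : ℂ)] with z hz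
  have hz' : 0 < ‖z‖ := norm_pos_iff.2 hz
  have e : ∀ (p q : ℂ) (w : ℝ), ‖p + q * z‖ ^ w = ‖p * z⁻¹ + q‖ ^ w * ‖z‖ ^ w := by
    intro p q w
    rw [← Real.mul_rpow (norm_nonneg _) (norm_nonneg _), ← norm_mul]
    congr 2
    field_simp
  unfold energy
  rw [e 1 β, e (-1) 1, e (-α) 1, zero_add, one_mul,
    show 1 - (x + u) = (1 - x) + x + x + -(u + 2 * x) by ring, Real.rpow_add hz', Real.rpow_add hz',
    Real.rpow_add hz']
  ring

/-- The exponent at `0` is `-(u + 2 x)`, negative above the lower boundary of the domain. -/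
theorem tendsto_energy_zero (hα : 0 < α) (hu : 0 < u + 2 * x) :
    Tendsto (energy α β x u) (𝓝[≠] 0) atTop := by
  have key : ∀ (p q : ℂ) (w : ℝ), p ≠ 0 →
      Tendsto (fun z : ℂ => ‖p + q * z‖ ^ w) (𝓝[≠] 0) (𝓝 (‖p‖ ^ w)) := by
    intro p q w hp
    have h1 : Tendsto (fun z : ℂ => p + q * z) (𝓝[≠] 0) (𝓝 p) := by
      have : ContinuousAt (fun z : ℂ => p + q * z) 0 := by fun_prop
      have := this.tendsto
      simp only [mul_zero, add_zero] at this
      exact this.mono_left nhdsWithin_le_nhds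
    exact h1.norm.rpow_const (Or.inl (norm_ne_zero_iff.2 hp))
  have hα' : (-α : ℂ) ≠ 0 := neg_ne_zero.2 (by exact_mod_cast hα.ne')
  have h1 := ((key 1 β (1 - x) one_ne_zero).mul (key (-1) 1 x (by norm_num))).mul
    (key (-α) 1 x hα')
  have h2 : Tendsto (fun z : ℂ => ‖0 + 1 * z‖ ^ (-(u + 2 * x))) (𝓝[≠] 0) atTop := by
    simp only [zero_add, one_mul]
    exact (tendsto_rpow_neg_nhdsGT_zero (by linarith)).comp tendsto_norm_nhdsNE_zero
  exact h1.pos_mul_atTop (by have := norm_pos_iff.2 hα'; simp; positivity) h2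

theorem exists_energy_large (hα : 0 < α) (hβ : 0 < β) (hu : 0 < u + 2 * x) (hu' : x + u < 1)
    (M : ℝ) : ∃ a b : ℝ, ∀ z : ℂ, z ≠ 0 → (‖z‖ ≤ Real.exp a → M < energy α β x u z) ∧
      (Real.exp b ≤ ‖z‖ → M < energy α β x u z) := by
  have h1 := (tendsto_energy_zero (β := β) hα hu).eventually_gt_atTop M
  have h2 := (tendsto_energy_cobounded (α := α) hβ hu').eventually_gt_atTop M
  rw [eventually_nhdsWithin_iff, Metric.eventually_nhds_iff] at h1
  obtain ⟨ε, hε, h1⟩ := h1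
  rw [← comap_norm_atTop, eventually_comap, eventually_atTop] at h2
  obtain ⟨R, hR⟩ := h2
  refine ⟨Real.log (ε / 2), Real.log (max R 1), fun z hz => ⟨fun h => h1 ?_ hz, fun h => ?_⟩⟩
  · rw [Real.exp_log (by positivity)] at h
    rw [dist_zero_right]
    linarith
  · rw [Real.exp_log (by positivity)] at h
    exact hR ‖z‖ ((le_max_left _ _).trans h) z rfl

end

end TowerDimer

end

/-! ### The minimax point and the saddle in the frozen region. -/

noncomputable section

namespace TowerDimer

open MeasureTheory Filter Topology Metric Complex Bornology

section

variable {α β x u : ℝ}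

theorem energy_conj (z : ℂ) : energy α β x u ((starRingEnd ℂ) z) = energy α β x u z := by
  have e : ∀ p q : ℝ, ‖(p : ℂ) + q * (starRingEnd ℂ) z‖ = ‖(p : ℂ) + q * z‖ := by
    intro p q
    rw [← Complex.norm_conj ((p : ℂ) + q * z)]
    simp
  have e1 := e 1 β
  have e2 := e (-1) 1
  have e3 := e (-α) 1
  have e4 := e 0 1
  push_cast at e1 e2 e3 e4
  unfold energy
  rw [e1, e2, e3, e4]

/-- The minimum over all circles of the maximal energy on the circle is attained. -/
theorem exists_minimax (hα : 0 < α) (hβ : 0 < β) (hx0 : 0 < x) (hx1 : x < 1)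
    (hu : 0 < u + 2 * x) (hu' : x + u < 1) : ∃ z₀ : ℂ, z₀ ≠ 0 ∧ 0 ≤ z₀.im ∧
      (∀ z : ℂ, ‖z‖ = ‖z₀‖ → energy α β x u z ≤ energy α β x u z₀) ∧
      ∀ r > 0, ∃ z : ℂ, ‖z‖ = r ∧ energy α β x u z₀ ≤ energy α β x u z := by
  set F : ℝ → ℝ → ℝ := fun s θ => energy α β x u (circleMap 0 (Real.exp s) θ) with hF
  have hFc : Continuous (Function.uncurry F) := by
    rw [continuous_iff_continuousAt]
    rintro ⟨s, θ⟩
    refine ContinuousAt.comp (f := fun p : ℝ × ℝ => circleMap 0 (Real.exp p.1) p.2)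
      (continuousAt_energy hx0 hx1 (circleMap_ne_center (Real.exp_pos s).ne')) ?_
    unfold circleMap
    fun_prop
  set K := Set.Icc (-Real.pi) Real.pi with hK
  have hKc : IsCompact K := isCompact_Icc
  have hKn : K.Nonempty := ⟨0, by rw [hK]; constructor <;> linarith [Real.pi_pos]⟩
  -- The maximum over the circle of radius `exp s`. It is continuous by compactness of the circle
  -- and tends to infinity at both ends, hence has a minimum.
  set m : ℝ → ℝ := fun s => sSup (F s '' K) with hm
  have hmc : Continuous m := hKc.continuous_sSup hFc
  have hFs : ∀ s, ContinuousOn (F s) K := fun s =>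
    (hFc.comp (Continuous.prodMk continuous_const continuous_id)).continuousOn
  have hle : ∀ z : ℂ, z ≠ 0 → energy α β x u z ≤ m (Real.log ‖z‖) := by
    intro z hz
    have h1 : z = circleMap 0 (Real.exp (Real.log ‖z‖)) z.arg := by
      rw [Real.exp_log (norm_pos_iff.2 hz), circleMap, zero_add, Complex.norm_mul_exp_arg_mul_I]
    have h2 : energy α β x u z = F (Real.log ‖z‖) z.arg := by rw [hF]; simp only; rw [← h1]
    rw [h2]
    exact le_csSup (hKc.image_of_continuousOn (hFs _)).bddAbove
      ⟨z.arg, ⟨(Complex.neg_pi_lt_arg z).le, Complex.arg_le_pi z⟩, rfl⟩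
  have hnorm : ∀ s θ, ‖circleMap 0 (Real.exp s) θ‖ = Real.exp s := fun s θ => by
    rw [norm_circleMap_zero, abs_of_pos (Real.exp_pos s)]
  have hne : ∀ s θ, circleMap 0 (Real.exp s) θ ≠ 0 := fun s θ =>
    circleMap_ne_center (Real.exp_pos s).ne'
  have hatt : ∀ s, ∃ z : ℂ, ‖z‖ = Real.exp s ∧ m s = energy α β x u z := by
    intro s
    obtain ⟨θ, hθ, h1⟩ := hKc.exists_sSup_image_eq hKn (hFs s)
    exact ⟨circleMap 0 (Real.exp s) θ, hnorm s θ, h1⟩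
  have hlim : Tendsto m (cocompact ℝ) atTop := by
    rw [Filter.tendsto_atTop]
    intro M
    obtain ⟨a, b, hab⟩ := exists_energy_large hα hβ hu hu' M
    have hmge : ∀ s, s ≤ a ∨ b ≤ s → M ≤ m s := by
      intro s hs
      have h1 := hle _ (hne s 0)
      rw [hnorm, Real.log_exp] at h1
      refine le_trans (le_of_lt ?_) h1
      rcases hs with hs | hs
      · exact (hab _ (hne s 0)).1 (by rw [hnorm]; exact Real.exp_le_exp.2 hs)
      · exact (hab _ (hne s 0)).2 (by rw [hnorm]; exact Real.exp_le_exp.2 hs)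
    rw [cocompact_eq_atBot_atTop, eventually_sup]
    exact ⟨(eventually_le_atBot a).mono fun s hs => hmge s (Or.inl hs),
      (eventually_ge_atTop b).mono fun s hs => hmge s (Or.inr hs)⟩
  obtain ⟨s₀, hs₀⟩ := hmc.exists_forall_le hlim
  obtain ⟨z₁, hz₁, hmz₁⟩ := hatt s₀
  have hz₁0 : z₁ ≠ 0 := by
    rw [← norm_ne_zero_iff, hz₁]
    exact (Real.exp_pos _).ne'
  have key : ∀ z₀ : ℂ, ‖z₀‖ = ‖z₁‖ → energy α β x u z₀ = energy α β x u z₁ →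
      (∀ z : ℂ, ‖z‖ = ‖z₀‖ → energy α β x u z ≤ energy α β x u z₀) ∧
      ∀ r > 0, ∃ z : ℂ, ‖z‖ = r ∧ energy α β x u z₀ ≤ energy α β x u z := by
    intro z₀ h1 h2
    rw [h2, ← hmz₁]
    constructor
    · intro z hz
      have h3 := hle z (by rw [← norm_ne_zero_iff, hz, h1]; exact norm_ne_zero_iff.2 hz₁0)
      rwa [hz, h1, hz₁, Real.log_exp] at h3
    · intro r hr
      obtain ⟨z, hz, hmz⟩ := hatt (Real.log r)
      refine ⟨z, by rw [hz, Real.exp_log hr], ?_⟩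
      rw [← hmz]
      exact hs₀ _
  rcases le_total 0 z₁.im with h | h
  · exact ⟨z₁, hz₁0, h, key z₁ rfl rfl⟩
  · exact ⟨(starRingEnd ℂ) z₁, by simpa using hz₁0, by simpa using h,
      key _ (Complex.norm_conj _) (energy_conj _)⟩

/-- The derivative of a branch of the action along the curve `exp (t d) z`. -/
theorem hasDerivAt_re_branch {g : ℂ → ℂ} {d z : ℂ} {t : ℝ}
    (h : HasDerivAt g (actionDeriv α β x u (Complex.exp (t * d) * z)) (Complex.exp (t * d) * z)) :
    HasDerivAt (fun t : ℝ => (g (Complex.exp (t * d) * z)).re)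
      (d * ((Complex.exp (t * d) * z) * actionDeriv α β x u (Complex.exp (t * d) * z))).re t := by
  have h3 : HasDerivAt (fun t : ℂ => Complex.exp (t * d) * z)
      (Complex.exp (t * d) * (1 * d) * z) t :=
    (((hasDerivAt_id (t : ℂ)).mul_const d).cexp).mul_const z
  have h4 := Complex.reCLM.hasFDerivAt.comp_hasDerivAt t (h.comp t h3.comp_ofReal)
  refine h4.congr_deriv ?_
  simp only [Complex.reCLM_apply]
  congr 1
  ring

/-- The logarithmic derivative of the energy along the circle is `Re (I * z S') = -Im (z S')`. -/
theorem im_eq_zero_of_max {z₀ : ℂ} (hreg : Regular α β z₀)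
    (hle : ∀ z : ℂ, ‖z‖ = ‖z₀‖ → energy α β x u z ≤ energy α β x u z₀) :
    (z₀ * actionDeriv α β x u z₀).im = 0 := by
  obtain ⟨g, hg0, hgd, hge⟩ := exists_branch x u hreg
  have hγc : Continuous fun t : ℝ => Complex.exp (t * I) * z₀ := by fun_prop
  have hγt : Tendsto (fun t : ℝ => Complex.exp (t * I) * z₀) (𝓝 0) (𝓝 z₀) := by
    simpa using hγc.tendsto 0
  have h1 : HasDerivAt g (actionDeriv α β x u (Complex.exp ((0 : ℝ) * I) * z₀))
      (Complex.exp ((0 : ℝ) * I) * z₀) := by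
    simpa using hgd.self_of_nhds
  have h2 := hasDerivAt_re_branch h1
  have hmax : IsLocalMax (fun t : ℝ => (g (Complex.exp (t * I) * z₀)).re) 0 := by
    filter_upwards [hγt.eventually hge] with t ht
    have h3 := hle (Complex.exp (t * I) * z₀) (by
      rw [norm_mul, Complex.norm_exp_ofReal_mul_I, one_mul])
    rw [ht] at h3
    have h4 : 0 < energy α β x u z₀ := hreg.energy_pos
    have h5 : Real.exp (g (Complex.exp (t * I) * z₀)).re ≤ 1 :=
      le_of_mul_le_mul_left (by linarith) h4
    simpa [hg0] using h5
  have h3 := hmax.hasDerivAt_eq_zero h2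
  simp at h3 ⊢
  linarith

/-- A minimax point of the energy is critical. -/
theorem actionDeriv_eq_zero_of_minimax (hα : 0 < α) (hβ : 0 < β) (hx0 : 0 < x) (hx1 : x < 1)
    {z₀ : ℂ} (hreg : Regular α β z₀) (him : 0 ≤ z₀.im)
    (hle : ∀ z : ℂ, ‖z‖ = ‖z₀‖ → energy α β x u z ≤ energy α β x u z₀)
    (hmin : ∀ r > 0, ∃ z : ℂ, ‖z‖ = r ∧ energy α β x u z₀ ≤ energy α β x u z) :
    actionDeriv α β x u z₀ = 0 := by
  have hpos : 0 < energy α β x u z₀ := hreg.energy_pos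
  have hz₀ : z₀ ≠ 0 := hreg.1
  have hr₀ : 0 < ‖z₀‖ := norm_pos_iff.2 hz₀
  -- The derivative along the circle vanishes already. It remains to exclude a positive radial
  -- derivative, outward (`σ = 1`) or inward (`σ = -1`).
  suffices hre : ∀ σ : ℝ, |σ| = 1 → ¬0 < (σ * (z₀ * actionDeriv α β x u z₀)).re by
    have h1 := hre 1 (by simp)
    have h2 := hre (-1) (by simp)
    have h3 : z₀ * actionDeriv α β x u z₀ = 0 := by
      refine Complex.ext ?_ ?_
      · rw [Complex.re_ofReal_mul] at h1 h2
        rw [Complex.zero_re]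
        linarith
      · exact im_eq_zero_of_max hreg hle
    exact (mul_eq_zero.1 h3).resolve_left hz₀
  intro σ hσ hpos'
  obtain ⟨g, hg0, hgd, hge⟩ := exists_branch x u hreg
  have hcont : ContinuousAt (fun z => (σ * (z * actionDeriv α β x u z)).re) z₀ :=
    Complex.continuous_re.continuousAt.comp
      (continuousAt_const.mul (hasDerivAt_mul_actionDeriv hreg).continuousAt)
  have hev := hgd.and (hge.and (hcont.eventually (lt_mem_nhds hpos')))
  have hγc : Continuous fun p : ℝ × ℂ => Complex.exp (p.1 * σ) * p.2 := by fun_prop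
  have hγt : Tendsto (fun p : ℝ × ℂ => Complex.exp (p.1 * σ) * p.2) (𝓝 (0, z₀)) (𝓝 z₀) := by
    simpa using hγc.tendsto (0, z₀)
  obtain ⟨ρ, hρ, hball⟩ := Metric.eventually_nhds_iff.1 (hγt.eventually hev)
  set t : ℕ → ℝ := fun n => 1 / ((n : ℝ) + 1) with ht
  have ht0 : ∀ n, 0 < t n := fun n => by rw [ht]; positivity
  have htt : Tendsto t atTop (𝓝 0) := tendsto_one_div_add_atTop_nhds_zero_nat
  have ht1 : ∀ n, t n ≤ 1 := fun n => by
    rw [ht]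
    simp only
    rw [div_le_one (by positivity)]
    linarith [(Nat.cast_nonneg n : (0 : ℝ) ≤ n)]
  -- By the minimax property, the nearby circles on the descending side contain points with energy
  -- at least that of `z₀`. These points may be reflected into the upper half plane.
  have hex : ∀ n, ∃ z : ℂ, ‖z‖ = Real.exp (-(t n * σ)) * ‖z₀‖ ∧ 0 ≤ z.im ∧
      energy α β x u z₀ ≤ energy α β x u z := by
    intro n
    obtain ⟨z, hz1, hz2⟩ := hmin (Real.exp (-(t n * σ)) * ‖z₀‖) (by positivity)
    rcases le_total 0 z.im with h | h
    · exact ⟨z, hz1, h, hz2⟩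
    · exact ⟨(starRingEnd ℂ) z, by rw [Complex.norm_conj, hz1], by simpa using h,
        by rwa [energy_conj]⟩
  choose z hz1 hz2 hz3 using hex
  have hbd : ∀ n, z n ∈ closedBall (0 : ℂ) (Real.exp 1 * ‖z₀‖) := by
    intro n
    rw [mem_closedBall_zero_iff, hz1]
    refine mul_le_mul_of_nonneg_right (Real.exp_le_exp.2 ?_) hr₀.le
    have := abs_le.1 hσ.le
    nlinarith [ht1 n, ht0 n]
  obtain ⟨y, -, φ, hφ, hlim⟩ := (isCompact_closedBall (0 : ℂ) _).tendsto_subseq hbd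
  have htφ : Tendsto (fun n => t (φ n)) atTop (𝓝 0) := htt.comp hφ.tendsto_atTop
  have hyn : ‖y‖ = ‖z₀‖ := by
    have h1 : Tendsto (fun n => ‖z (φ n)‖) atTop (𝓝 ‖y‖) := hlim.norm
    have h2 : Tendsto (fun n => ‖z (φ n)‖) atTop (𝓝 (Real.exp (-(0 * σ)) * ‖z₀‖)) := by
      simp only [hz1]
      exact ((Real.continuous_exp.tendsto _).comp (htφ.mul_const σ).neg).mul_const _
    rw [tendsto_nhds_unique h1 h2]
    simp
  have hy0 : y ≠ 0 := by rw [← norm_ne_zero_iff, hyn]; exact hr₀.ne'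
  have hyim : 0 ≤ y.im :=
    ge_of_tendsto' ((Complex.continuous_im.tendsto y).comp hlim) fun n => hz2 (φ n)
  have hyE : energy α β x u z₀ ≤ energy α β x u y :=
    ge_of_tendsto' ((continuousAt_energy hx0 hx1 hy0).tendsto.comp hlim) fun n => hz3 (φ n)
  -- A limit of such points is a maximum on the circle of `z₀`, so it is `z₀` by uniqueness of the
  -- real part. The points are therefore eventually in the neighbourhood where the radial derivative
  -- is positive.
  have hyre := re_eq_of_max hα hβ hx0 hx1 hz₀ hpos hyn hle hyE
  have hyz : y = z₀ := by
    refine Complex.ext hyre.symm ?_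
    have h1 : ‖y‖ ^ 2 = ‖z₀‖ ^ 2 := by rw [hyn]
    rw [Complex.sq_norm, Complex.sq_norm, Complex.normSq_apply, Complex.normSq_apply, hyre] at h1
    nlinarith
  rw [hyz] at hlim
  obtain ⟨n, hn1, hn2⟩ := ((Metric.tendsto_nhds.1 hlim ρ hρ).and
    (Metric.tendsto_nhds.1 htφ ρ hρ)).exists
  set w := z (φ n) with hw
  set T := t (φ n) with hT
  have hT0 : 0 < T := ht0 _
  have hseg : ∀ τ ∈ Set.Icc 0 T, HasDerivAt g (actionDeriv α β x u (Complex.exp (τ * σ) * w))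
      (Complex.exp (τ * σ) * w) ∧
      energy α β x u (Complex.exp (τ * σ) * w) =
        energy α β x u z₀ * Real.exp (g (Complex.exp (τ * σ) * w)).re ∧
      0 < (σ * ((Complex.exp (τ * σ) * w) * actionDeriv α β x u (Complex.exp (τ * σ) * w))).re := by
    intro τ hτ
    refine @hball (τ, w) ?_
    rw [Prod.dist_eq, max_lt_iff]
    refine ⟨?_, hn1⟩
    rw [Real.dist_eq, sub_zero, abs_of_pos hT0] at hn2
    rw [Real.dist_eq, sub_zero, abs_of_nonneg hτ.1]
    exact hτ.2.trans_lt hn2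
  -- Following the ray from `w` for the parameter length `T` leads back to the circle of `z₀` with
  -- strictly larger energy, exceeding the maximum there.
  have hmono : StrictMonoOn (fun τ : ℝ => (g (Complex.exp (τ * σ) * w)).re) (Set.Icc 0 T) := by
    refine strictMonoOn_of_deriv_pos (convex_Icc 0 T) (fun τ hτ =>
      (hasDerivAt_re_branch (hseg τ hτ).1).continuousAt.continuousWithinAt) fun τ hτ => ?_
    rw [interior_Icc] at hτ
    have h1 := hseg τ ⟨hτ.1.le, hτ.2.le⟩
    rw [(hasDerivAt_re_branch h1.1).deriv]
    exact h1.2.2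
  have h1 := hmono ⟨le_rfl, hT0.le⟩ ⟨hT0.le, le_rfl⟩ hT0
  have h2 := (hseg 0 ⟨le_rfl, hT0.le⟩).2.1
  have h3 := (hseg T ⟨hT0.le, le_rfl⟩).2.1
  simp only at h1
  have h4 : energy α β x u (Complex.exp ((0 : ℝ) * σ) * w) <
      energy α β x u (Complex.exp (T * σ) * w) := by
    rw [h2, h3]
    exact mul_lt_mul_of_pos_left (Real.exp_lt_exp.2 h1) hpos
  have h5 : Complex.exp ((0 : ℝ) * σ) * w = w := by simp
  rw [h5] at h4
  have h6 := hle (Complex.exp (T * σ) * w) (by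
    rw [norm_mul, hw, hz1, Complex.norm_exp, ← mul_assoc, ← Real.exp_add]
    have : (T * σ : ℂ).re = T * σ := by
      rw [← Complex.ofReal_mul, Complex.ofReal_re]
    rw [this]
    simp [hT])
  have h7 := hz3 (φ n)
  linarith

/-- In the frozen region there is a real saddle point. -/
theorem exists_isSaddle_of_frozen (hα : 0 < α) (hβ : 0 < β) (hx0 : 0 < x) (hx1 : x < 1)
    (hu : 0 < u + 2 * x) (hu' : x + u < 1)
    (hfr : ∀ z : ℂ, IsCriticalPoint α β x u z →
      z.im = 0 ∧ deriv (actionDeriv α β x u) z ≠ 0) :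
    ∃ z₀ : ℂ, z₀.im = 0 ∧ IsSaddle α β x u z₀ := by
  obtain ⟨z₀, hz₀, him, hle, hmin⟩ := exists_minimax hα hβ hx0 hx1 hu hu'
  -- The maximum on the circle is at least the energy at the purely imaginary point `‖z₀‖ * I`,
  -- which is not a singularity.
  have hpos : 0 < energy α β x u z₀ := by
    have hr : 0 < ‖z₀‖ := norm_pos_iff.2 hz₀
    have h1 := hle (‖z₀‖ * I) (by simp)
    refine lt_of_lt_of_le (Regular.energy_pos ?_) h1
    have him : (‖z₀‖ * I : ℂ).im ≠ 0 := by simpa using hr.ne'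
    refine ⟨?_, ?_, ?_, ?_⟩
    · intro h; rw [h] at him; simp at him
    · intro h; rw [h] at him; simp at him
    · intro h; rw [h] at him; simp at him
    · intro h
      have := congrArg Complex.im h
      simp at this
      rcases this with h | h
      · exact hβ.ne' h
      · exact hz₀ h
  have hreg := regular_of_energy_ne hx0 hx1 hz₀ hpos.ne'
  have h0 := actionDeriv_eq_zero_of_minimax hα hβ hx0 hx1 hreg him hle hmin
  have hc := isCriticalPoint_iff.2 ⟨hreg, h0⟩
  obtain ⟨him0, hder⟩ := hfr z₀ hc
  refine ⟨z₀, him0, isSaddle_of him hc hle ?_⟩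
  have hd := (differentiableAt_of_deriv_ne_zero hder).hasDerivAt
  -- At a critical point `(z S')' = z S''`, so simplicity of the critical point makes the second
  -- derivative nonzero.
  have hB : actionSecond α β x z₀ = z₀ * deriv (actionDeriv α β x u) z₀ := by
    have h1 := (hasDerivAt_id z₀).mul hd
    have h2 := (hasDerivAt_mul_actionDeriv (x := x) (u := u) hreg).unique h1
    rw [h2, h0]
    simp
  have hA0 : z₀ * actionSecond α β x z₀ ≠ 0 := by
    rw [hB]
    exact mul_ne_zero hz₀ (mul_ne_zero hz₀ hder)
  have hAim : (z₀ * actionSecond α β x z₀).im = 0 := by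
    have hz : z₀ = (z₀.re : ℂ) := Complex.ext rfl (by simpa using him0)
    have : z₀ * actionSecond α β x z₀ = ((z₀.re * ((1 - x) * (β / (1 + β * z₀.re) ^ 2) +
        x * (-1 / (-1 + 1 * z₀.re) ^ 2) + x * (-α / (-α + 1 * z₀.re) ^ 2)) : ℝ) : ℂ) := by
      rw [hz]
      unfold actionSecond
      push_cast
      rfl
    rw [this, Complex.ofReal_im]
  have hAre : (z₀ * actionSecond α β x z₀).re ≠ 0 := fun h => hA0 (Complex.ext h hAim)
  -- The second radial derivative is real and nonzero. If it were negative, the energy would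
  -- increase along the circle, in the direction `d = I`, against maximality.
  refine lt_of_le_of_ne ?_ hAre.symm
  by_contra hneg
  push Not at hneg
  have h1 := energy_lt_of_second x u (d := I) hreg (by rw [h0]; simp) (by
    rw [Complex.I_sq, neg_one_mul, Complex.neg_re]
    linarith)
  obtain ⟨t, ht⟩ := h1.exists
  have h2 := hle (Complex.exp (t * I) * z₀) (by
    rw [norm_mul, Complex.norm_exp_ofReal_mul_I, one_mul])
  linarith

end

end TowerDimer

end

/-! ### A smooth curve of high energy through the saddle. -/

noncomputable section

namespace TowerDimer

open MeasureTheory Filter Topology Metric Complex Bornology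

section

variable {α β x u : ℝ}

theorem circleMap_neg (r θ : ℝ) : circleMap 0 r (-θ) = (starRingEnd ℂ) (circleMap 0 r θ) := by
  simp [circleMap, ← Complex.exp_conj]

theorem circleMap_arg (z : ℂ) : circleMap 0 ‖z‖ z.arg = z := by
  rw [circleMap, zero_add, Complex.norm_mul_exp_arg_mul_I]

theorem norm_circleMap_exp (s θ : ℝ) : ‖circleMap 0 (Real.exp s) θ‖ = Real.exp s := by
  rw [norm_circleMap_zero, abs_of_pos (Real.exp_pos s)]

/-- A smooth curve, crossing every circle around the origin once, along which the energy exceeds its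
value at the saddle point. -/
theorem IsSaddle.exists_curve {z₀ : ℂ} (h : IsSaddle α β x u z₀) (hα : 0 < α) (hβ : 0 < β)
    (hx0 : 0 < x) (hx1 : x < 1) (hu : 0 < u + 2 * x) :
    ∃ θ : ℝ → ℝ, ContDiff ℝ 1 θ ∧ (∀ s, θ s ∈ Set.Icc 0 Real.pi) ∧
      θ (Real.log ‖z₀‖) = z₀.arg ∧ ∀ s, s ≠ Real.log ‖z₀‖ →
        energy α β x u z₀ < energy α β x u (circleMap 0 (Real.exp s) (θ s)) := by
  obtain ⟨δ, hδ, hrad⟩ := h.lt_radial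
  have hz₀ : z₀ ≠ 0 := h.crit.1
  have hr₀ : 0 < ‖z₀‖ := norm_pos_iff.2 hz₀
  have hpos : 0 < energy α β x u z₀ := (isCriticalPoint_iff.1 h.crit).1.energy_pos
  set s₀ := Real.log ‖z₀‖ with hs₀
  have hes₀ : Real.exp s₀ = ‖z₀‖ := Real.exp_log hr₀
  set F : ℝ → ℝ → ℝ := fun s θ => energy α β x u (circleMap 0 (Real.exp s) θ) with hF
  have hFc : ∀ θ, Continuous fun s => F s θ := by
    intro θ
    rw [continuous_iff_continuousAt]
    intro s
    refine ContinuousAt.comp (f := fun s : ℝ => circleMap 0 (Real.exp s) θ)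
      (continuousAt_energy hx0 hx1 (circleMap_ne_center (Real.exp_pos s).ne')) ?_
    unfold circleMap
    fun_prop
  have harg : z₀.arg ∈ Set.Icc 0 Real.pi := ⟨Complex.arg_nonneg_iff.2 h.im_nonneg, Complex.arg_le_pi _⟩
  have hrad' : ∀ s, s ≠ s₀ → |s - s₀| ≤ δ → energy α β x u z₀ < F s z₀.arg := by
    intro s hs hs'
    have h1 := hrad (s - s₀) (sub_ne_zero.2 hs) hs'
    have h2 : circleMap 0 (Real.exp s) z₀.arg = Real.exp (s - s₀) * z₀ := by
      conv_rhs => rw [← circleMap_arg z₀]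
      rw [circleMap, circleMap, zero_add, zero_add, ← mul_assoc, ← Complex.ofReal_mul, ← hes₀,
        ← Real.exp_add]
      congr 4
      ring
    rw [hF]
    simp only
    rw [h2]
    exact h1
  -- The admissible angles on the circle of radius `exp s`. Near the saddle the angle is prescribed,
  -- so that the curve is a ray through it; all the sets are convex, as smooth selection by a
  -- partition of unity requires.
  set T : ℝ → Set ℝ := fun s => if |s - s₀| < δ / 2 then {z₀.arg} else
    {θ | θ ∈ Set.Icc 0 Real.pi ∧ energy α β x u z₀ < F s θ} with hT
  have hTconv : ∀ s, Convex ℝ (T s) := by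
    intro s
    rw [hT]
    simp only
    split_ifs
    · exact convex_singleton _
    · exact convex_superlevel hα hβ hx0 hx1 (Real.exp_pos s) hpos
  -- Locally one angle serves all nearby circles: that of `z₀` within distance `δ`, which is
  -- admissible on both sides of the threshold `δ / 2`, and elsewhere an angle supplied by the
  -- maximum principle, by continuity.
  have hTloc : ∀ s : ℝ, ∃ c : ℝ, ∀ᶠ y in 𝓝 s, c ∈ T y := by
    intro s
    have hcs : Continuous fun y : ℝ => |y - s₀| := by fun_prop
    have hTmem : ∀ y, |y - s₀| ≤ δ → z₀.arg ∈ T y := by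
      intro y hy
      rw [hT]
      simp only
      split_ifs with h1
      · rfl
      · refine ⟨harg, hrad' y ?_ hy⟩
        rintro rfl
        rw [sub_self, abs_zero] at h1
        exact h1 (by linarith)
    rcases lt_or_ge |s - s₀| δ with h1 | h1
    · exact ⟨z₀.arg, (hcs.continuousAt.eventually (gt_mem_nhds h1)).mono fun y hy => hTmem y hy.le⟩
    · have hs : Real.exp s ≠ ‖z₀‖ := by
        intro h2
        rw [← hes₀] at h2
        rw [Real.exp_injective h2, sub_self, abs_zero] at h1
        linarith
      obtain ⟨z, hz, hz'⟩ := h.exists_lt hα hx0 hx1 hu (Real.exp_pos s) hs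
      have hex : ∃ θ ∈ Set.Icc 0 Real.pi, energy α β x u z₀ < F s θ := by
        have key : ∀ z : ℂ, ‖z‖ = Real.exp s → 0 ≤ z.im → energy α β x u z₀ < energy α β x u z →
            ∃ θ ∈ Set.Icc 0 Real.pi, energy α β x u z₀ < F s θ := by
          intro z hz him hz'
          refine ⟨z.arg, ⟨Complex.arg_nonneg_iff.2 him, Complex.arg_le_pi _⟩, ?_⟩
          rw [hF]
          simp only
          rw [← hz, circleMap_arg]
          exact hz'
        rcases le_total 0 z.im with h2 | h2
        · exact key z hz h2 hz'
        · exact key ((starRingEnd ℂ) z) (by rw [Complex.norm_conj, hz]) (by simpa using h2)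
            (by rwa [energy_conj])
      obtain ⟨θ, hθ, hθ'⟩ := hex
      refine ⟨θ, ?_⟩
      filter_upwards [hcs.continuousAt.eventually (lt_mem_nhds (show δ / 2 < |s - s₀| by linarith)),
        (hFc θ).continuousAt.eventually (lt_mem_nhds hθ')] with y hy hy'
      rw [hT]
      simp only
      rw [if_neg (not_lt.2 hy.le)]
      exact ⟨hθ, hy'⟩
  obtain ⟨g, hg⟩ := exists_contMDiffMap_forall_mem_convex_of_local_const (n := 1)
    (modelWithCornersSelf ℝ ℝ) hTconv hTloc
  have hmem : ∀ s, g s ∈ Set.Icc 0 Real.pi ∧ (s = s₀ → g s = z₀.arg) ∧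
      (s ≠ s₀ → energy α β x u z₀ < F s (g s)) := by
    intro s
    have h1 := hg s
    rw [hT] at h1
    simp only at h1
    split_ifs at h1 with h2
    · rw [Set.mem_singleton_iff] at h1
      rw [h1]
      exact ⟨harg, fun _ => rfl, fun hs => hrad' s hs (by linarith)⟩
    · refine ⟨h1.1, ?_, fun _ => h1.2⟩
      rintro rfl
      rw [sub_self, abs_zero] at h2
      exact absurd (by linarith) h2
  exact ⟨g, g.contMDiff.contDiff, fun s => (hmem s).1, (hmem s₀).2.1 rfl, fun s => (hmem s).2.2⟩

end

/-! ### Bounds for powers -/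

/-- The integer exponents differ from `w * M` by a bounded amount, which costs a constant factor.
The one-sided condition `w * M ≤ m` is what permits `ζ = 0`. -/
theorem norm_zpow_le_of_le {ζ : ℂ} {R K w : ℝ} {m : ℤ} {M : ℕ} (hR : 1 ≤ R) (hζ : ‖ζ‖ ≤ R)
    (hw : 0 < w) (h1 : w * M ≤ m) (h2 : m ≤ w * M + K) :
    ‖ζ ^ m‖ ≤ R ^ K * (‖ζ‖ ^ w) ^ M := by
  have hR0 : 0 < R := by linarith
  have hK : 0 ≤ K := by linarith
  have hRK : 1 ≤ R ^ K := Real.one_le_rpow hR hK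
  rw [norm_zpow]
  rcases (norm_nonneg ζ).eq_or_lt with h0 | h0
  · rw [← h0]
    have hm0 : (0 : ℝ) ≤ m := le_trans (by positivity) h1
    by_cases hm : m = 0
    · have hM : M = 0 := by
        rw [hm] at h1
        push_cast at h1
        by_contra hM
        have : (0 : ℝ) < M := by exact_mod_cast Nat.pos_of_ne_zero hM
        nlinarith [mul_pos hw this]
      rw [hm, hM]
      simpa using hRK
    · rw [zero_zpow _ hm]
      positivity
  · rw [← Real.rpow_intCast, ← Real.rpow_natCast, ← Real.rpow_mul h0.le,
      show (m : ℝ) = (m - w * M) + w * M by ring, Real.rpow_add h0]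
    refine mul_le_mul_of_nonneg_right ?_ (by positivity)
    calc ‖ζ‖ ^ ((m : ℝ) - w * M) ≤ R ^ ((m : ℝ) - w * M) :=
          Real.rpow_le_rpow h0.le hζ (by linarith)
      _ ≤ R ^ K := Real.rpow_le_rpow_of_exponent_le hR (by linarith)

theorem norm_zpow_le_of_abs {ζ : ℂ} {R K w : ℝ} {m : ℤ} {M : ℕ} (hR : 1 ≤ R) (hζ : ‖ζ‖ ≤ R)
    (hζ' : R⁻¹ ≤ ‖ζ‖) (h1 : |m - w * M| ≤ K) :
    ‖ζ ^ m‖ ≤ R ^ K * (‖ζ‖ ^ w) ^ M := by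
  have hR0 : 0 < R := by linarith
  have h0 : 0 < ‖ζ‖ := lt_of_lt_of_le (by positivity) hζ'
  rw [norm_zpow, ← Real.rpow_intCast, ← Real.rpow_natCast, ← Real.rpow_mul h0.le,
    show (m : ℝ) = (m - w * M) + w * M by ring, Real.rpow_add h0]
  refine mul_le_mul_of_nonneg_right ?_ (by positivity)
  have hab := abs_le.1 h1
  rcases le_total 0 ((m : ℝ) - w * M) with h | h
  · calc ‖ζ‖ ^ ((m : ℝ) - w * M) ≤ R ^ ((m : ℝ) - w * M) := Real.rpow_le_rpow h0.le hζ h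
      _ ≤ R ^ K := Real.rpow_le_rpow_of_exponent_le hR hab.2
  · calc ‖ζ‖ ^ ((m : ℝ) - w * M) ≤ R⁻¹ ^ ((m : ℝ) - w * M) :=
          Real.rpow_le_rpow_of_nonpos (by positivity) hζ' h
      _ = R ^ (-((m : ℝ) - w * M)) := by rw [Real.inv_rpow hR0.le, Real.rpow_neg hR0.le]
      _ ≤ R ^ K := Real.rpow_le_rpow_of_exponent_le hR (by linarith [hab.1])

end TowerDimer

end

/-! ### Uniform exponential bounds for the two factors of the kernel. -/

noncomputable section

namespace TowerDimer

open MeasureTheory Filter Topology Metric Complex Bornology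

theorem tOf_add (n X : ℤ) : tOf (3 * n + X) = n + tOf X := by unfold tOf; omega

theorem mOf_add (n X : ℤ) : mOf (3 * n + X) = mOf X := by unfold mOf; omega

theorem expB_add (n X : ℤ) : expB (3 * n + X) = n + expB X := by
  unfold expB
  rw [mOf_add, tOf_add]
  ring

theorem expC_add (n X : ℤ) : expC (3 * n + X) = n + expC X := by
  unfold expC
  rw [mOf_add, tOf_add]
  ring

section

variable {α β : ℝ}

theorem phiK_site (N : ℕ) (p : ℝ × ℝ) (P : Pt) : phiK α β N (site N p + P) =
    mono α β (N - ⌊(N : ℝ) * p.1⌋ + (1 - tOf P.1)) (⌊(N : ℝ) * p.1⌋ + expB P.1)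
      (⌊(N : ℝ) * p.1⌋ + expC P.1)
      (-2 * ⌊(N : ℝ) * p.1⌋ - ⌊(N : ℝ) * p.2⌋ + (-expB P.1 - expC P.1 - P.2 - 1)) := by
  unfold phiK site
  simp only [Prod.fst_add, Prod.snd_add]
  rw [tOf_add, expB_add, expC_add]
  congr 1 <;> ring

theorem psiK_site (N : ℕ) (p : ℝ × ℝ) (Q : Pt) : psiK α β N (site N p + Q) =
    mono α β (-(N - ⌊(N : ℝ) * p.1⌋ + (1 - tOf Q.1))) (-(⌊(N : ℝ) * p.1⌋ + expB Q.1))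
      (-(⌊(N : ℝ) * p.1⌋ + expC Q.1))
      (2 * ⌊(N : ℝ) * p.1⌋ + ⌊(N : ℝ) * p.2⌋ + (expB Q.1 + expC Q.1 + Q.2)) := by
  unfold psiK site
  simp only [Prod.fst_add, Prod.snd_add]
  rw [tOf_add, expB_add, expC_add]
  congr 1 <;> ring

theorem floor_bounds (N : ℕ) (y : ℝ) :
    N * y - 1 ≤ (⌊(N : ℝ) * y⌋ : ℝ) ∧ (⌊(N : ℝ) * y⌋ : ℝ) ≤ N * y :=
  ⟨(Int.sub_one_lt_floor _).le, Int.floor_le _⟩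

theorem norm_mono (a b c d : ℤ) (z : ℂ) : ‖mono α β a b c d z‖ =
    ‖(1 + β * z) ^ a‖ * ‖(-1 + 1 * z) ^ b‖ * ‖(-α + 1 * z) ^ c‖ * ‖(0 + 1 * z) ^ d‖ := by
  unfold mono
  rw [norm_mul, norm_mul, norm_mul, one_mul, neg_add_eq_sub, neg_add_eq_sub, zero_add]

/-- The circle may pass through zeros of `phiK`, where lower bounds for the factors are not
available. Giving up `N₀` powers of the energy makes the true exponents at these zeros larger than
those of the bound, in spite of offsets and rounding. -/
theorem norm_phiK_le {p : ℝ × ℝ} (hx0 : 0 < p.1) (hx1 : p.1 < 1) {r : ℝ} (hr : 0 < r) (P : Pt) :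
    ∀ᶠ N₀ : ℕ in atTop, ∃ C : ℝ, 0 < C ∧ ∀ N : ℕ, N₀ ≤ N → ∀ z : ℂ, ‖z‖ = r →
      ‖phiK α β N (site N p + P) z‖ ≤ C * energy α β p.1 p.2 z ^ (N - N₀) := by
  obtain ⟨x, u⟩ := p
  simp only at hx0 hx1
  have hN1 := (tendsto_natCast_atTop_atTop (R := ℝ)).const_mul_atTop (show 0 < 1 - x by linarith)
  have hN2 := (tendsto_natCast_atTop_atTop (R := ℝ)).const_mul_atTop hx0
  filter_upwards [hN1.eventually_ge_atTop (|((1 - tOf P.1 : ℤ) : ℝ)| + 1),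
    hN2.eventually_ge_atTop (|(expB P.1 : ℝ)| + 1),
    hN2.eventually_ge_atTop (|(expC P.1 : ℝ)| + 1)] with N₀ h1 h2 h3
  set d₀ : ℤ := -expB P.1 - expC P.1 - P.2 - 1 with hd₀
  set R : ℝ := max (max 1 (1 + |β| * r)) (max (1 + r) (max (|α| + r) r⁻¹)) with hR
  have hR1 : 1 ≤ R := (le_max_left _ _).trans (le_max_left _ _)
  have hRβ : 1 + |β| * r ≤ R := (le_max_right _ _).trans (le_max_left _ _)
  have hR2 : 1 + r ≤ R := (le_max_left _ _).trans (le_max_right _ _)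
  have hRα : |α| + r ≤ R := (le_max_left _ _).trans ((le_max_right _ _).trans (le_max_right _ _))
  have hRr : r⁻¹ ≤ R := (le_max_right _ _).trans ((le_max_right _ _).trans (le_max_right _ _))
  set K : ℝ := |((1 - tOf P.1 : ℤ) : ℝ)| + |(expB P.1 : ℝ)| + |(expC P.1 : ℝ)| + |(d₀ : ℝ)| + 3 +
    (1 - x) * N₀ + x * N₀ + |u + 2 * x| * N₀ with hK
  have hx1' : 0 ≤ (1 - x) * N₀ := mul_nonneg (by linarith) (Nat.cast_nonneg _)
  have hx0' : 0 ≤ x * N₀ := by positivity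
  have hu' : 0 ≤ |u + 2 * x| * N₀ := by positivity
  have ha1 := abs_nonneg ((1 - tOf P.1 : ℤ) : ℝ)
  have ha2 := abs_nonneg (expB P.1 : ℝ)
  have ha3 := abs_nonneg (expC P.1 : ℝ)
  have ha4 := abs_nonneg (d₀ : ℝ)
  have hb1 := abs_le.1 (le_refl |((1 - tOf P.1 : ℤ) : ℝ)|)
  have hb2 := abs_le.1 (le_refl |(expB P.1 : ℝ)|)
  have hb3 := abs_le.1 (le_refl |(expC P.1 : ℝ)|)
  have hb4 := abs_le.1 (le_refl |(d₀ : ℝ)|)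
  refine ⟨(R ^ K) ^ 4, by positivity, fun N hN z hz => ?_⟩
  obtain ⟨f1, f2⟩ := floor_bounds N x
  obtain ⟨g1, g2⟩ := floor_bounds N u
  have hM : ((N - N₀ : ℕ) : ℝ) = N - N₀ := by push_cast [Nat.cast_sub hN]; ring
  rw [phiK_site, norm_mono]
  have n1 : ‖1 + β * z‖ ≤ R := by
    refine ((norm_add_le _ _).trans ?_).trans hRβ
    rw [norm_one, norm_mul, hz, Complex.norm_real, Real.norm_eq_abs]
  have n2 : ‖-1 + 1 * z‖ ≤ R := by
    refine ((norm_add_le _ _).trans ?_).trans hR2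
    rw [norm_neg, norm_one, one_mul, hz]
  have n3 : ‖-(α : ℂ) + 1 * z‖ ≤ R := by
    refine ((norm_add_le _ _).trans ?_).trans hRα
    rw [norm_neg, one_mul, hz, Complex.norm_real, Real.norm_eq_abs]
  have n4 : ‖0 + 1 * z‖ = r := by simpa using hz
  have m1 := norm_zpow_le_of_le (m := N - ⌊(N : ℝ) * x⌋ + (1 - tOf P.1)) (M := N - N₀) (K := K)
    (w := 1 - x) hR1 n1 (by linarith) (by rw [hM]; push_cast at *; linarith)
    (by rw [hM]; push_cast at *; linarith)
  have m2 := norm_zpow_le_of_le (m := ⌊(N : ℝ) * x⌋ + expB P.1) (M := N - N₀) (K := K)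
    (w := x) hR1 n2 hx0 (by rw [hM]; push_cast; linarith) (by rw [hM]; push_cast; linarith)
  have m3 := norm_zpow_le_of_le (m := ⌊(N : ℝ) * x⌋ + expC P.1) (M := N - N₀) (K := K)
    (w := x) hR1 n3 hx0 (by rw [hM]; push_cast; linarith) (by rw [hM]; push_cast; linarith)
  have m4 := norm_zpow_le_of_abs (ζ := 0 + 1 * z)
    (m := -2 * ⌊(N : ℝ) * x⌋ - ⌊(N : ℝ) * u⌋ + d₀) (M := N - N₀) (K := K)
    (w := -(u + 2 * x)) hR1 (by rw [n4]; linarith)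
    (by rw [n4, inv_le_comm₀ (by linarith) hr]; exact hRr) (by
      rw [hM, abs_le]
      have hu2 : |(u + 2 * x) * N₀| = |u + 2 * x| * N₀ := by
        rw [abs_mul, abs_of_nonneg (Nat.cast_nonneg N₀ : (0 : ℝ) ≤ N₀)]
      have hu3 := abs_le.1 hu2.le
      push_cast
      constructor <;> linarith [hu3.1, hu3.2])
  calc _ ≤ (R ^ K * (‖1 + β * z‖ ^ (1 - x)) ^ (N - N₀)) * (R ^ K * (‖-1 + 1 * z‖ ^ x) ^ (N - N₀)) *
        (R ^ K * (‖-(α : ℂ) + 1 * z‖ ^ x) ^ (N - N₀)) *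
        (R ^ K * (‖0 + 1 * z‖ ^ (-(u + 2 * x))) ^ (N - N₀)) := by gcongr
    _ = _ := by
      unfold energy
      simp only [mul_pow]
      ring

theorem exists_norm_bounds {W : Set ℂ} (hW : IsCompact W) {f : ℂ → ℂ} (hf : Continuous f)
    (h0 : ∀ w ∈ W, f w ≠ 0) : ∃ R : ℝ, 1 ≤ R ∧ ∀ w ∈ W, ‖f w‖ ≤ R ∧ R⁻¹ ≤ ‖f w‖ := by
  obtain ⟨C, hC⟩ := hW.exists_bound_of_continuousOn hf.continuousOn
  obtain ⟨C', hC'⟩ := hW.exists_bound_of_continuousOn (hf.continuousOn.inv₀ h0)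
  refine ⟨max 1 (max C C'), le_max_left _ _, fun w hw =>
    ⟨(hC w hw).trans ((le_max_left _ _).trans (le_max_right _ _)), ?_⟩⟩
  have h1 : 0 < ‖f w‖ := norm_pos_iff.2 (h0 w hw)
  rw [inv_le_comm₀ (by positivity) h1]
  have h2 := hC' w hw
  rw [Pi.inv_apply, norm_inv] at h2
  exact h2.trans ((le_max_right _ _).trans (le_max_right _ _))

/-- Away from the singularities all factors are bounded above and below, so bounded changes of the
exponents only cost a constant. The exponent `N - N₀` is chosen to match the bound for `phiK`. -/
theorem norm_psiK_mul_le (p : ℝ × ℝ) {W : Set ℂ} (hW : IsCompact W)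
    (hreg : ∀ w ∈ W, Regular α β w) (Q : Pt) (N₀ : ℕ) : ∃ C : ℝ, 0 < C ∧ ∀ N : ℕ, N₀ ≤ N →
      ∀ w ∈ W, ‖psiK α β N (site N p + Q) w‖ * energy α β p.1 p.2 w ^ (N - N₀) ≤ C := by
  obtain ⟨x, u⟩ := p
  obtain ⟨R1, hR1, hb1⟩ := exists_norm_bounds hW (f := fun w => 1 + β * w) (by fun_prop)
    fun w hw => (hreg w hw).factors.1
  obtain ⟨R2, hR2, hb2⟩ := exists_norm_bounds hW (f := fun w => -1 + 1 * w) (by fun_prop)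
    fun w hw => (hreg w hw).factors.2.1
  obtain ⟨R3, hR3, hb3⟩ := exists_norm_bounds hW (f := fun w => -(α : ℂ) + 1 * w) (by fun_prop)
    fun w hw => (hreg w hw).factors.2.2.1
  obtain ⟨R4, hR4, hb4⟩ := exists_norm_bounds hW (f := fun w => 0 + 1 * w) (by fun_prop)
    fun w hw => (hreg w hw).factors.2.2.2
  set d₀ : ℤ := expB Q.1 + expC Q.1 + Q.2 with hd₀
  set K : ℝ := |((1 - tOf Q.1 : ℤ) : ℝ)| + |(expB Q.1 : ℝ)| + |(expC Q.1 : ℝ)| + |(d₀ : ℝ)| + 3 +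
    |1 - x| * N₀ + |x| * N₀ + |u + 2 * x| * N₀ with hK
  have hx1' : 0 ≤ |1 - x| * N₀ := by positivity
  have hx0' : 0 ≤ |x| * N₀ := by positivity
  have hu' : 0 ≤ |u + 2 * x| * N₀ := by positivity
  have ha1 := abs_nonneg ((1 - tOf Q.1 : ℤ) : ℝ)
  have ha2 := abs_nonneg (expB Q.1 : ℝ)
  have ha3 := abs_nonneg (expC Q.1 : ℝ)
  have ha4 := abs_nonneg (d₀ : ℝ)
  have hb1' := abs_le.1 (le_refl |((1 - tOf Q.1 : ℤ) : ℝ)|)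
  have hb2' := abs_le.1 (le_refl |(expB Q.1 : ℝ)|)
  have hb3' := abs_le.1 (le_refl |(expC Q.1 : ℝ)|)
  have hb4' := abs_le.1 (le_refl |(d₀ : ℝ)|)
  have hcast : ∀ y : ℝ, |y * N₀| ≤ |y| * N₀ := fun y => by
    rw [abs_mul, abs_of_nonneg (Nat.cast_nonneg N₀ : (0 : ℝ) ≤ N₀)]
  have hy1 := abs_le.1 (hcast (1 - x))
  have hy2 := abs_le.1 (hcast x)
  have hy3 := abs_le.1 (hcast (u + 2 * x))
  refine ⟨R1 ^ K * R2 ^ K * R3 ^ K * R4 ^ K, by positivity, fun N hN w hw => ?_⟩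
  obtain ⟨f1, f2⟩ := floor_bounds N x
  obtain ⟨g1, g2⟩ := floor_bounds N u
  have hM : ((N - N₀ : ℕ) : ℝ) = N - N₀ := by push_cast [Nat.cast_sub hN]; ring
  obtain ⟨k1, k2, k3, k4⟩ := (hreg w hw).factors
  rw [psiK_site, norm_mono]
  have m1 := norm_zpow_le_of_abs (m := -(N - ⌊(N : ℝ) * x⌋ + (1 - tOf Q.1))) (M := N - N₀) (K := K)
    (w := -(1 - x)) hR1 (hb1 w hw).1 (hb1 w hw).2 (by
      rw [hM, abs_le]; push_cast at *; constructor <;> linarith [hy1.1, hy1.2])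
  have m2 := norm_zpow_le_of_abs (m := -(⌊(N : ℝ) * x⌋ + expB Q.1)) (M := N - N₀) (K := K)
    (w := -x) hR2 (hb2 w hw).1 (hb2 w hw).2 (by
      rw [hM, abs_le]; push_cast; constructor <;> linarith [hy2.1, hy2.2])
  have m3 := norm_zpow_le_of_abs (m := -(⌊(N : ℝ) * x⌋ + expC Q.1)) (M := N - N₀) (K := K)
    (w := -x) hR3 (hb3 w hw).1 (hb3 w hw).2 (by
      rw [hM, abs_le]; push_cast; constructor <;> linarith [hy2.1, hy2.2])
  have m4 := norm_zpow_le_of_abs (m := 2 * ⌊(N : ℝ) * x⌋ + ⌊(N : ℝ) * u⌋ + d₀) (M := N - N₀)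
    (K := K) (w := u + 2 * x) hR4 (hb4 w hw).1 (hb4 w hw).2 (by
      rw [hM, abs_le]; push_cast; constructor <;> linarith [hy3.1, hy3.2])
  have hcancel : ∀ (ζ : ℂ) (y : ℝ), ζ ≠ 0 →
      (‖ζ‖ ^ (-y)) ^ (N - N₀) * (‖ζ‖ ^ y) ^ (N - N₀) = 1 := by
    intro ζ y hζ
    rw [← mul_pow, ← Real.rpow_add (norm_pos_iff.2 hζ), neg_add_cancel, Real.rpow_zero, one_pow]
  have hc4 := hcancel _ (-(u + 2 * x)) k4
  rw [neg_neg] at hc4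
  calc _ ≤ (R1 ^ K * (‖1 + β * w‖ ^ (-(1 - x))) ^ (N - N₀)) *
        (R2 ^ K * (‖-1 + 1 * w‖ ^ (-x)) ^ (N - N₀)) *
        (R3 ^ K * (‖-(α : ℂ) + 1 * w‖ ^ (-x)) ^ (N - N₀)) *
        (R4 ^ K * (‖0 + 1 * w‖ ^ (u + 2 * x)) ^ (N - N₀)) *
        energy α β x u w ^ (N - N₀) := by
        have := energy_nonneg (α := α) (β := β) (x := x) (u := u) w
        gcongr
    _ = R1 ^ K * R2 ^ K * R3 ^ K * R4 ^ K *
        ((‖1 + β * w‖ ^ (-(1 - x))) ^ (N - N₀) * (‖1 + β * w‖ ^ (1 - x)) ^ (N - N₀)) *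
        ((‖-1 + 1 * w‖ ^ (-x)) ^ (N - N₀) * (‖-1 + 1 * w‖ ^ x) ^ (N - N₀)) *
        ((‖-(α : ℂ) + 1 * w‖ ^ (-x)) ^ (N - N₀) * (‖-(α : ℂ) + 1 * w‖ ^ x) ^ (N - N₀)) *
        ((‖0 + 1 * w‖ ^ (u + 2 * x)) ^ (N - N₀) *
          (‖0 + 1 * w‖ ^ (-(u + 2 * x))) ^ (N - N₀)) := by
      unfold energy
      simp only [mul_pow]
      ring
    _ = _ := by
      rw [hcancel _ _ k1, hcancel _ _ k2, hcancel _ _ k3, hc4]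
      ring

/-- For `0 < x < 1` the exponents at `1`, `α` and `-1 / β` are eventually nonnegative, so `0` is the
only possible singularity, as `cauchyPart` requires. -/
theorem eventually_differentiableAt_phiK {p : ℝ × ℝ} (hx0 : 0 < p.1) (hx1 : p.1 < 1) (P : Pt) :
    ∀ᶠ N : ℕ in atTop, ∀ z, z ≠ 0 → DifferentiableAt ℂ (phiK α β N (site N p + P)) z := by
  obtain ⟨x, u⟩ := p
  simp only at hx0 hx1
  have hN1 := (tendsto_natCast_atTop_atTop (R := ℝ)).const_mul_atTop (show 0 < 1 - x by linarith)
  have hN2 := (tendsto_natCast_atTop_atTop (R := ℝ)).const_mul_atTop hx0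
  filter_upwards [hN1.eventually_ge_atTop (|((1 - tOf P.1 : ℤ) : ℝ)| + 1),
    hN2.eventually_ge_atTop (|(expB P.1 : ℝ)| + 1),
    hN2.eventually_ge_atTop (|(expC P.1 : ℝ)| + 1)] with N h1 h2 h3 z hz
  obtain ⟨f1, f2⟩ := floor_bounds N x
  have hb1 := (abs_le.1 (le_refl |((1 - tOf P.1 : ℤ) : ℝ)|)).1
  have hb2 := (abs_le.1 (le_refl |(expB P.1 : ℝ)|)).1
  have hb3 := (abs_le.1 (le_refl |(expC P.1 : ℝ)|)).1
  rw [phiK_site]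
  refine differentiableAt_mono (Or.inr ?_) (Or.inr ?_) (Or.inr ?_) (Or.inl hz)
  · have : (0 : ℝ) ≤ ((N - ⌊(N : ℝ) * x⌋ + (1 - tOf P.1) : ℤ) : ℝ) := by push_cast at *; linarith
    exact_mod_cast this
  · have : (0 : ℝ) ≤ ((⌊(N : ℝ) * x⌋ + expB P.1 : ℤ) : ℝ) := by push_cast; linarith
    exact_mod_cast this
  · have : (0 : ℝ) ≤ ((⌊(N : ℝ) * x⌋ + expC P.1 : ℤ) : ℝ) := by push_cast; linarith
    exact_mod_cast this

end

end TowerDimer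

end

/-! ### Dominated convergence along pieces of the deformed contour. -/

noncomputable section

namespace TowerDimer

open MeasureTheory Filter Topology Metric Complex Bornology

section

variable {α β : ℝ}

/-- The product of the two factors of the Schur kernel on the diagonal, which does not depend on the
size of the tower. -/
def diagK (α β : ℝ) (P Q : Pt) : ℂ → ℂ :=
  mono α β (tOf Q.1 - tOf P.1) (expB P.1 - expB Q.1) (expC P.1 - expC Q.1)
    (expB Q.1 + expC Q.1 - expB P.1 - expC P.1 + Q.2 - P.2 - 1)

theorem phiK_mul_psiK_site (N : ℕ) (p : ℝ × ℝ) (P Q : Pt) {z : ℂ} (hz : Regular α β z) :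
    phiK α β N (site N p + P) z * psiK α β N (site N p + Q) z = diagK α β P Q z := by
  rw [phiK_site, psiK_site, mono_mul hz.2.2.2 hz.2.1 hz.2.2.1 hz.1, diagK]
  congr 1 <;> ring

theorem Regular.differentiableAt_mono {a b c d : ℤ} {z : ℂ} (hz : Regular α β z) :
    DifferentiableAt ℂ (mono α β a b c d) z :=
  TowerDimer.differentiableAt_mono (Or.inl hz.2.2.2) (Or.inl hz.2.1) (Or.inl hz.2.2.1)
    (Or.inl hz.1)

/-- The contribution to the Schur kernel of a piece of the `w`-contour along which the energy exceeds
its maximum on the `z`-contour, the circle through the saddle point. -/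
theorem tendsto_integral_piece {p : ℝ × ℝ} {z₀ : ℂ} (h : IsSaddle α β p.1 p.2 z₀)
    (hx0 : 0 < p.1) (hx1 : p.1 < 1) (P Q : Pt) {γ γ' : ℝ → ℂ} {a b : ℝ}
    (hγ : ContinuousOn γ (Set.uIcc a b)) (hγ' : ContinuousOn γ' (Set.uIcc a b))
    (hreg : ∀ t ∈ Set.uIcc a b, Regular α β (γ t))
    (hE : ∀ᵐ t, t ∈ Set.uIoc a b → energy α β p.1 p.2 z₀ < energy α β p.1 p.2 (γ t))
    (hint : IntervalIntegrable (fun t => |‖z₀‖ ^ 2 - ‖γ t‖ ^ 2| ^ (-(1 / 2) : ℝ)) volume a b)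
    {χ : ℂ} (hχ : (χ = 0 ∧ ∀ᵐ t, t ∈ Set.uIoc a b → ‖z₀‖ < ‖γ t‖) ∨
      (χ = 1 ∧ ∀ᵐ t, t ∈ Set.uIoc a b → ‖γ t‖ < ‖z₀‖)) :
    Tendsto (fun N : ℕ => ∫ t in a..b, psiK α β N (site N p + Q) (γ t) *
        cauchyPart (phiK α β N (site N p + P)) (γ t) * γ' t) atTop
      (𝓝 (-χ * (2 * Real.pi * I) * ∫ t in a..b, diagK α β P Q (γ t) * γ' t)) := by
  have hr₀ : 0 < ‖z₀‖ := norm_pos_iff.2 h.crit.1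
  have he : 0 < energy α β p.1 p.2 z₀ := (isCriticalPoint_iff.1 h.crit).1.energy_pos
  set e := energy α β p.1 p.2 z₀ with hedef
  obtain ⟨N₀, hN₀d, C₁, hC₁, hφ⟩ := ((eventually_differentiableAt_phiK (α := α) (β := β) hx0 hx1
    P).and (norm_phiK_le (α := α) (β := β) hx0 hx1 hr₀ P)).exists
  obtain ⟨N₁, hN₁⟩ := Filter.eventually_atTop.1
    (eventually_differentiableAt_phiK (α := α) (β := β) hx0 hx1 P)
  have hW : IsCompact (γ '' Set.uIcc a b) := isCompact_uIcc.image_of_continuousOn hγ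
  obtain ⟨C₂, hC₂, hψ⟩ := norm_psiK_mul_le p hW (by rintro _ ⟨t, ht, rfl⟩; exact hreg t ht) Q N₀
  obtain ⟨G, hG⟩ := isCompact_uIcc.exists_bound_of_continuousOn hγ'
  have hG0 : 0 ≤ G := (norm_nonneg _).trans (hG a Set.left_mem_uIcc)
  have hψc : ∀ N, ContinuousOn (fun t => psiK α β N (site N p + Q) (γ t)) (Set.uIcc a b) := by
    intro N t ht
    rw [psiK_site]
    exact (hreg t ht).differentiableAt_mono.continuousAt.comp_continuousWithinAt (hγ t ht)
  have hκc : ContinuousOn (fun t => diagK α β P Q (γ t)) (Set.uIcc a b) := fun t ht =>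
    (hreg t ht).differentiableAt_mono.continuousAt.comp_continuousWithinAt (hγ t ht)
  have hDc : ∀ N, N₁ ≤ N → ContinuousOn
      (fun t => cauchyPart (phiK α β N (site N p + P)) (γ t)) (Set.uIcc a b) := by
    intro N hN t ht
    exact (differentiableAt_cauchyPart (hN₁ N hN)
      (hreg t ht).1).continuousAt.comp_continuousWithinAt (hγ t ht)
  -- With the residue restored, `F` is the integrand in which `z` runs over the circle through the
  -- saddle; `χ` records whether `w` lies inside that circle.
  set F : ℕ → ℝ → ℂ := fun N t => psiK α β N (site N p + Q) (γ t) *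
        cauchyPart (phiK α β N (site N p + P)) (γ t) * γ' t +
        χ * (2 * Real.pi * I) * (diagK α β P Q (γ t) * γ' t) with hF
  have hFc : ∀ N, N₁ ≤ N → ContinuousOn (F N) (Set.uIcc a b) := fun N hN =>
    (((hψc N).mul (hDc N hN)).mul hγ').add ((hκc.mul hγ').const_mul _)
  set K : ℝ := C₂ * (2 * Real.pi * ‖z₀‖ * C₁) * G with hK
  have hK0 : 0 ≤ K := by positivity
  -- The energy is at most `e` on the `z`-circle and larger than `e` at `γ t`, which gives a
  -- geometric factor; the square root bound takes care of the pole at `z = γ t`.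
  have hbound : ∀ N, N₁ ≤ N → N₀ ≤ N → ∀ᵐ t, t ∈ Set.uIoc a b →
      ‖F N t‖ ≤ K * |‖z₀‖ ^ 2 - ‖γ t‖ ^ 2| ^ (-(1 / 2) : ℝ) *
        (e / energy α β p.1 p.2 (γ t)) ^ (N - N₀) := by
    intro N hN hN'
    have hχ' : ∀ᵐ t, t ∈ Set.uIoc a b → ‖γ t‖ ≠ ‖z₀‖ ∧
        F N t = psiK α β N (site N p + Q) (γ t) *
          (∮ z in C(0, ‖z₀‖), phiK α β N (site N p + P) z * (z - γ t)⁻¹) * γ' t := by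
      rcases hχ with ⟨h0, h1⟩ | ⟨h0, h1⟩
      · filter_upwards [h1] with t ht ht'
        have h2 := ht ht'
        refine ⟨h2.ne', ?_⟩
        have h3 := circleIntegral_cauchy_of_notMem (hN₁ N hN) (c := 0) (ρ := ‖z₀‖)
          (hreg t (Set.uIoc_subset_uIcc ht')).1 (by simpa using hr₀) (by simpa using h2)
        rw [Complex.ofReal_zero] at h3
        rw [h3, hF]
        simp only [h0]
        ring
      · filter_upwards [h1] with t ht ht'
        have h2 := ht ht'
        refine ⟨h2.ne, ?_⟩
        have hr := hreg t (Set.uIoc_subset_uIcc ht')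
        have h3 := circleIntegral_cauchy_of_mem (hN₁ N hN) (c := 0) (ρ := ‖z₀‖)
          hr.1 (by simpa using hr₀) (by simpa using h2)
        rw [Complex.ofReal_zero] at h3
        rw [h3, hF]
        simp only [h0]
        rw [← phiK_mul_psiK_site N p P Q hr]
        ring
    filter_upwards [hχ', hE] with t ht htE ht'
    obtain ⟨h1, h2⟩ := ht ht'
    have hEt := htE ht'
    have hEpos : 0 < energy α β p.1 p.2 (γ t) := he.trans hEt
    have h3 := norm_circleIntegral_cauchy_le hr₀ h1 (f := phiK α β N (site N p + P))
      (M := C₁ * e ^ (N - N₀)) (fun z hz => by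
        have hz' : ‖z‖ = ‖z₀‖ := by simpa using hz
        refine (hφ N hN' z hz').trans ?_
        have := h.le z hz'
        have := energy_nonneg (α := α) (β := β) (x := p.1) (u := p.2) z
        gcongr)
    have h4 := hψ N hN' (γ t) ⟨t, Set.uIoc_subset_uIcc ht', rfl⟩
    rw [← le_div_iff₀ (pow_pos hEpos _)] at h4
    rw [h2, norm_mul, norm_mul]
    have h5 := hG t (Set.uIoc_subset_uIcc ht')
    calc _ ≤ (C₂ / energy α β p.1 p.2 (γ t) ^ (N - N₀)) *
          (2 * Real.pi * ‖z₀‖ * (C₁ * e ^ (N - N₀)) *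
            |‖z₀‖ ^ 2 - ‖γ t‖ ^ 2| ^ (-(1 / 2) : ℝ)) * G := by
          gcongr
      _ = _ := by
        rw [div_pow, hK]
        ring
  -- The geometric factor is at most `1` and tends to `0` for almost every `t`; only the crossing
  -- with the circle may be exceptional.
  have hlim : Tendsto (fun N => ∫ t in a..b, F N t) atTop (𝓝 (∫ _ in a..b, (0 : ℂ))) := by
    refine intervalIntegral.tendsto_integral_filter_of_dominated_convergence
      (fun t => K * |‖z₀‖ ^ 2 - ‖γ t‖ ^ 2| ^ (-(1 / 2) : ℝ)) ?_ ?_ (hint.const_mul K) ?_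
    · filter_upwards [Filter.eventually_ge_atTop N₁] with N hN
      exact ((hFc N hN).mono Set.uIoc_subset_uIcc).aestronglyMeasurable measurableSet_uIoc
    · filter_upwards [Filter.eventually_ge_atTop N₁, Filter.eventually_ge_atTop N₀] with N hN hN'
      filter_upwards [hbound N hN hN', hE] with t ht htE ht'
      refine (ht ht').trans (mul_le_of_le_one_right (by positivity) (pow_le_one₀ ?_ ?_))
      · exact div_nonneg he.le (energy_nonneg _)
      · exact (div_le_one (he.trans (htE ht'))).2 (htE ht').le
    · have hall : ∀ᵐ t, ∀ N, N₁ ≤ N → N₀ ≤ N → t ∈ Set.uIoc a b →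
          ‖F N t‖ ≤ K * |‖z₀‖ ^ 2 - ‖γ t‖ ^ 2| ^ (-(1 / 2) : ℝ) *
            (e / energy α β p.1 p.2 (γ t)) ^ (N - N₀) := by
        rw [ae_all_iff]
        intro N
        by_cases h1 : N₁ ≤ N
        · by_cases h2 : N₀ ≤ N
          · filter_upwards [hbound N h1 h2] with t ht _ _ using ht
          · exact ae_of_all _ fun t _ h => absurd h h2
        · exact ae_of_all _ fun t h => absurd h h1
      filter_upwards [hall, hE] with t ht htE ht'
      have hq0 : 0 ≤ e / energy α β p.1 p.2 (γ t) := div_nonneg he.le (energy_nonneg _)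
      have hq1 : e / energy α β p.1 p.2 (γ t) < 1 :=
        (div_lt_one (he.trans (htE ht'))).2 (htE ht')
      refine squeeze_zero_norm' (a := fun N => K * |‖z₀‖ ^ 2 - ‖γ t‖ ^ 2| ^ (-(1 / 2) : ℝ) *
            (e / energy α β p.1 p.2 (γ t)) ^ (N - N₀)) ?_ ?_
      · filter_upwards [Filter.eventually_ge_atTop N₁, Filter.eventually_ge_atTop N₀] with N hN hN'
        exact ht N hN hN' ht'
      · have := ((tendsto_pow_atTop_nhds_zero_of_lt_one hq0 hq1).comp
          (tendsto_sub_atTop_nat N₀)).const_mul (K * |‖z₀‖ ^ 2 - ‖γ t‖ ^ 2| ^ (-(1 / 2) : ℝ))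
        rw [mul_zero] at this
        exact this
  rw [intervalIntegral.integral_zero] at hlim
  have h2 := hlim.add_const (-χ * (2 * Real.pi * I) * ∫ t in a..b, diagK α β P Q (γ t) * γ' t)
  rw [zero_add] at h2
  refine h2.congr' ?_
  filter_upwards [Filter.eventually_ge_atTop N₁] with N hN
  rw [hF]
  simp only
  rw [intervalIntegral.integral_add, intervalIntegral.integral_const_mul]
  · ring
  · exact (((hψc N).mul (hDc N hN)).mul hγ').intervalIntegrable
  · exact ((hκc.mul hγ').const_mul _).intervalIntegrable

/-- The singularity of the logarithmic derivative on crossing the circle through the saddle point is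
integrable. -/
theorem intervalIntegrable_crossing (s₀ a b : ℝ) : IntervalIntegrable
    (fun s => |Real.exp s₀ ^ 2 - Real.exp s ^ 2| ^ (-(1 / 2) : ℝ)) volume a b := by
  have h0 : IntervalIntegrable (fun s : ℝ => |s| ^ (-(1 / 2) : ℝ)) volume (a - s₀) (b - s₀) := by
    have h1 : ∀ c : ℝ, 0 ≤ c → IntervalIntegrable (fun s : ℝ => |s| ^ (-(1 / 2) : ℝ)) volume 0 c := by
      intro c hc
      refine (intervalIntegral.intervalIntegrable_rpow' (r := -(1 / 2)) (by norm_num)).congr ?_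
      intro s hs
      rw [Set.uIoc_of_le hc] at hs
      simp only [abs_of_pos hs.1]
    have h2 : ∀ c : ℝ, IntervalIntegrable (fun s : ℝ => |s| ^ (-(1 / 2) : ℝ)) volume 0 c := by
      intro c
      rcases le_total 0 c with hc | hc
      · exact h1 c hc
      · have := (IntervalIntegrable.iff_comp_neg (a := 0) (b := -c)).1 (h1 (-c) (by linarith))
        simpa using this
    exact (h2 _).symm.trans (h2 _)
  have h1 : IntervalIntegrable (fun s : ℝ => |s - s₀| ^ (-(1 / 2) : ℝ)) volume a b := by
    have := h0.comp_sub_right s₀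
    simpa using this
  -- A lower bound for all parameters involved. On the half line above `m` the function `exp s ^ 2`
  -- grows at rate at least `c = 2 exp (2 m)`, so the integrand is dominated by a multiple of `|s -
  -- s₀| ^ (-1/2)`.
  set m := min (min a b) s₀ with hm
  set c : ℝ := 2 * Real.exp m * Real.exp m with hc
  have hc0 : 0 < c := by positivity
  refine (h1.const_mul (c ^ (-(1 / 2) : ℝ))).mono_fun' ?_ ?_
  · exact (by fun_prop : Measurable fun s : ℝ =>
      |Real.exp s₀ ^ 2 - Real.exp s ^ 2| ^ (-(1 / 2) : ℝ)).aestronglyMeasurable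
  · have hmem : ∀ᵐ s ∂(volume.restrict (Set.uIoc a b)), s ≠ s₀ :=
      ae_restrict_of_ae (by simp [ae_iff, measure_singleton])
    filter_upwards [ae_restrict_mem measurableSet_uIoc, hmem] with s hs hs0
    have hsm : m ≤ s := (min_le_left _ _).trans (Set.uIoc_subset_uIcc hs).1
    have hsm₀ : m ≤ s₀ := min_le_right _ _
    rw [Real.norm_of_nonneg (by positivity), ← Real.mul_rpow hc0.le (abs_nonneg _)]
    refine Real.rpow_le_rpow_of_nonpos (mul_pos hc0 (abs_pos.2 (sub_ne_zero.2 hs0))) ?_ (by norm_num)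
    have key : ∀ x y : ℝ, m ≤ x → x ≤ y →
        c * (y - x) ≤ Real.exp y ^ 2 - Real.exp x ^ 2 := by
      intro x y hx hxy
      have e1 : Real.exp m ≤ Real.exp x := Real.exp_le_exp.2 hx
      have e2 : Real.exp x ≤ Real.exp y := Real.exp_le_exp.2 hxy
      have e3 : Real.exp m * (y - x) ≤ Real.exp y - Real.exp x := by
        have h1 := Real.add_one_le_exp (y - x)
        have h2 : Real.exp y = Real.exp x * Real.exp (y - x) := by rw [← Real.exp_add]; ring_nf
        have h3 := Real.exp_pos x
        nlinarith [mul_le_mul_of_nonneg_right e1 (by linarith : 0 ≤ y - x),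
          mul_le_mul_of_nonneg_left h1 h3.le]
      have e4 := Real.exp_pos m
      rw [hc]
      have e5 : 0 ≤ Real.exp m * (y - x) := mul_nonneg e4.le (by linarith)
      calc 2 * Real.exp m * Real.exp m * (y - x) = (2 * Real.exp m) * (Real.exp m * (y - x)) := by ring
        _ ≤ (Real.exp y + Real.exp x) * (Real.exp y - Real.exp x) := by
          apply mul_le_mul (by linarith) e3 e5 (by linarith)
        _ = _ := by ring
    rcases le_total s s₀ with h | h
    · rw [abs_sub_comm, abs_of_nonneg (by linarith : 0 ≤ s₀ - s),
        abs_of_nonneg (by nlinarith [key s s₀ hsm h])]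
      exact key s s₀ hsm h
    · rw [abs_of_nonneg (by linarith : 0 ≤ s - s₀), abs_sub_comm (Real.exp s₀ ^ 2),
        abs_of_nonneg (by nlinarith [key s₀ s hsm₀ h])]
      exact key s₀ s hsm₀ h

end

end TowerDimer

end

/-! ### The limit of the deformed integral in one half plane. -/

noncomputable section

namespace TowerDimer

open MeasureTheory Filter Topology Metric Complex Bornology

section

variable {α β : ℝ}

/-- The real points where the factors of the kernel may be singular. -/
def singularSet (α β : ℝ) : Set ℝ := {-(1 / β), 0, 1, α}

theorem finite_singularSet : (singularSet α β).Finite := by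
  unfold singularSet
  exact Set.toFinite _

theorem regular_iff_singularSet (hβ : 0 < β) {z : ℂ} :
    (∀ a ∈ singularSet α β, z ≠ (a : ℝ)) ↔ Regular α β z := by
  have hβ' : (β : ℂ) ≠ 0 := by exact_mod_cast hβ.ne'
  have h : z = ((-(1 / β) : ℝ) : ℂ) ↔ 1 + β * z = 0 := by
    push_cast
    rw [eq_neg_iff_add_eq_zero, ← mul_right_inj' hβ', mul_add, mul_zero, mul_one_div_cancel hβ',
      add_comm]
  unfold singularSet Regular
  simp only [Set.mem_insert_iff, Set.mem_singleton_iff, forall_eq_or_imp, forall_eq,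
    Complex.ofReal_zero, Complex.ofReal_one, ne_eq, h]
  tauto

theorem im_circleMap_zero (r t : ℝ) : (circleMap 0 r t).im = r * Real.sin t := by
  simp [circleMap, Complex.exp_ofReal_mul_I_im]

theorem circleMap_pi (r : ℝ) : circleMap 0 r Real.pi = ((-r : ℝ) : ℂ) := by
  simp [circleMap]

theorem circleMap_neg_pi (r : ℝ) : circleMap 0 r (-Real.pi) = ((-r : ℝ) : ℂ) := by
  rw [circleMap_neg, circleMap_pi, Complex.conj_ofReal]

theorem circleMap_zero_angle (r : ℝ) : circleMap 0 r 0 = (r : ℂ) := by simp [circleMap]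

theorem mul_im_nonneg_of_angle {σ r t : ℝ} (hσ : σ = 1 ∨ σ = -1) (hr : 0 ≤ r)
    (ht : σ * t ∈ Set.Icc 0 Real.pi) : 0 ≤ σ * (circleMap 0 r t).im := by
  rw [im_circleMap_zero]
  have h := Real.sin_nonneg_of_nonneg_of_le_pi ht.1 ht.2
  rcases hσ with rfl | rfl
  · rw [one_mul] at h ⊢; positivity
  · rw [neg_one_mul, Real.sin_neg] at h
    nlinarith

/-- The deformed `w`-contour in a half plane. -/
theorem IsSaddle.tendsto_half {p : ℝ × ℝ} {z₀ : ℂ} (h : IsSaddle α β p.1 p.2 z₀)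
    (hx0 : 0 < p.1) (hx1 : p.1 < 1) (P Q : Pt) {σ : ℝ} (hσ : σ = 1 ∨ σ = -1) {θ : ℝ → ℝ}
    (hθ : ContDiff ℝ 1 θ) (hθI : ∀ s, θ s ∈ Set.Icc 0 Real.pi) (hθ0 : θ (Real.log ‖z₀‖) = z₀.arg)
    (hθE : ∀ s, s ≠ Real.log ‖z₀‖ → energy α β p.1 p.2 z₀ <
      energy α β p.1 p.2 (circleMap 0 (Real.exp s) (θ s))) {a b : ℝ}
    (ha : a < Real.log ‖z₀‖) (hb : Real.log ‖z₀‖ < b)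
    (haE : ∀ z, ‖z‖ = Real.exp a → energy α β p.1 p.2 z₀ < energy α β p.1 p.2 z)
    (hbE : ∀ z, ‖z‖ = Real.exp b → energy α β p.1 p.2 z₀ < energy α β p.1 p.2 z)
    {J : ℕ → ℂ → ℂ} {Jκ : ℂ → ℂ}
    (hJ : ∀ᶠ N in atTop, ∀ z : ℂ, 0 ≤ σ * z.im → Regular α β z → HasDerivAt (J N)
      (psiK α β N (site N p + Q) z * cauchyPart (phiK α β N (site N p + P)) z) z)
    (hJκ : ∀ z : ℂ, 0 ≤ σ * z.im → Regular α β z → HasDerivAt Jκ (diagK α β P Q z) z) :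
    Tendsto (fun N => J N ((-Real.exp a : ℝ) : ℂ) - J N ((Real.exp b : ℝ) : ℂ)) atTop
      (𝓝 (-(2 * Real.pi * I) * (Jκ ((-Real.exp a : ℝ) : ℂ) -
        Jκ (circleMap 0 ‖z₀‖ (σ * z₀.arg))))) := by
  have hr₀ : 0 < ‖z₀‖ := norm_pos_iff.2 h.crit.1
  have hreg₀ := (isCriticalPoint_iff.1 h.crit).1
  have he : 0 < energy α β p.1 p.2 z₀ := hreg₀.energy_pos
  set s₀ := Real.log ‖z₀‖ with hs₀
  have hes₀ : Real.exp s₀ = ‖z₀‖ := Real.exp_log hr₀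
  set e := energy α β p.1 p.2 z₀ with hedef
  have hregE : ∀ z : ℂ, z ≠ 0 → e < energy α β p.1 p.2 z → Regular α β z := fun z hz hz' =>
    regular_of_energy_ne hx0 hx1 hz (he.trans hz').ne'
  have hσσ : σ * σ = 1 := by rcases hσ with rfl | rfl <;> norm_num
  have hconj : ∀ r t, energy α β p.1 p.2 (circleMap 0 r (σ * t)) =
      energy α β p.1 p.2 (circleMap 0 r t) := by
    intro r t
    rcases hσ with rfl | rfl
    · rw [one_mul]
    · rw [neg_one_mul, circleMap_neg, energy_conj]
  have hcE : ∀ s, s ≠ s₀ → e < energy α β p.1 p.2 (circleMap 0 (Real.exp s) (σ * θ s)) := by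
    intro s hs
    rw [hconj]
    exact hθE s hs
  have hcreg : ∀ s, Regular α β (circleMap 0 (Real.exp s) (σ * θ s)) := by
    intro s
    by_cases hs : s = s₀
    · rw [hs, hes₀, hθ0]
      refine regular_of_energy_ne hx0 hx1 (circleMap_ne_center hr₀.ne') (x := p.1) (u := p.2) ?_
      rw [hconj, circleMap_arg]
      exact he.ne'
    · exact hregE _ (circleMap_ne_center (Real.exp_pos s).ne') (hcE s hs)
  have hcim : ∀ s, 0 ≤ σ * (circleMap 0 (Real.exp s) (σ * θ s)).im := fun s =>
    mul_im_nonneg_of_angle hσ (Real.exp_pos s).le (by rw [← mul_assoc, hσσ, one_mul]; exact hθI s)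
  -- The curve of high energy, parametrized by the logarithm of the radius, or its mirror image when
  -- `σ = -1`.
  set γ : ℝ → ℂ := fun s => circleMap 0 (Real.exp s) (σ * θ s) with hγ
  set γ' : ℝ → ℂ := fun s => Real.exp s * Complex.exp ((σ * θ s : ℝ) * I) +
    Real.exp s * (Complex.exp ((σ * θ s : ℝ) * I) * ((σ * deriv θ s : ℝ) * I)) with hγ'
  have hθd : ∀ s, HasDerivAt θ (deriv θ s) s := fun s =>
    (hθ.differentiable one_ne_zero s).hasDerivAt
  have hγd : ∀ s, HasDerivAt γ (γ' s) s := by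
    intro s
    have h1 : HasDerivAt (fun s : ℝ => (Real.exp s : ℂ)) (Real.exp s) s :=
      (Real.hasDerivAt_exp s).ofReal_comp
    have h2 : HasDerivAt (fun s : ℝ => ((σ * θ s : ℝ) : ℂ) * I) ((σ * deriv θ s : ℝ) * I) s :=
      (((hθd s).const_mul σ).ofReal_comp).mul_const I
    have h3 := h1.mul h2.cexp
    have h4 : γ = fun s : ℝ => (Real.exp s : ℂ) * Complex.exp (((σ * θ s : ℝ) : ℂ) * I) := by
      funext s
      rw [hγ]
      simp only [circleMap, zero_add]
    rw [h4]
    exact h3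
  have hθc : Continuous θ := hθ.continuous
  have hθc' : Continuous (deriv θ) := hθ.continuous_deriv_one
  have hγc' : Continuous γ' := by
    rw [hγ']
    fun_prop
  have hγn : ∀ s, ‖γ s‖ = Real.exp s := fun s => norm_circleMap_exp s _
  -- the four pieces
  have harcd : ∀ (r t : ℝ), HasDerivAt (circleMap 0 r) (circleMap 0 r t * I) t := fun r t =>
    hasDerivAt_circleMap _ _ t
  have harcc : ∀ r : ℝ, Continuous fun t => circleMap 0 r t * I := fun r => by fun_prop
  have harcint : ∀ r c d : ℝ, IntervalIntegrable
      (fun t => |‖z₀‖ ^ 2 - ‖circleMap 0 r t‖ ^ 2| ^ (-(1 / 2) : ℝ)) volume c d := by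
    intro r c d
    simp only [norm_circleMap_zero]
    exact intervalIntegrable_const
  have hsub : ∀ c d : ℝ, σ * c ∈ Set.Icc 0 Real.pi → σ * d ∈ Set.Icc 0 Real.pi →
      ∀ t ∈ Set.uIcc c d, σ * t ∈ Set.Icc 0 Real.pi := by
    intro c d hc hd t ht
    rcases Set.mem_uIcc.1 ht with ht | ht <;> rcases hσ with rfl | rfl <;>
      constructor <;> linarith [hc.1, hc.2, hd.1, hd.2, ht.1, ht.2]
  have hσb : σ * (σ * θ b) ∈ Set.Icc 0 Real.pi := by rw [← mul_assoc, hσσ, one_mul]; exact hθI b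
  have hσa : σ * (σ * θ a) ∈ Set.Icc 0 Real.pi := by rw [← mul_assoc, hσσ, one_mul]; exact hθI a
  have hσ0 : σ * 0 ∈ Set.Icc 0 Real.pi := by rw [mul_zero]; exact ⟨le_rfl, Real.pi_pos.le⟩
  have hσπ : σ * (σ * Real.pi) ∈ Set.Icc 0 Real.pi := by
    rw [← mul_assoc, hσσ, one_mul]; exact ⟨Real.pi_pos.le, le_rfl⟩
  have hn : ∀ c t : ℝ, ‖circleMap 0 (Real.exp c) t‖ = Real.exp c := norm_circleMap_exp
  have hbreg : ∀ t, Regular α β (circleMap 0 (Real.exp b) t) := fun t =>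
    hregE _ (circleMap_ne_center (Real.exp_pos b).ne') (hbE _ (hn b t))
  have hareg : ∀ t, Regular α β (circleMap 0 (Real.exp a) t) := fun t =>
    hregE _ (circleMap_ne_center (Real.exp_pos a).ne') (haE _ (hn a t))
  have hlta : Real.exp a < ‖z₀‖ := by rw [← hes₀]; exact Real.exp_lt_exp.2 ha
  have hltb : ‖z₀‖ < Real.exp b := by rw [← hes₀]; exact Real.exp_lt_exp.2 hb
  have hne : ∀ᵐ s : ℝ, s ≠ s₀ := by simp [ae_iff, measure_singleton]
  have hcross : ∀ c d, IntervalIntegrable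
      (fun s => |‖z₀‖ ^ 2 - ‖γ s‖ ^ 2| ^ (-(1 / 2) : ℝ)) volume c d := by
    intro c d
    simp only [hγn]
    rw [← hes₀]
    exact intervalIntegrable_crossing s₀ c d
  -- The path leads from `exp b` along the large circle to the curve, down the curve to the saddle,
  -- further down, and along the small circle to `-exp a`. The first two pieces are outside the
  -- `z`-circle (`χ = 0`), the last two inside (`χ = 1`).
  have t1 := tendsto_integral_piece h hx0 hx1 P Q (γ := circleMap 0 (Real.exp b))
    (γ' := fun t => circleMap 0 (Real.exp b) t * I) (a := 0) (b := σ * θ b) (χ := 0)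
    (continuous_circleMap _ _).continuousOn (harcc _).continuousOn (fun t _ => hbreg t)
    (ae_of_all _ fun t _ => hbE _ (hn b t)) (harcint _ _ _)
    (Or.inl ⟨rfl, ae_of_all _ fun t _ => by rw [hn]; exact hltb⟩)
  have t2 := tendsto_integral_piece h hx0 hx1 P Q (γ := γ) (γ' := γ') (a := b) (b := s₀) (χ := 0)
    (fun s _ => (hγd s).continuousAt.continuousWithinAt) hγc'.continuousOn (fun s _ => hcreg s)
    (hne.mono fun s hs _ => hcE s hs) (hcross _ _)
    (Or.inl ⟨rfl, hne.mono fun s hs hs' => by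
      rw [hγn, ← hes₀]
      refine Real.exp_lt_exp.2 (lt_of_le_of_ne ?_ hs.symm)
      rw [Set.uIoc_of_ge hb.le] at hs'
      exact hs'.1.le⟩)
  have t3 := tendsto_integral_piece h hx0 hx1 P Q (γ := γ) (γ' := γ') (a := s₀) (b := a) (χ := 1)
    (fun s _ => (hγd s).continuousAt.continuousWithinAt) hγc'.continuousOn (fun s _ => hcreg s)
    (hne.mono fun s hs _ => hcE s hs) (hcross _ _)
    (Or.inr ⟨rfl, hne.mono fun s hs hs' => by
      rw [hγn, ← hes₀]
      refine Real.exp_lt_exp.2 (lt_of_le_of_ne ?_ hs)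
      rw [Set.uIoc_of_ge ha.le] at hs'
      exact hs'.2⟩)
  have t4 := tendsto_integral_piece h hx0 hx1 P Q (γ := circleMap 0 (Real.exp a))
    (γ' := fun t => circleMap 0 (Real.exp a) t * I) (a := σ * θ a) (b := σ * Real.pi) (χ := 1)
    (continuous_circleMap _ _).continuousOn (harcc _).continuousOn (fun t _ => hareg t)
    (ae_of_all _ fun t _ => haE _ (hn a t)) (harcint _ _ _)
    (Or.inr ⟨rfl, ae_of_all _ fun t _ => by rw [hn]; exact hlta⟩)
  have hend : circleMap 0 (Real.exp a) (σ * Real.pi) = ((-Real.exp a : ℝ) : ℂ) := by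
    rcases hσ with rfl | rfl
    · rw [one_mul, circleMap_pi]
    · rw [neg_one_mul, circleMap_neg_pi]
  have hγs₀ : γ s₀ = circleMap 0 ‖z₀‖ (σ * z₀.arg) := by
    rw [hγ]
    simp only
    rw [hes₀, hθ0]
  have hκc : ∀ z, Regular α β z → ContinuousAt (diagK α β P Q) z := fun z hz =>
    hz.differentiableAt_mono.continuousAt
  have k3 := integral_comp_path (f := diagK α β P Q) (J := Jκ) (γ := γ) (γ' := γ') (a := s₀) (b := a)
    (fun s _ => hγd s) hγc'.continuousOn (fun s _ => hJκ _ (hcim s) (hcreg s))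
    (fun s _ => hκc _ (hcreg s))
  have k4 := integral_comp_path (f := diagK α β P Q) (J := Jκ) (γ := circleMap 0 (Real.exp a))
    (γ' := fun t => circleMap 0 (Real.exp a) t * I) (a := σ * θ a) (b := σ * Real.pi)
    (fun t _ => harcd _ t) (harcc _).continuousOn
    (fun t ht => hJκ _ (mul_im_nonneg_of_angle hσ (Real.exp_pos a).le (hsub _ _ hσa hσπ t ht))
      (hareg t)) (fun t _ => hκc _ (hareg t))
  have hsum := ((t1.add t2).add t3).add t4
  rw [k3, k4, hend, hγs₀] at hsum
  -- The contributions of the two inner pieces telescope to the increment of `Jκ` from the saddle to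
  -- `-exp a`.
  have hlimit : (-0 * (2 * Real.pi * I) * ∫ t in (0 : ℝ)..(σ * θ b),
        diagK α β P Q (circleMap 0 (Real.exp b) t) * (circleMap 0 (Real.exp b) t * I)) +
      (-0 * (2 * Real.pi * I) * ∫ t in b..s₀, diagK α β P Q (γ t) * γ' t) +
      -1 * (2 * Real.pi * I) * (Jκ (γ a) - Jκ (circleMap 0 ‖z₀‖ (σ * z₀.arg))) +
      -1 * (2 * Real.pi * I) * (Jκ ((-Real.exp a : ℝ) : ℂ) -
        Jκ (circleMap 0 (Real.exp a) (σ * θ a))) =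
      -(2 * Real.pi * I) * (Jκ ((-Real.exp a : ℝ) : ℂ) -
        Jκ (circleMap 0 ‖z₀‖ (σ * z₀.arg))) := by
    rw [hγ]
    ring
  rw [hlimit] at hsum
  refine hsum.congr' ?_
  filter_upwards [hJ, eventually_differentiableAt_phiK (α := α) (β := β) hx0 hx1 P] with N hN hφ
  have hfc : ∀ z, Regular α β z → ContinuousAt (fun z => psiK α β N (site N p + Q) z *
      cauchyPart (phiK α β N (site N p + P)) z) z := by
    intro z hz
    rw [psiK_site]
    exact hz.differentiableAt_mono.continuousAt.mul
      (differentiableAt_cauchyPart hφ hz.1).continuousAt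
  have i1 := integral_comp_path (J := J N) (f := fun z => psiK α β N (site N p + Q) z *
      cauchyPart (phiK α β N (site N p + P)) z) (γ := circleMap 0 (Real.exp b))
    (γ' := fun t => circleMap 0 (Real.exp b) t * I) (a := 0) (b := σ * θ b)
    (fun t _ => harcd _ t) (harcc _).continuousOn
    (fun t ht => hN _ (mul_im_nonneg_of_angle hσ (Real.exp_pos b).le (hsub _ _ hσ0 hσb t ht))
      (hbreg t)) (fun t _ => hfc _ (hbreg t))
  have i2 := integral_comp_path (J := J N) (f := fun z => psiK α β N (site N p + Q) z *
      cauchyPart (phiK α β N (site N p + P)) z) (γ := γ) (γ' := γ') (a := b) (b := s₀)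
    (fun s _ => hγd s) hγc'.continuousOn (fun s _ => hN _ (hcim s) (hcreg s))
    (fun s _ => hfc _ (hcreg s))
  have i3 := integral_comp_path (J := J N) (f := fun z => psiK α β N (site N p + Q) z *
      cauchyPart (phiK α β N (site N p + P)) z) (γ := γ) (γ' := γ') (a := s₀) (b := a)
    (fun s _ => hγd s) hγc'.continuousOn (fun s _ => hN _ (hcim s) (hcreg s))
    (fun s _ => hfc _ (hcreg s))
  have i4 := integral_comp_path (J := J N) (f := fun z => psiK α β N (site N p + Q) z *
      cauchyPart (phiK α β N (site N p + P)) z) (γ := circleMap 0 (Real.exp a))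
    (γ' := fun t => circleMap 0 (Real.exp a) t * I) (a := σ * θ a) (b := σ * Real.pi)
    (fun t _ => harcd _ t) (harcc _).continuousOn
    (fun t ht => hN _ (mul_im_nonneg_of_angle hσ (Real.exp_pos a).le (hsub _ _ hσa hσπ t ht))
      (hareg t)) (fun t _ => hfc _ (hareg t))
  rw [i1, i2, i3, i4, hend, circleMap_zero_angle]
  have hγb : γ b = circleMap 0 (Real.exp b) (σ * θ b) := rfl
  have hγa : γ a = circleMap 0 (Real.exp a) (σ * θ a) := rfl
  rw [hγb, hγa]
  ring

end

end TowerDimer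

end

/-! ### Convergence of the Schur kernel to the Gibbs kernel. -/

noncomputable section

namespace TowerDimer

open MeasureTheory Filter Topology Metric Complex Bornology

section

variable {α β : ℝ}

theorem gibbsIntegrand_eq_diagK (P Q : Pt) {z : ℂ} (hz : z ≠ 0) :
    gibbsIntegrand α β P Q z = diagK α β P Q z := by
  have h1 : (1 : ℂ) - z⁻¹ = (z - 1) * z⁻¹ := by field_simp
  have h2 : (1 : ℂ) - α * z⁻¹ = (z - α) * z⁻¹ := by field_simp
  have hC : ∀ X, expC X = tOf X - ind (mOf X = 3) := by
    intro X
    obtain ⟨-, h1, h3⟩ := eq_three_mul_tOf_sub_mOf X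
    unfold expC ind
    split_ifs <;> omega
  have hB : ∀ X, expB X = tOf X - 1 + ind (mOf X = 1) := fun X => rfl
  unfold gibbsIntegrand diagK mono
  rw [h1, h2, mul_zpow, mul_zpow, inv_zpow', inv_zpow', hC, hC, hB, hB]
  generalize (1 + (β : ℂ) * z) = A
  have e1 : tOf P.1 - 1 + ind (mOf P.1 = 1) - (tOf Q.1 - 1 + ind (mOf Q.1 = 1)) =
      tOf P.1 - tOf Q.1 + ind (mOf P.1 = 1) - ind (mOf Q.1 = 1) := by ring
  have e2 : tOf P.1 - ind (mOf P.1 = 3) - (tOf Q.1 - ind (mOf Q.1 = 3)) =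
      tOf P.1 - tOf Q.1 - ind (mOf P.1 = 3) + ind (mOf Q.1 = 3) := by ring
  rw [e1, e2]
  have e3 : z ^ (tOf Q.1 - 1 + ind (mOf Q.1 = 1) + (tOf Q.1 - ind (mOf Q.1 = 3)) -
      (tOf P.1 - 1 + ind (mOf P.1 = 1)) - (tOf P.1 - ind (mOf P.1 = 3)) + Q.2 - P.2 - 1) =
      z ^ (-(tOf P.1 - tOf Q.1 + ind (mOf P.1 = 1) - ind (mOf Q.1 = 1))) *
      z ^ (-(tOf P.1 - tOf Q.1 - ind (mOf P.1 = 3) + ind (mOf Q.1 = 3))) * z ^ (Q.2 - P.2 - 1) := by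
    rw [← zpow_add₀ hz, ← zpow_add₀ hz]
    congr 1
    ring
  rw [e3]
  ring

/-- For `X' ≥ X` the diagonal function `diagK` therefore has no poles at `1` and `α`; by
`tOf_le_of_le`, for `X' < X` it has none at `-1 / β`. This decides on which side of the origin the
arc of the Gibbs kernel may pass. -/
theorem expBC_le_of_le {X X' : ℤ} (h : X ≤ X') : expB X ≤ expB X' ∧ expC X ≤ expC X' := by
  unfold expB expC tOf mOf ind
  constructor <;> split_ifs <;> omega

theorem tOf_le_of_le {X X' : ℤ} (h : X ≤ X') : tOf X ≤ tOf X' := by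
  unfold tOf
  omega

/-- The part of the Gibbs kernel along an arc in a half plane. -/
theorem integral_gibbs_arc (P Q : Pt) {S : Set ℝ} {J : ℂ → ℂ} {σ r : ℝ} (hr : 0 < r)
    (hκ : ∀ z : ℂ, (∀ a ∈ S, z ≠ (a : ℝ)) → DifferentiableAt ℂ (diagK α β P Q) z)
    (hJ : ∀ z : ℂ, 0 ≤ σ * z.im → (∀ a ∈ S, z ≠ (a : ℝ)) → HasDerivAt J (diagK α β P Q z) z)
    {c d : ℝ} (hS : ∀ t ∈ Set.uIcc c d, 0 ≤ σ * (circleMap 0 r t).im ∧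
      ∀ a ∈ S, circleMap 0 r t ≠ (a : ℝ)) :
    IntervalIntegrable (fun t => gibbsIntegrand α β P Q (circleMap 0 r t) * deriv (circleMap 0 r) t)
      volume c d ∧
    ∫ t in c..d, gibbsIntegrand α β P Q (circleMap 0 r t) * deriv (circleMap 0 r) t =
      J (circleMap 0 r d) - J (circleMap 0 r c) := by
  have h0 : (fun t => gibbsIntegrand α β P Q (circleMap 0 r t) * deriv (circleMap 0 r) t) =
      fun t => diagK α β P Q (circleMap 0 r t) * (circleMap 0 r t * I) := by
    funext t
    rw [gibbsIntegrand_eq_diagK P Q (circleMap_ne_center hr.ne'), deriv_circleMap]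
  have hc : Continuous fun t => circleMap 0 r t * I := by fun_prop
  rw [h0]
  refine ⟨ContinuousOn.intervalIntegrable (ContinuousOn.mul (fun t ht => ?_) hc.continuousOn), ?_⟩
  · exact ((hκ _ (hS t ht).2).continuousAt.comp
      (continuous_circleMap 0 r).continuousAt).continuousWithinAt
  · exact integral_comp_path (fun t _ => hasDerivAt_circleMap 0 r t) hc.continuousOn
      (fun t ht => hJ _ (hS t ht).1 (hS t ht).2) fun t ht => (hκ _ (hS t ht).2).continuousAt

/-- With the `z`-contour inside, the inner integral is `cauchyPart`, free of the pole at `w`. The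
`w`-circle is then cut at its real points, and each half is evaluated by a primitive and deformed in
its half plane. -/
theorem IsSaddle.tendsto_dblInt {p : ℝ × ℝ} {z₀ : ℂ} (h : IsSaddle α β p.1 p.2 z₀) (hα : 0 < α)
    (hβ : 0 < β) (hp : p ∈ domain) (P Q : Pt) {Jp Jm : ℂ → ℂ}
    (hJp : ∀ z : ℂ, 0 ≤ z.im → Regular α β z → HasDerivAt Jp (diagK α β P Q z) z)
    (hJm : ∀ z : ℂ, z.im ≤ 0 → Regular α β z → HasDerivAt Jm (diagK α β P Q z) z) :
    ∃ a : ℝ, Real.exp a < ‖z₀‖ ∧ Real.exp a < 1 / β ∧ Tendsto (fun N => dblInt α (innerRadius α β)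
      (outerRadius α β) (phiK α β N (site N p + P)) (psiK α β N (site N p + Q))) atTop
      (𝓝 (-(2 * Real.pi * I) * ((Jp ((-Real.exp a : ℝ) : ℂ) - Jp z₀) -
        (Jm ((-Real.exp a : ℝ) : ℂ) - Jm ((starRingEnd ℂ) z₀))))) := by
  obtain ⟨hx0, hx1, hu, hu'⟩ := hp
  obtain ⟨θ, hθ, hθI, hθ0, hθE⟩ := h.exists_curve hα hβ hx0 hx1 (by linarith)
  have hr₀ : 0 < ‖z₀‖ := norm_pos_iff.2 h.crit.1
  obtain ⟨a₀, b₀, hab⟩ := exists_energy_large hα hβ (x := p.1) (u := p.2) (by linarith)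
    (by linarith) (energy α β p.1 p.2 z₀)
  have hb : 0 < 1 / β := by positivity
  obtain ⟨r1, r2, r3⟩ := radii_lt (α := α) hβ
  -- The radii are chosen so that the energy is large on both circles, the saddle is strictly
  -- between them, `-exp a` lies in `(-1 / β, 0)`, and `exp b` lies to the right of `1` and `α`.
  set a := min a₀ (min (Real.log ‖z₀‖ - 1) (Real.log (1 / β) - 1)) with ha
  set b := max b₀ (max (Real.log ‖z₀‖ + 1) (Real.log (1 + α) + 1)) with hb'
  have ha1 : a < Real.log ‖z₀‖ := by
    have : a ≤ Real.log ‖z₀‖ - 1 := (min_le_right _ _).trans (min_le_left _ _)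
    linarith
  have ha2 : a < Real.log (1 / β) := by
    have : a ≤ Real.log (1 / β) - 1 := (min_le_right _ _).trans (min_le_right _ _)
    linarith
  have hb1 : Real.log ‖z₀‖ < b := by
    have : Real.log ‖z₀‖ + 1 ≤ b := (le_max_left _ _).trans (le_max_right _ _)
    linarith
  have hb2 : Real.log (1 + α) < b := by
    have : Real.log (1 + α) + 1 ≤ b := (le_max_right _ _).trans (le_max_right _ _)
    linarith
  have ha1' := Real.exp_lt_exp.2 ha1
  have ha2' := Real.exp_lt_exp.2 ha2
  have hb2' := Real.exp_lt_exp.2 hb2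
  rw [Real.exp_log hr₀] at ha1'
  rw [Real.exp_log hb] at ha2'
  rw [Real.exp_log (by linarith)] at hb2'
  have haE : ∀ z, ‖z‖ = Real.exp a → energy α β p.1 p.2 z₀ < energy α β p.1 p.2 z := by
    intro z hz
    refine (hab z ?_).1 ?_
    · rw [← norm_pos_iff, hz]; exact Real.exp_pos a
    · rw [hz]; exact Real.exp_le_exp.2 (min_le_left _ _)
  have hbE : ∀ z, ‖z‖ = Real.exp b → energy α β p.1 p.2 z₀ < energy α β p.1 p.2 z := by
    intro z hz
    refine (hab z ?_).2 ?_
    · rw [← norm_pos_iff, hz]; exact Real.exp_pos b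
    · rw [hz]; exact Real.exp_le_exp.2 (le_max_left _ _)
  refine ⟨a, ha1', ha2', ?_⟩
  obtain ⟨N₁, hN₁⟩ := Filter.eventually_atTop.1
    (eventually_differentiableAt_phiK (α := α) (β := β) hx0 hx1 P)
  set f : ℕ → ℂ → ℂ := fun N z =>
    psiK α β N (site N p + Q) z * cauchyPart (phiK α β N (site N p + P)) z with hf
  have hfd : ∀ N, N₁ ≤ N → ∀ z : ℂ, (∀ a ∈ singularSet α β, z ≠ (a : ℝ)) →
      DifferentiableAt ℂ (f N) z := by
    intro N hN z hz
    rw [regular_iff_singularSet hβ] at hz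
    rw [hf]
    simp only
    rw [psiK_site]
    exact hz.differentiableAt_mono.mul (differentiableAt_cauchyPart (hN₁ N hN) hz.1)
  have hex : ∀ σ : ℝ, σ * σ = 1 → ∃ J : ℕ → ℂ → ℂ, ∀ N, N₁ ≤ N → ∀ z : ℂ, 0 ≤ σ * z.im →
      (∀ a ∈ singularSet α β, z ≠ (a : ℝ)) → HasDerivAt (J N) (f N z) z := by
    intro σ hσ
    have : ∀ N, ∃ J : ℂ → ℂ, N₁ ≤ N → ∀ z : ℂ, 0 ≤ σ * z.im →
      (∀ a ∈ singularSet α β, z ≠ (a : ℝ)) → HasDerivAt J (f N z) z := by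
      intro N
      by_cases hN : N₁ ≤ N
      · obtain ⟨J, hJ⟩ := exists_primitive_halfPlane finite_singularSet (hfd N hN) hσ
        exact ⟨J, fun _ => hJ⟩
      · exact ⟨0, fun h => absurd h hN⟩
    choose J hJ using this
    exact ⟨J, hJ⟩
  obtain ⟨Kp, hKp⟩ := hex 1 (by norm_num)
  obtain ⟨Km, hKm⟩ := hex (-1) (by norm_num)
  have T1 := h.tendsto_half hx0 hx1 P Q (Or.inl rfl) hθ hθI hθ0 hθE ha1 hb1 haE hbE (J := Kp)
    (Jκ := Jp) (by
      filter_upwards [Filter.eventually_ge_atTop N₁] with N hN z hz hz'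
      exact hKp N hN z hz ((regular_iff_singularSet hβ).2 hz'))
    (fun z hz hz' => hJp z (by linarith) hz')
  have T2 := h.tendsto_half hx0 hx1 P Q (Or.inr rfl) hθ hθI hθ0 hθE ha1 hb1 haE hbE (J := Km)
    (Jκ := Jm) (by
      filter_upwards [Filter.eventually_ge_atTop N₁] with N hN z hz hz'
      exact hKm N hN z hz ((regular_iff_singularSet hβ).2 hz'))
    (fun z hz hz' => hJm z (by linarith) hz')
  rw [one_mul, circleMap_arg] at T1
  rw [neg_one_mul, circleMap_neg, circleMap_arg] at T2
  have T := T1.sub T2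
  rw [← mul_sub] at T
  refine T.congr' ?_
  filter_upwards [Filter.eventually_ge_atTop N₁] with N hN
  have hp' : ∀ z : ℂ, 0 ≤ z.im → (∀ a ∈ singularSet α β, z ≠ (a : ℝ)) →
      HasDerivAt (Kp N) (f N z) z := fun z hz => hKp N hN z (by linarith)
  have hm' : ∀ z : ℂ, z.im ≤ 0 → (∀ a ∈ singularSet α β, z ≠ (a : ℝ)) →
      HasDerivAt (Km N) (f N z) z := fun z hz => hKm N hN z (by linarith)
  rw [dblInt_swap (f := phiK α β N (site N p + P)) (g := psiK α β N (site N p + Q))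
    (by linarith) (by linarith) r2.ne
    (by rw [phiK_site]; exact continuousOn_mono_sphere hα hβ r1 (r2.trans r3))
    (by rw [psiK_site]; exact continuousOn_mono_sphere hα hβ (r1.trans r2) r3)]
  have hcirc : (∮ w in C(contourCentre α, outerRadius α β), psiK α β N (site N p + Q) w *
      ∮ z in C(contourCentre α, innerRadius α β), phiK α β N (site N p + P) z * (z - w)⁻¹) =
      ∮ w in C(((1 + α : ℝ) : ℂ), outerRadius α β), f N w := by
    refine circleIntegral.integral_congr (by linarith) fun w hw => ?_
    rw [mem_sphere] at hw
    have hreg := contour_avoid hα hβ (z := w) (by rw [hw]; linarith) (by rw [hw]; exact r3)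
    simp only [hf]
    rw [contourCentre, circleIntegral_cauchy_of_notMem (hN₁ N hN) hreg.2.2.2
      (by rw [abs_of_pos (by linarith)]; exact r1) (by
        rw [mem_closedBall, not_le, ← contourCentre, hw]; exact r2)]
  rw [hcirc, circleIntegral_eq_primitive (hfd N hN) hp' hm' (by linarith)]
  -- The endpoints slide along real intervals without singularities: on the left inside `(-1 / β,
  -- 0)`, on the right beyond `1 + α`.
  · have e1 := primitive_sub_eq (hfd N hN) hp' hm' (p := 1 + α - outerRadius α β)
      (q := -Real.exp a) (by
        have := Real.exp_pos a
        intro s hs hs'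
        rw [Set.mem_uIcc] at hs'
        unfold singularSet at hs
        simp only [Set.mem_insert_iff, Set.mem_singleton_iff] at hs
        rcases hs with rfl | rfl | rfl | rfl <;> rcases hs' with hs' | hs' <;>
          linarith [hs'.1, hs'.2])
    have e2 := primitive_sub_eq (hfd N hN) hp' hm' (p := 1 + α + outerRadius α β)
      (q := Real.exp b) (by
        have := Real.exp_pos b
        intro s hs hs'
        rw [Set.mem_uIcc] at hs'
        unfold singularSet at hs
        simp only [Set.mem_insert_iff, Set.mem_singleton_iff] at hs
        rcases hs with rfl | rfl | rfl | rfl <;> rcases hs' with hs' | hs' <;>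
          linarith [hs'.1, hs'.2])
    linear_combination e1 - e2
  · intro s hs hs'
    rw [← contourCentre, mem_sphere] at hs'
    exact (regular_iff_singularSet hβ).2 (contour_avoid hα hβ (by rw [hs']; linarith)
      (by rw [hs']; exact r3) |> fun h => ⟨h.2.2.2, h.2.1, h.2.2.1, h.1⟩) s hs rfl

/-- Convergence of the extended kernels at a point with a saddle. -/
theorem IsSaddle.kernelConverges {p : ℝ × ℝ} {z₀ : ℂ} (h : IsSaddle α β p.1 p.2 z₀) (hα : 0 < α)
    (hβ : 0 < β) (hp : p ∈ domain) : KernelConverges α β p z₀ := by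
  intro P Q
  have hr₀ : 0 < ‖z₀‖ := norm_pos_iff.2 h.crit.1
  have hreg₀ := (isCriticalPoint_iff.1 h.crit).1
  have hS₀ := (regular_iff_singularSet hβ).2 hreg₀
  obtain ⟨r1, r2, r3⟩ := radii_lt (α := α) hβ
  have hb : 0 < 1 / β := by positivity
  have harg : z₀.arg ∈ Set.Icc 0 Real.pi :=
    ⟨Complex.arg_nonneg_iff.2 h.im_nonneg, Complex.arg_le_pi _⟩
  -- points of the circle through the saddle avoid a set of real points
  have hplus : ∀ S ⊆ singularSet α β, ∀ t, t ∈ Set.Icc 0 Real.pi →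
      (t = 0 → ‖z₀‖ ∉ S ∨ t = z₀.arg) → (t = Real.pi → -‖z₀‖ ∉ S ∨ t = z₀.arg) →
      0 ≤ 1 * (circleMap 0 ‖z₀‖ t).im ∧ ∀ a ∈ S, circleMap 0 ‖z₀‖ t ≠ (a : ℝ) := by
    intro S hS t ht h0 hπ
    refine ⟨mul_im_nonneg_of_angle (Or.inl rfl) hr₀.le (by rwa [one_mul]), fun a ha hta => ?_⟩
    have hz : t = z₀.arg → False := by
      rintro rfl
      rw [circleMap_arg] at hta
      exact hS₀ a (hS ha) hta
    rcases ht.1.eq_or_lt with h1 | h1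
    · rcases h0 h1.symm with h2 | h2
      · rw [← h1, circleMap_zero_angle, Complex.ofReal_inj] at hta
        exact h2 (hta ▸ ha)
      · exact hz h2
    · rcases ht.2.eq_or_lt with h3 | h3
      · rcases hπ h3 with h2 | h2
        · rw [h3, circleMap_pi, Complex.ofReal_inj] at hta
          exact h2 (hta ▸ ha)
        · exact hz h2
      · have h4 := congrArg Complex.im hta
        rw [im_circleMap_zero, Complex.ofReal_im] at h4
        exact (mul_pos hr₀ (Real.sin_pos_of_pos_of_lt_pi h1 h3)).ne' h4
  have hconj : ∀ S : Set ℝ, ∀ t, (0 ≤ 1 * (circleMap 0 ‖z₀‖ t).im ∧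
      ∀ a ∈ S, circleMap 0 ‖z₀‖ t ≠ (a : ℝ)) → (0 ≤ -1 * (circleMap 0 ‖z₀‖ (-t)).im ∧
      ∀ a ∈ S, circleMap 0 ‖z₀‖ (-t) ≠ (a : ℝ)) := by
    rintro S t ⟨h1, h2⟩
    rw [circleMap_neg]
    refine ⟨by rw [Complex.conj_im]; linarith, fun a ha h3 => h2 a ha ?_⟩
    have := congrArg (starRingEnd ℂ) h3
    rwa [Complex.conj_conj, Complex.conj_ofReal] at this
  by_cases hPQ : Q.1 ≤ P.1
  -- The only possible singularities of the diagonal function in this case; the positive half line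
  -- is free, so the primitives may be compared at `‖z₀‖`.
  · set S : Set ℝ := {-(1 / β), 0} with hS
    have hSsub : S ⊆ singularSet α β := by
      rw [hS]
      unfold singularSet
      intro s hs
      simp only [Set.mem_insert_iff, Set.mem_singleton_iff] at hs ⊢
      tauto
    have hSfin : S.Finite := Set.toFinite _
    have hκ : ∀ z : ℂ, (∀ a ∈ S, z ≠ (a : ℝ)) → DifferentiableAt ℂ (diagK α β P Q) z := by
      intro z hz
      obtain ⟨h1, h2⟩ := expBC_le_of_le hPQ
      refine differentiableAt_mono (Or.inl ?_) (Or.inr (by omega)) (Or.inr (by omega)) (Or.inl ?_)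
      · intro h3
        refine hz (-(1 / β)) (by simp [hS]) ?_
        have : (β : ℂ) ≠ 0 := by exact_mod_cast hβ.ne'
        push_cast
        field_simp
        linear_combination h3
      · simpa using hz 0 (by simp [hS])
    obtain ⟨Jp, hJp⟩ := exists_primitive_halfPlane hSfin hκ (σ := 1) (by norm_num)
    obtain ⟨Jm, hJm⟩ := exists_primitive_halfPlane hSfin hκ (σ := -1) (by norm_num)
    have hreg : ∀ z, Regular α β z → ∀ a ∈ S, z ≠ (a : ℝ) := fun z hz a ha =>
      (regular_iff_singularSet hβ).2 hz a (hSsub ha)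
    have hJp' : ∀ z : ℂ, 0 ≤ z.im → (∀ a ∈ S, z ≠ (a : ℝ)) →
      HasDerivAt Jp (diagK α β P Q z) z := fun z hz => hJp z (by linarith)
    have hJm' : ∀ z : ℂ, z.im ≤ 0 → (∀ a ∈ S, z ≠ (a : ℝ)) →
      HasDerivAt Jm (diagK α β P Q z) z := fun z hz => hJm z (by linarith)
    obtain ⟨a, -, ha, T⟩ := h.tendsto_dblInt hα hβ hp P Q (Jp := Jp) (Jm := Jm)
      (fun z hz hz' => hJp' z hz (hreg z hz')) (fun z hz hz' => hJm' z hz (hreg z hz'))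
    have hcircle := circleIntegral_eq_primitive hκ hJp' hJm' (c := 1 + α) (r := innerRadius α β)
      (by linarith) (by
        intro s hs hs'
        rw [← contourCentre, mem_sphere] at hs'
        have hav := contour_avoid hα hβ (by rw [hs']; linarith) (by rw [hs']; linarith)
        exact hreg _ ⟨hav.2.2.2, hav.2.1, hav.2.2.1, hav.1⟩ s hs rfl)
    have e1 := primitive_sub_eq hκ hJp' hJm' (p := 1 + α - innerRadius α β)
      (q := -Real.exp a) (by
        have := Real.exp_pos a
        intro s hs hs'
        rw [Set.mem_uIcc] at hs'
        rw [hS] at hs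
        simp only [Set.mem_insert_iff, Set.mem_singleton_iff] at hs
        rcases hs with rfl | rfl <;> rcases hs' with hs' | hs' <;> linarith [hs'.1, hs'.2])
    have e2 := primitive_sub_eq hκ hJp' hJm' (p := 1 + α + innerRadius α β)
      (q := ‖z₀‖) (by
        intro s hs hs'
        rw [Set.mem_uIcc] at hs'
        rw [hS] at hs
        simp only [Set.mem_insert_iff, Set.mem_singleton_iff] at hs
        rcases hs with rfl | rfl <;> rcases hs' with hs' | hs' <;> linarith [hs'.1, hs'.2])
    have hr0S : ‖z₀‖ ∉ S := by
      rw [hS]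
      simp only [Set.mem_insert_iff, Set.mem_singleton_iff]
      rintro (h1 | h1) <;> linarith
    have hcirc' : ∀ t ∈ Set.uIcc 0 z₀.arg, 0 ≤ 1 * (circleMap 0 ‖z₀‖ t).im ∧
        ∀ a ∈ S, circleMap 0 ‖z₀‖ t ≠ (a : ℝ) := by
      intro t ht
      rw [Set.uIcc_of_le harg.1] at ht
      exact hplus S hSsub t ⟨ht.1, ht.2.trans harg.2⟩ (fun _ => Or.inl hr0S) fun hπ =>
        Or.inr (le_antisymm ht.2 (hπ ▸ harg.2))
    obtain ⟨i1, i2⟩ := integral_gibbs_arc P Q hr₀ hκ hJp (c := 0) (d := z₀.arg) hcirc'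
    obtain ⟨j1, j2⟩ := integral_gibbs_arc P Q hr₀ hκ hJm (c := -z₀.arg) (d := 0) (by
      intro t ht
      have := hconj S (-t) (hcirc' (-t) (by
        rw [Set.uIcc_of_le (by linarith [harg.1])] at ht
        rw [Set.uIcc_of_le harg.1]
        exact ⟨by linarith [ht.2], by linarith [ht.1]⟩))
      rwa [neg_neg] at this)
    have hG : gibbsKernel α β z₀ P Q = 1 / (2 * Real.pi * I) * ((Jp z₀ - Jp (‖z₀‖ : ℂ)) +
        (Jm (‖z₀‖ : ℂ) - Jm ((starRingEnd ℂ) z₀))) := by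
      unfold gibbsKernel
      rw [if_pos hPQ, ← intervalIntegral.integral_add_adjacent_intervals j1 i1, i2, j2,
        circleMap_zero_angle, circleMap_neg, circleMap_arg]
      ring
    have T' := (T.add_const (2 * Real.pi * I * ∮ z in C(((1 + α : ℝ) : ℂ), innerRadius α β),
      diagK α β P Q z)).const_mul (1 / (2 * Real.pi * I) ^ 2)
    -- The residue circle cancels the terms at `-exp a` and leaves those at the positive point
    -- `‖z₀‖`, which form the arc on the right of the origin.
    have hval : gibbsKernel α β z₀ P Q = 1 / (2 * Real.pi * I) ^ 2 *
        (-(2 * Real.pi * I) * ((Jp ((-Real.exp a : ℝ) : ℂ) - Jp z₀) -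
        (Jm ((-Real.exp a : ℝ) : ℂ) - Jm ((starRingEnd ℂ) z₀))) +
        2 * Real.pi * I * ∮ z in C(((1 + α : ℝ) : ℂ), innerRadius α β), diagK α β P Q z) := by
      rw [hG, hcircle]
      have hpi := Complex.two_pi_I_ne_zero
      field_simp
      linear_combination e1 - e2
    rw [hval]
    refine T'.congr fun N => ?_
    rw [schurKernel_eq hα hβ, if_pos (by simpa using hPQ), dblInt_exchange hα hβ
      (f := phiK α β N (site N p + P)) (g := psiK α β N (site N p + Q))
      (fun z h1 h2 => by rw [phiK_site]; exact differentiableAt_mono_annulus hα hβ h1 h2)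
      (fun z h1 h2 => by rw [psiK_site]; exact differentiableAt_mono_annulus hα hβ h1 h2)]
    congr 3
    refine (circleIntegral.integral_congr (by linarith) fun z hz => ?_).symm
    rw [← contourCentre, mem_sphere] at hz
    have hav := contour_avoid hα hβ (by rw [hz]; linarith) (by rw [hz]; linarith)
    exact phiK_mul_psiK_site N p P Q ⟨hav.2.2.2, hav.2.1, hav.2.2.1, hav.1⟩
  -- Now the negative half line is free and there is no residue circle: the terms at `-exp a` move
  -- to `-‖z₀‖` and form the arc on the left.
  · set S : Set ℝ := {0, 1, α} with hS
    have hSsub : S ⊆ singularSet α β := by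
      rw [hS]
      unfold singularSet
      intro s hs
      simp only [Set.mem_insert_iff, Set.mem_singleton_iff] at hs ⊢
      tauto
    have hSfin : S.Finite := Set.toFinite _
    have hκ : ∀ z : ℂ, (∀ a ∈ S, z ≠ (a : ℝ)) → DifferentiableAt ℂ (diagK α β P Q) z := by
      intro z hz
      have h1 := tOf_le_of_le (not_le.1 hPQ).le
      refine differentiableAt_mono (Or.inr (by omega)) (Or.inl ?_) (Or.inl ?_) (Or.inl ?_)
      · simpa using hz 1 (by simp [hS])
      · exact hz α (by simp [hS])
      · simpa using hz 0 (by simp [hS])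
    obtain ⟨Jp, hJp⟩ := exists_primitive_halfPlane hSfin hκ (σ := 1) (by norm_num)
    obtain ⟨Jm, hJm⟩ := exists_primitive_halfPlane hSfin hκ (σ := -1) (by norm_num)
    have hreg : ∀ z, Regular α β z → ∀ a ∈ S, z ≠ (a : ℝ) := fun z hz a ha =>
      (regular_iff_singularSet hβ).2 hz a (hSsub ha)
    have hJp' : ∀ z : ℂ, 0 ≤ z.im → (∀ a ∈ S, z ≠ (a : ℝ)) →
      HasDerivAt Jp (diagK α β P Q z) z := fun z hz => hJp z (by linarith)
    have hJm' : ∀ z : ℂ, z.im ≤ 0 → (∀ a ∈ S, z ≠ (a : ℝ)) →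
      HasDerivAt Jm (diagK α β P Q z) z := fun z hz => hJm z (by linarith)
    obtain ⟨a, -, ha, T⟩ := h.tendsto_dblInt hα hβ hp P Q (Jp := Jp) (Jm := Jm)
      (fun z hz hz' => hJp' z hz (hreg z hz')) (fun z hz hz' => hJm' z hz (hreg z hz'))
    have e2 := primitive_sub_eq hκ hJp' hJm' (p := -Real.exp a) (q := -‖z₀‖) (by
        have := Real.exp_pos a
        intro s hs hs'
        rw [Set.mem_uIcc] at hs'
        rw [hS] at hs
        simp only [Set.mem_insert_iff, Set.mem_singleton_iff] at hs
        rcases hs with rfl | rfl | rfl <;> rcases hs' with hs' | hs' <;>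
          linarith [hs'.1, hs'.2])
    have hr0S : -‖z₀‖ ∉ S := by
      rw [hS]
      simp only [Set.mem_insert_iff, Set.mem_singleton_iff]
      rintro (h1 | h1 | h1) <;> linarith
    have hcirc' : ∀ t ∈ Set.uIcc Real.pi z₀.arg, 0 ≤ 1 * (circleMap 0 ‖z₀‖ t).im ∧
        ∀ a ∈ S, circleMap 0 ‖z₀‖ t ≠ (a : ℝ) := by
      intro t ht
      rw [Set.uIcc_of_ge harg.2] at ht
      exact hplus S hSsub t ⟨harg.1.trans ht.1, ht.2⟩ (fun h0 => Or.inr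
        (le_antisymm (h0 ▸ harg.1) ht.1)) fun _ => Or.inl hr0S
    obtain ⟨i1, i2⟩ := integral_gibbs_arc P Q hr₀ hκ hJp (c := Real.pi) (d := z₀.arg) hcirc'
    have hper : ∀ t, circleMap 0 ‖z₀‖ (2 * Real.pi - t) = circleMap 0 ‖z₀‖ (-t) := by
      intro t
      have := periodic_circleMap 0 ‖z₀‖ (-t)
      rwa [neg_add_eq_sub] at this
    obtain ⟨j1, j2⟩ := integral_gibbs_arc P Q hr₀ hκ hJm (c := 2 * Real.pi - z₀.arg)
      (d := Real.pi) (by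
        intro t ht
        have := hconj S (2 * Real.pi - t) (hcirc' (2 * Real.pi - t) (by
          rw [Set.uIcc_of_ge (by linarith [harg.2])] at ht
          rw [Set.uIcc_of_ge harg.2]
          exact ⟨by linarith [ht.2], by linarith [ht.1]⟩))
        rw [← hper] at this
        rwa [sub_sub_cancel] at this)
    have hG : gibbsKernel α β z₀ P Q = 1 / (2 * Real.pi * I) * ((Jp z₀ - Jp ((-‖z₀‖ : ℝ) : ℂ)) +
        (Jm ((-‖z₀‖ : ℝ) : ℂ) - Jm ((starRingEnd ℂ) z₀))) := by
      unfold gibbsKernel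
      rw [if_neg hPQ, ← intervalIntegral.integral_add_adjacent_intervals j1 i1, i2, j2,
        hper, circleMap_pi, circleMap_neg, circleMap_arg]
      ring
    have T' := T.const_mul (1 / (2 * Real.pi * I) ^ 2)
    have hval : gibbsKernel α β z₀ P Q = 1 / (2 * Real.pi * I) ^ 2 *
        (-(2 * Real.pi * I) * ((Jp ((-Real.exp a : ℝ) : ℂ) - Jp z₀) -
        (Jm ((-Real.exp a : ℝ) : ℂ) - Jm ((starRingEnd ℂ) z₀)))) := by
      rw [hG]
      have hpi := Complex.two_pi_I_ne_zero
      field_simp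
      linear_combination -e2
    rw [hval]
    refine T'.congr fun N => ?_
    rw [schurKernel_eq hα hβ, if_neg (by simpa using hPQ)]

end

end TowerDimer

end

/-! ### Compactness for laws of random sets. -/

noncomputable section

namespace TowerDimer

open MeasureTheory Filter Topology

section

variable {ι : Type*}

/-- A set of configurations which depends only on finitely many coordinates. -/
def IsLocal (B : Set (Set ι)) : Prop :=
  ∃ t : Finset ι, ∀ M M' : Set ι, (∀ e ∈ t, e ∈ M ↔ e ∈ M') → M ∈ B → M' ∈ B

theorem IsLocal.compl {B : Set (Set ι)} (h : IsLocal B) : IsLocal Bᶜ := by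
  obtain ⟨t, ht⟩ := h
  exact ⟨t, fun M M' hM hB hB' => hB (ht M' M (fun e he => (hM e he).symm) hB')⟩

theorem isLocal_superset (s : Finset ι) : IsLocal {M : Set ι | (s : Set ι) ⊆ M} :=
  ⟨s, fun _ _ hM h e he => (hM e he).1 (h he)⟩

/-- Random sets are transported to the compact space `ι → Bool`; probabilities of clopen sets pass
to weak limits. -/
theorem isClopen_of_isLocal {B : Set (Set ι)} (h : IsLocal B) :
    IsClopen {ω : ι → Bool | {e | ω e = true} ∈ B} := by
  have key : ∀ B : Set (Set ι), IsLocal B → IsOpen {ω : ι → Bool | {e | ω e = true} ∈ B} := by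
    rintro B ⟨t, ht⟩
    rw [isOpen_iff_mem_nhds]
    intro ω hω
    have h1 : ∀ᶠ ω' in 𝓝 ω, ∀ e ∈ t, ω' e = ω e := by
      rw [Filter.eventually_all_finset]
      intro e _
      have : ContinuousAt (fun ω' : ι → Bool => ω' e) ω := (continuous_apply e).continuousAt
      exact this.eventually (show ∀ᶠ b in 𝓝 (ω e), b = ω e by
        rw [nhds_discrete]
        exact rfl)
    filter_upwards [h1] with ω' hω'
    refine ht _ _ (fun e he => ?_) hω
    show ω e = true ↔ ω' e = true
    rw [hω' e he]
  refine ⟨⟨?_⟩, key B h⟩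
  exact key Bᶜ h.compl

theorem measurable_boolSet : Measurable fun ω : ι → Bool => {e | ω e = true} := by
  rw [measurable_set_iff]
  intro e
  exact (Measurable.of_discrete (f := fun b : Bool => b = true)).comp (measurable_pi_apply e)

open Classical in
theorem measurable_indicatorBool : Measurable fun (M : Set ι) (e : ι) => decide (e ∈ M) := by
  rw [measurable_pi_iff]
  intro e
  exact (Measurable.of_discrete (f := fun q : Prop => decide q)).comp (measurable_set_mem e)

variable [Countable ι]

theorem IsLocal.measurableSet {B : Set (Set ι)} (h : IsLocal B) : MeasurableSet B := by
  classical
  have h1 := measurable_indicatorBool (isClopen_of_isLocal h).isClosed.measurableSet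
  have h2 : (fun (M : Set ι) (e : ι) => decide (e ∈ M)) ⁻¹' {ω : ι → Bool | {e | ω e = true} ∈ B} =
      B := by
    ext M
    simp
  rwa [h2] at h1

/-- Sequences of laws of random sets have limit points for the convergence on local events. -/
theorem exists_local_limit (ν : ℕ → Measure (Set ι)) [∀ N, IsProbabilityMeasure (ν N)]
    (U : Ultrafilter ℕ) : ∃ μ : Measure (Set ι), IsProbabilityMeasure μ ∧
      ∀ B : Set (Set ι), IsLocal B → Tendsto (fun N => (ν N).real B) U (𝓝 (μ.real B)) := by
  classical
  set χ : Set ι → ι → Bool := fun M e => decide (e ∈ M) with hχ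
  have hχm : Measurable χ := measurable_indicatorBool
  have hprob : ∀ N, IsProbabilityMeasure ((ν N).map χ) := fun N =>
    Measure.isProbabilityMeasure_map hχm.aemeasurable
  set ν' : ℕ → ProbabilityMeasure (ι → Bool) := fun N => ⟨(ν N).map χ, hprob N⟩ with hν'
  -- The probability measures on a compact space form a compact space, in which every ultrafilter
  -- converges.
  set κ : ProbabilityMeasure (ι → Bool) := (U.map ν').lim with hκ
  have hlim : Tendsto ν' U (𝓝 κ) := (U.map ν').le_nhds_lim
  set μ : Measure (Set ι) := (κ : Measure (ι → Bool)).map fun ω => {e | ω e = true} with hμ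
  refine ⟨μ, Measure.isProbabilityMeasure_map measurable_boolSet.aemeasurable, fun B hB => ?_⟩
  have h1 := ProbabilityMeasure.tendsto_measure_of_isClopen_of_tendsto hlim (isClopen_of_isLocal hB)
  have h2 : Tendsto (fun N => (((ν' N) {ω : ι → Bool | {e | ω e = true} ∈ B} : NNReal) : ℝ)) U
      (𝓝 ((κ {ω : ι → Bool | {e | ω e = true} ∈ B} : NNReal) : ℝ)) :=
    (NNReal.continuous_coe.tendsto _).comp h1
  have e1 : μ.real B = ((κ {ω : ι → Bool | {e | ω e = true} ∈ B} : NNReal) : ℝ) := by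
    rw [hμ, Measure.real, Measure.map_apply measurable_boolSet hB.measurableSet]
    rfl
  have e2 : ∀ N, (ν N).real B = (((ν' N) {ω : ι → Bool | {e | ω e = true} ∈ B} : NNReal) : ℝ) := by
    intro N
    have : (((ν' N) {ω : ι → Bool | {e | ω e = true} ∈ B} : NNReal) : ℝ) =
        ((ν N).map χ {ω : ι → Bool | {e | ω e = true} ∈ B}).toReal := rfl
    rw [this, Measure.map_apply hχm (isClopen_of_isLocal hB).isClosed.measurableSet, Measure.real]
    congr 2
    ext M
    simp [hχ]
  rw [e1]
  simpa only [e2] using h2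

end

section

variable {ι : Type*}

/-- The events that finitely many given points belong to the random set. -/
def cylinders (ι : Type*) : Set (Set (Set ι)) :=
  Set.range fun s : Finset ι => {M : Set ι | (s : Set ι) ⊆ M}

theorem isPiSystem_cylinders : IsPiSystem (cylinders ι) := by
  classical
  rintro _ ⟨s, rfl⟩ _ ⟨t, rfl⟩ _
  refine ⟨s ∪ t, ?_⟩
  ext M
  simp only [Finset.coe_union, Set.union_subset_iff, Set.mem_inter_iff, Set.mem_ofPred_eq]

theorem measurableSet_superset (s : Finset ι) : MeasurableSet {M : Set ι | (s : Set ι) ⊆ M} := by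
  have : {M : Set ι | (s : Set ι) ⊆ M} = ⋂ e ∈ s, {M : Set ι | e ∈ M} := by
    ext M
    simp [Set.subset_def]
  rw [this]
  exact s.measurableSet_biInter fun e _ => measurableSet_mem e

theorem generateFrom_cylinders :
    (Set.instMeasurableSpace : MeasurableSpace (Set ι)) =
      MeasurableSpace.generateFrom (cylinders ι) := by
  refine le_antisymm ?_ (MeasurableSpace.generateFrom_le ?_)
  · have h1 : @Measurable (Set ι) (Set ι) (MeasurableSpace.generateFrom (cylinders ι))
        Set.instMeasurableSpace id := by
      let := MeasurableSpace.generateFrom (cylinders ι)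
      rw [measurable_set_iff]
      intro e
      refine measurable_to_prop ?_
      refine MeasurableSpace.measurableSet_generateFrom ⟨{e}, ?_⟩
      ext M
      simp
    intro B hB
    exact h1 hB
  · rintro _ ⟨s, rfl⟩
    exact measurableSet_superset s

/-- Laws of random sets are determined by the probabilities of cylinders. -/
theorem ext_of_cylinders {μ ν : Measure (Set ι)} [IsFiniteMeasure μ]
    (h : ∀ s : Finset ι, μ {M | (s : Set ι) ⊆ M} = ν {M | (s : Set ι) ⊆ M}) : μ = ν := by
  refine ext_of_generate_finite (cylinders ι) generateFrom_cylinders isPiSystem_cylinders ?_ ?_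
  · rintro _ ⟨s, rfl⟩
    exact h s
  · have := h ∅
    simpa using this

end

end TowerDimer

end

noncomputable section

namespace TowerDimer

open MeasureTheory Filter Topology

/-! ### Translations -/

theorem shiftEdge_injective (v : Pt) : Function.Injective (shiftEdge v) := by
  intro e e' h
  simp only [shiftEdge, Prod.mk.injEq, add_left_inj] at h
  exact Prod.ext h.1 h.2

theorem isEdge_shiftEdge (a b : ℤ) (e : Edge) : IsEdge (shiftEdge (3 * a, b) e) ↔ IsEdge e := by
  obtain ⟨⟨X, U⟩, ⟨Y, V⟩⟩ := e
  have h0 : (X + 3 * a) % 3 = X % 3 := by omega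
  have h1 : ∀ c d : ℤ, (Y + 3 * a = X + 3 * a + c ∧ V + b = U + b + d) ↔ (Y = X + c ∧ V = U + d) := by
    intros; omega
  have h2 := h1 1 0
  have h3 := h1 1 (-1)
  have h4 := h1 (-1) 0
  have h5 := h1 (-1) 1
  have h6 := h1 0 0
  simp only [add_zero, ← sub_eq_add_neg] at h2 h3 h4 h5 h6
  simp only [IsEdge, shiftEdge, Prod.mk_add_mk, Prod.mk.injEq, h0, h2, h3, h4, h5, h6]

theorem weight_shiftEdge (α β : ℝ) (a b : ℤ) (e : Edge) :
    weight α β (shiftEdge (3 * a, b) e) = weight α β e := by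
  obtain ⟨⟨X, U⟩, ⟨Y, V⟩⟩ := e
  have h0 : (X + 3 * a) % 3 = X % 3 := by omega
  have h1 : ∀ c d : ℤ, (Y + 3 * a = X + 3 * a + c ∧ V + b = U + b + d) ↔ (Y = X + c ∧ V = U + d) := by
    intros; omega
  have h2 := h1 1 0
  have h3 := h1 1 (-1)
  have h4 := h1 (-1) 0
  have h5 := h1 (-1) 1
  have h6 := h1 0 0
  simp only [add_zero, ← sub_eq_add_neg] at h2 h3 h4 h5 h6
  simp only [weight, shiftEdge, Prod.mk_add_mk, Prod.mk.injEq, h0, h2, h3, h4, h5, h6]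

theorem kasteleyn_shiftEdge (α β : ℝ) (a b : ℤ) (e : Edge) :
    kasteleyn α β (shiftEdge (3 * a, b) e) = kasteleyn α β e := by
  have h : (shiftEdge (3 * a, b) e).2 = ((shiftEdge (3 * a, b) e).1.1 + 1,
      (shiftEdge (3 * a, b) e).1.2) ↔ e.2 = (e.1.1 + 1, e.1.2) := by
    obtain ⟨⟨X, U⟩, ⟨Y, V⟩⟩ := e
    simp only [shiftEdge, Prod.mk_add_mk, Prod.mk.injEq]
    omega
  unfold kasteleyn
  rw [weight_shiftEdge]
  simp only [h]

/-- Reindexing of a determinant over a finite set of edges. -/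
theorem det_finset_eq {ι : Type*} [Fintype ι] [DecidableEq ι] {t : Finset Edge} {e : ι → Edge}
    (he : Function.Injective e) (ht : ∀ x, x ∈ t ↔ ∃ i, e i = x) (G : Edge → Edge → ℂ) :
    (Matrix.of fun a b : t => G a b).det = (Matrix.of fun i j => G (e i) (e j)).det := by
  set φ : ι ≃ t := Equiv.ofBijective (fun i => ⟨e i, (ht _).2 ⟨i, rfl⟩⟩)
    ⟨fun i j h => he (congrArg Subtype.val h), fun x => by
      obtain ⟨i, hi⟩ := (ht x).1 x.2
      exact ⟨i, Subtype.ext hi⟩⟩ with hφ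
  rw [← Matrix.det_submatrix_equiv_self φ]
  rfl

/-! ### Exchanging matchings in dimer covers -/

/-- `A` and `A'` match the same vertices, so a vertex is matched by `A'` exactly when its edge in
`M` was removed. -/
theorem IsDimerCover.exchange {R : Set Pt} {M A A' : Set Edge} (hM : IsDimerCover R M) (hA : A ⊆ M)
    (hA' : ∀ e ∈ A', IsEdge e) (h1 : Set.InjOn Prod.fst A') (h2 : Set.InjOn Prod.snd A')
    (hfst : Prod.fst '' A = Prod.fst '' A') (hsnd : Prod.snd '' A = Prod.snd '' A') :
    IsDimerCover R (M \ A ∪ A') ∧ Disjoint (M \ A) A' := by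
  have hw : ∀ e ∈ M, ∀ e' ∈ M, e.1 = e'.1 → e = e' := by
    intro e he e' he' h
    have := hM.edge e he
    exact Prod.ext h ((hM.white e.1 this.2.1 this.1.isWhite).unique he (by rw [h]; exact he'))
  have hb : ∀ e ∈ M, ∀ e' ∈ M, e.2 = e'.2 → e = e' := by
    intro e he e' he' h
    have := hM.edge e he
    exact Prod.ext ((hM.black e.2 this.2.2 this.1.isBlack).unique he (by rw [h]; exact he')) h
  have hfst' : ∀ e' ∈ A', ∃ e ∈ A, e.1 = e'.1 := fun e' he' => by
    have : e'.1 ∈ Prod.fst '' A := hfst ▸ ⟨e', he', rfl⟩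
    exact this
  have hsnd' : ∀ e' ∈ A', ∃ e ∈ A, e.2 = e'.2 := fun e' he' => by
    have : e'.2 ∈ Prod.snd '' A := hsnd ▸ ⟨e', he', rfl⟩
    exact this
  refine ⟨⟨?_, ?_, ?_⟩, ?_⟩
  · rintro e (he | he)
    · exact hM.edge e he.1
    · obtain ⟨a, ha, ha'⟩ := hfst' e he
      obtain ⟨c, hc, hc'⟩ := hsnd' e he
      exact ⟨hA' e he, ha' ▸ (hM.edge a (hA ha)).2.1, hc' ▸ (hM.edge c (hA hc)).2.2⟩
  · intro w hwR hww
    obtain ⟨b, hb1, hb2⟩ := hM.white w hwR hww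
    by_cases hwA : w ∈ Prod.fst '' A'
    · obtain ⟨e, he, rfl⟩ := hwA
      refine ⟨e.2, Or.inr he, ?_⟩
      rintro c (hc | hc)
      · obtain ⟨a, ha, ha'⟩ := hfst' e he
        exact absurd ha (hw _ hc.1 a (hA ha) ha'.symm ▸ hc.2)
      · exact congrArg Prod.snd (h1 hc he rfl)
    · refine ⟨b, Or.inl ⟨hb1, fun h => hwA (hfst ▸ ⟨_, h, rfl⟩)⟩, ?_⟩
      rintro c (hc | hc)
      · exact hb2 c hc.1
      · exact absurd ⟨_, hc, rfl⟩ hwA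
  · intro b hbR hbb
    obtain ⟨w, hw1, hw2⟩ := hM.black b hbR hbb
    by_cases hbA : b ∈ Prod.snd '' A'
    · obtain ⟨e, he, rfl⟩ := hbA
      refine ⟨e.1, Or.inr he, ?_⟩
      rintro c (hc | hc)
      · obtain ⟨a, ha, ha'⟩ := hsnd' e he
        exact absurd ha (hb _ hc.1 a (hA ha) ha'.symm ▸ hc.2)
      · exact congrArg Prod.fst (h2 hc he rfl)
    · refine ⟨w, Or.inl ⟨hw1, fun h => hbA (hsnd ▸ ⟨_, h, rfl⟩)⟩, ?_⟩
      rintro c (hc | hc)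
      · exact hw2 c hc.1
      · exact absurd ⟨_, hc, rfl⟩ hbA
  · rw [Set.disjoint_left]
    rintro e ⟨he, he'⟩ heA
    obtain ⟨a, ha, ha'⟩ := hfst' e heA
    exact he' (hw a (hA ha) e he ha' ▸ ha)

open Classical in
/-- The weight of the dimer covers of the tower with a matching in a given place is proportional to
the weight of the matching. -/
theorem sum_towerCovers_exchange (α β : ℝ) (N : ℕ) {A A' : Finset Edge}
    (hA : ∀ e ∈ A, IsEdge e) (hA' : ∀ e ∈ A', IsEdge e)
    (h1 : Set.InjOn Prod.fst (A : Set Edge)) (h2 : Set.InjOn Prod.snd (A : Set Edge))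
    (h1' : Set.InjOn Prod.fst (A' : Set Edge)) (h2' : Set.InjOn Prod.snd (A' : Set Edge))
    (hfst : A.image Prod.fst = A'.image Prod.fst) (hsnd : A.image Prod.snd = A'.image Prod.snd)
    (D : Set (Set Edge)) :
    (∑ M ∈ (towerCovers N).filter fun M => A ⊆ M ∧ (M : Set Edge) \ A ∈ D,
        ∏ e ∈ M, weight α β e) * ∏ e ∈ A', weight α β e =
      (∑ M ∈ (towerCovers N).filter fun M => A' ⊆ M ∧ (M : Set Edge) \ A' ∈ D,
        ∏ e ∈ M, weight α β e) * ∏ e ∈ A, weight α β e := by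
  have key : ∀ A A' : Finset Edge, (∀ e ∈ A', IsEdge e) →
      Set.InjOn Prod.fst (A' : Set Edge) → Set.InjOn Prod.snd (A' : Set Edge) →
      A.image Prod.fst = A'.image Prod.fst → A.image Prod.snd = A'.image Prod.snd →
      ∀ M ∈ (towerCovers N).filter fun M => A ⊆ M ∧ (M : Set Edge) \ A ∈ D,
        (M \ A ∪ A' ∈ (towerCovers N).filter fun M => A' ⊆ M ∧ (M : Set Edge) \ A' ∈ D) ∧
        (M \ A ∪ A') \ A' ∪ A = M ∧ Disjoint (M \ A) A' := by
    intro A A' hA' h1 h2 hf hs M hM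
    rw [Finset.mem_filter, mem_towerCovers] at hM
    obtain ⟨hM, hAM, hD⟩ := hM
    have hf' : Prod.fst '' (A : Set Edge) = Prod.fst '' (A' : Set Edge) := by
      have := congrArg (fun s : Finset Pt => (s : Set Pt)) hf
      simpa only [Finset.coe_image] using this
    have hs' : Prod.snd '' (A : Set Edge) = Prod.snd '' (A' : Set Edge) := by
      have := congrArg (fun s : Finset Pt => (s : Set Pt)) hs
      simpa only [Finset.coe_image] using this
    obtain ⟨hc, hd⟩ := hM.exchange (Finset.coe_subset.2 hAM) hA' h1 h2 hf' hs'
    have hd' : Disjoint (M \ A) A' := by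
      rw [← Finset.disjoint_coe, Finset.coe_sdiff]
      exact hd
    have hsd : (M \ A ∪ A') \ A' = M \ A := by
      rw [Finset.union_sdiff_right, Finset.sdiff_eq_self_of_disjoint hd']
    refine ⟨?_, ?_, hd'⟩
    · rw [Finset.mem_filter, mem_towerCovers]
      refine ⟨by rw [Finset.coe_union, Finset.coe_sdiff]; exact hc, Finset.subset_union_right, ?_⟩
      rw [← Finset.coe_sdiff, hsd, Finset.coe_sdiff]
      exact hD
    · rw [hsd, Finset.sdiff_union_of_subset hAM]
  rw [Finset.sum_mul, Finset.sum_mul]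
  -- The exchange of `A` for `A'` is a bijection which leaves the rest of the cover, and hence its
  -- weight and the event `D`, unchanged.
  refine Finset.sum_bij' (fun M _ => M \ A ∪ A') (fun M _ => M \ A' ∪ A)
    (fun M hM => (key A A' hA' h1' h2' hfst hsnd M hM).1)
    (fun M hM => (key A' A hA h1 h2 hfst.symm hsnd.symm M hM).1)
    (fun M hM => (key A A' hA' h1' h2' hfst hsnd M hM).2.1)
    (fun M hM => (key A' A hA h1 h2 hfst.symm hsnd.symm M hM).2.1) fun M hM => ?_
  have hd := (key A A' hA' h1' h2' hfst hsnd M hM).2.2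
  rw [Finset.mem_filter] at hM
  rw [Finset.prod_union hd, ← Finset.prod_sdiff hM.2.1]
  ring

/-! ### The law of the translated dimer cover of the tower -/

section

variable {α β : ℝ}

/-- The law of the dimer cover of the tower of size `N`, translated by `-v`. -/
def towerMeasure (α β : ℝ) (N : ℕ) (v : Pt) : Measure (Set Edge) :=
  ∑ M ∈ towerCovers N, ENNReal.ofReal ((∏ e ∈ M, weight α β e) /
    ∑ M ∈ towerCovers N, ∏ e ∈ M, weight α β e) • Measure.dirac (shiftEdge v ⁻¹' (M : Set Edge))

theorem prod_weight_nonneg (hα : 0 < α) (hβ : 0 < β) {N : ℕ} {M : Finset Edge}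
    (hM : M ∈ towerCovers N) : 0 ≤ ∏ e ∈ M, weight α β e :=
  Finset.prod_nonneg fun e he => (weight_pos hα hβ ((mem_towerCovers.1 hM).edge e he).1).le

theorem partition_pos (hα : 0 < α) (hβ : 0 < β) (N : ℕ) :
    0 < ∑ M ∈ towerCovers N, ∏ e ∈ M, weight α β e :=
  lt_of_le_of_ne (Finset.sum_nonneg fun _ hM => prod_weight_nonneg hα hβ hM)
    (sum_towerCovers_ne_zero hα hβ
      (fun _ hb _ hb' => sum_kasteleyn_mul_schurKernel hα hβ hb hb')).symm

open Classical in
theorem towerMeasure_real (hα : 0 < α) (hβ : 0 < β) (N : ℕ) (v : Pt) {B : Set (Set Edge)}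
    (hB : MeasurableSet B) : (towerMeasure α β N v).real B =
      (∑ M ∈ (towerCovers N).filter fun M : Finset Edge => shiftEdge v ⁻¹' (M : Set Edge) ∈ B,
        ∏ e ∈ M, weight α β e) / ∑ M ∈ towerCovers N, ∏ e ∈ M, weight α β e := by
  unfold towerMeasure Measure.real
  rw [Measure.finsetSum_apply, ENNReal.toReal_sum, Finset.sum_filter, Finset.sum_div]
  · refine Finset.sum_congr rfl fun M hM => ?_
    rw [Measure.smul_apply, Measure.dirac_apply' _ hB, smul_eq_mul, ENNReal.toReal_mul,
      ENNReal.toReal_ofReal (div_nonneg (prod_weight_nonneg hα hβ hM) (partition_pos hα hβ N).le)]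
    by_cases h : shiftEdge v ⁻¹' (M : Set Edge) ∈ B
    · simp [h]
    · simp [h]
  · intro M _
    rw [Measure.smul_apply, Measure.dirac_apply' _ hB, smul_eq_mul]
    by_cases h : shiftEdge v ⁻¹' (M : Set Edge) ∈ B
    · simp [h]
    · simp [h]

theorem isProbabilityMeasure_towerMeasure (hα : 0 < α) (hβ : 0 < β) (N : ℕ) (v : Pt) :
    IsProbabilityMeasure (towerMeasure α β N v) := by
  classical
  have h := towerMeasure_real hα hβ N v MeasurableSet.univ
  simp only [Set.mem_univ, Finset.filter_true] at h
  rw [div_self (partition_pos hα hβ N).ne', Measure.real] at h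
  exact ⟨(ENNReal.toReal_eq_one_iff _).1 h⟩

open Classical in
theorem towerMeasure_superset (hα : 0 < α) (hβ : 0 < β) (N : ℕ) (v : Pt) (s : Finset Edge) :
    (towerMeasure α β N v).real {M | (s : Set Edge) ⊆ M} =
      towerProb α β N (s.image (shiftEdge v)) := by
  rw [towerMeasure_real hα hβ N v (measurableSet_superset s)]
  unfold towerProb
  congr 1
  refine Finset.sum_congr ?_ fun _ _ => rfl
  ext M
  rw [Finset.mem_filter, Finset.mem_filter]
  refine and_congr_right fun _ => ?_
  rw [Set.mem_ofPred_eq, ← Finset.coe_subset, Finset.coe_image, Set.image_subset_iff]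

theorem towerMeasure_eq_zero (hα : 0 < α) (hβ : 0 < β) (N : ℕ) (v : Pt) {B : Set (Set Edge)}
    (hB : MeasurableSet B)
    (h : ∀ M ∈ towerCovers N, shiftEdge v ⁻¹' (M : Set Edge) ∉ B) :
    (towerMeasure α β N v).real B = 0 := by
  classical
  rw [towerMeasure_real hα hβ N v hB, Finset.filter_false_of_mem h]
  simp

theorem towerMeasure_exchange (hα : 0 < α) (hβ : 0 < β) (N : ℕ) (a b : ℤ) {A A' : Finset Edge}
    (hA : ∀ e ∈ A, IsEdge e) (hA' : ∀ e ∈ A', IsEdge e)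
    (h1 : Set.InjOn Prod.fst (A : Set Edge)) (h2 : Set.InjOn Prod.snd (A : Set Edge))
    (h1' : Set.InjOn Prod.fst (A' : Set Edge)) (h2' : Set.InjOn Prod.snd (A' : Set Edge))
    (hfst : A.image Prod.fst = A'.image Prod.fst) (hsnd : A.image Prod.snd = A'.image Prod.snd)
    {D : Set (Set Edge)} (hD : MeasurableSet {M | (A : Set Edge) ⊆ M ∧ M \ A ∈ D})
    (hD' : MeasurableSet {M | (A' : Set Edge) ⊆ M ∧ M \ A' ∈ D}) :
    (towerMeasure α β N (3 * a, b)).real {M | (A : Set Edge) ⊆ M ∧ M \ A ∈ D} *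
        ∏ e ∈ A', weight α β e =
      (towerMeasure α β N (3 * a, b)).real {M | (A' : Set Edge) ⊆ M ∧ M \ A' ∈ D} *
        ∏ e ∈ A, weight α β e := by
  classical
  set v : Pt := (3 * a, b) with hv
  have hinj := shiftEdge_injective v
  have hedge : ∀ A : Finset Edge, (∀ e ∈ A, IsEdge e) → ∀ e ∈ A.image (shiftEdge v), IsEdge e := by
    intro A hA e he
    obtain ⟨c, hc, rfl⟩ := Finset.mem_image.1 he
    exact (isEdge_shiftEdge a b c).2 (hA c hc)
  have hi1 : ∀ A : Finset Edge, Set.InjOn Prod.fst (A : Set Edge) →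
      Set.InjOn Prod.fst (A.image (shiftEdge v) : Set Edge) := by
    intro A hA e he e' he' h
    rw [Finset.coe_image] at he he'
    obtain ⟨e, he, rfl⟩ := he
    obtain ⟨e', he', rfl⟩ := he'
    rw [hA he he' (add_right_cancel h)]
  have hi2 : ∀ A : Finset Edge, Set.InjOn Prod.snd (A : Set Edge) →
      Set.InjOn Prod.snd (A.image (shiftEdge v) : Set Edge) := by
    intro A hA e he e' he' h
    rw [Finset.coe_image] at he he'
    obtain ⟨e, he, rfl⟩ := he
    obtain ⟨e', he', rfl⟩ := he'
    rw [hA he he' (add_right_cancel h)]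
  have hf : ∀ A : Finset Edge, (A.image (shiftEdge v)).image Prod.fst =
      (A.image Prod.fst).image (· + v) := by
    intro A
    rw [Finset.image_image, Finset.image_image]
    rfl
  have hs : ∀ A : Finset Edge, (A.image (shiftEdge v)).image Prod.snd =
      (A.image Prod.snd).image (· + v) := by
    intro A
    rw [Finset.image_image, Finset.image_image]
    rfl
  have hprod : ∀ A : Finset Edge, ∏ e ∈ A.image (shiftEdge v), weight α β e =
      ∏ e ∈ A, weight α β e := by
    intro A
    rw [Finset.prod_image hinj.injOn]
    exact Finset.prod_congr rfl fun e _ => weight_shiftEdge α β a b e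
  have hex := sum_towerCovers_exchange α β N (hedge A hA) (hedge A' hA') (hi1 A h1) (hi2 A h2)
    (hi1 A' h1') (hi2 A' h2') (by rw [hf, hf, hfst]) (by rw [hs, hs, hsnd])
    {K | shiftEdge v ⁻¹' K ∈ D}
  rw [hprod, hprod] at hex
  have hset : ∀ A : Finset Edge, ((towerCovers N).filter fun M => A.image (shiftEdge v) ⊆ M ∧
      (M : Set Edge) \ (A.image (shiftEdge v) : Finset Edge) ∈ {K | shiftEdge v ⁻¹' K ∈ D}) =
      (towerCovers N).filter fun M : Finset Edge => shiftEdge v ⁻¹' (M : Set Edge) ∈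
        {M | (A : Set Edge) ⊆ M ∧ M \ A ∈ D} := by
    intro A
    refine Finset.filter_congr fun M _ => ?_
    rw [Set.mem_ofPred_eq, Set.mem_ofPred_eq, ← Finset.coe_subset, Finset.coe_image,
      Set.image_subset_iff, Set.preimage_sdiff, Set.preimage_image_eq _ hinj]
  rw [hset, hset] at hex
  rw [towerMeasure_real hα hβ N v hD, towerMeasure_real hα hβ N v hD', div_mul_eq_mul_div,
    div_mul_eq_mul_div]
  congr 1
  convert hex

end

end TowerDimer

end

/-! ### The local limit of the towers. -/

noncomputable section

namespace TowerDimer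

open MeasureTheory Filter Topology

section

variable {α β : ℝ}

/-- The domain is open, so each defining inequality has room proportional to `N`; the constant `c`
absorbs the fixed offset and the rounding. -/
theorem eventually_site_mem {p : ℝ × ℝ} (hp : p ∈ domain) (P : Pt) :
    ∀ᶠ N : ℕ in atTop, P + site N p ∈ towerVertices N := by
  obtain ⟨x, u⟩ := p
  obtain ⟨hx0, hx1, hu, hu'⟩ := hp
  simp only at hx0 hx1 hu hu'
  obtain ⟨X, U⟩ := P
  set c : ℝ := |(X : ℝ)| + |((X / 3 : ℤ) : ℝ)| + |(U : ℝ)| + 5 with hc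
  have hlim : ∀ d : ℝ, 0 < d → ∀ᶠ N : ℕ in atTop, c ≤ d * N := fun d hd =>
    ((tendsto_natCast_atTop_atTop (R := ℝ)).const_mul_atTop hd).eventually_ge_atTop c
  filter_upwards [hlim x hx0, hlim (1 - x) (by linarith), hlim (u + 2 * x) (by linarith),
    hlim (1 - x - u) (by linarith)] with N h1 h2 h3 h4
  obtain ⟨f1, f2⟩ := floor_bounds N x
  obtain ⟨g1, g2⟩ := floor_bounds N u
  have a1 := abs_le.1 (le_refl |(X : ℝ)|)
  have a2 := abs_le.1 (le_refl |((X / 3 : ℤ) : ℝ)|)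
  have a3 := abs_le.1 (le_refl |(U : ℝ)|)
  have b1 := abs_nonneg (X : ℝ)
  have b2 := abs_nonneg ((X / 3 : ℤ) : ℝ)
  have b3 := abs_nonneg (U : ℝ)
  rw [mem_towerVertices]
  simp only [site, Prod.mk_add_mk]
  set m := ⌊(N : ℝ) * x⌋ with hm
  set n := ⌊(N : ℝ) * u⌋ with hn
  have hdiv : (X + 3 * m) / 3 = X / 3 + m := by omega
  rw [hdiv]
  refine ⟨?_, ?_, ?_, ?_⟩
  · have : (0 : ℝ) ≤ ((X + 3 * m : ℤ) : ℝ) := by push_cast; linarith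
    exact_mod_cast this
  · have : ((X + 3 * m : ℤ) : ℝ) ≤ ((3 * N : ℤ) : ℝ) := by push_cast; linarith
    exact_mod_cast this
  · have : ((-(X + 3 * m) + (X / 3 + m) : ℤ) : ℝ) ≤ ((U + n : ℤ) : ℝ) := by push_cast; linarith
    exact_mod_cast this
  · have : ((U + n : ℤ) : ℝ) ≤ ((N - (X / 3 + m) - 1 : ℤ) : ℝ) := by push_cast; linarith
    exact_mod_cast this

theorem isWhite_add (a b : ℤ) (P : Pt) : IsWhite (P + (3 * a, b)) ↔ IsWhite P := by
  obtain ⟨X, U⟩ := P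
  simp only [IsWhite, Prod.mk_add_mk]
  omega

theorem isBlack_add (a b : ℤ) (P : Pt) : IsBlack (P + (3 * a, b)) ↔ IsBlack P := by
  obtain ⟨X, U⟩ := P
  simp only [IsBlack, Prod.mk_add_mk]
  omega

/-- Convergence of the edge probabilities from convergence of the kernels. -/
theorem exists_tendsto_towerProb (hα : 0 < α) (hβ : 0 < β) {p : ℝ × ℝ} (hp : p ∈ domain) {z₀ : ℂ}
    (hK : KernelConverges α β p z₀) {s : Finset Edge} (hs : ∀ e ∈ s, IsEdge e) :
    ∃ L : ℝ, Tendsto (fun N : ℕ => towerProb α β N (s.image (shiftEdge (site N p)))) atTop (𝓝 L) ∧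
      (L : ℂ) = (∏ e ∈ s, (kasteleyn α β e : ℂ)) *
        (Matrix.of fun e f : s => gibbsKernel α β z₀ e.1.1 f.1.2).det := by
  set D : ℂ := (∏ e ∈ s, (kasteleyn α β e : ℂ)) *
        (Matrix.of fun e f : s => gibbsKernel α β z₀ e.1.1 f.1.2).det with hD
  have hlim : Tendsto (fun N : ℕ => ((towerProb α β N (s.image (shiftEdge (site N p))) : ℝ) : ℂ))
      atTop (𝓝 D) := by
    have h1 : Tendsto (fun N : ℕ => (∏ e ∈ s, (kasteleyn α β e : ℂ)) *
        (Matrix.of fun e f : s => schurKernel α β N (site N p + e.1.1) (site N p + f.1.2)).det)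
        atTop (𝓝 D) := by
      refine Tendsto.const_mul _ ?_
      have hc : Continuous fun A : Matrix s s ℂ => A.det := continuous_id.matrix_det
      refine (hc.tendsto _).comp ?_
      exact tendsto_pi_nhds.2 fun e => tendsto_pi_nhds.2 fun f => hK e.1.1 f.1.2
    refine h1.congr' ?_
    have h2 : ∀ᶠ N : ℕ in atTop, ∀ e ∈ s, e.1 + site N p ∈ towerVertices N ∧
        e.2 + site N p ∈ towerVertices N := by
      rw [Filter.eventually_all_finset]
      exact fun e _ => (eventually_site_mem hp e.1).and (eventually_site_mem hp e.2)
    filter_upwards [h2] with N hN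
    have hinj := shiftEdge_injective (site N p)
    rw [towerProb_eq_det_schurKernel hα hβ, Finset.prod_image hinj.injOn,
      det_finset_eq (e := fun i : s => shiftEdge (site N p) i) (hinj.comp Subtype.val_injective)
        (G := fun e f => schurKernel α β N e.1 f.2)]
    · congr 1
      · exact Finset.prod_congr rfl fun e _ => by
          rw [site, kasteleyn_shiftEdge]
      · congr 1
        ext e f
        simp only [Matrix.of_apply, shiftEdge]
        rw [add_comm (site N p), add_comm (site N p)]
    · intro x
      rw [Finset.mem_image]
      exact ⟨fun ⟨e, he, h⟩ => ⟨⟨e, he⟩, h⟩, fun ⟨e, h⟩ => ⟨e.1, e.2, h⟩⟩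
    · intro e he
      obtain ⟨c, hc, rfl⟩ := Finset.mem_image.1 he
      rw [mem_whites, mem_blacks]
      exact ⟨⟨(hN c hc).1, (isWhite_add _ _ _).2 (hs c hc).isWhite⟩,
        ⟨(hN c hc).2, (isBlack_add _ _ _).2 (hs c hc).isBlack⟩⟩
  have hre := (Complex.continuous_re.tendsto D).comp hlim
  have him := (Complex.continuous_im.tendsto D).comp hlim
  have him' : D.im = 0 := tendsto_nhds_unique him (by
    simp only [Function.comp_def, Complex.ofReal_im]
    exact tendsto_const_nhds)
  refine ⟨D.re, by simpa only [Function.comp_def, Complex.ofReal_re] using hre, ?_⟩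
  exact Complex.ext (by simp) (by simp [him'])

/-- Vertices have bounded degree, so being matched exactly once is a local event. -/
theorem exists_finset_edges (P : Pt) : ∃ t : Finset Pt, ∀ Q : Pt,
    (IsEdge (P, Q) ∨ IsEdge (Q, P)) → Q ∈ t := by
  refine ⟨Finset.Icc (P.1 - 1) (P.1 + 1) ×ˢ Finset.Icc (P.2 - 1) (P.2 + 1), fun Q hQ => ?_⟩
  obtain ⟨X, U⟩ := P
  obtain ⟨Y, V⟩ := Q
  simp only [IsEdge, Prod.mk.injEq] at hQ
  simp only [Finset.mem_product, Finset.mem_Icc]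
  omega

/-- A local limit of the towers at a point where the kernels converge: a random dimer cover of the
lattice with determinantal correlations and the Gibbs property. -/
theorem exists_limit_measure (hα : 0 < α) (hβ : 0 < β) {p : ℝ × ℝ} (hp : p ∈ domain) {z₀ : ℂ}
    (hK : KernelConverges α β p z₀) : ∃ μ : Measure (Set Edge), IsProbabilityMeasure μ ∧
      (∀ᵐ M ∂μ, IsDimerCover Set.univ M) ∧ IsLocalLimit α β p μ ∧
      (∀ s : Finset Edge, (∀ e ∈ s, IsEdge e) → ((μ.real {M | (s : Set Edge) ⊆ M} : ℝ) : ℂ) =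
        (∏ e ∈ s, (kasteleyn α β e : ℂ)) *
          (Matrix.of fun e f : s => gibbsKernel α β z₀ e.1.1 f.1.2).det) ∧
      ∀ A A' : Finset Edge, (∀ e ∈ A, IsEdge e) → (∀ e ∈ A', IsEdge e) →
        Set.InjOn Prod.fst (A : Set Edge) → Set.InjOn Prod.snd (A : Set Edge) →
        Set.InjOn Prod.fst (A' : Set Edge) → Set.InjOn Prod.snd (A' : Set Edge) →
        A.image Prod.fst = A'.image Prod.fst → A.image Prod.snd = A'.image Prod.snd →
        ∀ B : Set (Set Edge), MeasurableSet B →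
          μ.real {M | (A : Set Edge) ⊆ M ∧ M \ A ∈ B} * ∏ e ∈ A', weight α β e =
            μ.real {M | (A' : Set Edge) ⊆ M ∧ M \ A' ∈ B} * ∏ e ∈ A, weight α β e := by
  set ν : ℕ → Measure (Set Edge) := fun N => towerMeasure α β N (site N p) with hν
  have hνp : ∀ N, IsProbabilityMeasure (ν N) := fun N =>
    isProbabilityMeasure_towerMeasure hα hβ N _
  -- The ultrafilter only serves to produce a candidate; convergence along all `N` follows since the
  -- edge probabilities converge.
  set U : Ultrafilter ℕ := Ultrafilter.of atTop with hU
  have hUle : (U : Filter ℕ) ≤ atTop := Ultrafilter.of_le atTop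
  obtain ⟨μ, hμ, hlim⟩ := exists_local_limit ν U
  have hzero : ∀ B : Set (Set Edge), IsLocal B → (∀ᶠ N in atTop, (ν N).real B = 0) →
      μ B = 0 := by
    intro B hB h
    have h1 : Tendsto (fun N => (ν N).real B) U (𝓝 0) :=
      tendsto_const_nhds.congr' ((h.filter_mono hUle).mono fun N hN => hN.symm)
    have h2 := tendsto_nhds_unique (hlim B hB) h1
    exact (measureReal_eq_zero_iff).1 h2
  have hedge : ∀ᵐ M ∂μ, ∀ e : Edge, e ∈ M → IsEdge e := by
    rw [ae_all_iff]
    intro e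
    by_cases he : IsEdge e
    · exact ae_of_all _ fun _ _ => he
    · have h1 : μ {M | e ∈ M} = 0 := by
        have hl : IsLocal {M : Set Edge | e ∈ M} :=
          ⟨{e}, fun M M' h hM => (h e (Finset.mem_singleton_self e)).1 hM⟩
        refine hzero _ hl (Eventually.of_forall fun N => ?_)
        refine towerMeasure_eq_zero hα hβ N _ hl.measurableSet fun M hM hM' => he ?_
        have := ((mem_towerCovers.1 hM).edge _ hM').1
        rwa [site, isEdge_shiftEdge] at this
      have h2 : ∀ᵐ M ∂μ, e ∉ M := by
        rw [ae_iff]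
        simpa using h1
      filter_upwards [h2] with M hM hM'
      exact absurd hM' hM
  have hwhite : ∀ᵐ M ∂μ, ∀ w, IsWhite w → ∃! b, IsEdge (w, b) ∧ (w, b) ∈ M := by
    rw [ae_all_iff]
    intro w
    by_cases hw : IsWhite w
    · obtain ⟨t, ht⟩ := exists_finset_edges w
      have hl : IsLocal {M : Set Edge | ∃! b, IsEdge (w, b) ∧ (w, b) ∈ M} := by
        refine ⟨t.image fun b => (w, b), fun M M' h hM => ?_⟩
        have h' : ∀ b, (IsEdge (w, b) ∧ (w, b) ∈ M) ↔ (IsEdge (w, b) ∧ (w, b) ∈ M') := fun b =>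
          and_congr_right fun hb => h _ (Finset.mem_image_of_mem _ (ht b (Or.inl hb)))
        have hM' : ∃! b, IsEdge (w, b) ∧ (w, b) ∈ M := hM
        simp only [h'] at hM'
        exact hM'
      -- Once the translated vertex lies in the tower, every cover of the tower matches it exactly
      -- once.
      have h1 := hzero _ hl.compl (by
        filter_upwards [eventually_site_mem hp w] with N hN
        refine towerMeasure_eq_zero hα hβ N _ hl.compl.measurableSet fun M hM hM' => hM' ?_
        obtain ⟨b, hb1, hb2⟩ := (mem_towerCovers.1 hM).white _ hN ((isWhite_add _ _ _).2 hw)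
        have key : ∀ c, (w, c) ∈ shiftEdge (site N p) ⁻¹' (M : Set Edge) ↔ c + site N p = b := by
          intro c
          exact ⟨fun h => hb2 _ h, fun h => by
            show (w + site N p, c + site N p) ∈ (M : Set Edge)
            rw [h]; exact hb1⟩
        refine ⟨b - site N p, ⟨?_, (key _).2 (sub_add_cancel _ _)⟩, fun c hc =>
          eq_sub_of_add_eq ((key c).1 hc.2)⟩
        have h2 := ((mem_towerCovers.1 hM).edge _ hb1).1
        rw [← isEdge_shiftEdge ⌊(N : ℝ) * p.1⌋ ⌊(N : ℝ) * p.2⌋]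
        have h3 : shiftEdge (site N p) (w, b - site N p) = (w + site N p, b) := by
          simp only [shiftEdge, sub_add_cancel]
        exact h3 ▸ h2)
      have h2 : ∀ᵐ M ∂μ, ∃! b, IsEdge (w, b) ∧ (w, b) ∈ M := h1
      filter_upwards [h2] with M hM _ using hM
    · exact ae_of_all _ fun _ h => absurd h hw
  have hblack : ∀ᵐ M ∂μ, ∀ b, IsBlack b → ∃! w, IsEdge (w, b) ∧ (w, b) ∈ M := by
    rw [ae_all_iff]
    intro b
    by_cases hb : IsBlack b
    · obtain ⟨t, ht⟩ := exists_finset_edges b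
      have hl : IsLocal {M : Set Edge | ∃! w, IsEdge (w, b) ∧ (w, b) ∈ M} := by
        refine ⟨t.image fun w => (w, b), fun M M' h hM => ?_⟩
        have h' : ∀ w, (IsEdge (w, b) ∧ (w, b) ∈ M) ↔ (IsEdge (w, b) ∧ (w, b) ∈ M') := fun w =>
          and_congr_right fun hb => h _ (Finset.mem_image_of_mem (fun w => (w, b))
            (ht w (Or.inr hb)))
        have hM' : ∃! w, IsEdge (w, b) ∧ (w, b) ∈ M := hM
        simp only [h'] at hM'
        exact hM'
      have h1 := hzero _ hl.compl (by
        filter_upwards [eventually_site_mem hp b] with N hN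
        refine towerMeasure_eq_zero hα hβ N _ hl.compl.measurableSet fun M hM hM' => hM' ?_
        obtain ⟨w, hw1, hw2⟩ := (mem_towerCovers.1 hM).black _ hN ((isBlack_add _ _ _).2 hb)
        have key : ∀ c, (c, b) ∈ shiftEdge (site N p) ⁻¹' (M : Set Edge) ↔ c + site N p = w := by
          intro c
          exact ⟨fun h => hw2 _ h, fun h => by
            show (c + site N p, b + site N p) ∈ (M : Set Edge)
            rw [h]; exact hw1⟩
        refine ⟨w - site N p, ⟨?_, (key _).2 (sub_add_cancel _ _)⟩, fun c hc =>
          eq_sub_of_add_eq ((key c).1 hc.2)⟩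
        have h2 := ((mem_towerCovers.1 hM).edge _ hw1).1
        rw [← isEdge_shiftEdge ⌊(N : ℝ) * p.1⌋ ⌊(N : ℝ) * p.2⌋]
        have h3 : shiftEdge (site N p) (w - site N p, b) = (w, b + site N p) := by
          simp only [shiftEdge, sub_add_cancel]
        exact h3 ▸ h2)
      have h2 : ∀ᵐ M ∂μ, ∃! w, IsEdge (w, b) ∧ (w, b) ∈ M := h1
      filter_upwards [h2] with M hM _ using hM
    · exact ae_of_all _ fun _ h => absurd h hb
  have hcover : ∀ᵐ M ∂μ, IsDimerCover Set.univ M := by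
    filter_upwards [hedge, hwhite, hblack] with M h1 h2 h3
    refine ⟨fun e he => ⟨h1 e he, trivial, trivial⟩, fun w _ hw => ?_, fun b _ hb => ?_⟩
    · obtain ⟨b, hb, hb'⟩ := h2 w hw
      exact ⟨b, hb.2, fun c hc => hb' c ⟨h1 _ hc, hc⟩⟩
    · obtain ⟨w, hw, hw'⟩ := h3 b hb
      exact ⟨w, hw.2, fun c hc => hw' c ⟨h1 _ hc, hc⟩⟩
  have hsup : ∀ s : Finset Edge, (∀ e ∈ s, IsEdge e) → ∀ L, Tendsto (fun N : ℕ =>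
      towerProb α β N (s.image (shiftEdge (site N p)))) atTop (𝓝 L) →
      μ.real {M | (s : Set Edge) ⊆ M} = L := by
    intro s _ L hL
    have h1 := hlim _ (isLocal_superset s)
    simp only [hν, towerMeasure_superset hα hβ] at h1
    exact tendsto_nhds_unique h1 (hL.mono_left hUle)
  refine ⟨μ, hμ, hcover, ?_, ?_, ?_⟩
  · intro s hs
    obtain ⟨L, hL, -⟩ := exists_tendsto_towerProb hα hβ hp hK hs
    rw [hsup s hs L hL]
    exact hL
  · intro s hs
    obtain ⟨L, hL, hL'⟩ := exists_tendsto_towerProb hα hβ hp hK hs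
    rw [hsup s hs L hL, hL']
  · intro A A' hA hA' h1 h2 h1' h2' hf hs
    -- the two sides are finite measures in `B` which agree on cylinders
    have hdiff : ∀ A : Finset Edge, Measurable fun M : Set Edge => M \ (A : Set Edge) := by
      intro A
      rw [measurable_set_iff]
      intro e
      by_cases he : e ∈ A
      · have : (fun M : Set Edge => e ∈ M \ (A : Set Edge)) = fun _ => False := by
          funext M
          simp [he]
        rw [this]
        exact measurable_const
      · have : (fun M : Set Edge => e ∈ M \ (A : Set Edge)) = fun M => e ∈ M := by
          funext M
          simp [he]
        rw [this]
        exact measurable_set_mem e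
    -- The law of the configuration with `A` removed, on the event that `A` is present.
    set ρ : Finset Edge → Measure (Set Edge) := fun A =>
      (μ.restrict {M | (A : Set Edge) ⊆ M}).map fun M => M \ (A : Set Edge) with hρ
    have hρB : ∀ A : Finset Edge, ∀ B, MeasurableSet B →
        ρ A B = μ {M | (A : Set Edge) ⊆ M ∧ M \ (A : Set Edge) ∈ B} := by
      intro A B hB
      rw [hρ]
      simp only
      rw [Measure.map_apply (hdiff A) hB, Measure.restrict_apply (hdiff A hB), Set.inter_comm]
      rfl
    have hw0 : ∀ A : Finset Edge, (∀ e ∈ A, IsEdge e) → 0 < ∏ e ∈ A, weight α β e := fun A hA =>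
      Finset.prod_pos fun e he => weight_pos hα hβ (hA e he)
    have hfin : ∀ A : Finset Edge, IsFiniteMeasure (ρ A) := fun A =>
      inferInstanceAs (IsFiniteMeasure ((μ.restrict {M | (A : Set Edge) ⊆ M}).map
        fun M => M \ (A : Set Edge)))
    have hloc : ∀ A s : Finset Edge,
        IsLocal {M : Set Edge | (A : Set Edge) ⊆ M ∧ M \ A ∈ {M : Set Edge | (s : Set Edge) ⊆ M}} := by
      intro A s
      classical
      refine ⟨A ∪ s, fun M M' h hM => ⟨fun e he => ?_, fun e he => ⟨?_, (hM.2 he).2⟩⟩⟩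
      · exact (h e (Finset.mem_union_left _ he)).1 (hM.1 he)
      · exact (h e (Finset.mem_union_right _ he)).1 (hM.2 he).1
    have heq : (ENNReal.ofReal (∏ e ∈ A', weight α β e)) • ρ A =
        (ENNReal.ofReal (∏ e ∈ A, weight α β e)) • ρ A' := by
      have : IsFiniteMeasure ((ENNReal.ofReal (∏ e ∈ A', weight α β e)) • ρ A) :=
        Measure.smul_finite _ ENNReal.ofReal_ne_top
      refine ext_of_cylinders fun s => ?_
      have t1 := (hlim _ (hloc A s)).mul_const (∏ e ∈ A', weight α β e)
      have t2 := (hlim _ (hloc A' s)).mul_const (∏ e ∈ A, weight α β e)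
      have t3 := tendsto_nhds_unique t1 (t2.congr fun N => by
        rw [hν]
        exact (towerMeasure_exchange hα hβ N _ _ hA hA' h1 h2 h1' h2' hf hs
          (hloc A s).measurableSet (hloc A' s).measurableSet).symm)
      rw [Measure.smul_apply, Measure.smul_apply, smul_eq_mul, smul_eq_mul,
        hρB A _ (measurableSet_superset s), hρB A' _ (measurableSet_superset s),
        ← ENNReal.toReal_eq_toReal_iff' (ENNReal.mul_ne_top ENNReal.ofReal_ne_top (measure_ne_top _ _))
        (ENNReal.mul_ne_top ENNReal.ofReal_ne_top (measure_ne_top _ _)), ENNReal.toReal_mul,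
        ENNReal.toReal_mul, ENNReal.toReal_ofReal (hw0 A hA).le,
        ENNReal.toReal_ofReal (hw0 A' hA').le, mul_comm, mul_comm (∏ e ∈ A, weight α β e)]
      exact t3
    intro B hB
    have h3 := congrArg (fun m : Measure (Set Edge) => (m B).toReal) heq
    simp only [Measure.smul_apply, smul_eq_mul, ENNReal.toReal_mul] at h3
    rw [ENNReal.toReal_ofReal (hw0 A hA).le, ENNReal.toReal_ofReal (hw0 A' hA').le, hρB A B hB,
      hρB A' B hB, mul_comm, mul_comm (∏ e ∈ A, weight α β e)] at h3
    exact h3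

end

end TowerDimer

end

/-! ### Decay of the Gibbs kernel and decorrelation. -/

noncomputable section

namespace TowerDimer

open MeasureTheory Filter Topology

section

variable {α β : ℝ}

theorem gibbsIntegrand_add (a b : ℤ) (P Q : Pt) (z : ℂ) :
    gibbsIntegrand α β (P + (3 * a, b)) (Q + (3 * a, b)) z = gibbsIntegrand α β P Q z := by
  have h1 : ∀ X, tOf (X + 3 * a) = a + tOf X := fun X => by rw [add_comm, tOf_add]
  have h2 : ∀ X, mOf (X + 3 * a) = mOf X := fun X => by rw [add_comm, mOf_add]
  unfold gibbsIntegrand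
  simp only [Prod.fst_add, Prod.snd_add, h1, h2, add_sub_add_left_eq_sub,
    add_sub_add_right_eq_sub]

theorem gibbsKernel_add (z₀ : ℂ) (a b : ℤ) (P Q : Pt) :
    gibbsKernel α β z₀ (P + (3 * a, b)) (Q + (3 * a, b)) = gibbsKernel α β z₀ P Q := by
  unfold gibbsKernel
  simp only [gibbsIntegrand_add, Prod.fst_add, add_le_add_iff_right]

/-- The Riemann-Lebesgue lemma for Fourier coefficients on an interval. -/
theorem tendsto_integral_mul_exp_zpow (h : ℝ → ℂ) (a b : ℝ) :
    Tendsto (fun m : ℤ => ∫ t in a..b, h t * Complex.exp (t * Complex.I) ^ m) cofinite (𝓝 0) := by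
  have key : ∀ s : Set ℝ, MeasurableSet s → Tendsto
      (fun m : ℤ => ∫ t in s, h t * Complex.exp (t * Complex.I) ^ m) cofinite (𝓝 0) := by
    intro s hs
    -- The lemma on the line is applied to `h` cut off to `s`, at the frequencies `-m / (2 π)`.
    have h1 := Real.tendsto_integral_exp_smul_cocompact (s.indicator h)
    have hc : (-(2 * Real.pi)⁻¹ : ℝ) ≠ 0 := by
      have := Real.pi_pos
      exact neg_ne_zero.2 (inv_ne_zero (by positivity))
    have h2 : Tendsto (fun m : ℤ => -(2 * Real.pi)⁻¹ * (m : ℝ)) cofinite (cocompact ℝ) := by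
      rw [← cocompact_eq_cofinite]
      exact (Homeomorph.mulLeft₀ _ hc).isClosedEmbedding.tendsto_cocompact.comp
        Int.isClosedEmbedding_coe_real.tendsto_cocompact
    refine (h1.comp h2).congr fun m => ?_
    simp only [Function.comp_def]
    rw [← integral_indicator hs]
    refine integral_congr_ae (ae_of_all _ fun t => ?_)
    simp only
    by_cases ht : t ∈ s
    · rw [Set.indicator_of_mem ht, Set.indicator_of_mem ht, Circle.smul_def,
        Real.fourierChar_apply, smul_eq_mul, mul_comm, ← Complex.exp_int_mul]
      congr 2
      have := Complex.ofReal_ne_zero.2 Real.pi_ne_zero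
      push_cast
      field_simp
    · rw [Set.indicator_of_notMem ht, Set.indicator_of_notMem ht, smul_zero]
  have h3 := (key _ measurableSet_Ioc).sub (key _ measurableSet_Ioc) (f := fun m : ℤ =>
    ∫ t in Set.Ioc a b, h t * Complex.exp (t * Complex.I) ^ m) (g := fun m : ℤ =>
    ∫ t in Set.Ioc b a, h t * Complex.exp (t * Complex.I) ^ m)
  rw [sub_zero] at h3
  exact h3

/-- The Gibbs kernel, normalized so that it decays. -/
def gaugedKernel (α β : ℝ) (z₀ : ℂ) (P Q : Pt) : ℂ :=
  (‖z₀‖ : ℂ) ^ P.2 * gibbsKernel α β z₀ P Q * (‖z₀‖ : ℂ) ^ (-Q.2)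

/-- On the circle the heights enter the integrand only through a power of `z`. The gauge removes its
modulus, so between two fixed columns the kernel is a Fourier coefficient with index the difference
of heights. -/
theorem exists_gaugedKernel_eq {z₀ : ℂ} (hz₀ : z₀ ≠ 0) (X Y : ℤ) : ∃ (h : ℝ → ℂ) (a b : ℝ),
    ∀ P Q : Pt, P.1 = X → Q.1 = Y → gaugedKernel α β z₀ P Q =
      ∫ t in a..b, h t * Complex.exp (t * Complex.I) ^ (Q.2 - P.2) := by
  have hr : (‖z₀‖ : ℂ) ≠ 0 := by exact_mod_cast norm_ne_zero_iff.2 hz₀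
  refine ⟨fun t => 1 / (2 * Real.pi * Complex.I) *
    (gibbsIntegrand α β (X, 0) (Y, 1) (circleMap 0 ‖z₀‖ t) * Complex.I),
    if Y ≤ X then -Complex.arg z₀ else 2 * Real.pi - Complex.arg z₀, Complex.arg z₀, ?_⟩
  rintro ⟨X, U⟩ ⟨Y, V⟩ rfl rfl
  unfold gaugedKernel gibbsKernel
  rw [← intervalIntegral.integral_const_mul, ← intervalIntegral.integral_const_mul,
    ← intervalIntegral.integral_mul_const]
  refine intervalIntegral.integral_congr fun t _ => ?_
  simp only
  have hc : circleMap 0 ‖z₀‖ t = ‖z₀‖ * Complex.exp (t * Complex.I) := by simp [circleMap]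
  have hc0 : circleMap 0 ‖z₀‖ t ≠ 0 := by
    rw [hc]
    exact mul_ne_zero hr (Complex.exp_ne_zero _)
  have hz : (‖z₀‖ : ℂ) ^ U * (circleMap 0 ‖z₀‖ t ^ (V - U - 1) * circleMap 0 ‖z₀‖ t) *
      (‖z₀‖ : ℂ) ^ (-V) = Complex.exp (t * Complex.I) ^ (V - U) := by
    rw [← zpow_add_one₀ hc0, sub_add_cancel, hc, mul_zpow, zpow_sub₀ hr, zpow_neg]
    have h1 := zpow_ne_zero U hr
    have h2 := zpow_ne_zero V hr
    field_simp
  rw [deriv_circleMap, ← hz]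
  unfold gibbsIntegrand
  simp only [sub_zero, sub_self, zpow_zero, mul_one]
  ring

theorem tendsto_gaugedKernel {z₀ : ℂ} (hz₀ : z₀ ≠ 0) (P Q : Pt) :
    Tendsto (fun n : ℕ => gaugedKernel α β z₀ P (Q + (0, (n : ℤ)))) atTop (𝓝 0) ∧
      Tendsto (fun n : ℕ => gaugedKernel α β z₀ (P + (0, (n : ℤ))) Q) atTop (𝓝 0) := by
  obtain ⟨h, a, b, hab⟩ := exists_gaugedKernel_eq (α := α) (β := β) hz₀ P.1 Q.1
  have hRL := tendsto_integral_mul_exp_zpow h a b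
  constructor
  · have h1 : Function.Injective fun n : ℕ => Q.2 + (n : ℤ) - P.2 := by
      intro m n hmn
      simpa using hmn
    refine (hRL.comp (Nat.cofinite_eq_atTop ▸ h1.tendsto_cofinite)).congr fun n => ?_
    rw [hab _ _ rfl (by simp)]
    rfl
  · have h1 : Function.Injective fun n : ℕ => Q.2 - (P.2 + (n : ℤ)) := by
      intro m n hmn
      simpa using hmn
    refine (hRL.comp (Nat.cofinite_eq_atTop ▸ h1.tendsto_cofinite)).congr fun n => ?_
    rw [hab _ _ (by simp) rfl]
    rfl

theorem gaugedKernel_add (z₀ : ℂ) (hz₀ : z₀ ≠ 0) (a b : ℤ) (P Q : Pt) :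
    gaugedKernel α β z₀ (P + (3 * a, b)) (Q + (3 * a, b)) = gaugedKernel α β z₀ P Q := by
  have hr : (‖z₀‖ : ℂ) ≠ 0 := by exact_mod_cast norm_ne_zero_iff.2 hz₀
  unfold gaugedKernel
  rw [gibbsKernel_add]
  simp only [Prod.snd_add]
  rw [zpow_add₀ hr, neg_add, zpow_add₀ hr, zpow_neg _ b]
  have := zpow_ne_zero b hr
  field_simp

/-- The determinantal formula for a family of edges. -/
def correlation (α β : ℝ) (z₀ : ℂ) {ι : Type*} [Fintype ι] [DecidableEq ι] (e : ι → Edge) : ℂ :=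
  (∏ i, (kasteleyn α β (e i) : ℂ) * (‖z₀‖ : ℂ) ^ ((e i).2.2 - (e i).1.2)) *
    (Matrix.of fun i j => gaugedKernel α β z₀ (e i).1 (e j).2).det

/-- The gauge multiplies rows and columns by powers of `‖z₀‖`, which the prefactor compensates. -/
theorem correlation_eq {z₀ : ℂ} (hz₀ : z₀ ≠ 0) {ι : Type*} [Fintype ι] [DecidableEq ι]
    (e : ι → Edge) : correlation α β z₀ e = (∏ i, (kasteleyn α β (e i) : ℂ)) *
      (Matrix.of fun i j => gibbsKernel α β z₀ (e i).1 (e j).2).det := by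
  have hr : (‖z₀‖ : ℂ) ≠ 0 := by exact_mod_cast norm_ne_zero_iff.2 hz₀
  have h1 : (Matrix.of fun i j => gaugedKernel α β z₀ (e i).1 (e j).2) =
      Matrix.of fun i j => (‖z₀‖ : ℂ) ^ (-(e j).2.2) *
        (Matrix.of fun i j => (‖z₀‖ : ℂ) ^ (e i).1.2 *
          (Matrix.of fun i j => gibbsKernel α β z₀ (e i).1 (e j).2) i j) i j := by
    ext i j
    simp only [Matrix.of_apply, gaugedKernel]
    ring
  unfold correlation
  rw [h1, Matrix.det_mul_row, Matrix.det_mul_column, Finset.prod_mul_distrib]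
  have h2 : (∏ i, (‖z₀‖ : ℂ) ^ ((e i).2.2 - (e i).1.2)) * ((∏ i, (‖z₀‖ : ℂ) ^ (-(e i).2.2)) *
      ∏ i, (‖z₀‖ : ℂ) ^ (e i).1.2) = 1 := by
    rw [← Finset.prod_mul_distrib, ← Finset.prod_mul_distrib]
    refine Finset.prod_eq_one fun i _ => ?_
    rw [← zpow_add₀ hr, ← zpow_add₀ hr, show (e i).2.2 - (e i).1.2 + (-(e i).2.2 + (e i).1.2) = 0 by
      ring, zpow_zero]
  linear_combination (∏ i, (kasteleyn α β (e i) : ℂ)) *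
      (Matrix.of fun i j => gibbsKernel α β z₀ (e i).1 (e j).2).det * h2

theorem correlation_shift {z₀ : ℂ} (hz₀ : z₀ ≠ 0) {ι : Type*} [Fintype ι] [DecidableEq ι]
    (e : ι → Edge) (a b : ℤ) :
    correlation α β z₀ (fun i => shiftEdge (3 * a, b) (e i)) = correlation α β z₀ e := by
  rw [correlation_eq hz₀, correlation_eq hz₀]
  simp only [kasteleyn_shiftEdge]
  simp only [shiftEdge, gibbsKernel_add]

/-- Decorrelation of distant families of edges. -/
theorem tendsto_correlation {z₀ : ℂ} (hz₀ : z₀ ≠ 0) {ι κ : Type*} [Fintype ι] [DecidableEq ι]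
    [Fintype κ] [DecidableEq κ] (e : ι → Edge) (f : κ → Edge) :
    Tendsto (fun n : ℕ => correlation α β z₀
      (Sum.elim e fun j => shiftEdge (3 * 0, (n : ℤ)) (f j))) atTop
      (𝓝 (correlation α β z₀ e * correlation α β z₀ f)) := by
  set A : Matrix ι ι ℂ := Matrix.of fun i j => gaugedKernel α β z₀ (e i).1 (e j).2 with hA
  set D : Matrix κ κ ℂ := Matrix.of fun i j => gaugedKernel α β z₀ (f i).1 (f j).2 with hD
  set B : ℕ → Matrix ι κ ℂ := fun n => Matrix.of fun i j =>
    gaugedKernel α β z₀ (e i).1 ((f j).2 + (3 * 0, (n : ℤ))) with hB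
  set C : ℕ → Matrix κ ι ℂ := fun n => Matrix.of fun i j =>
    gaugedKernel α β z₀ ((f i).1 + (3 * 0, (n : ℤ))) (e j).2 with hC
  have hmat : ∀ n : ℕ, (Matrix.of fun i j => gaugedKernel α β z₀
      (Sum.elim e (fun j => shiftEdge (3 * 0, (n : ℤ)) (f j)) i).1
      (Sum.elim e (fun j => shiftEdge (3 * 0, (n : ℤ)) (f j)) j).2) =
      Matrix.fromBlocks A (B n) (C n) D := by
    intro n
    ext (i | i) (j | j)
    · rfl
    · rfl
    · rfl
    · simp only [Matrix.of_apply, Sum.elim_inr, Matrix.fromBlocks_apply₂₂, hD, shiftEdge]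
      exact gaugedKernel_add z₀ hz₀ 0 n _ _
  -- The off-diagonal blocks couple the two distant families and tend to zero, so the determinant
  -- factorizes in the limit.
  have hlim : Tendsto (fun n => Matrix.fromBlocks A (B n) (C n) D) atTop
      (𝓝 (Matrix.fromBlocks A 0 0 D)) := by
    refine tendsto_pi_nhds.2 fun i => tendsto_pi_nhds.2 fun j => ?_
    rcases i with i | i <;> rcases j with j | j
    · exact tendsto_const_nhds
    · simp only [Matrix.fromBlocks_apply₁₂, Matrix.zero_apply, hB, Matrix.of_apply, mul_zero]
      exact (tendsto_gaugedKernel hz₀ _ _).1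
    · simp only [Matrix.fromBlocks_apply₂₁, Matrix.zero_apply, hC, Matrix.of_apply, mul_zero]
      exact (tendsto_gaugedKernel hz₀ _ _).2
    · exact tendsto_const_nhds
  have hc : Continuous fun A : Matrix (ι ⊕ κ) (ι ⊕ κ) ℂ => A.det := continuous_id.matrix_det
  have hdet := (hc.tendsto _).comp hlim
  rw [Matrix.det_fromBlocks_zero₂₁] at hdet
  have h := hdet.const_mul ((∏ i, (kasteleyn α β (e i) : ℂ) *
      (‖z₀‖ : ℂ) ^ ((e i).2.2 - (e i).1.2)) * ∏ i, (kasteleyn α β (f i) : ℂ) *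
      (‖z₀‖ : ℂ) ^ ((f i).2.2 - (f i).1.2))
  have hval : correlation α β z₀ e * correlation α β z₀ f = ((∏ i, (kasteleyn α β (e i) : ℂ) *
      (‖z₀‖ : ℂ) ^ ((e i).2.2 - (e i).1.2)) * ∏ i, (kasteleyn α β (f i) : ℂ) *
      (‖z₀‖ : ℂ) ^ ((f i).2.2 - (f i).1.2)) * (A.det * D.det) := by
    unfold correlation
    ring
  rw [hval]
  refine h.congr fun n => ?_
  unfold correlation
  rw [hmat, Fintype.prod_sum_type]
  simp only [Function.comp_def, Sum.elim_inl, Sum.elim_inr, kasteleyn_shiftEdge]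
  simp only [shiftEdge, Prod.snd_add, add_sub_add_right_eq_sub]

end

end TowerDimer

end

/-! ### Invariance, mixing and ergodicity. -/

noncomputable section

namespace TowerDimer

open MeasureTheory Filter Topology

section

variable {α β : ℝ}

theorem measurable_shift (v : Pt) : Measurable fun M : Set Edge => shiftEdge v ⁻¹' M :=
  measurable_set_iff.2 fun e => measurable_set_mem (shiftEdge v e)

theorem measure_superset_eq_zero {μ : Measure (Set Edge)} (hcover : ∀ᵐ M ∂μ, IsDimerCover Set.univ M)
    {s : Finset Edge} (hs : ¬ ∀ e ∈ s, IsEdge e) : μ {M | (s : Set Edge) ⊆ M} = 0 := by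
  push Not at hs
  obtain ⟨e, he, he'⟩ := hs
  have h : ∀ᵐ M ∂μ, ¬ (s : Set Edge) ⊆ M := by
    filter_upwards [hcover] with M hM hsM
    exact he' (hM.edge e (hsM he)).1
  rw [ae_iff] at h
  simpa only [not_not] using h

theorem measureReal_family {μ : Measure (Set Edge)} {z₀ : ℂ} (hz₀ : z₀ ≠ 0)
    (hdet : ∀ s : Finset Edge, (∀ e ∈ s, IsEdge e) → ((μ.real {M | (s : Set Edge) ⊆ M} : ℝ) : ℂ) =
      (∏ e ∈ s, (kasteleyn α β e : ℂ)) *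
        (Matrix.of fun e f : s => gibbsKernel α β z₀ e.1.1 f.1.2).det)
    {ι : Type*} [Fintype ι] [DecidableEq ι] {e : ι → Edge} (he : Function.Injective e)
    (hE : ∀ i, IsEdge (e i)) :
    ((μ.real {M | ∀ i, e i ∈ M} : ℝ) : ℂ) = correlation α β z₀ e := by
  have h1 := hdet (Finset.univ.image e) (by simpa using hE)
  rw [Finset.prod_image he.injOn, det_finset_eq he (by simp)
    (G := fun e f => gibbsKernel α β z₀ e.1 f.2), ← correlation_eq hz₀] at h1
  rw [← h1]
  congr 3
  ext M
  simp only [Finset.coe_image, Finset.coe_univ, Set.image_univ, Set.range_subset_iff]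

/-- Translation invariance from the determinantal formula. -/
theorem invariant_of_determinantal {μ : Measure (Set Edge)} [IsProbabilityMeasure μ] {z₀ : ℂ}
    (hz₀ : z₀ ≠ 0) (hcover : ∀ᵐ M ∂μ, IsDimerCover Set.univ M)
    (hdet : ∀ s : Finset Edge, (∀ e ∈ s, IsEdge e) → ((μ.real {M | (s : Set Edge) ⊆ M} : ℝ) : ℂ) =
      (∏ e ∈ s, (kasteleyn α β e : ℂ)) *
        (Matrix.of fun e f : s => gibbsKernel α β z₀ e.1.1 f.1.2).det) (a b : ℤ) :
    μ.map (fun M => shiftEdge (3 * a, b) ⁻¹' M) = μ := by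
  have hprob : IsProbabilityMeasure (μ.map (fun M => shiftEdge (3 * a, b) ⁻¹' M)) :=
    Measure.isProbabilityMeasure_map (measurable_shift _).aemeasurable
  refine ext_of_cylinders fun s => ?_
  rw [Measure.map_apply (measurable_shift _) (measurableSet_superset s)]
  have hset : (fun M : Set Edge => shiftEdge (3 * a, b) ⁻¹' M) ⁻¹' {M | (s : Set Edge) ⊆ M} =
      {M | ((s.image (shiftEdge (3 * a, b)) : Finset Edge) : Set Edge) ⊆ M} := by
    ext M
    simp only [Set.mem_preimage, Set.mem_ofPred_eq, Finset.coe_image, Set.image_subset_iff]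
  rw [hset]
  by_cases hs : ∀ e ∈ s, IsEdge e
  · have h1 := measureReal_family hz₀ hdet (e := fun i : s => (i : Edge)) Subtype.val_injective
      fun i => hs i i.2
    have h2 := measureReal_family hz₀ hdet (e := fun i : s => shiftEdge (3 * a, b) i)
      ((shiftEdge_injective _).comp Subtype.val_injective)
      fun i => (isEdge_shiftEdge a b _).2 (hs i i.2)
    rw [correlation_shift hz₀, ← h1, Complex.ofReal_inj] at h2
    have e1 : {M : Set Edge | ∀ i : s, (i : Edge) ∈ M} = {M | (s : Set Edge) ⊆ M} := by
      ext M
      simp [Set.subset_def]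
    have e2 : {M : Set Edge | ∀ i : s, shiftEdge (3 * a, b) (i : Edge) ∈ M} =
        {M | ((s.image (shiftEdge (3 * a, b)) : Finset Edge) : Set Edge) ⊆ M} := by
      ext M
      rw [Set.mem_ofPred_eq, Set.mem_ofPred_eq, Finset.coe_image, Set.image_subset_iff]
      simp [Set.subset_def]
    rw [e1, e2] at h2
    exact (measureReal_eq_measureReal_iff).1 h2
  · rw [measure_superset_eq_zero hcover hs, measure_superset_eq_zero hcover]
    intro h
    refine hs fun e he => ?_
    rw [← isEdge_shiftEdge a b]
    exact h _ (Finset.mem_image_of_mem _ he)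

/-- Mixing on cylinders. -/
theorem tendsto_measure_cylinders {μ : Measure (Set Edge)} [IsProbabilityMeasure μ] {z₀ : ℂ}
    (hz₀ : z₀ ≠ 0) (hcover : ∀ᵐ M ∂μ, IsDimerCover Set.univ M)
    (hdet : ∀ s : Finset Edge, (∀ e ∈ s, IsEdge e) → ((μ.real {M | (s : Set Edge) ⊆ M} : ℝ) : ℂ) =
      (∏ e ∈ s, (kasteleyn α β e : ℂ)) *
        (Matrix.of fun e f : s => gibbsKernel α β z₀ e.1.1 f.1.2).det) (s t : Finset Edge) :
    Tendsto (fun n : ℕ => μ.real ({M | (s : Set Edge) ⊆ M} ∩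
      (fun M => shiftEdge (3 * 0, (n : ℤ)) ⁻¹' M) ⁻¹' {M | (t : Set Edge) ⊆ M})) atTop
      (𝓝 (μ.real {M | (s : Set Edge) ⊆ M} * μ.real {M | (t : Set Edge) ⊆ M})) := by
  have hinv := invariant_of_determinantal hz₀ hcover hdet
  by_cases hs : ∀ e ∈ s, IsEdge e
  · by_cases ht : ∀ e ∈ t, IsEdge e
    · have e1 : ∀ s : Finset Edge, {M : Set Edge | ∀ i : s, (i : Edge) ∈ M} =
          {M | (s : Set Edge) ⊆ M} := by
        intro s
        ext M
        simp [Set.subset_def]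
      have h1 := measureReal_family hz₀ hdet (e := fun i : s => (i : Edge)) Subtype.val_injective
        fun i => hs i i.2
      have h2 := measureReal_family hz₀ hdet (e := fun i : t => (i : Edge)) Subtype.val_injective
        fun i => ht i i.2
      rw [e1] at h1 h2
      have hlim := tendsto_correlation (α := α) (β := β) hz₀ (fun i : s => (i : Edge))
        (fun i : t => (i : Edge))
      rw [← h1, ← h2] at hlim
      have hre := (Complex.continuous_re.tendsto _).comp hlim
      rw [← Complex.ofReal_mul, Complex.ofReal_re] at hre
      refine hre.congr' ?_
      -- The determinantal formula applies to distinct edges; after a large translation the two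
      -- families are disjoint.
      have hne : ∀ᶠ n : ℕ in atTop, ∀ (i : s) (j : t),
          (i : Edge) ≠ shiftEdge (3 * 0, (n : ℤ)) (j : Edge) := by
        rw [Filter.eventually_all]
        intro i
        rw [Filter.eventually_all]
        intro j
        filter_upwards [Filter.eventually_gt_atTop ((i : Edge).1.2 - (j : Edge).1.2).toNat]
          with n hn h
        have h3 := congrArg (fun e : Edge => e.1.2) h
        simp only [shiftEdge, Prod.snd_add] at h3
        omega
      filter_upwards [hne] with n hn
      have h3 := measureReal_family hz₀ hdet (e := Sum.elim (fun i : s => (i : Edge))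
        fun j : t => shiftEdge (3 * 0, (n : ℤ)) (j : Edge))
        (Subtype.val_injective.sumElim ((shiftEdge_injective _).comp Subtype.val_injective) hn)
        (by
          rintro (i | j)
          · exact hs i i.2
          · exact (isEdge_shiftEdge 0 n _).2 (ht j j.2))
      rw [Function.comp_apply, ← h3, Complex.ofReal_re]
      congr 1
      ext M
      simp [Set.subset_def, Sum.forall]
    · have h0 := measure_superset_eq_zero hcover ht
      have h0' : μ.real {M | (t : Set Edge) ⊆ M} = 0 := by rw [Measure.real, h0]; rfl
      have h1 : μ.real {M | (s : Set Edge) ⊆ M} * μ.real {M | (t : Set Edge) ⊆ M} = 0 := by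
        rw [h0', mul_zero]
      rw [h1]
      refine tendsto_const_nhds.congr fun n => ?_
      symm
      rw [measureReal_eq_zero_iff]
      refine measure_mono_null Set.inter_subset_right ?_
      rw [← Measure.map_apply (measurable_shift _) (measurableSet_superset t), hinv]
      exact h0
  · have h0 := measure_superset_eq_zero hcover hs
    have h0' : μ.real {M | (s : Set Edge) ⊆ M} = 0 := by rw [Measure.real, h0]; rfl
    have h1 : μ.real {M | (s : Set Edge) ⊆ M} * μ.real {M | (t : Set Edge) ⊆ M} = 0 := by
      rw [h0', zero_mul]
    rw [h1]
    refine tendsto_const_nhds.congr fun n => ?_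
    symm
    rw [measureReal_eq_zero_iff]
    exact measure_mono_null Set.inter_subset_left h0

/-- Mixing of cylinders against arbitrary events makes an invariant event independent of all
cylinders, hence of itself: its probability satisfies `p = p²`. -/
theorem ergodic_of_determinantal {μ : Measure (Set Edge)} [IsProbabilityMeasure μ] {z₀ : ℂ}
    (hz₀ : z₀ ≠ 0) (hcover : ∀ᵐ M ∂μ, IsDimerCover Set.univ M)
    (hdet : ∀ s : Finset Edge, (∀ e ∈ s, IsEdge e) → ((μ.real {M | (s : Set Edge) ⊆ M} : ℝ) : ℂ) =
      (∏ e ∈ s, (kasteleyn α β e : ℂ)) *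
        (Matrix.of fun e f : s => gibbsKernel α β z₀ e.1.1 f.1.2).det) {B : Set (Set Edge)}
    (hB : MeasurableSet B)
    (hinvB : ∀ a b : ℤ, (fun M => shiftEdge (3 * a, b) ⁻¹' M) ⁻¹' B = B) : μ B = 0 ∨ μ B = 1 := by
  have hinv := invariant_of_determinantal hz₀ hcover hdet
  have hτ : ∀ (n : ℕ) (C : Set (Set Edge)), MeasurableSet C →
      μ.real ((fun M => shiftEdge (3 * 0, (n : ℤ)) ⁻¹' M) ⁻¹' C) = μ.real C := by
    intro n C hC
    rw [Measure.real, ← Measure.map_apply (measurable_shift _) hC, hinv, Measure.real]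
  have hτm : ∀ (n : ℕ) (C : Set (Set Edge)), MeasurableSet C →
      MeasurableSet ((fun M => shiftEdge (3 * 0, (n : ℤ)) ⁻¹' M) ⁻¹' C) := fun n C hC =>
    measurable_shift _ hC
  -- mixing of cylinders with arbitrary events
  have hmix : ∀ s : Finset Edge, ∀ C : Set (Set Edge), MeasurableSet C →
      Tendsto (fun n : ℕ => μ.real ({M | (s : Set Edge) ⊆ M} ∩
        (fun M => shiftEdge (3 * 0, (n : ℤ)) ⁻¹' M) ⁻¹' C)) atTop
        (𝓝 (μ.real {M | (s : Set Edge) ⊆ M} * μ.real C)) := by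
    intro s C hC
    induction C, hC using MeasurableSpace.induction_on_inter generateFrom_cylinders
      isPiSystem_cylinders with
    | empty => simp
    | basic C hC =>
      obtain ⟨t, rfl⟩ := hC
      exact tendsto_measure_cylinders hz₀ hcover hdet s t
    | compl C hC ih =>
      have h1 := ih.const_sub (μ.real {M | (s : Set Edge) ⊆ M})
      rw [measureReal_compl hC, probReal_univ, mul_sub, mul_one]
      refine h1.congr fun n => ?_
      have h2 := measureReal_inter_add_sdiff (μ := μ) (s := {M | (s : Set Edge) ⊆ M})
        (hτm n C hC)
      rw [Set.preimage_compl, ← Set.sdiff_eq]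
      linarith
    | iUnion f hd hf ih =>
      have hsum : ∀ g : ℕ → Set (Set Edge), Pairwise (Function.onFun Disjoint g) →
          (∀ i, MeasurableSet (g i)) → HasSum (fun i => μ.real (g i)) (μ.real (⋃ i, g i)) := by
        intro g hg hgm
        have h1 := measure_iUnion (μ := μ) hg hgm
        have h2 : ∑' i, μ (g i) ≠ ⊤ := by
          rw [← h1]
          exact measure_ne_top _ _
        have h3 := ENNReal.hasSum_toReal h2
        rw [← ENNReal.tsum_toReal_eq (fun i => measure_ne_top _ _), ← h1] at h3
        exact h3
      have hS := hsum f hd hf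
      -- By invariance the terms are dominated by `μ (f i)` for all `n`, and these are summable.
      have h1 := tendsto_tsum_of_dominated_convergence (𝓕 := atTop)
        (f := fun (n : ℕ) i => μ.real ({M | (s : Set Edge) ⊆ M} ∩
          (fun M => shiftEdge (3 * 0, (n : ℤ)) ⁻¹' M) ⁻¹' f i)) hS.summable ih
        (Eventually.of_forall fun n i => by
          rw [Real.norm_of_nonneg measureReal_nonneg, ← hτ n (f i) (hf i)]
          exact measureReal_mono Set.inter_subset_right)
      rw [(hS.mul_left (μ.real {M | (s : Set Edge) ⊆ M})).tsum_eq] at h1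
      refine h1.congr fun n => ?_
      have h2 := hsum (fun i => {M | (s : Set Edge) ⊆ M} ∩
          (fun M => shiftEdge (3 * 0, (n : ℤ)) ⁻¹' M) ⁻¹' f i)
        (fun i j hij => ((hd hij).preimage _).mono Set.inter_subset_right Set.inter_subset_right)
        fun i => (measurableSet_superset s).inter (hτm n _ (hf i))
      rw [h2.tsum_eq, ← Set.inter_iUnion, Set.preimage_iUnion]
  have hcyl : ∀ s : Finset Edge, μ.real ({M | (s : Set Edge) ⊆ M} ∩ B) =
      μ.real {M | (s : Set Edge) ⊆ M} * μ.real B := by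
    intro s
    have h1 := hmix s B hB
    simp only [hinvB] at h1
    exact tendsto_nhds_unique tendsto_const_nhds h1
  have heq : μ.restrict B = μ B • μ := by
    refine ext_of_cylinders fun s => ?_
    rw [Measure.restrict_apply (measurableSet_superset s), Measure.smul_apply, smul_eq_mul,
      ← ENNReal.toReal_eq_toReal_iff' (measure_ne_top _ _)
      (ENNReal.mul_ne_top (measure_ne_top _ _) (measure_ne_top _ _)), ENNReal.toReal_mul, mul_comm]
    exact hcyl s
  have h2 := congrArg (fun m : Measure (Set Edge) => (m B).toReal) heq
  simp only [Measure.restrict_apply hB, Set.inter_self, Measure.smul_apply, smul_eq_mul,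
    ENNReal.toReal_mul] at h2
  have h3 : (μ B).toReal * ((μ B).toReal - 1) = 0 := by linear_combination -h2
  rcases mul_eq_zero.1 h3 with h | h
  · left
    exact ((ENNReal.toReal_eq_zero_iff _).1 h).resolve_right (measure_ne_top _ _)
  · right
    exact (ENNReal.toReal_eq_one_iff _).1 (by linarith)

/-- The local limit of the towers at a point where the kernels converge. -/
theorem exists_isGibbsMeasure (hα : 0 < α) (hβ : 0 < β) {p : ℝ × ℝ} (hp : p ∈ domain) {z₀ : ℂ}
    (hz₀ : z₀ ≠ 0) (hK : KernelConverges α β p z₀) :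
    ∃ μ : Measure (Set Edge), IsGibbsMeasure α β z₀ μ ∧ IsLocalLimit α β p μ := by
  obtain ⟨μ, hμ, hcover, hlim, hdet, hgibbs⟩ := exists_limit_measure hα hβ hp hK
  exact ⟨μ, ⟨hμ, hcover, hdet, hgibbs, invariant_of_determinantal hz₀ hcover hdet,
    fun B hB hinv => ergodic_of_determinantal hz₀ hcover hdet hB hinv⟩, hlim⟩

end

end TowerDimer

end

/-! ### Real complex coordinates and frozen dimer covers. -/

noncomputable section

namespace TowerDimer

open MeasureTheory Filter Topology Complex Metric

section

variable {α β : ℝ}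

/-- The second integrand is `1 / (z - c) - 1 / z`, so its integral vanishes exactly when `c` is
inside the circle. -/
theorem circleIntegral_real_pole {c r : ℝ} (hr : 0 < r) (hc : |c| ≠ r) :
    ((∮ z in C(0, r), (z - (c : ℂ))⁻¹) = 0 ∨ (∮ z in C(0, r), (z - (c : ℂ))⁻¹) = 2 * Real.pi * I) ∧
    ((∮ z in C(0, r), c * (z⁻¹ * (z - (c : ℂ))⁻¹)) = 0 ∨
      (∮ z in C(0, r), c * (z⁻¹ * (z - (c : ℂ))⁻¹)) = -(2 * Real.pi * I)) := by
  have h0 : (∮ z in C(0, r), z⁻¹) = 2 * Real.pi * I := by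
    have := circleIntegral.integral_sub_inv_of_mem_ball (c := 0) (w := 0) (R := r) (by simpa using hr)
    simpa using this
  have hne : ∀ z ∈ sphere (0 : ℂ) r, z - (c : ℂ) ≠ 0 ∧ z ≠ 0 := by
    intro z hz
    rw [mem_sphere_zero_iff_norm] at hz
    refine ⟨fun h => hc ?_, fun h => ?_⟩
    · rw [sub_eq_zero.1 h, Complex.norm_real, Real.norm_eq_abs] at hz
      exact hz
    · rw [h, norm_zero] at hz
      exact hr.ne hz
  have h1 : (∮ z in C(0, r), c * (z⁻¹ * (z - (c : ℂ))⁻¹)) =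
      (∮ z in C(0, r), (z - (c : ℂ))⁻¹) - ∮ z in C(0, r), z⁻¹ := by
    rw [← circleIntegral.integral_sub]
    · refine circleIntegral.integral_congr hr.le fun z hz => ?_
      obtain ⟨h1, h2⟩ := hne z hz
      field_simp
      ring
    · exact ContinuousOn.circleIntegrable hr.le
        (ContinuousOn.inv₀ (by fun_prop) fun z hz => (hne z hz).1)
    · exact ContinuousOn.circleIntegrable hr.le
        (ContinuousOn.inv₀ (by fun_prop) fun z hz => (hne z hz).2)
  rw [h1, h0]
  rcases lt_or_gt_of_ne hc with h | h
  · have h2 : (∮ z in C(0, r), (z - (c : ℂ))⁻¹) = 2 * Real.pi * I :=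
      circleIntegral.integral_sub_inv_of_mem_ball (by simpa using h)
    rw [h2]
    exact ⟨Or.inr rfl, Or.inl (sub_self _)⟩
  · have h2 : (∮ z in C(0, r), (z - (c : ℂ))⁻¹) = 0 :=
      circleIntegral_sub_inv_of_lt hr.le (by simpa using h)
    rw [h2]
    exact ⟨Or.inl rfl, Or.inr (zero_sub _)⟩

/-- The argument is `0`: the right arc is a point, and the left arc is the full circle run
clockwise, whence the sign. -/
theorem gibbsKernel_of_pos {r : ℝ} (hr : 0 < r) (P Q : Pt) : gibbsKernel α β (r : ℂ) P Q =
    if Q.1 ≤ P.1 then 0 else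
      -(1 / (2 * Real.pi * I) * ∮ z in C(0, r), gibbsIntegrand α β P Q z) := by
  unfold gibbsKernel
  rw [Complex.arg_ofReal_of_nonneg hr.le, Complex.norm_real, Real.norm_of_nonneg hr.le]
  split_ifs
  · rw [neg_zero, intervalIntegral.integral_same, mul_zero]
  · rw [sub_zero, intervalIntegral.integral_symm, circleIntegral, mul_neg]
    simp only [smul_eq_mul, mul_comm]

/-- The argument is `π`: the left arc is a point, and the right arc is the full circle run
counterclockwise from `-π` to `π`. -/
theorem gibbsKernel_of_neg {r : ℝ} (hr : 0 < r) (P Q : Pt) : gibbsKernel α β ((-r : ℝ) : ℂ) P Q =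
    if Q.1 ≤ P.1 then 1 / (2 * Real.pi * I) * ∮ z in C(0, r), gibbsIntegrand α β P Q z else 0 := by
  unfold gibbsKernel
  rw [Complex.arg_ofReal_of_neg (by linarith), Complex.norm_real, norm_neg, Real.norm_of_nonneg hr.le]
  split_ifs
  · congr 1
    have hper : Function.Periodic (fun θ => gibbsIntegrand α β P Q (circleMap 0 r θ) *
        deriv (circleMap 0 r) θ) (2 * Real.pi) := by
      intro θ
      simp only [deriv_circleMap, periodic_circleMap 0 r θ]
    have := hper.intervalIntegral_add_eq (-Real.pi) 0
    rw [show -Real.pi + 2 * Real.pi = Real.pi by ring, zero_add] at this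
    rw [this, circleIntegral]
    simp only [smul_eq_mul, mul_comm]
  · rw [show 2 * Real.pi - Real.pi = Real.pi by ring, intervalIntegral.integral_same, mul_zero]

/-- For a real complex coordinate each edge has probability `0` or `1`. -/
theorem edge_zero_or_one (hα : 0 < α) (hβ : 0 < β) {z₀ : ℂ} (hz₀ : Regular α β z₀)
    (him : z₀.im = 0) {e : Edge} (he : IsEdge e) :
    (kasteleyn α β e : ℂ) * gibbsKernel α β z₀ e.1 e.2 = 0 ∨
      (kasteleyn α β e : ℂ) * gibbsKernel α β z₀ e.1 e.2 = 1 := by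
  obtain ⟨x, rfl⟩ : ∃ x : ℝ, z₀ = (x : ℂ) := ⟨z₀.re, Complex.ext rfl (by simpa using him)⟩
  have hx0 : x ≠ 0 := fun h => hz₀.1 (by rw [h]; rfl)
  have hpi := Complex.two_pi_I_ne_zero
  -- values of the kernel from those of the contour integral
  have hright : ∀ c : ℝ, 0 < c → x ≠ c → ¬ e.2.1 ≤ e.1.1 →
      ((∀ z : ℂ, z ≠ 0 → z ≠ c → (kasteleyn α β e : ℂ) * gibbsIntegrand α β e.1 e.2 z =
        -(z - c)⁻¹) ∨ (∀ z : ℂ, z ≠ 0 → z ≠ c → (kasteleyn α β e : ℂ) *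
        gibbsIntegrand α β e.1 e.2 z = c * (z⁻¹ * (z - c)⁻¹))) →
      ((kasteleyn α β e : ℂ) * gibbsKernel α β (x : ℂ) e.1 e.2 = 0 ∨
        (kasteleyn α β e : ℂ) * gibbsKernel α β (x : ℂ) e.1 e.2 = 1) := by
    intro c hc hxc hle hval
    rcases lt_or_gt_of_ne hx0 with hx | hx
    · left
      rw [show x = -(-x) by ring, gibbsKernel_of_neg (by linarith), if_neg hle, mul_zero]
    · rw [gibbsKernel_of_pos hx, if_neg hle, mul_neg, mul_left_comm,
        ← circleIntegral.integral_const_mul]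
      obtain ⟨h1, h2⟩ := circleIntegral_real_pole hx (c := c) (by rw [abs_of_pos hc]; exact hxc.symm)
      have hne : ∀ z ∈ sphere (0 : ℂ) x, z ≠ 0 ∧ z ≠ c := by
        intro z hz
        rw [mem_sphere_zero_iff_norm] at hz
        refine ⟨fun h => ?_, fun h => ?_⟩
        · rw [h, norm_zero] at hz
          exact hx.ne hz
        · rw [h, Complex.norm_real, Real.norm_of_nonneg hc.le] at hz
          exact hxc hz.symm
      rcases hval with hval | hval
      · rw [circleIntegral.integral_congr hx.le (g := fun z => (-1 : ℂ) * (z - (c : ℂ))⁻¹) fun z hz => by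
          simp only [hval z (hne z hz).1 (hne z hz).2, neg_one_mul],
          circleIntegral.integral_const_mul]
        rcases h1 with h | h
        · left; rw [h]; ring
        · right; rw [h]; field_simp
      · rw [circleIntegral.integral_congr hx.le (g := fun z => (c : ℂ) * (z⁻¹ * (z - (c : ℂ))⁻¹))
          fun z hz => hval z (hne z hz).1 (hne z hz).2]
        rcases h2 with h | h
        · left; rw [h]; ring
        · right; rw [h]; field_simp
  have hleft : ∀ c : ℝ, c ≤ 0 → x ≠ c → e.2.1 ≤ e.1.1 →
      ((∀ z : ℂ, z ≠ 0 → z ≠ c → (kasteleyn α β e : ℂ) * gibbsIntegrand α β e.1 e.2 z =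
        (z - c)⁻¹) ∨ (∀ z : ℂ, z ≠ 0 → z ≠ c → (kasteleyn α β e : ℂ) *
        gibbsIntegrand α β e.1 e.2 z = -(c * (z⁻¹ * (z - c)⁻¹)))) →
      ((kasteleyn α β e : ℂ) * gibbsKernel α β (x : ℂ) e.1 e.2 = 0 ∨
        (kasteleyn α β e : ℂ) * gibbsKernel α β (x : ℂ) e.1 e.2 = 1) := by
    intro c hc hxc hle hval
    rcases lt_or_gt_of_ne hx0 with hx | hx
    · have hx' : 0 < -x := by linarith
      rw [show x = -(-x) by ring, gibbsKernel_of_neg hx', if_pos hle, mul_left_comm,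
        ← circleIntegral.integral_const_mul]
      obtain ⟨h1, h2⟩ := circleIntegral_real_pole hx' (c := c) (by
        rw [abs_of_nonpos hc]
        intro h
        exact hxc (by linarith))
      have hne : ∀ z ∈ sphere (0 : ℂ) (-x), z ≠ 0 ∧ z ≠ c := by
        intro z hz
        rw [mem_sphere_zero_iff_norm] at hz
        refine ⟨fun h => ?_, fun h => ?_⟩
        · rw [h, norm_zero] at hz
          linarith
        · rw [h, Complex.norm_real, Real.norm_of_nonpos hc] at hz
          exact hxc (by linarith)
      rcases hval with hval | hval
      · rw [circleIntegral.integral_congr hx'.le (g := fun z => (z - (c : ℂ))⁻¹) fun z hz =>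
          hval z (hne z hz).1 (hne z hz).2]
        rcases h1 with h | h
        · left; rw [h]; ring
        · right; rw [h]; field_simp
      · rw [circleIntegral.integral_congr hx'.le
          (g := fun z => (-1 : ℂ) * ((c : ℂ) * (z⁻¹ * (z - (c : ℂ))⁻¹)))
          fun z hz => by simp only [hval z (hne z hz).1 (hne z hz).2, neg_one_mul],
          circleIntegral.integral_const_mul]
        rcases h2 with h | h
        · left; rw [h]; ring
        · right; rw [h]; field_simp
    · left
      rw [gibbsKernel_of_pos hx, if_pos hle, mul_zero]
  have hxα : x ≠ α := fun h => hz₀.2.2.1 (by rw [h])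
  have hx1 : x ≠ 1 := fun h => hz₀.2.1 (by rw [h]; rfl)
  have hxβ : x ≠ -(1 / β) := fun h => hz₀.2.2.2 (by
    rw [h]
    have : (β : ℂ) ≠ 0 := by exact_mod_cast hβ.ne'
    push_cast
    field_simp
    ring)
  have hβ' : (β : ℂ) ≠ 0 := by exact_mod_cast hβ.ne'
  have hfac : ∀ z : ℂ, (1 + β * z)⁻¹ = (β : ℂ)⁻¹ * (z - ((-(1 / β) : ℝ) : ℂ))⁻¹ := by
    intro z
    rw [← mul_inv]
    congr 1
    push_cast
    field_simp
    ring
  have hsub : ∀ z c : ℂ, z ≠ 0 → (1 - c * z⁻¹)⁻¹ = z * (z - c)⁻¹ := by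
    intro z c hz
    rw [show 1 - c * z⁻¹ = (z - c) * z⁻¹ by field_simp, mul_inv, inv_inv, mul_comm]
  -- For each of the seven kinds of edges the integrand has, up to sign, the form `1 / (z - c)` or
  -- `c / (z (z - c))`. Edges to a column on the right have `c = α` or `c = 1`; the others have `c =
  -- -1 / β` or `c = 0`.
  obtain ⟨⟨X, U⟩, Q⟩ := e
  simp only [IsEdge] at he
  rcases he with ⟨hX, hQ⟩ | ⟨hX, hQ⟩
  · obtain ⟨k, rfl⟩ : ∃ k, X = 3 * k := ⟨X / 3, by omega⟩
    have t0 : tOf (3 * k) = k + 1 := by unfold tOf; omega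
    have t1 : tOf (3 * k + 1) = k + 1 := by unfold tOf; omega
    have t2 : tOf (3 * k - 1) = k := by unfold tOf; omega
    have m0 : mOf (3 * k) = 3 := by unfold mOf; omega
    have m1 : mOf (3 * k + 1) = 2 := by unfold mOf; omega
    have m2 : mOf (3 * k - 1) = 1 := by unfold mOf; omega
    have hn1 : (3 * k - 1 : ℤ) ≠ 3 * k + 1 := by omega
    rcases hQ with rfl | rfl | rfl | rfl
    · refine hright α hα hxα (by simp) (Or.inl fun z hz hz' => ?_)
      simp only [kasteleyn, weight, hX, gibbsIntegrand, t0, t1, m0, m1, ind]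
      simp only [if_true, sub_self, zpow_zero]
      norm_num
      rw [hsub z α hz]
      field_simp
    · refine hright α hα hxα (by simp) (Or.inr fun z hz hz' => ?_)
      simp only [kasteleyn, weight, hX, gibbsIntegrand, t0, t1, m0, m1, ind]
      simp only [if_true, sub_self, zpow_zero]
      norm_num
      rw [hsub z α hz]
      left
      field_simp
    · refine hleft (-(1 / β)) (by simp; positivity) hxβ (by simp) (Or.inr fun z hz hz' => ?_)
      simp only [kasteleyn, weight, hX, gibbsIntegrand, t0, t2, m0, m2, ind]
      simp only [if_true, sub_self]
      norm_num [hn1]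
      rw [hfac]
      push_cast
      rw [sub_neg_eq_add, one_div]
      ring
    · refine hleft (-(1 / β)) (by simp; positivity) hxβ (by simp) (Or.inl fun z hz hz' => ?_)
      simp only [kasteleyn, weight, hX, gibbsIntegrand, t0, t2, m0, m2, ind]
      simp only [if_true]
      norm_num [hn1]
      rw [hfac]
      push_cast
      rw [sub_neg_eq_add, one_div, mul_inv_cancel_left₀ hβ']
  · obtain ⟨k, rfl⟩ : ∃ k, X = 3 * k + 1 := ⟨X / 3, by omega⟩
    have t1 : tOf (3 * k + 1) = k + 1 := by unfold tOf; omega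
    have t2 : tOf (3 * k + 1 + 1) = k + 1 := by unfold tOf; omega
    have m1 : mOf (3 * k + 1) = 2 := by unfold mOf; omega
    have m2 : mOf (3 * k + 1 + 1) = 1 := by unfold mOf; omega
    rcases hQ with rfl | rfl | rfl
    · refine hleft 0 le_rfl hx0 le_rfl (Or.inl fun z hz hz' => ?_)
      simp only [kasteleyn, weight, hX, gibbsIntegrand, t1, m1, ind]
      norm_num
    · refine hright 1 one_pos hx1 (by simp) (Or.inl fun z hz hz' => ?_)
      simp only [kasteleyn, weight, hX, gibbsIntegrand, t1, t2, m1, m2, ind]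
      norm_num
      have h1 := hsub z 1 hz
      rw [one_mul] at h1
      rw [h1]
      field_simp
    · refine hright 1 one_pos hx1 (by simp) (Or.inr fun z hz hz' => ?_)
      simp only [kasteleyn, weight, hX, gibbsIntegrand, t1, t2, m1, m2, ind]
      norm_num
      have h1 := hsub z 1 hz
      rw [one_mul] at h1
      rw [h1]
      field_simp

/-- For a real complex coordinate the Gibbs measure is nonrandom. -/
theorem IsGibbsMeasure.exists_eq_dirac (hα : 0 < α) (hβ : 0 < β) {z₀ : ℂ} (hz₀ : Regular α β z₀)
    (him : z₀.im = 0) {μ : Measure (Set Edge)} (hμ : IsGibbsMeasure α β z₀ μ) :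
    ∃ M : Set Edge, IsDimerCover Set.univ M ∧ μ = Measure.dirac M := by
  have := hμ.isProbabilityMeasure
  have hedge : ∀ e, IsEdge e → μ {M | e ∈ M} = 0 ∨ μ {M | e ∈ M} = 1 := by
    intro e he
    have h1 := measureReal_family hz₀.1 hμ.determinantal (e := fun _ : Unit => e)
      (fun _ _ _ => rfl) fun _ => he
    rw [correlation_eq hz₀.1, Matrix.det_unique] at h1
    simp only [Finset.univ_unique, Finset.prod_singleton, Matrix.of_apply, forall_const] at h1
    rcases edge_zero_or_one hα hβ hz₀ him he with h | h
    · left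
      rw [h, Complex.ofReal_eq_zero] at h1
      exact (measureReal_eq_zero_iff).1 h1
    · right
      rw [h, Complex.ofReal_eq_one, Measure.real] at h1
      exact (ENNReal.toReal_eq_one_iff _).1 h1
  -- The edges of probability one. As there are countably many edges, the random cover is almost
  -- surely equal to this set.
  set M₀ : Set Edge := {e | μ {M | e ∈ M} = 1} with hM₀
  have hae : ∀ᵐ M ∂μ, M = M₀ := by
    have h1 : ∀ᵐ M ∂μ, ∀ e : Edge, e ∈ M ↔ e ∈ M₀ := by
      rw [ae_all_iff]
      intro e
      have hzero : μ {M | e ∈ M} = 0 → ∀ᵐ M ∂μ, e ∈ M ↔ e ∈ M₀ := by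
        intro h
        have h2 : ∀ᵐ M ∂μ, e ∉ M := by
          rw [ae_iff]
          simpa only [not_not] using h
        filter_upwards [h2] with M hM
        refine iff_of_false hM fun h3 => ?_
        rw [hM₀, Set.mem_ofPred_eq, h] at h3
        exact zero_ne_one h3
      by_cases he : IsEdge e
      · rcases hedge e he with h | h
        · exact hzero h
        · have h2 : ∀ᵐ M ∂μ, e ∈ M := (mem_ae_iff_prob_eq_one (measurableSet_mem e)).2 h
          filter_upwards [h2] with M hM
          exact iff_of_true hM h
      · refine hzero ?_
        have h2 : ∀ᵐ M ∂μ, ¬ e ∈ M := by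
          filter_upwards [hμ.cover] with M hM hM'
          exact he (hM.edge e hM').1
        rw [ae_iff] at h2
        simpa only [not_not] using h2
    filter_upwards [h1] with M hM
    exact Set.ext hM
  obtain ⟨M, hM, hM'⟩ := (hμ.cover.and hae).exists
  refine ⟨M₀, hM' ▸ hM, Measure.ext fun B hB => ?_⟩
  rw [Measure.dirac_apply' _ hB]
  by_cases h : M₀ ∈ B
  · rw [Set.indicator_of_mem h, Pi.one_apply]
    refine (mem_ae_iff_prob_eq_one hB).1 ?_
    filter_upwards [hae] with M hM
    rw [hM]
    exact h
  · rw [Set.indicator_of_notMem h]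
    have h2 : ∀ᵐ M ∂μ, M ∉ B := by
      filter_upwards [hae] with M hM
      rw [hM]
      exact h
    rw [ae_iff] at h2
    simp only [not_not] at h2
    exact h2

end

end TowerDimer

end

theorem mainTheorem2 (α β : ℝ) (hα : 0 < α) (hβ : 0 < β) :
    ∃ z₀ : ℝ × ℝ → ℂ,
      (∀ p ∈ TowerDimer.liquidRegion α β,
        (∀ z : ℂ, (0 < z.im ∧ TowerDimer.IsCriticalPoint α β p.1 p.2 z) ↔ z = z₀ p) ∧
        TowerDimer.KernelConverges α β p (z₀ p) ∧
        ∃ μ : MeasureTheory.Measure (Set TowerDimer.Edge),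
          TowerDimer.IsGibbsMeasure α β (z₀ p) μ ∧ TowerDimer.IsLocalLimit α β p μ) ∧
      (∀ p ∈ TowerDimer.frozenRegion α β,
        (z₀ p).im = 0 ∧ TowerDimer.IsCriticalPoint α β p.1 p.2 (z₀ p) ∧
        TowerDimer.KernelConverges α β p (z₀ p) ∧
        ∃ M : Set TowerDimer.Edge, TowerDimer.IsDimerCover Set.univ M ∧
          TowerDimer.IsGibbsMeasure α β (z₀ p) (MeasureTheory.Measure.dirac M) ∧
          TowerDimer.IsLocalLimit α β p (MeasureTheory.Measure.dirac M)) := by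
  -- The coordinate is chosen point by point. The regions are disjoint, since a liquid point has a
  -- non-real critical point; outside both of them the value `0` is a dummy.
  have key : ∀ p : ℝ × ℝ, ∃ z₀ : ℂ,
      (p ∈ TowerDimer.liquidRegion α β → TowerDimer.IsSaddle α β p.1 p.2 z₀ ∧
        ∀ z : ℂ, (0 < z.im ∧ TowerDimer.IsCriticalPoint α β p.1 p.2 z) ↔ z = z₀) ∧
      (p ∈ TowerDimer.frozenRegion α β → TowerDimer.IsSaddle α β p.1 p.2 z₀ ∧ z₀.im = 0) := by
    intro p
    by_cases hl : p ∈ TowerDimer.liquidRegion α β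
    · obtain ⟨⟨hx0, hx1, hu, -⟩, z₀, him, hc, -⟩ := hl
      refine ⟨z₀, fun _ => ⟨TowerDimer.isSaddle_of_im_pos hβ hx0 hx1 hc him, fun z =>
        ⟨fun h => TowerDimer.critical_unique hα (by linarith) h.2 h.1 hc him, ?_⟩⟩,
        fun hf => absurd (hf.2 z₀ hc).1 him.ne'⟩
      rintro rfl
      exact ⟨him, hc⟩
    · by_cases hf : p ∈ TowerDimer.frozenRegion α β
      · obtain ⟨⟨hx0, hx1, hu, hu'⟩, hfr⟩ := hf
        obtain ⟨z₀, him, hs⟩ := TowerDimer.exists_isSaddle_of_frozen hα hβ hx0 hx1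
          (by linarith) (by linarith) hfr
        exact ⟨z₀, fun h => absurd h hl, fun _ => ⟨hs, him⟩⟩
      · exact ⟨0, fun h => absurd h hl, fun h => absurd h hf⟩
  choose z₀ hz₀ using key
  refine ⟨z₀, fun p hp => ?_, fun p hp => ?_⟩
  · obtain ⟨hs, huniq⟩ := (hz₀ p).1 hp
    have hK := hs.kernelConverges hα hβ hp.1
    exact ⟨huniq, hK, TowerDimer.exists_isGibbsMeasure hα hβ hp.1 hs.crit.1 hK⟩
  · obtain ⟨hs, him⟩ := (hz₀ p).2 hp
    have hK := hs.kernelConverges hα hβ hp.1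
    obtain ⟨μ, hμ, hlim⟩ := TowerDimer.exists_isGibbsMeasure hα hβ hp.1 hs.crit.1 hK
    obtain ⟨M, hM, rfl⟩ :=
      hμ.exists_eq_dirac hα hβ (TowerDimer.isCriticalPoint_iff.1 hs.crit).1 him
    exact ⟨him, hs.crit, hK, M, hM, hμ, hlim⟩
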